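/- **Setting.** Consider a collection of hidden Markov models $(X_k,Y_k)_{k\ge 0}$ indexed by $\theta\in\Theta$, where $\Theta\subset\mathbb R^d$ is compact, connected and *quasiconvex*: for some constant $C$, any two points $a,b\in\Theta$ are joined by a curve in $\Theta$ of length at most $C|a-b|$. The hidden chain $(X_k)$ is time-homogeneous on a compact Polish space $\mathcal X$ and has transition density $q_\theta(x,x')$ with respect to a finite measure $\mu$. The observations take values in a measurable set $\mathcal Y\subset\mathbb R^m$; given the hidden chain they are independent, and $Y_k$ has conditional density $g_\theta(y\mid X_k)$ with respect to a $\sigma$-finite measure $\nu$ on $\mathcal Y$. For every $\theta$ the joint chain has a unique invariant distribution. Let $\overline{\mathbb P}_\theta$ be the stationary law and $\overline{\mathbb E}_\theta$ its expectation, and let $\theta^*\in\Theta$. Differentiability in $\theta$ at a point of $\Theta$ is understood for an extension to a neighbourhood of that point. Let $B^r_y$ be the closed Euclidean ball of radius $r$ around $y$. Assume: (A1) $\theta^*$ is an interior point of $\Theta$, and for $\theta\in\Theta$ the law of the process $(Y_k)$ under $\overline{\mathbb P}_\theta$ equals its law under $\overline{\mathbb P}_{\theta^*}$ if and only if $\theta=\theta^*$.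 (A2) For all $x,x'\in\mathcal X$ and $y\in\mathcal Y$, the maps $\theta\mapsto q_\theta(x,x')$ and $\theta\mapsto g_\theta(y\mid x)$ are three times continuously differentiable on $\Theta$. (A3) There are constants $0<\underline c_1\le\overline c_1<\infty$ with $\underline c_1\le q_\theta(x,x')\le\overline c_1$ and $g_\theta(y\mid x)\le \overline c_1$ for all $\theta,x,x'$ and all $y\in\mathcal Y$. (A4) $|\nabla_\theta\log q_\theta(x,x')|$ and $\|\nabla^2_\theta\log q_\theta(x,x')\|$ are bounded uniformly in $\theta,x,x'$. (A5) $0<\int_{\mathcal X} g_\theta(y\mid x)\,\mu(dx)<\infty$ for all $\theta\in\Theta$ and $y\in\mathcal Y$. (A6) $g_\theta(y\mid x)>0$ for all $\theta\in\Theta$, $y\in\mathcal Y$, $x\in\mathcal X$, and for every $K>0$ and each $(j,p)\in\{(1,3),(2,2),(3,1)\}$, $$\overline{\mathbb E}_{\theta^*}\Big[\sup_{\theta\in\Theta}\ \sup_{x\in\mathcal X}\ \sup_{z\in B_0^K,\ Y_0+z\in\mathcal Y}\big\|\nabla^j_\theta\log g_\theta(Y_0+z\mid x)\big\|^p\Big]<\infty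 .$$ For $\varepsilon>0$, an initial distribution $\pi_0$ of $X_0$ and data $\hat Y_1,\dots,\hat Y_n$, let $$L_n^{\varepsilon,\pi_0}(\theta)=\mathbb P_\theta\big(Y_1\in B^\varepsilon_{\hat Y_1},\dots,Y_n\in B^\varepsilon_{\hat Y_n}\big),\qquad X_0\sim\pi_0,$$ be the ABC approximate likelihood. Let $L_n^{0,\pi_0}(\theta)$ be the exact likelihood $$\int\prod_{k=1}^n q_\theta(x_{k-1},x_k)\,g_\theta(\hat Y_k\mid x_k)\ \pi_0(dx_0)\,\mu(dx_1)\cdots\mu(dx_n).$$ An ABC maximum likelihood estimator $\hat\theta^\varepsilon_n$ is any maximiser of $L_n^{\varepsilon,\pi_0}$ over $\Theta$. **Theorem.** Under these assumptions there are continuous functions $l^\varepsilon:\Theta\to\mathbb R$, $\varepsilon\ge0$, twice continuously differentiable in the interior of $\Theta$, such that for every $\varepsilon\ge 0$ and every initial distribution $\pi_0$, for $\overline{\mathbb P}_{\theta^*}$-almost every data sequence, $$\frac1n\big(\log L^{\varepsilon,\pi_0}_n(\theta)-\log L^{\varepsilon,\pi_0}_n(\theta^*)\big)\to l^\varepsilon(\theta)\quad\text{uniformly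 in }\theta\in\Theta .$$ For $\varepsilon>0$, let $\mathcal T^\varepsilon$ be the set of maximisers of $l^\varepsilon$ over $\Theta$; it is non-empty. Then: 1. For every $\varepsilon>0$ and every initial distribution $\pi_0$, $\overline{\mathbb P}_{\theta^*}$-almost surely, ABC maximum likelihood estimators exist for all $n$, and every accumulation point of every sequence $(\hat\theta^\varepsilon_n)_n$ of them lies in $\mathcal T^\varepsilon$. 2. $\displaystyle\lim_{\varepsilon\to0}\ \sup_{\theta\in\mathcal T^\varepsilon}|\theta-\theta^*|=0$. 3. If $\nabla^2_\theta l^0(\theta^*)$ is negative definite, then for all sufficiently small $\varepsilon>0$ the set $\mathcal T^\varepsilon$ consists of a single point $\theta^{*,\varepsilon}$. -/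

import Mathlib

open MeasureTheory ProbabilityTheory Filter Topology
open scoped ENNReal

noncomputable section

/-- A set is quasiconvex if, for some constant `C`, any two of its points `a`, `b` can be joined
inside the set by a curve of length at most `C * |a - b|`. -/
def IsQuasiconvexSet {E : Type*} [PseudoMetricSpace E] (s : Set E) : Prop :=
  ∃ C : NNReal, ∀ a ∈ s, ∀ b ∈ s, ∃ γ : ℝ → E,
    LipschitzOnWith (C * nndist a b) γ (Set.Icc 0 1) ∧ γ 0 = a ∧ γ 1 = b ∧
      ∀ t ∈ Set.Icc (0 : ℝ) 1, γ t ∈ s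

/-- `f` has finite expectation under `P`; no measurability of `f` is presupposed, the
expectation being the infimum of the integrals of the measurable majorants of `f`. -/
def HasFiniteExpectation {α : Type*} [MeasurableSpace α] (P : Measure α) (f : α → ℝ≥0∞) : Prop :=
  ∃ F : α → ℝ≥0∞, Measurable F ∧ (∀ a, f a ≤ F a) ∧ ∫⁻ a, F a ∂P < ∞

/-- A collection of hidden Markov models on a common state space, with hidden states in `X` and
observations in `Obs ⊆ ℝᵐ`, indexed by the parameters `θ ∈ Param ⊆ ℝᵈ`.  The values of the
densities `q`, `g` at parameters outside `Param` carry no probabilistic meaning: they only serve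
to speak of derivatives at the boundary points of `Param`. -/
structure HMMFamily (d m : ℕ) (X : Type*) [MeasurableSpace X] where
  /-- the parameter set `Θ` -/
  Param : Set (EuclideanSpace ℝ (Fin d))
  isCompact_param : IsCompact Param
  isConnected_param : IsConnected Param
  /-- the observation space `𝒴` -/
  Obs : Set (EuclideanSpace ℝ (Fin m))
  measurableSet_obs : MeasurableSet Obs
  /-- the dominating measure on the hidden states -/
  μ : Measure X
  finite_μ : IsFiniteMeasure μ
  /-- the dominating measure on the observations -/
  ν : Measure (EuclideanSpace ℝ (Fin m))
  sigmaFinite_ν : SigmaFinite ν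
  ν_compl_obs : ν Obsᶜ = 0
  /-- the transition densities, `q θ x x'` is the density at `x'` of the law of `X₁` given
  `X₀ = x` -/
  q : EuclideanSpace ℝ (Fin d) → X → X → ℝ
  q_nonneg : ∀ θ ∈ Param, ∀ x x', 0 ≤ q θ x x'
  measurable_q : ∀ θ ∈ Param, Measurable (fun p : X × X => q θ p.1 p.2)
  /-- the observation densities, `g θ y x` is the density at `y` of the law of `Yₖ` given
  `Xₖ = x` -/
  g : EuclideanSpace ℝ (Fin d) → EuclideanSpace ℝ (Fin m) → X → ℝ
  g_nonneg : ∀ θ ∈ Param, ∀ y ∈ Obs, ∀ x, 0 ≤ g θ y x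
  measurable_g : ∀ θ ∈ Param, Measurable (fun p : EuclideanSpace ℝ (Fin m) × X => g θ p.1 p.2)
  /-- the transition kernels of the hidden chain -/
  Q : Param → Kernel X X
  markov_Q : ∀ θ, IsMarkovKernel (Q θ)
  Q_eq : ∀ (θ : Param) (x : X),
    Q θ x = μ.withDensity (fun x' => ENNReal.ofReal (q θ x x'))
  /-- the conditional laws of the observations -/
  G : Param → Kernel X (EuclideanSpace ℝ (Fin m))
  markov_G : ∀ θ, IsMarkovKernel (G θ)
  G_eq : ∀ (θ : Param) (x : X),
    G θ x = ν.withDensity (fun y => ENNReal.ofReal (g θ y x))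
  /-- the invariant distributions of the joint chains `(Xₖ, Yₖ)` -/
  π : Param → Measure (X × EuclideanSpace ℝ (Fin m))
  prob_π : ∀ θ, IsProbabilityMeasure (π θ)
  invariant_π : ∀ θ, Kernel.Invariant
    ((Q θ ⊗ₖ Kernel.prodMkLeft X (G θ)).comap Prod.fst measurable_fst) (π θ)
  unique_π : ∀ θ, ∀ ρ : Measure (X × EuclideanSpace ℝ (Fin m)), IsProbabilityMeasure ρ →
    Kernel.Invariant
      ((Q θ ⊗ₖ Kernel.prodMkLeft X (G θ)).comap Prod.fst measurable_fst) ρ → ρ = π θ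

attribute [instance] HMMFamily.finite_μ HMMFamily.sigmaFinite_ν HMMFamily.markov_Q
  HMMFamily.markov_G HMMFamily.prob_π

namespace HMMFamily

variable {d m : ℕ} {X : Type*} [MeasurableSpace X] (M : HMMFamily d m X)

/-- The transition kernel of the joint chain `(Xₖ, Yₖ)`: from `(x, y)`, draw `x'` from `Q θ x`,
then `y'` from `G θ x'`. -/
def jointKernel (θ : M.Param) :
    Kernel (X × EuclideanSpace ℝ (Fin m)) (X × EuclideanSpace ℝ (Fin m)) :=
  (M.Q θ ⊗ₖ Kernel.prodMkLeft X (M.G θ)).comap Prod.fst measurable_fst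

instance (θ : M.Param) : IsMarkovKernel (M.jointKernel θ) := by
  unfold jointKernel; infer_instance

/-- The transition at time `n` of the joint chain, as a kernel on the past `0, …, n`. -/
def stepKernel (θ : M.Param) (n : ℕ) :
    Kernel (Finset.Iic n → X × EuclideanSpace ℝ (Fin m)) (X × EuclideanSpace ℝ (Fin m)) :=
  (M.jointKernel θ).comap (fun h => h ⟨n, Finset.mem_Iic.2 le_rfl⟩) (measurable_pi_apply _)

instance (θ : M.Param) (n : ℕ) : IsMarkovKernel (M.stepKernel θ n) := by
  unfold stepKernel; infer_instance

/-- The law of the process `(Xₖ, Yₖ)`, `k ≥ 0`, with parameter `θ`, when `(X₀, Y₀)` has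
law `ρ`. -/
def law (θ : M.Param) (ρ : Measure (X × EuclideanSpace ℝ (Fin m))) :
    Measure (ℕ → X × EuclideanSpace ℝ (Fin m)) :=
  Kernel.trajMeasure (X := fun _ => X × EuclideanSpace ℝ (Fin m)) ρ (M.stepKernel θ)

/-- The law of `(Xₖ, Yₖ)`, `k ≥ 0`, with parameter `θ` and `X₀` distributed according to `π₀`. -/
def lawFrom (θ : M.Param) (π₀ : Measure X) : Measure (ℕ → X × EuclideanSpace ℝ (Fin m)) :=
  M.law θ (π₀ ⊗ₘ M.G θ)

/-- The stationary law of `(Xₖ, Yₖ)`, `k ≥ 0`, with parameter `θ`. -/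
def stationaryLaw (θ : M.Param) : Measure (ℕ → X × EuclideanSpace ℝ (Fin m)) :=
  M.law θ (M.π θ)

/-- The law of the observations `(Yₖ)`, `k ≥ 0`, under the stationary law. -/
def obsLaw (θ : M.Param) : Measure (ℕ → EuclideanSpace ℝ (Fin m)) :=
  (M.stationaryLaw θ).map (fun ω k => (ω k).2)

/-- The ABC approximate likelihood of the data `y 1, …, y n`: the probability that each `Yₖ`,
`1 ≤ k ≤ n`, falls in the closed ball of radius `ε` around `y k`. -/
def abcLikelihood (ε : ℝ) (π₀ : Measure X) (n : ℕ) (y : ℕ → EuclideanSpace ℝ (Fin m))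
    (θ : M.Param) : ℝ :=
  (M.lawFrom θ π₀).real {ω | ∀ k ∈ Finset.Icc 1 n, (ω k).2 ∈ Metric.closedBall (y k) ε}

/-- The exact likelihood of the data `y 1, …, y n`: the integral of
`∏ₖ q θ xₖ₋₁ xₖ * g θ (y k) xₖ` against `π₀(dx₀) μ(dx₁) ⋯ μ(dxₙ)`. -/
def exactLikelihood (π₀ : Measure X) (n : ℕ) (y : ℕ → EuclideanSpace ℝ (Fin m))
    (θ : M.Param) : ℝ :=
  (∫⁻ x₀, ∫⁻ x : Fin n → X,
    ∏ k : Fin n,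
      (ENNReal.ofReal (M.q θ (Fin.cons (α := fun _ => X) x₀ x k.castSucc) (x k)) *
        ENNReal.ofReal (M.g θ (y ((k : ℕ) + 1)) (x k)))
    ∂(Measure.pi fun _ => M.μ) ∂π₀).toReal

/-- The likelihood with tolerance `ε ≥ 0`; tolerance `0` stands for the exact likelihood. -/
def likelihood (ε : ℝ) (π₀ : Measure X) (n : ℕ) (y : ℕ → EuclideanSpace ℝ (Fin m))
    (θ : M.Param) : ℝ :=
  if ε = 0 then M.exactLikelihood π₀ n y θ else M.abcLikelihood ε π₀ n y θ

/-- The mean log likelihood of the data relative to the parameter `θ₀`. -/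
def relMeanLogLik (ε : ℝ) (θ₀ : M.Param) (π₀ : Measure X) (n : ℕ)
    (y : ℕ → EuclideanSpace ℝ (Fin m)) (θ : M.Param) : ℝ :=
  (1 / (n : ℝ)) *
    (Real.log (M.likelihood ε π₀ n y θ) - Real.log (M.likelihood ε π₀ n y θ₀))

/-- `θ` is a value of the ABC maximum likelihood estimator for the data `y 1, …, y n`. -/
def IsABCMLE (ε : ℝ) (π₀ : Measure X) (n : ℕ) (y : ℕ → EuclideanSpace ℝ (Fin m))
    (θ : M.Param) : Prop :=
  ∀ θ' : M.Param, M.abcLikelihood ε π₀ n y θ' ≤ M.abcLikelihood ε π₀ n y θ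

/-- The limit surface with tolerance `ε` of the relative mean log likelihoods: a function on the
parameter set, twice continuously differentiable, to which they converge uniformly almost surely
under the stationary law with parameter `θ₀`, for every initial condition. -/
def IsLimitSurface (ε : ℝ) (θ₀ : M.Param) (l : EuclideanSpace ℝ (Fin d) → ℝ) : Prop :=
  ContinuousOn l M.Param ∧ ContDiffOn ℝ 2 l (interior M.Param) ∧
  ∀ π₀ : Measure X, IsProbabilityMeasure π₀ → ∀ᵐ ω ∂(M.stationaryLaw θ₀),
    TendstoUniformly (fun (n : ℕ) (θ : M.Param) =>
      M.relMeanLogLik ε θ₀ π₀ n (fun k => (ω k).2) θ) (fun θ => l θ) atTop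

/-- The set of maximisers over the parameter set of a function `l`. -/
def maximisers (l : EuclideanSpace ℝ (Fin d) → ℝ) : Set (EuclideanSpace ℝ (Fin d)) :=
  {θ | θ ∈ M.Param ∧ ∀ θ' ∈ M.Param, l θ' ≤ l θ}

/-- Identifiability of an interior true parameter. -/
def A1 (θ₀ : M.Param) : Prop :=
  (θ₀ : EuclideanSpace ℝ (Fin d)) ∈ interior M.Param ∧
  ∀ θ : M.Param, θ = θ₀ ↔ M.obsLaw θ = M.obsLaw θ₀

/-- The densities are three times continuously differentiable in `θ`. -/
def A2 : Prop :=
  (∀ x x', ∀ θ ∈ M.Param, ContDiffAt ℝ 3 (fun t => M.q t x x') θ) ∧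
  ∀ y ∈ M.Obs, ∀ x, ∀ θ ∈ M.Param, ContDiffAt ℝ 3 (fun t => M.g t y x) θ

/-- Bounds on the densities. -/
def A3 : Prop :=
  ∃ c C : ℝ, 0 < c ∧ 0 < C ∧ ∀ θ ∈ M.Param,
    (∀ x x', c ≤ M.q θ x x' ∧ M.q θ x x' ≤ C) ∧ ∀ y ∈ M.Obs, ∀ x, M.g θ y x ≤ C

/-- Bounds on the first two derivatives of the logarithm of the transition density. -/
def A4 : Prop :=
  ∃ C : ℝ, 0 < C ∧ ∀ θ ∈ M.Param, ∀ x x',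
    ‖iteratedFDeriv ℝ 1 (fun t => Real.log (M.q t x x')) θ‖ ≤ C ∧
    ‖iteratedFDeriv ℝ 2 (fun t => Real.log (M.q t x x')) θ‖ ≤ C

/-- Positivity and finiteness of the mass of the observation density. -/
def A5 : Prop :=
  ∀ θ ∈ M.Param, ∀ y ∈ M.Obs,
    0 < ∫⁻ x, ENNReal.ofReal (M.g θ y x) ∂M.μ ∧ ∫⁻ x, ENNReal.ofReal (M.g θ y x) ∂M.μ < ∞

/-- The supremum of the norm of the `j`-th derivative in `θ` of `log g θ (y + z) x` over all
parameters `θ`, states `x`, and `z` with `|z| ≤ K` for which `y + z` is an observation. -/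
def supLogDeriv (j : ℕ) (K : ℝ) (y : EuclideanSpace ℝ (Fin m)) : ℝ≥0∞ :=
  ⨆ θ ∈ M.Param, ⨆ x : X, ⨆ z ∈ {z ∈ Metric.closedBall (0 : EuclideanSpace ℝ (Fin m)) K |
    y + z ∈ M.Obs}, ‖iteratedFDeriv ℝ j (fun t => Real.log (M.g t (y + z) x)) θ‖ₑ

/-- The observation density is positive, so that its logarithm makes sense, and the derivatives
of the logarithm have finite moments under the stationary law with parameter `θ₀`. -/
def A6 (θ₀ : M.Param) : Prop :=
  (∀ θ ∈ M.Param, ∀ y ∈ M.Obs, ∀ x, 0 < M.g θ y x) ∧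
  ∀ K : ℝ, 0 < K →
    HasFiniteExpectation ((M.π θ₀).map Prod.snd) (fun y => M.supLogDeriv 1 K y ^ 3) ∧
    HasFiniteExpectation ((M.π θ₀).map Prod.snd) (fun y => M.supLogDeriv 2 K y ^ 2) ∧
    HasFiniteExpectation ((M.π θ₀).map Prod.snd) (fun y => M.supLogDeriv 3 K y)

end HMMFamily

end

/-! Each observation is replaced by a window, a measure on the observation space: `ν` restricted to
the closed ball for positive tolerance, a point mass for tolerance zero. Integrating the observation
density over the window leaves a positive weight on the hidden states. The exact and the approximate
likelihood thus become the same object, a product `chain` of positive integral operators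
(`likelihood_eq`), and the derivative bounds attached to a window serve all tolerances up to a fixed
radius at once.

Limits. Since the transition density lies between `c` and `C`, every step contracts the range of
ratios of positive functions by the factor `1 - c / C`. An increment of the log likelihood therefore
depends on the initial law and on the remote past only up to a geometrically small error
(`abs_log_chain_sub_le`). Birkhoff's theorem applied to increments of finite memory, with ergodicity
coming from a Doeblin minorisation, gives convergence at each parameter; Lipschitz bounds on the
quasiconvex parameter set make it uniform (`isLimitSurface`), and convergence of the estimators is
then a compactness argument (`ae_mle`). By stationarity the limit `surface` is a telescoping series
of mean effects of one further observation in the past.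

Smoothness. For the limit to be twice differentiable, the gradients and Hessians of these effects
must be summable too. The values decay geometrically, while direct derivative bounds only grow with
the number of windows. The two are reconciled by freezing second order jets: replacing every log
density by its quadratic Taylor polynomial at `θ` along `v`, evaluated at `r`, gives another chain
with a kernel bounded above and below, to which forgetting applies again. As a function of `r` its
log likelihood is quadratic up to a cubic error, with the wanted derivatives as coefficients. Small
values at `0` and at plus and minus `r` force small coefficients (`norm_fderiv_forget_le`), and no
third derivative is needed. The resulting bounds do not involve the tolerance, so finite-length
means approximate the surface and its Hessian uniformly in it (`exists_surface_approx`).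

Consistency. If two parameters give different laws of the observations, some event of finitely many
coordinates is more likely under the true one. Counting its occurrences in well separated blocks,
Jensen's inequality together with a change of measure makes the exact surface strictly negative at
the wrong parameter (`surface_zero_neg`). For vanishing tolerance, Besicovitch differentiation in
the supremum norm, whose balls are exactly the products of windows, gives convergence of finite
likelihood ratios, hence uniform convergence of the surfaces (`tendstoUniformlyOn_surface`).
Maximisers are then driven to the true parameter.

Uniqueness. Convergence of the Hessians is not proved by differentiating the limit. Instead, the
Hessians are equicontinuous at the true parameter as the tolerance vanishes
(`tendsto_fderiv2_surface`), so that uniform closeness of the values transfers to second differences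
and makes the surfaces strictly concave on a fixed ball (`exists_ball_unique_maximiser`). In the
equicontinuity, the observation densities are controlled by their third derivatives. The Hessians of
the transition densities are merely continuous for each pair of states; their variation is averaged
over the posterior law of the hidden path and vanishes by a second use of Besicovitch's theorem. -/

noncomputable section

set_option maxSynthPendingDepth 3
set_option linter.unusedSectionVars false

/-! ### The pointwise ergodic theorem -/

section Birkhoff

variable {α : Type*}

/-- The running maxima of the Birkhoff sums of positive length. -/
def birkhoffMax (T : α → α) (f : α → ℝ) : ℕ → α → ℝ
  | 0 => f
  | n + 1 => fun x => f x + max 0 (birkhoffMax T f n (T x))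

lemma birkhoffMax_mono (T : α → α) (f : α → ℝ) (n : ℕ) (x : α) :
    birkhoffMax T f n x ≤ birkhoffMax T f (n + 1) x := by
  induction n generalizing x with
  | zero => simp [birkhoffMax]
  | succ n ih =>
    simp only [birkhoffMax] at ih ⊢
    gcongr
    exact ih (T x)

lemma birkhoffSum_le_birkhoffMax (T : α → α) (f : α → ℝ) (n : ℕ) (x : α) :
    birkhoffSum T f (n + 1) x ≤ birkhoffMax T f n x := by
  induction n generalizing x with
  | zero => simp [birkhoffMax, birkhoffSum]
  | succ n ih =>
    rw [birkhoffSum_succ']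
    simp only [birkhoffMax]
    gcongr
    exact (ih (T x)).trans (le_max_right _ _)

variable [MeasurableSpace α] {P : Measure α} {T : α → α}

lemma birkhoffMax_measurable (hT : Measurable T) {f : α → ℝ} (hf : Measurable f) (n : ℕ) :
    Measurable (birkhoffMax T f n) := by
  induction n with
  | zero => exact hf
  | succ n ih => exact hf.add (measurable_const.max (ih.comp hT))

lemma birkhoffMax_integrable (hT : MeasurePreserving T P P) {f : α → ℝ} (hf : Integrable f P)
    (n : ℕ) : Integrable (birkhoffMax T f n) P := by
  induction n with
  | zero => exact hf
  | succ n ih =>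
    exact hf.add ((integrable_zero _ _ _).sup (hT.integrable_comp_of_integrable ih))

/-- The supremum `M` of the Birkhoff sums satisfies `M = f + max 0 (M ∘ T)`, so the set where it is
infinite is invariant. If that set had full measure, the differences of the maxima of order `n + 1`
at `x` and of order `n` at `T x` would converge to `f`; their integrals are nonnegative by
invariance and monotonicity, which contradicts the negative mean. -/
lemma ae_bddAbove_birkhoffSum [IsProbabilityMeasure P] (hT : Ergodic T P) {f : α → ℝ}
    (hfm : Measurable f) (hf : Integrable f P) (hneg : ∫ x, f x ∂P < 0) :
    ∀ᵐ x ∂P, ∃ C : ℝ, ∀ n, birkhoffSum T f (n + 1) x ≤ C := by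
  have hTm := hT.measurable
  set A : Set α := {x | ∀ C : ℕ, ∃ n, (C : ℝ) < birkhoffMax T f n x} with hA
  have hAm : MeasurableSet A := by
    have : A = ⋂ C : ℕ, ⋃ n, {x | (C : ℝ) < birkhoffMax T f n x} := by
      ext x; simp [hA]
    rw [this]
    exact MeasurableSet.iInter fun C => MeasurableSet.iUnion fun n =>
      measurableSet_lt measurable_const (birkhoffMax_measurable hTm hfm n)
  have mono : ∀ x, Monotone fun n => birkhoffMax T f n x := fun x =>
    monotone_nat_of_le_succ fun n => birkhoffMax_mono T f n x
  have hAinv : T ⁻¹' A = A := by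
    ext x
    simp only [hA, Set.mem_preimage, Set.mem_ofPred_eq]
    constructor
    · intro h C
      obtain ⟨k, hk⟩ := exists_nat_gt ((C : ℝ) - f x)
      obtain ⟨n, hn⟩ := h k
      refine ⟨n + 1, ?_⟩
      simp only [birkhoffMax]
      have := le_max_right 0 (birkhoffMax T f n (T x))
      linarith
    · intro h C
      obtain ⟨k, hk⟩ := exists_nat_gt ((C : ℝ) + f x)
      obtain ⟨n, hn⟩ := h (max k 0)
      have hn1 := hn.trans_le (birkhoffMax_mono T f n x)
      simp only [birkhoffMax] at hn1
      refine ⟨n, ?_⟩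
      have hk' : (C : ℝ) + f x < f x + max 0 (birkhoffMax T f n (T x)) := by
        refine hk.trans (lt_of_le_of_lt ?_ hn1)
        simp
      have h0 : (C : ℝ) < max 0 (birkhoffMax T f n (T x)) := by linarith
      rcases lt_max_iff.1 h0 with h0 | h0
      · exact absurd h0 (not_lt.2 (Nat.cast_nonneg C))
      · exact h0
  have hnotA : ∀ x, x ∉ A → ∃ C : ℝ, ∀ n, birkhoffSum T f (n + 1) x ≤ C := by
    intro x hx
    simp only [hA, Set.mem_ofPred_eq, not_forall, not_exists, not_lt] at hx
    obtain ⟨C, hC⟩ := hx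
    exact ⟨C, fun n => (birkhoffSum_le_birkhoffMax T f n x).trans (hC n)⟩
  rcases hT.toPreErgodic.ae_empty_or_univ hAm hAinv with h | h
  · filter_upwards [h] with x hx
    apply hnotA
    intro hxA
    exact (iff_of_eq hx).1 hxA
  · exfalso
    have hall : ∀ᵐ x ∂P, x ∈ A := by
      filter_upwards [h] with x hx
      exact (iff_of_eq hx).2 trivial
    set F : ℕ → α → ℝ := fun n x => birkhoffMax T f (n + 1) x - birkhoffMax T f n (T x) with hF
    have hFeq : ∀ n x, F n x = f x - min 0 (birkhoffMax T f n (T x)) := by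
      intro n x
      simp only [hF, birkhoffMax]
      rcases le_total 0 (birkhoffMax T f n (T x)) with h0 | h0
      · rw [max_eq_right h0, min_eq_left h0]; ring
      · rw [max_eq_left h0, min_eq_right h0]; ring
    have hint := birkhoffMax_integrable hT.toMeasurePreserving hf
    have hFnonneg : ∀ n, 0 ≤ ∫ x, F n x ∂P := by
      intro n
      simp only [hF]
      have hcomp : Integrable (fun x => birkhoffMax T f n (T x)) P :=
        hT.toMeasurePreserving.integrable_comp_of_integrable (hint n)
      rw [integral_sub (hint _) hcomp]
      have : ∫ x, birkhoffMax T f n (T x) ∂P = ∫ x, birkhoffMax T f n x ∂P := by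
        conv_rhs => rw [← hT.toMeasurePreserving.map_eq]
        rw [integral_map hTm.aemeasurable
          (birkhoffMax_measurable hTm hfm n).aestronglyMeasurable]
      rw [this, sub_nonneg]
      exact integral_mono (hint _) (hint _) fun x => birkhoffMax_mono T f n x
    have hlim : Tendsto (fun n => ∫ x, F n x ∂P) atTop (𝓝 (∫ x, f x ∂P)) := by
      -- The maxima are at least `f`, so the negative part of a maximum at `T x` is at most `|f (T
      -- x)|`.
      refine tendsto_integral_of_dominated_convergence (fun x => |f x| + |f (T x)|) ?_ ?_ ?_ ?_
      · intro n
        exact ((birkhoffMax_measurable hTm hfm _).sub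
          ((birkhoffMax_measurable hTm hfm n).comp hTm)).aestronglyMeasurable
      · exact hf.abs.add (hT.toMeasurePreserving.integrable_comp_of_integrable hf).abs
      · intro n
        refine Eventually.of_forall fun x => ?_
        rw [hFeq, Real.norm_eq_abs]
        refine (abs_sub _ _).trans (add_le_add le_rfl ?_)
        have h1 : f (T x) ≤ birkhoffMax T f n (T x) := mono (T x) (Nat.zero_le n)
        rw [abs_of_nonpos (inf_le_left : min 0 (birkhoffMax T f n (T x)) ≤ 0)]
        rcases le_total 0 (birkhoffMax T f n (T x)) with h0 | h0
        · rw [min_eq_left h0]; simp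
        · rw [min_eq_right h0]
          have := neg_abs_le (f (T x))
          linarith
      · filter_upwards [hall] with x hx
        have hx' : T x ∈ A := by rw [← Set.mem_preimage, hAinv]; exact hx
        obtain ⟨n, hn⟩ := hx' 0
        refine tendsto_const_nhds.congr' ?_
        filter_upwards [eventually_ge_atTop n] with k hk
        rw [hFeq, min_eq_left, sub_zero]
        have := mono (T x) hk
        simp only [Nat.cast_zero] at hn this
        linarith
    exact absurd (ge_of_tendsto' hlim hFnonneg) (not_le.2 hneg)

/-- The upper half of the pointwise ergodic theorem. -/
lemma ae_eventually_birkhoffSum_le [IsProbabilityMeasure P] (hT : Ergodic T P) {f : α → ℝ}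
    (hfm : Measurable f) (hf : Integrable f P) {δ : ℝ} (hδ : 0 < δ) :
    ∀ᵐ x ∂P, ∀ᶠ n : ℕ in atTop, (1 / (n : ℝ)) * birkhoffSum T f n x ≤ ∫ x, f x ∂P + δ := by
  -- Centring at the mean plus `δ / 2` makes the integral negative; the bounded excess is absorbed
  -- by the remaining `n * (δ / 2)`.
  have h := ae_bddAbove_birkhoffSum hT (f := fun x => f x - (∫ x, f x ∂P + δ / 2))
    (hfm.sub_const _) (hf.sub (integrable_const _)) (by
      rw [integral_sub hf (integrable_const _)]; simp; linarith)
  filter_upwards [h] with x ⟨C, hC⟩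
  obtain ⟨N, hN⟩ := exists_nat_gt (2 * C / δ)
  filter_upwards [eventually_ge_atTop (max N 1)] with n hn
  have hn1 : 1 ≤ n := (le_max_right _ _).trans hn
  have hnN : (N : ℝ) ≤ n := by exact_mod_cast (le_max_left _ _).trans hn
  obtain ⟨k, rfl⟩ : ∃ k, n = k + 1 := ⟨n - 1, by omega⟩
  have hk := hC k
  have hpos : (0 : ℝ) < ((k + 1 : ℕ) : ℝ) := by positivity
  have hsum : birkhoffSum T (fun x => f x - (∫ x, f x ∂P + δ / 2)) (k + 1) x
      = birkhoffSum T f (k + 1) x - ((k + 1 : ℕ) : ℝ) * (∫ x, f x ∂P + δ / 2) := by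
    simp [birkhoffSum, Finset.sum_sub_distrib, mul_add]
  rw [hsum] at hk
  rw [one_div, inv_mul_le_iff₀ hpos]
  have hC' : C ≤ ((k + 1 : ℕ) : ℝ) * (δ / 2) := by
    rw [div_lt_iff₀ hδ] at hN
    nlinarith
  nlinarith

/-- The pointwise ergodic theorem for an ergodic transformation of a probability space. -/
theorem ae_tendsto_birkhoffAverage [IsProbabilityMeasure P] (hT : Ergodic T P) {f : α → ℝ}
    (hfm : Measurable f) (hf : Integrable f P) :
    ∀ᵐ x ∂P, Tendsto (fun n : ℕ => (1 / (n : ℝ)) * ∑ i ∈ Finset.range n, f (T^[i] x)) atTop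
      (𝓝 (∫ x, f x ∂P)) := by
  have h1 : ∀ᵐ x ∂P, ∀ k : ℕ, ∀ᶠ n : ℕ in atTop,
      (1 / (n : ℝ)) * birkhoffSum T f n x ≤ ∫ x, f x ∂P + 1 / ((k : ℝ) + 1) :=
    ae_all_iff.2 fun k => ae_eventually_birkhoffSum_le hT hfm hf (by positivity)
  have h2 : ∀ᵐ x ∂P, ∀ k : ℕ, ∀ᶠ n : ℕ in atTop,
      (1 / (n : ℝ)) * birkhoffSum T (fun x => - f x) n x ≤ ∫ x, - f x ∂P + 1 / ((k : ℝ) + 1) :=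
    ae_all_iff.2 fun k => ae_eventually_birkhoffSum_le hT hfm.neg hf.neg (by positivity)
  filter_upwards [h1, h2] with x hx1 hx2
  rw [Metric.tendsto_atTop']
  intro ε hε
  obtain ⟨k, hk⟩ := exists_nat_one_div_lt hε
  obtain ⟨N, hN⟩ := eventually_atTop.1 ((hx1 k).and (hx2 k))
  refine ⟨N, fun n hn => ?_⟩
  obtain ⟨ha, hb⟩ := hN n hn.le
  simp only [birkhoffSum, Finset.sum_neg_distrib, integral_neg] at ha hb
  rw [Real.dist_eq, abs_lt]
  constructor <;> linarith

end Birkhoff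

/-! ### Lipschitz bounds on quasiconvex sets -/

/-- A mean value inequality along the connecting curve. The curve is only Lipschitz, so `f ∘ γ` need
not be differentiable, but bounds on its right slopes are enough. -/
lemma IsQuasiconvexSet.exists_lipschitz {E : Type*} [NormedAddCommGroup E] [NormedSpace ℝ E]
    {s : Set E} (hs : IsQuasiconvexSet s) :
    ∃ C : ℝ, 0 ≤ C ∧ ∀ (f : E → ℝ) (K : ℝ), 0 ≤ K →
      (∀ x ∈ s, DifferentiableAt ℝ f x ∧ ‖fderiv ℝ f x‖ ≤ K) →
      ∀ a ∈ s, ∀ b ∈ s, |f a - f b| ≤ C * K * dist a b := by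
  obtain ⟨C, hC⟩ := hs
  refine ⟨C, C.2, fun f K hK hf a ha b hb => ?_⟩
  obtain ⟨γ, hγ, h0, h1, hmem⟩ := hC a ha b hb
  set l : ℝ := C * dist a b with hl
  have hl0 : 0 ≤ l := by positivity
  have hlip : ∀ x ∈ Set.Icc (0 : ℝ) 1, ∀ y ∈ Set.Icc (0 : ℝ) 1, ‖γ x - γ y‖ ≤ l * |x - y| := by
    intro x hx y hy
    have := hγ.dist_le_mul x hx y hy
    rwa [dist_eq_norm, Real.dist_eq] at this
  -- The comparison principle needs the slope bound `K * l` to be strictly below the derivative of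
  -- the majorant; hence the slack `δ`, removed at the end.
  have key : ∀ δ > 0, ‖f (γ 1) - f (γ 0)‖ ≤ (K * l + δ) * 1 := by
    intro δ hδ
    have hcont : ContinuousOn (fun t => f (γ t) - f (γ 0)) (Set.Icc 0 1) := by
      refine ContinuousOn.sub ?_ continuousOn_const
      intro t ht
      exact ((hf _ (hmem t ht)).1.continuousAt).comp_continuousWithinAt (hγ.continuousOn t ht)
    refine image_norm_le_of_liminf_right_slope_norm_lt_deriv_boundary
      (f := fun t => f (γ t) - f (γ 0)) (f' := fun _ => K * l) (B := fun t => (K * l + δ) * t)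
      (B' := fun _ => K * l + δ) hcont ?_ (by simp) (by fun_prop) ?_ ?_
      (Set.right_mem_Icc.2 zero_le_one)
    · intro x hx r hr
      refine Eventually.frequently ?_
      obtain ⟨η, hη, hηr⟩ : ∃ η > 0, (K + η) * l < r := by
        refine ⟨(r - K * l) / (2 * (l + 1)), by
          apply div_pos <;> linarith, ?_⟩
        rw [add_mul]
        have : (r - K * l) / (2 * (l + 1)) * l ≤ (r - K * l) / 2 := by
          rw [div_mul_eq_mul_div, div_le_div_iff₀ (by linarith) (by norm_num)]
          nlinarith
        linarith
      have hxI : x ∈ Set.Icc (0 : ℝ) 1 := Set.Ico_subset_Icc_self hx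
      have hd := ((hf _ (hmem x hxI)).1.hasFDerivAt.isLittleO).def hη
      have hK' := (hf _ (hmem x hxI)).2
      have hnhds : ∀ᶠ z in 𝓝[>] x, z ∈ Set.Icc (0 : ℝ) 1 := by
        have : Set.Ioo x 1 ∈ 𝓝[>] x := Ioo_mem_nhdsGT hx.2
        filter_upwards [this] with z hz
        exact ⟨hx.1.trans hz.1.le, hz.2.le⟩
      have htend : Tendsto γ (𝓝[>] x) (𝓝 (γ x)) := by
        have h := (hγ.continuousOn x hxI)
        refine (h.mono_left ?_)
        rw [nhdsWithin_le_iff]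
        exact hnhds
      filter_upwards [htend.eventually hd, hnhds, self_mem_nhdsWithin] with z hz hzI hzx
      have hzx' : 0 < z - x := sub_pos.2 hzx
      have hA : |f (γ z) - f (γ x)| ≤ (K + η) * ‖γ z - γ x‖ := by
        have h1 := (fderiv ℝ f (γ x)).le_opNorm (γ z - γ x)
        have h2 : |f (γ z) - f (γ x)| ≤ ‖f (γ z) - f (γ x) - fderiv ℝ f (γ x) (γ z - γ x)‖
            + ‖fderiv ℝ f (γ x) (γ z - γ x)‖ := by
          have := norm_add_le (f (γ z) - f (γ x) - fderiv ℝ f (γ x) (γ z - γ x))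
            (fderiv ℝ f (γ x) (γ z - γ x))
          simpa using this
        have h3 := mul_le_mul_of_nonneg_right hK' (norm_nonneg (γ z - γ x))
        rw [add_mul]
        linarith
      have hB : |f (γ z) - f (γ x)| ≤ (K + η) * l * (z - x) := by
        refine hA.trans ?_
        rw [mul_assoc]
        gcongr
        have := hlip z hzI x hxI
        rwa [abs_of_pos hzx'] at this
      rw [slope_def_field, div_lt_iff₀ hzx']
      have hC' : ‖f (γ z) - f (γ 0)‖ - ‖f (γ x) - f (γ 0)‖ ≤ |f (γ z) - f (γ x)| := by
        have := norm_sub_norm_le (f (γ z) - f (γ 0)) (f (γ x) - f (γ 0))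
        simpa using this
      simp only [Function.comp_apply]
      have : (K + η) * l * (z - x) < r * (z - x) := by gcongr
      linarith
    · intro x _
      simpa using ((hasDerivAt_id x).const_mul (K * l + δ)).hasDerivWithinAt
    · intro x _ _
      linarith
  have hfin : ‖f (γ 1) - f (γ 0)‖ ≤ K * l := by
    refine le_of_forall_pos_le_add fun δ hδ => ?_
    simpa using key δ hδ
  rw [h0, h1, Real.norm_eq_abs, abs_sub_comm] at hfin
  calc |f a - f b| ≤ K * l := hfin
    _ = C * K * dist a b := by rw [hl]; ring

/-! ### Uniform convergence from convergence on a dense set -/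

/-- Compactness extracts a finite net from the dense set. Convergence is uniform on the net and
spreads from it by the common Lipschitz constant. -/
lemma tendstoUniformly_of_dense_of_lipschitz {S : Type*} [PseudoMetricSpace S] [CompactSpace S]
    {F : ℕ → S → ℝ} {l : S → ℝ} {D : Set S} (hD : Dense D) {K : ℝ} (hK : 0 ≤ K)
    (hF : ∀ᶠ n in atTop, ∀ a b, |F n a - F n b| ≤ K * dist a b)
    (hl : ∀ a b, |l a - l b| ≤ K * dist a b)
    (h : ∀ a ∈ D, Tendsto (fun n => F n a) atTop (𝓝 (l a))) :
    TendstoUniformly F l atTop := by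
  rw [Metric.tendstoUniformly_iff]
  intro ε hε
  set δ := ε / (4 * (K + 1)) with hδ
  have hδ0 : 0 < δ := by positivity
  have hKδ : K * δ ≤ ε / 4 := by
    rw [hδ, mul_div_assoc', div_le_div_iff₀ (by positivity) (by norm_num)]
    nlinarith
  have hcov : (Set.univ : Set S) ⊆ ⋃ a ∈ D, Metric.ball a δ := by
    intro x _
    obtain ⟨a, ha, hax⟩ := hD.exists_dist_lt x hδ0
    exact Set.mem_biUnion ha hax
  obtain ⟨t, htD, htf, ht⟩ := (isCompact_univ (X := S)).elim_finite_subcover_image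
    (fun a _ => Metric.isOpen_ball) hcov
  have hev : ∀ᶠ n in atTop, ∀ a ∈ t, |F n a - l a| < ε / 4 := by
    rw [eventually_all_finite htf]
    intro a ha
    have := (Metric.tendsto_nhds.1 (h a (htD ha))) (ε / 4) (by positivity)
    simpa [Real.dist_eq] using this
  filter_upwards [hev, hF] with n hn hFn x
  obtain ⟨a, ha, hxa⟩ := Set.mem_iUnion₂.1 (ht (Set.mem_univ x))
  have h1 := hn a ha
  have hdist : K * dist a x ≤ ε / 4 := by
    refine le_trans ?_ hKδ
    gcongr
    rw [dist_comm]
    exact (Metric.mem_ball.1 hxa).le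
  have h2 := hFn a x
  have h3 := hl a x
  rw [Real.dist_eq]
  have : l x - F n x = -(l a - l x) + (F n a - F n x) - (F n a - l a) := by ring
  rw [this]
  calc |-(l a - l x) + (F n a - F n x) - (F n a - l a)|
      ≤ |-(l a - l x)| + |F n a - F n x| + |F n a - l a| := by
        refine (abs_sub _ _).trans ?_
        gcongr
        exact abs_add_le _ _
    _ < ε := by rw [abs_neg]; linarith

/-! ### Twice differentiable integrals -/

section ParametricIntegral

variable {E : Type*} [NormedAddCommGroup E] [NormedSpace ℝ E] [FiniteDimensional ℝ E]
  {Ω : Type*} [MeasurableSpace Ω] {P : Measure Ω}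

/-- The derivative is the limit of difference quotients with steps `1 / n`. Measurability is known
only near `θ`, so the first `N` steps are dropped. -/
lemma aestronglyMeasurable_fderiv_apply {G : Type*} [NormedAddCommGroup G] [NormedSpace ℝ G]
    {f : E → Ω → G} {θ : E}
    (hf : ∀ᶠ t in 𝓝 θ, AEStronglyMeasurable (f t) P)
    (hd : ∀ᵐ ω ∂P, DifferentiableAt ℝ (fun t => f t ω) θ) (v : E) :
    AEStronglyMeasurable (fun ω => fderiv ℝ (fun t => f t ω) θ v) P := by
  have h1 : Tendsto (fun n : ℕ => θ + ((n : ℝ))⁻¹ • v) atTop (𝓝 θ) := by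
    have : Tendsto (fun n : ℕ => θ + ((n : ℝ))⁻¹ • v) atTop (𝓝 (θ + (0 : ℝ) • v)) :=
      tendsto_const_nhds.add ((tendsto_inv_atTop_nhds_zero_nat (𝕜 := ℝ)).smul_const v)
    simpa using this
  obtain ⟨N, hN⟩ := eventually_atTop.1 (h1.eventually hf)
  have hθ := hf.self_of_nhds
  refine aestronglyMeasurable_of_tendsto_ae (u := (atTop : Filter ℕ))
    (f := fun n ω => ((n + N : ℕ) : ℝ) • (f (θ + (((n + N : ℕ) : ℝ))⁻¹ • v) ω - f θ ω)) ?_ ?_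
  · intro n
    exact ((hN (n + N) (by omega)).sub hθ).const_smul _
  · filter_upwards [hd] with ω hω
    have := hω.hasFDerivAt.lim v (c := fun n : ℕ => ((n + N : ℕ) : ℝ)) (l := atTop) (by
      simp only [Real.norm_natCast]
      exact tendsto_natCast_atTop_atTop.comp (tendsto_add_atTop_nat N))
    exact this

/-- In finite dimension the derivative is a finite combination of its values on a basis, each of
which is measurable. -/
lemma aestronglyMeasurable_fderiv {G : Type*} [NormedAddCommGroup G] [NormedSpace ℝ G]
    {f : E → Ω → G} {θ : E}
    (hf : ∀ᶠ t in 𝓝 θ, AEStronglyMeasurable (f t) P)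
    (hd : ∀ᵐ ω ∂P, DifferentiableAt ℝ (fun t => f t ω) θ) :
    AEStronglyMeasurable (fun ω => fderiv ℝ (fun t => f t ω) θ) P := by
  set b := Module.finBasis ℝ E
  have h : (fun ω => fderiv ℝ (fun t => f t ω) θ) = fun ω =>
      ∑ i, ContinuousLinearMap.smulRightL ℝ E G (LinearMap.toContinuousLinearMap (b.coord i))
        (fderiv ℝ (fun t => f t ω) θ (b i)) := by
    funext ω
    ext v
    conv_lhs => rw [← b.sum_repr v, map_sum]
    simp
  rw [h]
  refine Finset.aestronglyMeasurable_fun_sum _ fun i _ => ?_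
  exact (ContinuousLinearMap.continuous _).comp_aestronglyMeasurable
    (aestronglyMeasurable_fderiv_apply hf hd (b i))

/-- Differentiation under the integral sign, with continuity of the derivative. -/
lemma hasFDerivAt_integral_of_contDiffAt {G : Type*} [NormedAddCommGroup G] [NormedSpace ℝ G]
    {U : Set E} (hU : IsOpen U)
    {f : E → Ω → G} {bound : Ω → ℝ} (hmeas : ∀ θ ∈ U, AEStronglyMeasurable (f θ) P)
    (hb : Integrable bound P)
    (h : ∀ᵐ ω ∂P, ∀ θ ∈ U, DifferentiableAt ℝ (fun t => f t ω) θ ∧ ‖f θ ω‖ ≤ bound ω ∧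
      ‖fderiv ℝ (fun t => f t ω) θ‖ ≤ bound ω) {θ : E} (hθ : θ ∈ U) :
    HasFDerivAt (fun t => ∫ ω, f t ω ∂P) (∫ ω, fderiv ℝ (fun t => f t ω) θ ∂P) θ := by
  have hnhds : ∀ᶠ t in 𝓝 θ, AEStronglyMeasurable (f t) P :=
    Filter.mem_of_superset (hU.mem_nhds hθ) hmeas
  refine hasFDerivAt_integral_of_dominated_of_fderiv_le (𝕜 := ℝ) (bound := bound)
    (F' := fun t ω => fderiv ℝ (fun t => f t ω) t) (hU.mem_nhds hθ) hnhds
    ?_ ?_ ?_ hb ?_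
  · exact hb.mono' (hmeas θ hθ) (h.mono fun ω hω => (hω θ hθ).2.1)
  · exact aestronglyMeasurable_fderiv hnhds (h.mono fun ω hω => (hω θ hθ).1)
  · exact h.mono fun ω hω t ht => (hω t ht).2.2
  · exact h.mono fun ω hω t ht => (hω t ht).1.hasFDerivAt

/-- The second Fréchet derivative. -/
abbrev fderiv2 (f : E → ℝ) (θ : E) : E →L[ℝ] E →L[ℝ] ℝ := fderiv ℝ (fderiv ℝ f) θ

omit [FiniteDimensional ℝ E] in
lemma ContDiffAt.differentiableAt_fderiv {f : E → ℝ} {θ : E} (h : ContDiffAt ℝ 2 f θ) :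
    DifferentiableAt ℝ (fderiv ℝ f) θ :=
  (h.fderiv_right (m := 1) (by norm_num)).differentiableAt (by norm_num)

omit [FiniteDimensional ℝ E] in
lemma ContDiffAt.continuousAt_fderiv2 {f : E → ℝ} {θ : E} (h : ContDiffAt ℝ 2 f θ) :
    ContinuousAt (fderiv2 f) θ :=
  ((h.fderiv_right (m := 1) (by norm_num)).fderiv_right (m := 0) (by norm_num)).continuousAt

/-- A single integrable bound, valid on all of `U` off one null set, dominates the values, gradients
and Hessians together. Integration then commutes with two derivatives, and the gradient and the
Hessian of the integral inherit the integrated bound. -/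
structure C2Dominated (P : Measure Ω) (U : Set E) (f : E → Ω → ℝ) (bound : Ω → ℝ) : Prop where
  isOpen : IsOpen U
  meas : ∀ θ ∈ U, AEStronglyMeasurable (f θ) P
  int_bound : Integrable bound P
  ae : ∀ᵐ ω ∂P, ∀ θ ∈ U, ContDiffAt ℝ 2 (fun t => f t ω) θ ∧ ‖f θ ω‖ ≤ bound ω ∧
      ‖fderiv ℝ (fun t => f t ω) θ‖ ≤ bound ω ∧ ‖fderiv2 (fun t => f t ω) θ‖ ≤ bound ω

namespace C2Dominated

variable {U : Set E} {f : E → Ω → ℝ} {bound : Ω → ℝ} {θ : E}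

lemma eventually_meas (h : C2Dominated P U f bound) (hθ : θ ∈ U) :
    ∀ᶠ t in 𝓝 θ, AEStronglyMeasurable (f t) P := by
  filter_upwards [h.isOpen.mem_nhds hθ] with t ht using h.meas t ht

lemma meas_fderiv (h : C2Dominated P U f bound) (hθ : θ ∈ U) :
    AEStronglyMeasurable (fun ω => fderiv ℝ (fun t => f t ω) θ) P :=
  aestronglyMeasurable_fderiv (h.eventually_meas hθ)
    (h.ae.mono fun _ hω => (hω θ hθ).1.differentiableAt (by norm_num))

lemma meas_fderiv2 (h : C2Dominated P U f bound) (hθ : θ ∈ U) :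
    AEStronglyMeasurable (fun ω => fderiv2 (fun t => f t ω) θ) P := by
  refine aestronglyMeasurable_fderiv (f := fun t ω => fderiv ℝ (fun t => f t ω) t) ?_
    (h.ae.mono fun _ hω => (hω θ hθ).1.differentiableAt_fderiv)
  filter_upwards [h.isOpen.mem_nhds hθ] with t ht using h.meas_fderiv ht

lemma integrable (h : C2Dominated P U f bound) (hθ : θ ∈ U) : Integrable (f θ) P :=
  h.int_bound.mono' (h.meas θ hθ) (h.ae.mono fun _ hω => (hω θ hθ).2.1)

lemma integrable_fderiv (h : C2Dominated P U f bound) (hθ : θ ∈ U) :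
    Integrable (fun ω => fderiv ℝ (fun t => f t ω) θ) P :=
  h.int_bound.mono' (h.meas_fderiv hθ) (h.ae.mono fun _ hω => (hω θ hθ).2.2.1)

lemma integrable_fderiv2 (h : C2Dominated P U f bound) (hθ : θ ∈ U) :
    Integrable (fun ω => fderiv2 (fun t => f t ω) θ) P :=
  h.int_bound.mono' (h.meas_fderiv2 hθ) (h.ae.mono fun _ hω => (hω θ hθ).2.2.2)

lemma hasFDerivAt (h : C2Dominated P U f bound) (hθ : θ ∈ U) :
    HasFDerivAt (fun t => ∫ ω, f t ω ∂P) (∫ ω, fderiv ℝ (fun t => f t ω) θ ∂P) θ :=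
  hasFDerivAt_integral_of_contDiffAt h.isOpen h.meas h.int_bound (h.ae.mono fun _ hω t ht =>
    ⟨(hω t ht).1.differentiableAt (by norm_num), (hω t ht).2.1, (hω t ht).2.2.1⟩) hθ

lemma hasFDerivAt_fderiv (h : C2Dominated P U f bound) (hθ : θ ∈ U) :
    HasFDerivAt (fderiv ℝ fun t => ∫ ω, f t ω ∂P) (∫ ω, fderiv2 (fun t => f t ω) θ ∂P) θ := by
  have h1 : HasFDerivAt (fun t => ∫ ω, fderiv ℝ (fun t => f t ω) t ∂P)
      (∫ ω, fderiv2 (fun t => f t ω) θ ∂P) θ :=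
    hasFDerivAt_integral_of_contDiffAt (f := fun t ω => fderiv ℝ (fun t => f t ω) t) h.isOpen
      (fun t ht => h.meas_fderiv ht) h.int_bound (h.ae.mono fun _ hω t ht =>
      ⟨(hω t ht).1.differentiableAt_fderiv, (hω t ht).2.2.1, (hω t ht).2.2.2⟩) hθ
  refine h1.congr_of_eventuallyEq ?_
  filter_upwards [h.isOpen.mem_nhds hθ] with t ht using (h.hasFDerivAt ht).fderiv

lemma fderiv_eq (h : C2Dominated P U f bound) (hθ : θ ∈ U) :
    fderiv ℝ (fun t => ∫ ω, f t ω ∂P) θ = ∫ ω, fderiv ℝ (fun t => f t ω) θ ∂P :=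
  (h.hasFDerivAt hθ).fderiv

lemma fderiv2_eq (h : C2Dominated P U f bound) (hθ : θ ∈ U) :
    fderiv2 (fun t => ∫ ω, f t ω ∂P) θ = ∫ ω, fderiv2 (fun t => f t ω) θ ∂P :=
  (h.hasFDerivAt_fderiv hθ).fderiv

lemma contDiffOn (h : C2Dominated P U f bound) :
    ContDiffOn ℝ 2 (fun t => ∫ ω, f t ω ∂P) U := by
  rw [show (2 : WithTop ℕ∞) = 1 + 1 by norm_num, contDiffOn_succ_iff_fderiv_of_isOpen h.isOpen]
  refine ⟨fun θ hθ => (h.hasFDerivAt hθ).differentiableAt.differentiableWithinAt,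
    fun hc => absurd hc (by decide), ?_⟩
  rw [show (1 : WithTop ℕ∞) = 0 + 1 by norm_num, contDiffOn_succ_iff_fderiv_of_isOpen h.isOpen]
  refine ⟨fun θ hθ => (h.hasFDerivAt_fderiv hθ).differentiableAt.differentiableWithinAt,
    fun hc => absurd hc (by decide), ?_⟩
  rw [contDiffOn_zero]
  have hcont : ContinuousOn (fun θ => ∫ ω, fderiv2 (fun t => f t ω) θ ∂P) U := by
    intro θ hθ
    refine ContinuousAt.continuousWithinAt ?_
    refine tendsto_integral_filter_of_dominated_convergence bound ?_ ?_ h.int_bound ?_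
    · filter_upwards [h.isOpen.mem_nhds hθ] with t ht using h.meas_fderiv2 ht
    · filter_upwards [h.isOpen.mem_nhds hθ] with t ht
      exact h.ae.mono fun _ hω => (hω t ht).2.2.2
    · exact h.ae.mono fun _ hω => (hω θ hθ).1.continuousAt_fderiv2
  exact hcont.congr fun θ hθ => h.fderiv2_eq hθ

lemma contDiffAt (h : C2Dominated P U f bound) (hθ : θ ∈ U) :
    ContDiffAt ℝ 2 (fun t => ∫ ω, f t ω ∂P) θ :=
  h.contDiffOn.contDiffAt (h.isOpen.mem_nhds hθ)

lemma norm_fderiv_le (h : C2Dominated P U f bound) (hθ : θ ∈ U) :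
    ‖fderiv ℝ (fun t => ∫ ω, f t ω ∂P) θ‖ ≤ ∫ ω, bound ω ∂P := by
  rw [h.fderiv_eq hθ]
  exact norm_integral_le_of_norm_le h.int_bound (h.ae.mono fun _ hω => (hω θ hθ).2.2.1)

lemma norm_fderiv2_le (h : C2Dominated P U f bound) (hθ : θ ∈ U) :
    ‖fderiv2 (fun t => ∫ ω, f t ω ∂P) θ‖ ≤ ∫ ω, bound ω ∂P := by
  rw [h.fderiv2_eq hθ]
  exact norm_integral_le_of_norm_le h.int_bound (h.ae.mono fun _ hω => (hω θ hθ).2.2.2)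

end C2Dominated

end ParametricIntegral

/-! ### Derivatives of exponentials and logarithms -/

section ExpLog

variable {E : Type*} [NormedAddCommGroup E] [NormedSpace ℝ E]

lemma fderiv_exp_comp {L : E → ℝ} {θ : E} (h : DifferentiableAt ℝ L θ) :
    fderiv ℝ (fun t => Real.exp (L t)) θ = Real.exp (L θ) • fderiv ℝ L θ :=
  (h.hasFDerivAt.exp).fderiv

lemma fderiv2_exp_comp {L : E → ℝ} {θ : E} (h : ContDiffAt ℝ 2 L θ) :
    fderiv2 (fun t => Real.exp (L t)) θ =
      Real.exp (L θ) • (fderiv2 L θ + (fderiv ℝ L θ).smulRight (fderiv ℝ L θ)) := by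
  have hev : ∀ᶠ t in 𝓝 θ, DifferentiableAt ℝ L t :=
    (h.eventually (by norm_num)).mono fun t ht => ht.differentiableAt (by norm_num)
  have h1 : fderiv ℝ (fun t => Real.exp (L t)) =ᶠ[𝓝 θ] fun t => Real.exp (L t) • fderiv ℝ L t :=
    hev.mono fun t ht => fderiv_exp_comp ht
  rw [fderiv2, h1.fderiv_eq]
  have hd := (hev.self_of_nhds.hasFDerivAt.exp).smul h.differentiableAt_fderiv.hasFDerivAt
  have hd' : HasFDerivAt (fun t => Real.exp (L t) • fderiv ℝ L t) _ θ := hd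
  rw [hd'.fderiv]
  ext v w
  simp [mul_assoc]

lemma fderiv_log_comp {Z : E → ℝ} {θ : E} (h : DifferentiableAt ℝ Z θ) (h0 : Z θ ≠ 0) :
    fderiv ℝ (fun t => Real.log (Z t)) θ = (Z θ)⁻¹ • fderiv ℝ Z θ :=
  (h.hasFDerivAt.log h0).fderiv

lemma fderiv2_log_comp_apply {Z : E → ℝ} {θ : E} (h : ContDiffAt ℝ 2 Z θ) (h0 : Z θ ≠ 0)
    (v w : E) :
    fderiv2 (fun t => Real.log (Z t)) θ v w =
      (Z θ)⁻¹ * fderiv2 Z θ v w - ((Z θ)⁻¹ * fderiv ℝ Z θ v) * ((Z θ)⁻¹ * fderiv ℝ Z θ w) := by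
  have hev : ∀ᶠ t in 𝓝 θ, DifferentiableAt ℝ Z t :=
    (h.eventually (by norm_num)).mono fun t ht => ht.differentiableAt (by norm_num)
  have h1 : fderiv ℝ (fun t => Real.log (Z t)) =ᶠ[𝓝 θ] fun t => (Z t)⁻¹ • fderiv ℝ Z t := by
    filter_upwards [hev, h.continuousAt.eventually_ne h0] with t ht ht0
    exact fderiv_log_comp ht ht0
  rw [fderiv2, h1.fderiv_eq]
  have hd := ((hasDerivAt_inv h0).comp_hasFDerivAt θ hev.self_of_nhds.hasFDerivAt).smul
    h.differentiableAt_fderiv.hasFDerivAt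
  have hd' : HasFDerivAt (fun t => (Z t)⁻¹ • fderiv ℝ Z t) _ θ := hd
  rw [hd'.fderiv]
  simp [smul_eq_mul]
  field_simp
  ring

end ExpLog

/-! ### Logarithms of parametric integrals -/

section LogLaplace

variable {E : Type*} [NormedAddCommGroup E] [NormedSpace ℝ E] [FiniteDimensional ℝ E]
  {Ω : Type*} [MeasurableSpace Ω]

/-- The logarithm of a positive density, depending on a parameter in an open set, with bounded
first and second derivatives. -/
structure LogDensity (m : Measure Ω) (U : Set E) (L : E → Ω → ℝ) (a b : ℝ) (W : Ω → ℝ) :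
    Prop where
  isOpen : IsOpen U
  ne_zero : m ≠ 0
  meas : ∀ θ ∈ U, AEStronglyMeasurable (L θ) m
  int_majorant : Integrable W m
  ae : ∀ᵐ ω ∂m, ∀ θ ∈ U, ContDiffAt ℝ 2 (fun t => L t ω) θ ∧ ‖fderiv ℝ (fun t => L t ω) θ‖ ≤ a ∧
    ‖fderiv2 (fun t => L t ω) θ‖ ≤ b ∧ Real.exp (L θ ω) ≤ W ω

namespace LogDensity

variable {m : Measure Ω} {U : Set E} {L : E → Ω → ℝ} {a b : ℝ} {W : Ω → ℝ} {θ : E}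

/-- The gradient of `exp L` is `exp L` times that of `L`, and the Hessian is `exp L` times the
Hessian of `L` plus the square of its gradient; this accounts for the terms `|a|`, `|b|` and `a ^ 2`
of the factor. -/
lemma c2Dominated (h : LogDensity m U L a b W) :
    C2Dominated m U (fun θ ω => Real.exp (L θ ω)) (fun ω => W ω * (1 + |a| + |b| + a ^ 2)) where
  isOpen := h.isOpen
  meas θ hθ := Real.continuous_exp.comp_aestronglyMeasurable (h.meas θ hθ)
  int_bound := h.int_majorant.mul_const _
  ae := by
    filter_upwards [h.ae] with ω hω θ hθ
    obtain ⟨h1, h2, h3, h4⟩ := hω θ hθ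
    have hW : 0 < W ω := (Real.exp_pos _).trans_le h4
    have ha := le_abs_self a
    have hb := le_abs_self b
    have ha0 := abs_nonneg a
    have hb0 := abs_nonneg b
    refine ⟨h1.exp, ?_, ?_, ?_⟩
    · rw [Real.norm_eq_abs, abs_of_pos (Real.exp_pos _)]
      refine h4.trans (le_mul_of_one_le_right hW.le ?_)
      nlinarith [sq_nonneg a]
    · rw [fderiv_exp_comp (h1.differentiableAt (by norm_num)), norm_smul, Real.norm_eq_abs,
        abs_of_pos (Real.exp_pos _)]
      refine mul_le_mul h4 ?_ (norm_nonneg _) hW.le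
      nlinarith [sq_nonneg a]
    · rw [fderiv2_exp_comp h1, norm_smul, Real.norm_eq_abs, abs_of_pos (Real.exp_pos _)]
      refine mul_le_mul h4 ?_ (norm_nonneg _) hW.le
      refine (norm_add_le _ _).trans ?_
      rw [ContinuousLinearMap.norm_smulRight_apply]
      have : ‖fderiv ℝ (fun t => L t ω) θ‖ * ‖fderiv ℝ (fun t => L t ω) θ‖ ≤ a ^ 2 := by
        rw [sq]
        exact mul_self_le_mul_self (norm_nonneg _) h2
      linarith

lemma integrable_exp (h : LogDensity m U L a b W) (hθ : θ ∈ U) :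
    Integrable (fun ω => Real.exp (L θ ω)) m := h.c2Dominated.integrable hθ

lemma integral_pos (h : LogDensity m U L a b W) (hθ : θ ∈ U) :
    0 < ∫ ω, Real.exp (L θ ω) ∂m := by
  have : NeZero m := ⟨h.ne_zero⟩
  exact integral_exp_pos (h.integrable_exp hθ)

lemma contDiffAt (h : LogDensity m U L a b W) (hθ : θ ∈ U) :
    ContDiffAt ℝ 2 (fun t => Real.log (∫ ω, Real.exp (L t ω) ∂m)) θ :=
  (h.c2Dominated.contDiffAt hθ).log (h.integral_pos hθ).ne'

lemma isProbabilityMeasure_tilted (h : LogDensity m U L a b W) (hθ : θ ∈ U) :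
    IsProbabilityMeasure (m.tilted (L θ)) := by
  have : NeZero m := ⟨h.ne_zero⟩
  exact MeasureTheory.isProbabilityMeasure_tilted (h.integrable_exp hθ)

lemma integral_tilted_eq (g : Ω → ℝ) (L : Ω → ℝ) :
    ∫ ω, g ω ∂m.tilted L = (∫ ω, Real.exp (L ω) ∂m)⁻¹ * ∫ ω, Real.exp (L ω) * g ω ∂m := by
  rw [integral_tilted, ← integral_const_mul]
  congr 1
  funext ω
  rw [smul_eq_mul]
  ring

lemma fderiv_integral_apply (h : LogDensity m U L a b W) (hθ : θ ∈ U) (v : E) :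
    (∫ ω, Real.exp (L θ ω) ∂m)⁻¹ * fderiv ℝ (fun t => ∫ ω, Real.exp (L t ω) ∂m) θ v =
      ∫ ω, fderiv ℝ (fun t => L t ω) θ v ∂m.tilted (L θ) := by
  rw [integral_tilted_eq, h.c2Dominated.fderiv_eq hθ,
    ContinuousLinearMap.integral_apply (h.c2Dominated.integrable_fderiv hθ)]
  congr 1
  refine integral_congr_ae ?_
  filter_upwards [h.ae] with ω hω
  rw [fderiv_exp_comp ((hω θ hθ).1.differentiableAt (by norm_num))]
  rfl

lemma fderiv2_integral_apply (h : LogDensity m U L a b W) (hθ : θ ∈ U) (v w : E) :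
    (∫ ω, Real.exp (L θ ω) ∂m)⁻¹ * fderiv2 (fun t => ∫ ω, Real.exp (L t ω) ∂m) θ v w =
      ∫ ω, (fderiv2 (fun t => L t ω) θ v w +
        fderiv ℝ (fun t => L t ω) θ v * fderiv ℝ (fun t => L t ω) θ w) ∂m.tilted (L θ) := by
  have hi := h.c2Dominated.integrable_fderiv2 hθ
  rw [integral_tilted_eq, h.c2Dominated.fderiv2_eq hθ,
    ContinuousLinearMap.integral_apply hi,
    ContinuousLinearMap.integral_apply (hi.apply_continuousLinearMap v)]
  congr 1
  refine integral_congr_ae ?_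
  filter_upwards [h.ae] with ω hω
  rw [fderiv2_exp_comp (hω θ hθ).1]
  simp [mul_add]

/-- The derivative of the logarithm of the integral is the mean derivative of the log density. -/
lemma fderiv_log_apply (h : LogDensity m U L a b W) (hθ : θ ∈ U) (v : E) :
    fderiv ℝ (fun t => Real.log (∫ ω, Real.exp (L t ω) ∂m)) θ v =
      ∫ ω, fderiv ℝ (fun t => L t ω) θ v ∂m.tilted (L θ) := by
  rw [fderiv_log_comp (h.c2Dominated.hasFDerivAt hθ).differentiableAt (h.integral_pos hθ).ne',
    ← h.fderiv_integral_apply hθ]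
  rfl

/-- The second derivative of the logarithm of the integral is a mean plus a covariance. -/
lemma fderiv2_log_apply (h : LogDensity m U L a b W) (hθ : θ ∈ U) (v w : E) :
    fderiv2 (fun t => Real.log (∫ ω, Real.exp (L t ω) ∂m)) θ v w =
      ∫ ω, (fderiv2 (fun t => L t ω) θ v w +
        fderiv ℝ (fun t => L t ω) θ v * fderiv ℝ (fun t => L t ω) θ w) ∂m.tilted (L θ) -
      (∫ ω, fderiv ℝ (fun t => L t ω) θ v ∂m.tilted (L θ)) *
        (∫ ω, fderiv ℝ (fun t => L t ω) θ w ∂m.tilted (L θ)) := by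
  rw [fderiv2_log_comp_apply (h.c2Dominated.contDiffAt hθ) (h.integral_pos hθ).ne',
    h.fderiv_integral_apply hθ, h.fderiv_integral_apply hθ, h.fderiv2_integral_apply hθ]

lemma ae_tilted (h : LogDensity m U L a b W) (θ : E) :
    ∀ᵐ ω ∂m.tilted (L θ), ∀ θ ∈ U, ContDiffAt ℝ 2 (fun t => L t ω) θ ∧
      ‖fderiv ℝ (fun t => L t ω) θ‖ ≤ a ∧ ‖fderiv2 (fun t => L t ω) θ‖ ≤ b ∧
      Real.exp (L θ ω) ≤ W ω :=
  (tilted_absolutelyContinuous m (L θ)).ae_le h.ae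

lemma nonneg_left (h : LogDensity m U L a b W) (hθ : θ ∈ U) : 0 ≤ a := by
  have : NeZero m := ⟨h.ne_zero⟩
  obtain ⟨ω, hω⟩ := h.ae.exists
  exact (norm_nonneg _).trans (hω θ hθ).2.1

lemma nonneg_right (h : LogDensity m U L a b W) (hθ : θ ∈ U) : 0 ≤ b := by
  have : NeZero m := ⟨h.ne_zero⟩
  obtain ⟨ω, hω⟩ := h.ae.exists
  exact (norm_nonneg _).trans (hω θ hθ).2.2.1

lemma abs_fderiv_log_le (h : LogDensity m U L a b W) (hθ : θ ∈ U) (v : E) :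
    |fderiv ℝ (fun t => Real.log (∫ ω, Real.exp (L t ω) ∂m)) θ v| ≤ a * ‖v‖ := by
  have := h.isProbabilityMeasure_tilted hθ
  rw [h.fderiv_log_apply hθ, ← Real.norm_eq_abs]
  have := norm_integral_le_of_norm_le_const (μ := m.tilted (L θ)) (C := a * ‖v‖)
    (f := fun ω => fderiv ℝ (fun t => L t ω) θ v) (by
      filter_upwards [h.ae_tilted θ] with ω hω
      refine (ContinuousLinearMap.le_opNorm _ _).trans ?_
      gcongr
      exact (hω θ hθ).2.1)
  simpa using this

/-- The mean Hessian contributes `b`; the mean of the product and the product of the means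
contribute `a ^ 2` each. -/
lemma abs_fderiv2_log_le (h : LogDensity m U L a b W) (hθ : θ ∈ U) (v w : E) :
    |fderiv2 (fun t => Real.log (∫ ω, Real.exp (L t ω) ∂m)) θ v w| ≤
      (b + 2 * a ^ 2) * ‖v‖ * ‖w‖ := by
  have := h.isProbabilityMeasure_tilted hθ
  have ha := h.nonneg_left hθ
  have h1 := h.abs_fderiv_log_le hθ v
  have h2 := h.abs_fderiv_log_le hθ w
  rw [h.fderiv_log_apply hθ] at h1 h2
  rw [h.fderiv2_log_apply hθ]
  have h3 := norm_integral_le_of_norm_le_const (μ := m.tilted (L θ))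
    (C := (b + a ^ 2) * ‖v‖ * ‖w‖)
    (f := fun ω => fderiv2 (fun t => L t ω) θ v w +
        fderiv ℝ (fun t => L t ω) θ v * fderiv ℝ (fun t => L t ω) θ w) (by
      filter_upwards [h.ae_tilted θ] with ω hω
      obtain ⟨-, h4, h5, -⟩ := hω θ hθ
      refine (norm_add_le _ _).trans ?_
      have h6 : ‖fderiv2 (fun t => L t ω) θ v w‖ ≤ b * ‖v‖ * ‖w‖ :=
        (ContinuousLinearMap.le_opNorm₂ _ _ _).trans (by gcongr)
      have h7 : ‖fderiv ℝ (fun t => L t ω) θ v * fderiv ℝ (fun t => L t ω) θ w‖ ≤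
          (a * ‖v‖) * (a * ‖w‖) := by
        rw [norm_mul]
        refine mul_le_mul ?_ ?_ (norm_nonneg _) (by positivity)
        · exact (ContinuousLinearMap.le_opNorm _ _).trans (by gcongr)
        · exact (ContinuousLinearMap.le_opNorm _ _).trans (by gcongr)
      nlinarith)
  have h8 : |(∫ ω, fderiv ℝ (fun t => L t ω) θ v ∂m.tilted (L θ)) *
        (∫ ω, fderiv ℝ (fun t => L t ω) θ w ∂m.tilted (L θ))| ≤ (a * ‖v‖) * (a * ‖w‖) := by
    rw [abs_mul]
    exact mul_le_mul h1 h2 (abs_nonneg _) (by positivity)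
  rw [Real.norm_eq_abs] at h3
  refine (abs_sub _ _).trans ?_
  simp only [probReal_univ, mul_one] at h3
  nlinarith

end LogDensity

end LogLaplace

/-! ### Second order expansion of a logarithmic Laplace transform -/

section Expansion

/-- The smallness of `r` keeps the exponent below one in modulus, so that the exponential series
applies, and lets terms of order four be charged to order three. -/
lemma abs_exp_sub_quadratic_le {A B a b r : ℝ} (hA : |A| ≤ a) (hB : |B| ≤ b)
    (hr : |r| * (1 + a + b) ≤ 1 / 4) :
    |Real.exp (r * A + r ^ 2 / 2 * B) - 1 - (r * A + r ^ 2 / 2 * (B + A * A))| ≤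
      |r| ^ 3 * ((1 + a) ^ 3 + (1 + a) * b) ∧
    |Real.exp (r * A + r ^ 2 / 2 * B) - 1| ≤ 2 * |r| * (1 + a) := by
  have ha : 0 ≤ a := (abs_nonneg _).trans hA
  have hb : 0 ≤ b := (abs_nonneg _).trans hB
  set ρ := |r| with hρ
  have hρ0 : 0 ≤ ρ := abs_nonneg _
  have hρb : ρ * b ≤ 1 / 4 := by nlinarith
  have hρa : ρ * (1 + a) ≤ 1 / 4 := by nlinarith
  have hr2 : r ^ 2 = ρ ^ 2 := by rw [hρ, sq_abs]
  set s := r * A + r ^ 2 / 2 * B with hs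
  have hs1 : |s| ≤ ρ * (1 + a) := by
    have h1 : |r * A| ≤ ρ * a := by rw [abs_mul]; gcongr
    have h2 : |r ^ 2 / 2 * B| ≤ ρ ^ 2 / 2 * b := by
      rw [abs_mul, abs_of_nonneg (by positivity), hr2]; gcongr
    have h3 := abs_add_le (r * A) (r ^ 2 / 2 * B)
    have h4 : ρ ^ 2 / 2 * b ≤ ρ := by nlinarith
    calc |s| ≤ _ := h3
      _ ≤ ρ * (1 + a) := by linarith
  have hs2 : |s| ≤ 1 := by linarith
  constructor
  · have h1 := Real.exp_bound hs2 (n := 3) (by norm_num)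
    simp only [Finset.sum_range_succ, Finset.sum_range_zero, Nat.factorial] at h1
    norm_num at h1
    have h2 : |s| ^ 3 ≤ ρ ^ 3 * (1 + a) ^ 3 := by
      rw [← mul_pow]; gcongr
    -- What remains of `s ^ 2 / 2` beyond its leading part is the cross term `r ^ 3 * A * B / 2` and
    -- a term in `r ^ 4 * B ^ 2`; the latter loses one power of `r` and one factor `b` through `ρ *
    -- b ≤ 1 / 4`.
    have h3 : |s ^ 2 / 2 - r ^ 2 / 2 * (A * A)| ≤ ρ ^ 3 * (a * b / 2 + b / 32) := by
      have e : s ^ 2 / 2 - r ^ 2 / 2 * (A * A) = r ^ 3 * (A * B / 2 + r * (B * B) / 8) := by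
        rw [hs]; ring
      rw [e, abs_mul, abs_pow]
      have h5 : |A * B / 2| ≤ a * b / 2 := by
        rw [abs_div, abs_mul, abs_of_pos (by norm_num : (0 : ℝ) < 2)]; gcongr
      have h6 : |r * (B * B) / 8| ≤ b / 32 := by
        rw [abs_div, abs_mul, abs_mul, abs_of_pos (by norm_num : (0 : ℝ) < 8)]
        have : |B| * |B| ≤ b * b := by gcongr
        have h7 : |r| * (|B| * |B|) ≤ ρ * (b * b) := by gcongr
        have : ρ * (b * b) ≤ 1 / 4 * b := by nlinarith
        linarith
      have h7 := abs_add_le (A * B / 2) (r * (B * B) / 8)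
      exact mul_le_mul_of_nonneg_left (by linarith) (by positivity)
    have e : Real.exp s - 1 - (r * A + r ^ 2 / 2 * (B + A * A)) =
        (Real.exp s - (1 + s + s ^ 2 / 2)) + (s ^ 2 / 2 - r ^ 2 / 2 * (A * A)) := by
      rw [hs]; ring
    rw [e]
    have h4 := abs_add_le (Real.exp s - (1 + s + s ^ 2 / 2)) (s ^ 2 / 2 - r ^ 2 / 2 * (A * A))
    have h5 : ρ ^ 3 * (a * b / 2 + b / 32) ≤ ρ ^ 3 * ((1 + a) * b / 2) :=
      mul_le_mul_of_nonneg_left (by linarith) (by positivity)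
    have h6 : 0 ≤ ρ ^ 3 * ((1 + a) * b) := by positivity
    have h8 : 0 ≤ |s| ^ 3 := by positivity
    nlinarith
  · have h1 := Real.abs_exp_sub_one_le hs2
    nlinarith

/-- The logarithm is expanded to second order in `x`, after which `x ^ 2` is replaced by the square
of its linear part `r * α`. This turns the second moment `β` into the second cumulant `β - α * α`.
-/
lemma abs_log_sub_quadratic_le {x r α β a b : ℝ} (ha : 0 ≤ a) (hb : 0 ≤ b)
    (hr : |r| * (1 + a + b) ≤ 1 / 4)
    (hx : |x - (r * α + r ^ 2 / 2 * β)| ≤ |r| ^ 3 * ((1 + a) ^ 3 + (1 + a) * b))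
    (hx' : |x| ≤ 2 * |r| * (1 + a)) (hα : |α| ≤ a) (hβ : |β| ≤ b + a * a) :
    |Real.log (1 + x) - (r * α + r ^ 2 / 2 * (β - α * α))| ≤
      20 * (|r| ^ 3 * ((1 + a) ^ 3 + (1 + a) * b)) := by
  set ρ := |r| with hρ
  have hρ0 : 0 ≤ ρ := abs_nonneg _
  have hr2 : r ^ 2 = ρ ^ 2 := by rw [hρ, sq_abs]
  have hρa : ρ * (1 + a) ≤ 1 / 4 := by nlinarith
  set κ := (1 + a) ^ 3 + (1 + a) * b with hκ
  have hκ0 : 0 ≤ κ := by positivity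
  have hκ3 : (1 + a) ^ 3 ≤ κ := by rw [hκ]; nlinarith
  have hxh : |x| ≤ 1 / 2 := by linarith
  have h1 := Real.abs_log_sub_add_sum_range_le (x := -x) (by rw [abs_neg]; linarith) 2
  simp only [Finset.sum_range_succ, Finset.sum_range_zero, abs_neg, sub_neg_eq_add] at h1
  norm_num at h1
  have h2 : |x| ^ 3 / (1 - |x|) ≤ 16 * (ρ ^ 3 * κ) := by
    rw [div_le_iff₀ (by linarith)]
    have h3 : |x| ^ 3 ≤ (2 * ρ * (1 + a)) ^ 3 := by gcongr
    have h4 : (2 * ρ * (1 + a)) ^ 3 = 8 * (ρ ^ 3 * (1 + a) ^ 3) := by ring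
    have h5 : ρ ^ 3 * (1 + a) ^ 3 ≤ ρ ^ 3 * κ := by gcongr
    have h6 : 0 ≤ ρ ^ 3 * κ := by positivity
    nlinarith
  have h3 : |x - r * α| ≤ ρ ^ 2 * (((1 + a) ^ 2 + b) * (3 / 4)) := by
    have e : x - r * α = (x - (r * α + r ^ 2 / 2 * β)) + r ^ 2 / 2 * β := by ring
    have h4 : |r ^ 2 / 2 * β| ≤ ρ ^ 2 / 2 * (b + a * a) := by
      rw [abs_mul, abs_of_nonneg (by positivity), hr2]; gcongr
    have h5 : ρ ^ 3 * κ ≤ ρ ^ 2 * (((1 + a) ^ 2 + b) / 4) := by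
      have : ρ ^ 3 * κ = ρ ^ 2 * ((ρ * (1 + a)) * ((1 + a) ^ 2 + b)) := by rw [hκ]; ring
      rw [this]
      gcongr
      have : 0 ≤ (1 + a) ^ 2 + b := by positivity
      nlinarith
    rw [e]
    refine (abs_add_le _ _).trans ?_
    have h6 : ρ ^ 2 / 2 * (b + a * a) ≤ ρ ^ 2 * (((1 + a) ^ 2 + b) / 2) := by
      rw [div_mul_eq_mul_div, mul_div_assoc]
      refine mul_le_mul_of_nonneg_left ?_ (by positivity)
      nlinarith
    linarith
  have h4 : |x + r * α| ≤ 3 * ρ * (1 + a) := by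
    refine (abs_add_le _ _).trans ?_
    rw [abs_mul]
    have : |r| * |α| ≤ ρ * a := by gcongr
    nlinarith
  have h5 : |x ^ 2 / 2 - r ^ 2 / 2 * (α * α)| ≤ 2 * (ρ ^ 3 * κ) := by
    have e : x ^ 2 / 2 - r ^ 2 / 2 * (α * α) = (x - r * α) * (x + r * α) / 2 := by ring
    rw [e, abs_div, abs_mul, abs_of_pos (by norm_num : (0 : ℝ) < 2)]
    have h6 : |x - r * α| * |x + r * α| ≤
        (ρ ^ 2 * (((1 + a) ^ 2 + b) * (3 / 4))) * (3 * ρ * (1 + a)) := by gcongr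
    have h7 : (ρ ^ 2 * (((1 + a) ^ 2 + b) * (3 / 4))) * (3 * ρ * (1 + a)) =
        9 / 4 * (ρ ^ 3 * κ) := by rw [hκ]; ring
    have h8 : 0 ≤ ρ ^ 3 * κ := by positivity
    linarith
  have e : Real.log (1 + x) - (r * α + r ^ 2 / 2 * (β - α * α)) =
      (-x + x ^ 2 / 2 + Real.log (1 + x)) + (x - (r * α + r ^ 2 / 2 * β)) -
        (x ^ 2 / 2 - r ^ 2 / 2 * (α * α)) := by ring
  rw [e]
  have h6 := abs_sub ((-x + x ^ 2 / 2 + Real.log (1 + x)) + (x - (r * α + r ^ 2 / 2 * β)))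
    (x ^ 2 / 2 - r ^ 2 / 2 * (α * α))
  have h7 := abs_add_le (-x + x ^ 2 / 2 + Real.log (1 + x)) (x - (r * α + r ^ 2 / 2 * β))
  have h8 : 0 ≤ ρ ^ 3 * κ := by positivity
  linarith

/-- A cumulant expansion with explicit cubic remainder. The exponent carries a quadratic term of its
own, so the second coefficient is the mean of `B` plus the variance of `A`. -/
lemma abs_log_integral_exp_sub_le {Ω : Type*} [MeasurableSpace Ω] {P : Measure Ω}
    [IsProbabilityMeasure P] {A B : Ω → ℝ} (hAm : AEStronglyMeasurable A P)
    (hBm : AEStronglyMeasurable B P) {a b r : ℝ} (hA : ∀ᵐ ω ∂P, |A ω| ≤ a)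
    (hB : ∀ᵐ ω ∂P, |B ω| ≤ b) (hr : |r| * (1 + a + b) ≤ 1 / 4) :
    |Real.log (∫ ω, Real.exp (r * A ω + r ^ 2 / 2 * B ω) ∂P) -
      (r * ∫ ω, A ω ∂P + r ^ 2 / 2 * (∫ ω, (B ω + A ω * A ω) ∂P -
        (∫ ω, A ω ∂P) * ∫ ω, A ω ∂P))| ≤ 20 * (|r| ^ 3 * ((1 + a) ^ 3 + (1 + a) * b)) := by
  obtain ⟨ω₀, h1, h2⟩ := (hA.and hB).exists
  have ha : 0 ≤ a := (abs_nonneg _).trans h1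
  have hb : 0 ≤ b := (abs_nonneg _).trans h2
  have hAi : Integrable A P := (integrable_const a).mono' hAm hA
  have hBA : ∀ᵐ ω ∂P, ‖B ω + A ω * A ω‖ ≤ b + a * a := by
    filter_upwards [hA, hB] with ω h3 h4
    refine (norm_add_le _ _).trans (add_le_add h4 ?_)
    rw [norm_mul]
    exact mul_le_mul h3 h3 (norm_nonneg _) ha
  have hBi : Integrable (fun ω => B ω + A ω * A ω) P :=
    (integrable_const (b + a * a)).mono' (hBm.add (hAm.mul hAm)) hBA
  have hem : AEStronglyMeasurable (fun ω => Real.exp (r * A ω + r ^ 2 / 2 * B ω)) P :=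
    Real.continuous_exp.comp_aestronglyMeasurable ((hAm.const_mul r).add (hBm.const_mul _))
  have hei : Integrable (fun ω => Real.exp (r * A ω + r ^ 2 / 2 * B ω)) P := by
    refine (integrable_const (1 + 2 * |r| * (1 + a))).mono' hem ?_
    filter_upwards [hA, hB] with ω h3 h4
    have h5 := (abs_exp_sub_quadratic_le h3 h4 hr).2
    rw [Real.norm_eq_abs, abs_of_pos (Real.exp_pos _)]
    linarith [(abs_le.1 h5).2]
  set x := ∫ ω, (Real.exp (r * A ω + r ^ 2 / 2 * B ω) - 1) ∂P with hx
  have e1 : ∫ ω, Real.exp (r * A ω + r ^ 2 / 2 * B ω) ∂P = 1 + x := by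
    rw [hx, integral_sub hei (integrable_const _)]; simp
  rw [e1]
  refine abs_log_sub_quadratic_le ha hb hr ?_ ?_ ?_ ?_
  · have e2 : x - (r * ∫ ω, A ω ∂P + r ^ 2 / 2 * ∫ ω, (B ω + A ω * A ω) ∂P) =
        ∫ ω, (Real.exp (r * A ω + r ^ 2 / 2 * B ω) - 1 -
          (r * A ω + r ^ 2 / 2 * (B ω + A ω * A ω))) ∂P := by
      have i1 : Integrable (fun ω => Real.exp (r * A ω + r ^ 2 / 2 * B ω) - 1) P :=
        hei.sub (integrable_const _)
      have i2 : Integrable (fun ω => r * A ω) P := hAi.const_mul r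
      have i3 : Integrable (fun ω => r ^ 2 / 2 * (B ω + A ω * A ω)) P := hBi.const_mul _
      have i4 : Integrable (fun ω => r * A ω + r ^ 2 / 2 * (B ω + A ω * A ω)) P := i2.add i3
      rw [integral_sub i1 i4, integral_add i2 i3, integral_const_mul, integral_const_mul]
    rw [e2]
    have := norm_integral_le_of_norm_le_const (μ := P)
      (C := |r| ^ 3 * ((1 + a) ^ 3 + (1 + a) * b))
      (f := fun ω => Real.exp (r * A ω + r ^ 2 / 2 * B ω) - 1 -
          (r * A ω + r ^ 2 / 2 * (B ω + A ω * A ω))) (by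
        filter_upwards [hA, hB] with ω h3 h4 using (abs_exp_sub_quadratic_le h3 h4 hr).1)
    simpa using this
  · have := norm_integral_le_of_norm_le_const (μ := P) (C := 2 * |r| * (1 + a))
      (f := fun ω => Real.exp (r * A ω + r ^ 2 / 2 * B ω) - 1) (by
        filter_upwards [hA, hB] with ω h3 h4 using (abs_exp_sub_quadratic_le h3 h4 hr).2)
    simpa using this
  · simpa using norm_integral_le_of_norm_le_const (μ := P) (f := A) hA
  · simpa using norm_integral_le_of_norm_le_const (μ := P) hBA

end Expansion

/-! ### Second order Taylor polynomials and bounds for symmetric bilinear forms -/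

section Taylor

variable {E : Type*} [NormedAddCommGroup E] [NormedSpace ℝ E]

/-- The second order Taylor polynomial of `f` at `θ` along `v`. -/
def taylor2 (f : E → ℝ) (θ v : E) (r : ℝ) : ℝ :=
  f θ + (r * fderiv ℝ f θ v + r ^ 2 / 2 * fderiv2 f θ v v)

lemma taylor2_zero (f : E → ℝ) (θ v : E) : taylor2 f θ v 0 = f θ := by simp [taylor2]

lemma fderiv2_add {f g : E → ℝ} {θ : E} (hf : ContDiffAt ℝ 2 f θ) (hg : ContDiffAt ℝ 2 g θ) :
    fderiv2 (fun t => f t + g t) θ = fderiv2 f θ + fderiv2 g θ := by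
  have h : fderiv ℝ (fun t => f t + g t) =ᶠ[𝓝 θ] fun t => fderiv ℝ f t + fderiv ℝ g t := by
    filter_upwards [hf.eventually (by norm_num), hg.eventually (by norm_num)] with t h1 h2
    exact fderiv_fun_add (h1.differentiableAt (by norm_num)) (h2.differentiableAt (by norm_num))
  rw [fderiv2, h.fderiv_eq, fderiv_fun_add hf.differentiableAt_fderiv hg.differentiableAt_fderiv]

lemma fderiv2_sum {ι : Type*} (s : Finset ι) {f : ι → E → ℝ} {θ : E}
    (hf : ∀ i ∈ s, ContDiffAt ℝ 2 (f i) θ) :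
    fderiv2 (fun t => ∑ i ∈ s, f i t) θ = ∑ i ∈ s, fderiv2 (f i) θ := by
  classical
  induction s using Finset.induction_on with
  | empty => simp [fderiv2]
  | insert i s hi ih =>
    simp only [Finset.sum_insert hi]
    rw [fderiv2_add (hf i (Finset.mem_insert_self _ _))
      (ContDiffAt.sum fun j hj => hf j (Finset.mem_insert_of_mem hj)),
      ih fun j hj => hf j (Finset.mem_insert_of_mem hj)]

lemma fderiv2_sub {f g : E → ℝ} {θ : E} (hf : ContDiffAt ℝ 2 f θ) (hg : ContDiffAt ℝ 2 g θ) :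
    fderiv2 (fun t => f t - g t) θ = fderiv2 f θ - fderiv2 g θ := by
  have h : fderiv ℝ (fun t => f t - g t) =ᶠ[𝓝 θ] fun t => fderiv ℝ f t - fderiv ℝ g t := by
    filter_upwards [hf.eventually (by norm_num), hg.eventually (by norm_num)] with t h1 h2
    exact fderiv_fun_sub (h1.differentiableAt (by norm_num)) (h2.differentiableAt (by norm_num))
  rw [fderiv2, h.fderiv_eq, fderiv_fun_sub hf.differentiableAt_fderiv hg.differentiableAt_fderiv]

lemma fderiv2_sub_const (f : E → ℝ) (c : ℝ) (θ : E) :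
    fderiv2 (fun t => f t - c) θ = fderiv2 f θ := by
  have : fderiv ℝ (fun t => f t - c) = fderiv ℝ f := by
    funext t; exact fderiv_sub_const c
  rw [fderiv2, this]

lemma taylor2_sum {ι : Type*} (s : Finset ι) {f : ι → E → ℝ} {θ : E}
    (hf : ∀ i ∈ s, ContDiffAt ℝ 2 (f i) θ) (v : E) (r : ℝ) :
    taylor2 (fun t => ∑ i ∈ s, f i t) θ v r = ∑ i ∈ s, taylor2 (f i) θ v r := by
  simp only [taylor2]
  rw [fderiv2_sum s hf, fderiv_fun_sum fun i hi => (hf i hi).differentiableAt (by norm_num)]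
  simp [Finset.sum_add_distrib, Finset.mul_sum]

lemma taylor2_add {f g : E → ℝ} {θ : E} (hf : ContDiffAt ℝ 2 f θ) (hg : ContDiffAt ℝ 2 g θ)
    (v : E) (r : ℝ) :
    taylor2 (fun t => f t + g t) θ v r = taylor2 f θ v r + taylor2 g θ v r := by
  simp only [taylor2]
  rw [fderiv2_add hf hg, fderiv_fun_add (hf.differentiableAt (by norm_num))
    (hg.differentiableAt (by norm_num))]
  simp
  ring

/-- A symmetric bilinear form is bounded through its quadratic form. -/
lemma norm_le_of_forall_abs_apply_self_le {B : E →L[ℝ] E →L[ℝ] ℝ}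
    (hB : ∀ v w, B v w = B w v) {K : ℝ} (hK : 0 ≤ K) (h : ∀ v, ‖v‖ ≤ 1 → |B v v| ≤ K) :
    ‖B‖ ≤ 2 * K := by
  have hq : ∀ v, |B v v| ≤ K * ‖v‖ ^ 2 := by
    intro v
    by_cases hv : v = 0
    · simp [hv]
    have hn : ‖v‖ ≠ 0 := norm_ne_zero_iff.2 hv
    have h1 := h (‖v‖⁻¹ • v) (by rw [norm_smul, norm_inv, norm_norm, inv_mul_cancel₀ hn])
    simp only [map_smul, smul_apply, smul_eq_mul] at h1
    rw [← mul_assoc, abs_mul, ← mul_inv, abs_inv, abs_mul, abs_norm, inv_mul_le_iff₀ (by positivity)]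
      at h1
    calc |B v v| ≤ _ := h1
      _ = K * ‖v‖ ^ 2 := by ring
  -- Polarisation: `v + w` and `v - w` have norm at most `2`, so each quadratic value is at most `4
  -- * K`.
  have hpol : ∀ v w, ‖v‖ ≤ 1 → ‖w‖ ≤ 1 → |B v w| ≤ 2 * K := by
    intro v w hv hw
    have e : B v w = (B (v + w) (v + w) - B (v - w) (v - w)) / 4 := by
      simp only [map_add, map_sub, add_apply, sub_apply]
      rw [hB w v]
      ring
    rw [e, abs_div, abs_of_pos (by norm_num : (0 : ℝ) < 4), div_le_iff₀ (by norm_num)]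
    have h1 := hq (v + w)
    have h2 := hq (v - w)
    have h3 : ‖v + w‖ ≤ 2 := (norm_add_le _ _).trans (by linarith)
    have h4 : ‖v - w‖ ≤ 2 := (norm_sub_le _ _).trans (by linarith)
    have h5 : K * ‖v + w‖ ^ 2 ≤ K * 2 ^ 2 := by gcongr
    have h6 : K * ‖v - w‖ ^ 2 ≤ K * 2 ^ 2 := by gcongr
    refine (abs_sub _ _).trans ?_
    linarith
  refine B.opNorm_le_of_unit_norm (𝕜 := ℝ) (by positivity) fun v hv => ?_
  refine (B v).opNorm_le_of_unit_norm (𝕜 := ℝ) (by positivity) fun w hw => ?_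
  exact hpol v w hv.le hw.le

lemma ContDiffAt.fderiv2_symm {f : E → ℝ} {θ : E} (h : ContDiffAt ℝ 2 f θ) (v w : E) :
    fderiv2 f θ v w = fderiv2 f θ w v :=
  (h.isSymmSndFDerivAt (by simp)).eq v w

end Taylor

/-- Interpolation: a function that is small at three points and close to a quadratic polynomial
has small coefficients. -/
lemma abs_coeff_le_of_small {u₀ up um p₁ p₂ r η R : ℝ} (hr : 0 < r) (h0 : |u₀| ≤ η)
    (hp : |up| ≤ η) (hm : |um| ≤ η) (hup : |up - u₀ - (r * p₁ + r ^ 2 / 2 * p₂)| ≤ R)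
    (hum : |um - u₀ - (-r * p₁ + r ^ 2 / 2 * p₂)| ≤ R) :
    |p₁| ≤ (η + R) / r ∧ |p₂| ≤ (4 * η + 2 * R) / r ^ 2 := by
  -- The difference of the two outer values isolates `p₁`; their sum minus twice the central value
  -- isolates `p₂`.
  rw [abs_le] at *
  constructor
  · rw [← neg_div, div_le_iff₀ hr, le_div_iff₀ hr]
    constructor <;> nlinarith
  · rw [abs_le, ← neg_div, div_le_iff₀ (by positivity), le_div_iff₀ (by positivity)]
    constructor <;> nlinarith

namespace LogDensity

variable {E : Type*} [NormedAddCommGroup E] [NormedSpace ℝ E] [FiniteDimensional ℝ E]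
  {Ω : Type*} [MeasurableSpace Ω] {m : Measure Ω} {U : Set E} {L : E → Ω → ℝ} {a b : ℝ}
  {W : Ω → ℝ} {θ : E}

lemma meas_fderiv (h : LogDensity m U L a b W) (hθ : θ ∈ U) :
    AEStronglyMeasurable (fun ω => fderiv ℝ (fun t => L t ω) θ) m :=
  aestronglyMeasurable_fderiv (Filter.mem_of_superset (h.isOpen.mem_nhds hθ) h.meas)
    (h.ae.mono fun _ hω => (hω θ hθ).1.differentiableAt (by norm_num))

lemma meas_fderiv2 (h : LogDensity m U L a b W) (hθ : θ ∈ U) :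
    AEStronglyMeasurable (fun ω => fderiv2 (fun t => L t ω) θ) m :=
  aestronglyMeasurable_fderiv (f := fun t ω => fderiv ℝ (fun t => L t ω) t)
    (Filter.mem_of_superset (h.isOpen.mem_nhds hθ) fun _ ht => h.meas_fderiv ht)
    (h.ae.mono fun _ hω => (hω θ hθ).1.differentiableAt_fderiv)

/-- The logarithm of the integral of the density whose logarithm is frozen at second order agrees
at second order with the logarithm of the integral. -/
lemma abs_log_taylor2_sub_le (h : LogDensity m U L a b W) (hθ : θ ∈ U) {v : E} (hv : ‖v‖ ≤ 1)
    {r : ℝ} (hr : |r| * (1 + a + b) ≤ 1 / 4) :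
    |Real.log (∫ ω, Real.exp (taylor2 (fun t => L t ω) θ v r) ∂m) -
      Real.log (∫ ω, Real.exp (L θ ω) ∂m) -
      (r * fderiv ℝ (fun t => Real.log (∫ ω, Real.exp (L t ω) ∂m)) θ v +
        r ^ 2 / 2 * fderiv2 (fun t => Real.log (∫ ω, Real.exp (L t ω) ∂m)) θ v v)| ≤
      20 * (|r| ^ 3 * ((1 + a) ^ 3 + (1 + a) * b)) := by
  have hprob := h.isProbabilityMeasure_tilted hθ
  have hac := tilted_absolutelyContinuous m (L θ)
  have hA : AEStronglyMeasurable (fun ω => fderiv ℝ (fun t => L t ω) θ v) (m.tilted (L θ)) :=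
    ((h.meas_fderiv hθ).mono_ac hac).apply_continuousLinearMap v
  have hB : AEStronglyMeasurable (fun ω => fderiv2 (fun t => L t ω) θ v v) (m.tilted (L θ)) :=
    (((h.meas_fderiv2 hθ).mono_ac hac).apply_continuousLinearMap v).apply_continuousLinearMap v
  have hAb : ∀ᵐ ω ∂m.tilted (L θ), |fderiv ℝ (fun t => L t ω) θ v| ≤ a := by
    filter_upwards [h.ae_tilted θ] with ω hω
    refine ((fderiv ℝ (fun t => L t ω) θ).le_opNorm v).trans ?_
    have := (hω θ hθ).2.1
    have h2 := norm_nonneg (fderiv ℝ (fun t => L t ω) θ)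
    nlinarith
  have hBb : ∀ᵐ ω ∂m.tilted (L θ), |fderiv2 (fun t => L t ω) θ v v| ≤ b := by
    filter_upwards [h.ae_tilted θ] with ω hω
    refine ((fderiv2 (fun t => L t ω) θ).le_opNorm₂ v v).trans ?_
    have h1 := (hω θ hθ).2.2.1
    have h2 := norm_nonneg (fderiv2 (fun t => L t ω) θ)
    calc _ ≤ ‖fderiv2 (fun t => L t ω) θ‖ * 1 * 1 := by gcongr
      _ ≤ b := by linarith
  have key := abs_log_integral_exp_sub_le hA hB hAb hBb hr
  have hpos := h.integral_pos hθ
  have hpos' : 0 < ∫ ω, Real.exp (r * fderiv ℝ (fun t => L t ω) θ v +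
      r ^ 2 / 2 * fderiv2 (fun t => L t ω) θ v v) ∂m.tilted (L θ) := by
    refine integral_exp_pos ?_
    refine (integrable_const (Real.exp (|r| * a + r ^ 2 / 2 * b))).mono'
      (Real.continuous_exp.comp_aestronglyMeasurable ((hA.const_mul r).add (hB.const_mul _))) ?_
    filter_upwards [hAb, hBb] with ω h1 h2
    rw [Real.norm_eq_abs, abs_of_pos (Real.exp_pos _), Real.exp_le_exp]
    refine add_le_add ((le_abs_self _).trans ?_) ?_
    · rw [abs_mul]; gcongr
    · have := (le_abs_self (fderiv2 (fun t => L t ω) θ v v)).trans h2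
      gcongr
  -- The frozen exponent is `L θ` plus its first and second order terms. The integral therefore
  -- factors into the normalising constant at `θ` and an exponential moment of the tilted law, to
  -- which the cumulant expansion applies.
  have e : ∫ ω, Real.exp (taylor2 (fun t => L t ω) θ v r) ∂m =
      (∫ ω, Real.exp (L θ ω) ∂m) * ∫ ω, Real.exp (r * fderiv ℝ (fun t => L t ω) θ v +
        r ^ 2 / 2 * fderiv2 (fun t => L t ω) θ v v) ∂m.tilted (L θ) := by
    rw [integral_tilted_eq, mul_inv_cancel_left₀ hpos.ne']
    simp only [taylor2, Real.exp_add]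
  rw [e, Real.log_mul hpos.ne' hpos'.ne', add_sub_cancel_left, h.fderiv_log_apply hθ,
    h.fderiv2_log_apply hθ]
  exact key

end LogDensity

/-! ### Products of positive integral operators -/

section Chain

variable {X : Type*} [MeasurableSpace X]

/-- The likelihood of a chain with transition density `q` and observation weights `w 0, …, w (n-1)`
as a function of the initial state. -/
def chain (μ : Measure X) (q : X → X → ℝ) : ℕ → (ℕ → X → ℝ) → X → ℝ
  | 0, _, _ => 1
  | n + 1, w, x => ∫ x', q x x' * (w 0 x' * chain μ q n (fun k => w (k + 1)) x') ∂μ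

/-- A transition density bounded above and below. -/
structure KernelBounds (q : X → X → ℝ) (c C : ℝ) : Prop where
  meas : Measurable (fun p : X × X => q p.1 p.2)
  pos : 0 < c
  le : ∀ x x', c ≤ q x x'
  ge : ∀ x x', q x x' ≤ C

/-- A positive integrable weight. -/
structure IsWeight (μ : Measure X) (w : X → ℝ) : Prop where
  meas : Measurable w
  pos : ∀ x, 0 < w x
  int : Integrable w μ

lemma IsWeight.integral_pos {μ : Measure X} [NeZero μ] {w : X → ℝ} (hw : IsWeight μ w) :
    0 < ∫ x, w x ∂μ := by
  rw [integral_pos_iff_support_of_nonneg (fun x => (hw.pos x).le) hw.int]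
  have : Function.support w = Set.univ := by
    ext x; simp [(hw.pos x).ne']
  rw [this]
  exact (NeZero.pos (μ Set.univ)).bot_lt.trans_le le_rfl |> fun h => by simpa using h

/-- A bounded measurable function. -/
structure IsBdd (f : X → ℝ) : Prop where
  meas : Measurable f
  bdd : ∃ K, ∀ x, |f x| ≤ K

lemma IsWeight.integrable_mul {μ : Measure X} {w : X → ℝ} (hw : IsWeight μ w) {f : X → ℝ}
    (hf : IsBdd f) : Integrable (fun x => w x * f x) μ := by
  obtain ⟨K, hK⟩ := hf.bdd
  exact hw.int.mul_bdd (c := K) hf.meas.aestronglyMeasurable (Eventually.of_forall hK)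

lemma IsWeight.mul {μ : Measure X} {w : X → ℝ} (hw : IsWeight μ w) {f : X → ℝ}
    (hf : IsBdd f) (hpos : ∀ x, 0 < f x) : IsWeight μ (fun x => w x * f x) :=
  ⟨hw.meas.mul hf.meas, fun x => mul_pos (hw.pos x) (hpos x), hw.integrable_mul hf⟩

namespace KernelBounds

variable {μ : Measure X} [IsFiniteMeasure μ] {q : X → X → ℝ} {c C : ℝ}

lemma isBdd (h : KernelBounds q c C) (x : X) : IsBdd (q x) :=
  ⟨h.meas.comp measurable_prodMk_left, C, fun x' => by
    rw [abs_of_pos (h.pos.trans_le (h.le x x'))]; exact h.ge x x'⟩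

lemma integrable (h : KernelBounds q c C) {g : X → ℝ} (hg : Integrable g μ) (x : X) :
    Integrable (fun x' => q x x' * g x') μ := by
  obtain ⟨K, hK⟩ := (h.isBdd x).bdd
  exact hg.bdd_mul (c := K) (h.isBdd x).meas.aestronglyMeasurable (Eventually.of_forall hK)

lemma le_integral (h : KernelBounds q c C) {g : X → ℝ} (hg : Integrable g μ) (h0 : ∀ x, 0 ≤ g x)
    (x : X) : c * ∫ x', g x' ∂μ ≤ ∫ x', q x x' * g x' ∂μ := by
  rw [← integral_const_mul]
  exact integral_mono (hg.const_mul c) (h.integrable hg x)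
    fun x' => mul_le_mul_of_nonneg_right (h.le x x') (h0 x')

lemma integral_le (h : KernelBounds q c C) {g : X → ℝ} (hg : Integrable g μ) (h0 : ∀ x, 0 ≤ g x)
    (x : X) : ∫ x', q x x' * g x' ∂μ ≤ C * ∫ x', g x' ∂μ := by
  rw [← integral_const_mul]
  exact integral_mono (h.integrable hg x) (hg.const_mul C)
    fun x' => mul_le_mul_of_nonneg_right (h.ge x x') (h0 x')

lemma meas_integral (h : KernelBounds q c C) {g : X → ℝ} (hg : Measurable g) :
    Measurable (fun x => ∫ x', q x x' * g x' ∂μ) := by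
  have : StronglyMeasurable (Function.uncurry fun x x' => q x x' * g x') :=
    (h.meas.mul (hg.comp measurable_snd)).stronglyMeasurable
  exact this.integral_prod_right.measurable

lemma isBdd_integral (h : KernelBounds q c C) {g : X → ℝ} (hg : IsWeight μ g) :
    IsBdd (fun x => ∫ x', q x x' * g x' ∂μ) := by
  refine ⟨h.meas_integral hg.meas, C * ∫ x', g x' ∂μ, fun x => ?_⟩
  have h0 : ∀ x, 0 ≤ g x := fun x => (hg.pos x).le
  rw [abs_of_nonneg (integral_nonneg fun x' => mul_nonneg (h.pos.le.trans (h.le x x')) (h0 x'))]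
  exact h.integral_le hg.int h0 x

lemma lt_one_iff (h : KernelBounds q c C) [Nonempty X] : c ≤ C := by
  obtain ⟨x⟩ := ‹Nonempty X›
  exact (h.le x x).trans (h.ge x x)

variable [NeZero μ]

lemma chain_pos_isBdd (h : KernelBounds q c C) (n : ℕ) {w : ℕ → X → ℝ}
    (hw : ∀ k, IsWeight μ (w k)) :
    (∀ x, 0 < chain μ q n w x) ∧ IsBdd (chain μ q n w) := by
  induction n generalizing w with
  | zero => exact ⟨fun _ => one_pos, measurable_const, 1, fun x => by simp [chain]⟩
  | succ n ih =>
    obtain ⟨h1, h2⟩ := ih (w := fun k => w (k + 1)) fun k => hw (k + 1)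
    have h3 := (hw 0).mul h2 h1
    refine ⟨fun x => ?_, h.isBdd_integral h3⟩
    exact (mul_pos h.pos h3.integral_pos).trans_le (h.le_integral h3.int (fun x => (h3.pos x).le) x)

lemma chain_pos (h : KernelBounds q c C) (n : ℕ) {w : ℕ → X → ℝ} (hw : ∀ k, IsWeight μ (w k))
    (x : X) : 0 < chain μ q n w x := (h.chain_pos_isBdd n hw).1 x

lemma chain_isBdd (h : KernelBounds q c C) (n : ℕ) {w : ℕ → X → ℝ} (hw : ∀ k, IsWeight μ (w k)) :
    IsBdd (chain μ q n w) := (h.chain_pos_isBdd n hw).2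

/-- One step of the chain contracts the range of ratios of positive functions. -/
lemma ratio_contraction (h : KernelBounds q c C) {w f g : X → ℝ} (hw : IsWeight μ w)
    (hf : IsBdd f) (hg : IsBdd g) (hg0 : ∀ x, 0 < g x) {m M : ℝ}
    (hm : ∀ x, m * g x ≤ f x) (hM : ∀ x, f x ≤ M * g x) :
    ∃ m' M', m ≤ m' ∧ M' - m' = (1 - c / C) * (M - m) ∧
      ∀ x, m' * ∫ x', q x x' * (w x' * g x') ∂μ ≤ ∫ x', q x x' * (w x' * f x') ∂μ ∧
        ∫ x', q x x' * (w x' * f x') ∂μ ≤ M' * ∫ x', q x x' * (w x' * g x') ∂μ := by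
  have hX : Nonempty X := by
    by_contra hne
    rw [not_nonempty_iff] at hne
    exact NeZero.ne μ (Measure.eq_zero_of_isEmpty μ)
  have hC : 0 < C := h.pos.trans_le h.lt_one_iff
  have hwg := hw.mul hg hg0
  have hwf := hw.integrable_mul hf
  set p := ∫ x, w x * g x ∂μ with hp
  have hp0 : 0 < p := hwg.integral_pos
  have i1 : Integrable (fun x => w x * f x - m * (w x * g x)) μ := hwf.sub (hwg.int.const_mul m)
  have i2 : Integrable (fun x => M * (w x * g x) - w x * f x) μ := (hwg.int.const_mul M).sub hwf
  have n1 : ∀ x, 0 ≤ w x * f x - m * (w x * g x) := fun x => by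
    have := mul_le_mul_of_nonneg_left (hm x) (hw.pos x).le
    linarith
  have n2 : ∀ x, 0 ≤ M * (w x * g x) - w x * f x := fun x => by
    have := mul_le_mul_of_nonneg_left (hM x) (hw.pos x).le
    linarith
  set a := ∫ x, (w x * f x - m * (w x * g x)) ∂μ with ha
  set b := ∫ x, (M * (w x * g x) - w x * f x) ∂μ with hb
  have ha0 : 0 ≤ a := integral_nonneg n1
  have hb0 : 0 ≤ b := integral_nonneg n2
  have hab : a + b = (M - m) * p := by
    rw [ha, hb, integral_sub hwf (hwg.int.const_mul m), integral_sub (hwg.int.const_mul M) hwf,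
      integral_const_mul, integral_const_mul]
    ring
  -- The kernel maps the excess `f - m * g` to a function of size at least `c * a`, and maps `g` to
  -- one of size at most `C * p`. The lower ratio bound can therefore be raised by `c / C * (a /
  -- p)`, and the upper one lowered likewise. Since `a + b = (M - m) * p`, the gap shrinks by the
  -- fraction `c / C`.
  refine ⟨m + c / C * (a / p), M - c / C * (b / p), ?_, ?_, fun x => ?_⟩
  · have : 0 ≤ c / C * (a / p) := by have := h.pos; positivity
    linarith
  · have : b / p + a / p = M - m := by
      rw [← add_div, add_comm b a, hab, mul_div_cancel_right₀ _ hp0.ne']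
    linear_combination (-(c / C)) * this
  · have e1 : ∫ x', q x x' * (w x' * f x' - m * (w x' * g x')) ∂μ =
        ∫ x', q x x' * (w x' * f x') ∂μ - m * ∫ x', q x x' * (w x' * g x') ∂μ := by
      rw [← integral_const_mul, ← integral_sub (h.integrable hwf x)
        ((h.integrable hwg.int x).const_mul m)]
      congr 1; funext x'; ring
    have e2 : ∫ x', q x x' * (M * (w x' * g x') - w x' * f x') ∂μ =
        M * ∫ x', q x x' * (w x' * g x') ∂μ - ∫ x', q x x' * (w x' * f x') ∂μ := by
      rw [← integral_const_mul, ← integral_sub ((h.integrable hwg.int x).const_mul M)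
        (h.integrable hwf x)]
      congr 1; funext x'; ring
    have l1 := h.le_integral i1 n1 x
    have l2 := h.le_integral i2 n2 x
    rw [e1] at l1
    rw [e2] at l2
    have hG := h.integral_le hwg.int (fun x => (hwg.pos x).le) x
    set G := ∫ x', q x x' * (w x' * g x') ∂μ
    have k1 : c / C * (a / p) * G ≤ c * a := by
      calc c / C * (a / p) * G ≤ c / C * (a / p) * (C * p) := by
            have := h.pos; gcongr
        _ = c * a := by field_simp
    have k2 : c / C * (b / p) * G ≤ c * b := by
      calc c / C * (b / p) * G ≤ c / C * (b / p) * (C * p) := by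
            have := h.pos; gcongr
        _ = c * b := by field_simp
    rw [add_mul, sub_mul]
    constructor <;> linarith

/-- Two chains that differ by one factor at the end have almost proportional likelihoods. -/
lemma exists_ratio_chain (h : KernelBounds q c C) (n k : ℕ) {w : ℕ → X → ℝ}
    (hw : ∀ k, IsWeight μ (w k)) :
    ∃ m M, 0 < m ∧ M - m ≤ (C / c) * (1 - c / C) ^ n * m ∧
      (∀ x, m * chain μ q n (fun j => w (j + k)) x ≤ chain μ q (n + 1) (fun j => w (j + k)) x ∧
        chain μ q (n + 1) (fun j => w (j + k)) x ≤ M * chain μ q n (fun j => w (j + k)) x) ∧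
      ∀ x, m * chain μ q (n + k) w x ≤ chain μ q (n + k + 1) w x ∧
        chain μ q (n + k + 1) w x ≤ M * chain μ q (n + k) w x := by
  have hX : Nonempty X := by
    by_contra hne
    rw [not_nonempty_iff] at hne
    exact NeZero.ne μ (Measure.eq_zero_of_isEmpty μ)
  have hcC : c ≤ C := h.lt_one_iff
  have hC : 0 < C := h.pos.trans_le hcC
  have hδ : 0 ≤ 1 - c / C := by rw [sub_nonneg, div_le_one hC]; exact hcC
  -- Prepending a factor integrates both chains against the same positive kernel, which preserves
  -- the inequalities with the same `m` and `M`. The contraction takes place entirely in the inner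
  -- induction on `n`, for `k = 0`.
  induction k generalizing w with
  | zero =>
    suffices H : ∃ m M, 0 < m ∧ M - m ≤ (C / c) * (1 - c / C) ^ n * m ∧
        ∀ x, m * chain μ q n w x ≤ chain μ q (n + 1) w x ∧
          chain μ q (n + 1) w x ≤ M * chain μ q n w x by
      obtain ⟨m, M, h1, h2, h3⟩ := H
      exact ⟨m, M, h1, h2, h3, h3⟩
    induction n generalizing w with
    | zero =>
      have hw0 := (hw 0).integral_pos
      -- One step compared with the empty chain: the upper bound is `C / c` times the lower one,
      -- which is the source of the prefactor.
      refine ⟨c * ∫ x, w 0 x ∂μ, C * ∫ x, w 0 x ∂μ, mul_pos h.pos hw0, ?_, fun x => ?_⟩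
      · have := h.pos
        have e : C / c * (1 - c / C) ^ 0 * (c * ∫ x, w 0 x ∂μ) = C * ∫ x, w 0 x ∂μ := by
          field_simp
        rw [e]
        have : 0 < c * ∫ x, w 0 x ∂μ := by positivity
        linarith
      · simp only [chain, mul_one]
        exact ⟨h.le_integral (hw 0).int (fun x => ((hw 0).pos x).le) x,
          h.integral_le (hw 0).int (fun x => ((hw 0).pos x).le) x⟩
    | succ n ih =>
      obtain ⟨m, M, h1, h2, h3⟩ := ih (w := fun k => w (k + 1)) fun k => hw (k + 1)
      have hf := h.chain_isBdd (μ := μ) (n + 1) fun k => hw (k + 1)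
      have hg := h.chain_isBdd (μ := μ) n fun k => hw (k + 1)
      have hg0 := h.chain_pos (μ := μ) n fun k => hw (k + 1)
      obtain ⟨m', M', k1, k2, k3⟩ := h.ratio_contraction (hw 0) hf hg hg0
        (fun x => (h3 x).1) (fun x => (h3 x).2)
      refine ⟨m', M', h1.trans_le k1, ?_, fun x => k3 x⟩
      rw [k2]
      have hc := h.pos
      calc (1 - c / C) * (M - m) ≤ (1 - c / C) * ((C / c) * (1 - c / C) ^ n * m) := by gcongr
        _ = (C / c) * (1 - c / C) ^ (n + 1) * m := by ring
        _ ≤ (C / c) * (1 - c / C) ^ (n + 1) * m' := by gcongr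
  | succ k ih =>
    obtain ⟨m, M, h1, h2, h3, h4⟩ := ih (w := fun k => w (k + 1)) fun k => hw (k + 1)
    refine ⟨m, M, h1, h2, h3, fun x => ?_⟩
    have hf := h.chain_isBdd (μ := μ) (n + k + 1) fun k => hw (k + 1)
    have hg := h.chain_isBdd (μ := μ) (n + k) fun k => hw (k + 1)
    have i1 := h.integrable ((hw 0).integrable_mul hf) x
    have i2 := h.integrable ((hw 0).integrable_mul hg) x
    have hq : ∀ x', 0 ≤ q x x' := fun x' => h.pos.le.trans (h.le x x')
    constructor
    · change m * ∫ x', q x x' * (w 0 x' * chain μ q (n + k) (fun k => w (k + 1)) x') ∂μ ≤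
        ∫ x', q x x' * (w 0 x' * chain μ q (n + k + 1) (fun k => w (k + 1)) x') ∂μ
      rw [← integral_const_mul]
      refine integral_mono (i2.const_mul m) i1 fun x' => ?_
      have := mul_le_mul_of_nonneg_left (h4 x').1 (mul_nonneg (hq x') ((hw 0).pos x').le)
      simp only
      linarith
    · change ∫ x', q x x' * (w 0 x' * chain μ q (n + k + 1) (fun k => w (k + 1)) x') ∂μ ≤
        M * ∫ x', q x x' * (w 0 x' * chain μ q (n + k) (fun k => w (k + 1)) x') ∂μ
      rw [← integral_const_mul]
      refine integral_mono i1 (i2.const_mul M) fun x' => ?_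
      have := mul_le_mul_of_nonneg_left (h4 x').2 (mul_nonneg (hq x') ((hw 0).pos x').le)
      simp only
      linarith

lemma chain_integrable (h : KernelBounds q c C) (n : ℕ) {w : ℕ → X → ℝ}
    (hw : ∀ k, IsWeight μ (w k)) (ρ : Measure X) [IsFiniteMeasure ρ] :
    Integrable (chain μ q n w) ρ := by
  obtain ⟨K, hK⟩ := (h.chain_isBdd n hw).bdd
  exact (integrable_const K).mono' (h.chain_isBdd n hw).meas.aestronglyMeasurable
    (Eventually.of_forall hK)

lemma integral_chain_pos (h : KernelBounds q c C) (n : ℕ) {w : ℕ → X → ℝ}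
    (hw : ∀ k, IsWeight μ (w k)) (ρ : Measure X) [IsProbabilityMeasure ρ] :
    0 < ∫ x, chain μ q n w x ∂ρ :=
  IsWeight.integral_pos ⟨(h.chain_isBdd n hw).meas, h.chain_pos n hw, h.chain_integrable n hw ρ⟩

/-- Forgetting of the initial distribution and of the distant past. -/
lemma abs_log_chain_sub_le (h : KernelBounds q c C) (n k : ℕ) {w : ℕ → X → ℝ}
    (hw : ∀ k, IsWeight μ (w k)) (ρ ρ' : Measure X) [IsProbabilityMeasure ρ]
    [IsProbabilityMeasure ρ'] :
    |(Real.log (∫ x, chain μ q (n + k + 1) w x ∂ρ) - Real.log (∫ x, chain μ q (n + k) w x ∂ρ)) -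
      (Real.log (∫ x, chain μ q (n + 1) (fun j => w (j + k)) x ∂ρ') -
        Real.log (∫ x, chain μ q n (fun j => w (j + k)) x ∂ρ'))| ≤
      (C / c) * (1 - c / C) ^ n := by
  obtain ⟨m, M, h1, h2, h3, h4⟩ := h.exists_ratio_chain (μ := μ) n k hw
  -- Ratio bounds survive integration against any initial law. Both increments thus lie between `log
  -- m` and `log M`, and this interval has length at most `M / m - 1`.
  have key : ∀ (f g : X → ℝ) (σ : Measure X), 0 < ∫ x, g x ∂σ → Integrable f σ →
      Integrable g σ → (∀ x, m * g x ≤ f x ∧ f x ≤ M * g x) →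
      Real.log m ≤ Real.log (∫ x, f x ∂σ) - Real.log (∫ x, g x ∂σ) ∧
        Real.log (∫ x, f x ∂σ) - Real.log (∫ x, g x ∂σ) ≤ Real.log M := by
    intro f g σ hg0 hf hg hfg
    have a1 : m * ∫ x, g x ∂σ ≤ ∫ x, f x ∂σ := by
      rw [← integral_const_mul]; exact integral_mono (hg.const_mul m) hf fun x => (hfg x).1
    have a2 : ∫ x, f x ∂σ ≤ M * ∫ x, g x ∂σ := by
      rw [← integral_const_mul]; exact integral_mono hf (hg.const_mul M) fun x => (hfg x).2
    have hf0 : 0 < ∫ x, f x ∂σ := (mul_pos h1 hg0).trans_le a1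
    have hM0 : 0 < M := by
      by_contra hM
      have := mul_nonpos_of_nonpos_of_nonneg (not_lt.1 hM) hg0.le
      linarith
    rw [← Real.log_div hf0.ne' hg0.ne']
    constructor
    · exact Real.log_le_log h1 (by rwa [le_div_iff₀ hg0])
    · exact Real.log_le_log (div_pos hf0 hg0) (by rwa [div_le_iff₀ hg0])
  obtain ⟨a1, a2⟩ := key _ _ ρ (h.integral_chain_pos (μ := μ) (n + k) hw ρ)
    (h.chain_integrable _ hw ρ) (h.chain_integrable _ hw ρ) h4
  obtain ⟨b1, b2⟩ := key _ _ ρ' (h.integral_chain_pos (μ := μ) n (fun j => hw (j + k)) ρ')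
    (h.chain_integrable _ (fun j => hw (j + k)) ρ')
    (h.chain_integrable _ (fun j => hw (j + k)) ρ') h3
  have hX : Nonempty X := by
    by_contra hne
    rw [not_nonempty_iff] at hne
    exact NeZero.ne μ (Measure.eq_zero_of_isEmpty μ)
  have hM : 0 < M := by
    obtain ⟨x⟩ := hX
    have p1 := h.chain_pos (μ := μ) (n + k) hw x
    by_contra hM
    have := mul_nonpos_of_nonpos_of_nonneg (not_lt.1 hM) p1.le
    have := mul_pos h1 p1
    linarith [(h4 x).1, (h4 x).2]
  have hlog : Real.log M - Real.log m ≤ (C / c) * (1 - c / C) ^ n := by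
    rw [← Real.log_div hM.ne' h1.ne']
    refine (Real.log_le_sub_one_of_pos (div_pos hM h1)).trans ?_
    rw [div_sub_one h1.ne', div_le_iff₀ h1]
    exact h2
  rw [abs_le]
  constructor <;> linarith

end KernelBounds

end Chain

/-! ### Path integral representation of chains -/

section Pi

variable {Z : Type*} [MeasurableSpace Z]

lemma lintegral_pi_succ {n : ℕ} (μ : Fin (n + 1) → Measure Z) [∀ i, SigmaFinite (μ i)]
    {F : (Fin (n + 1) → Z) → ℝ≥0∞} (hF : Measurable F) :
    ∫⁻ z, F z ∂Measure.pi μ =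
      ∫⁻ a, ∫⁻ z, F (Fin.cons a z) ∂Measure.pi (fun i : Fin n => μ i.succ) ∂μ 0 := by
  have h := (measurePreserving_piFinSuccAbove μ 0).symm
  have hm : Measurable fun z => F ((MeasurableEquiv.piFinSuccAbove (fun _ => Z) 0).symm z) :=
    hF.comp h.measurable
  rw [← h.lintegral_comp hF, lintegral_prod _ hm.aemeasurable]
  simp [MeasurableEquiv.piFinSuccAbove, Fin.insertNthEquiv]

lemma measurable_fin_cons {n : ℕ} :
    Measurable (fun p : Z × (Fin n → Z) => (Fin.cons p.1 p.2 : Fin (n + 1) → Z)) := by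
  rw [measurable_pi_iff]
  intro i
  refine Fin.cases ?_ (fun j => ?_) i
  · simpa using measurable_fst
  · have : Measurable fun p : Z × (Fin n → Z) => p.2 j :=
      (measurable_pi_apply j).comp measurable_snd
    simpa using this

lemma lintegral_pi_prod {n : ℕ} (μ : Fin n → Measure Z) [∀ i, SigmaFinite (μ i)]
    {f : Fin n → Z → ℝ≥0∞} (hf : ∀ i, Measurable (f i)) :
    ∫⁻ z, ∏ i, f i (z i) ∂Measure.pi μ = ∏ i, ∫⁻ a, f i a ∂μ i := by
  induction n with
  | zero => simp
  | succ n ih =>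
    have hm : Measurable fun z : Fin (n + 1) → Z => ∏ i, f i (z i) :=
      Finset.measurable_fun_prod _ fun i _ => (hf i).comp (measurable_pi_apply i)
    have hm' : Measurable fun z : Fin n → Z => ∏ i : Fin n, f i.succ (z i) :=
      Finset.measurable_fun_prod _ fun i _ => (hf i.succ).comp (measurable_pi_apply i)
    rw [lintegral_pi_succ μ hm]
    simp only [Fin.prod_univ_succ, Fin.cons_zero, Fin.cons_succ]
    have : ∀ a, ∫⁻ z, f 0 a * ∏ i : Fin n, f i.succ (z i) ∂Measure.pi (fun i : Fin n => μ i.succ) =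
        f 0 a * ∏ i : Fin n, ∫⁻ a, f i.succ a ∂μ i.succ := fun a => by
      rw [lintegral_const_mul _ hm', ih _ fun i => hf i.succ]
    simp only [this]
    rw [lintegral_mul_const _ (hf 0)]

end Pi

section Representation

variable {X Y : Type*} [MeasurableSpace X] [MeasurableSpace Y]

/-- The likelihood of a chain, with values in the extended nonnegative reals. -/
def lchain (μ : Measure X) (q : X → X → ℝ≥0∞) : ℕ → (ℕ → X → ℝ≥0∞) → X → ℝ≥0∞
  | 0, _, _ => 1
  | n + 1, w, x => ∫⁻ x', q x x' * (w 0 x' * lchain μ q n (fun k => w (k + 1)) x') ∂μ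

lemma measurable_lchain {μ : Measure X} [SFinite μ] {q : X → X → ℝ≥0∞}
    (hq : Measurable fun p : X × X => q p.1 p.2) (n : ℕ) {w : ℕ → X → ℝ≥0∞}
    (hw : ∀ k, Measurable (w k)) : Measurable (lchain μ q n w) := by
  induction n generalizing w with
  | zero => exact measurable_const
  | succ n ih =>
    have h := ih fun k => hw (k + 1)
    exact Measurable.lintegral_prod_right' (f := fun p : X × X =>
      q p.1 p.2 * (w 0 p.2 * lchain μ q n (fun k => w (k + 1)) p.2))
      (hq.mul (((hw 0).mul h).comp measurable_snd))

lemma KernelBounds.ofReal_chain {μ : Measure X} [IsFiniteMeasure μ] [NeZero μ] {q : X → X → ℝ}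
    {c C : ℝ} (h : KernelBounds q c C) (n : ℕ) {w : ℕ → X → ℝ} (hw : ∀ k, IsWeight μ (w k))
    (x : X) : ENNReal.ofReal (chain μ q n w x) =
      lchain μ (fun x x' => ENNReal.ofReal (q x x')) n (fun k x => ENNReal.ofReal (w k x)) x := by
  induction n generalizing w x with
  | zero => simp [chain, lchain]
  | succ n ih =>
    simp only [chain, lchain]
    have hq : ∀ x', 0 ≤ q x x' := fun x' => h.pos.le.trans (h.le x x')
    have hi := (hw 0).mul (h.chain_isBdd (μ := μ) n fun k => hw (k + 1))
      (h.chain_pos n fun k => hw (k + 1))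
    rw [ofReal_integral_eq_lintegral_ofReal (h.integrable hi.int x)
      (Eventually.of_forall fun x' => mul_nonneg (hq x') (hi.pos x').le)]
    refine lintegral_congr fun x' => ?_
    rw [ENNReal.ofReal_mul (hq x'), ENNReal.ofReal_mul ((hw 0).pos x').le, ih fun k => hw (k + 1)]

/-- Tonelli's theorem, peeling off the first hidden state. The entry of `Fin.cons x z` at
`k.castSucc` is the state preceding `z k`, the initial state `x` coming before the first. -/
lemma lchain_eq_lintegral_pi {μ : Measure X} [SigmaFinite μ] {q : X → X → ℝ≥0∞}
    (hq : Measurable fun p : X × X => q p.1 p.2) (n : ℕ) {w : ℕ → X → ℝ≥0∞}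
    (hw : ∀ k, Measurable (w k)) (x : X) :
    lchain μ q n w x = ∫⁻ z : Fin n → X, ∏ k : Fin n,
      (q (Fin.cons (α := fun _ => X) x z k.castSucc) (z k) * w k (z k))
        ∂Measure.pi (fun _ => μ) := by
  induction n generalizing w x with
  | zero => simp [lchain]
  | succ n ih =>
    have hm : ∀ x, ∀ n, ∀ w : ℕ → X → ℝ≥0∞, (∀ k, Measurable (w k)) →
        Measurable fun z : Fin n → X => ∏ k : Fin n,
        (q (Fin.cons (α := fun _ => X) x z k.castSucc) (z k) * w k (z k)) := by
      intro x n w hw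
      refine Finset.measurable_fun_prod _ fun k _ => ?_
      have h1 : Measurable fun z : Fin n → X => (Fin.cons (α := fun _ => X) x z : Fin (n + 1) → X) :=
        measurable_fin_cons.comp measurable_prodMk_left
      have h2 : Measurable fun z : Fin n → X =>
          (Fin.cons (α := fun _ => X) x z : Fin (n + 1) → X) k.castSucc :=
        (measurable_pi_apply _).comp h1
      exact (hq.comp (h2.prodMk (measurable_pi_apply k))).mul
        ((hw k).comp (measurable_pi_apply k))
    rw [lintegral_pi_succ _ (hm x (n + 1) w hw)]
    simp only [lchain]
    refine lintegral_congr fun a => ?_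
    rw [ih fun k => hw (k + 1), ← mul_assoc, ← lintegral_const_mul _ (hm a n _ fun k => hw (k + 1))]
    refine lintegral_congr fun z => ?_
    rw [Fin.prod_univ_succ]
    rfl

/-- The density of a path of hidden states and observations. -/
def pathDensity (q : X → X → ℝ) (γ : Y → X → ℝ) (n : ℕ) (x : X) (p : (Fin n → X) × (Fin n → Y)) :
    ℝ :=
  ∏ k : Fin n, (q (Fin.cons (α := fun _ => X) x p.1 k.castSucc) (p.1 k) * γ (p.2 k) (p.1 k))

lemma measurable_pathDensity {q : X → X → ℝ} {γ : Y → X → ℝ}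
    (hq : Measurable fun p : X × X => q p.1 p.2) (hγ : Measurable fun p : Y × X => γ p.1 p.2)
    (n : ℕ) (x : X) : Measurable (pathDensity q γ n x) := by
  refine Finset.measurable_fun_prod _ fun k _ => ?_
  have h1 : Measurable fun p : (Fin n → X) × (Fin n → Y) =>
      (Fin.cons (α := fun _ => X) x p.1 : Fin (n + 1) → X) :=
    measurable_fin_cons.comp (measurable_const.prodMk measurable_fst)
  have h2 : Measurable fun p : (Fin n → X) × (Fin n → Y) => p.1 k :=
    (measurable_pi_apply k).comp measurable_fst
  have h3 : Measurable fun p : (Fin n → X) × (Fin n → Y) => p.2 k :=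
    (measurable_pi_apply k).comp measurable_snd
  have h4 : Measurable fun p : (Fin n → X) × (Fin n → Y) =>
      (Fin.cons (α := fun _ => X) x p.1 : Fin (n + 1) → X) k.castSucc :=
    (measurable_pi_apply _).comp h1
  exact (hq.comp (h4.prodMk h2)).mul (hγ.comp (h3.prodMk h2))

/-- A density of observations whose integral against `τ` is a weight on the hidden states. -/
structure IsObsWeight (μ : Measure X) (τ : Measure Y) (γ : Y → X → ℝ) : Prop where
  meas : Measurable (fun p : Y × X => γ p.1 p.2)
  pos : ∀ y x, 0 < γ y x
  ne_zero : τ ≠ 0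
  int_obs : ∀ x, Integrable (fun y => γ y x) τ
  int : Integrable (fun x => ∫ y, γ y x ∂τ) μ

lemma IsObsWeight.isWeight {μ : Measure X} {τ : Measure Y} [SFinite τ] {γ : Y → X → ℝ}
    (h : IsObsWeight μ τ γ) : IsWeight μ (fun x => ∫ y, γ y x ∂τ) where
  meas := by
    have : StronglyMeasurable (fun p : X × Y => γ p.2 p.1) :=
      (h.meas.comp measurable_swap).stronglyMeasurable
    exact this.integral_prod_right'.measurable
  pos x := by
    rw [integral_pos_iff_support_of_nonneg (fun y => (h.pos y x).le) (h.int_obs x)]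
    have : Function.support (fun y => γ y x) = Set.univ := by
      ext y; simp [(h.pos y x).ne']
    rw [this]
    simpa [pos_iff_ne_zero] using h.ne_zero
  int := h.int

/-- Given the hidden path the observations are independent, so by Tonelli each window contributes
its own weight. The likelihood becomes the total mass of an explicit path density against a
reference measure free of the parameter, and the calculus of logarithms of parametric integrals
applies to it. -/
lemma lintegral_pathDensity {μ : Measure X} [IsFiniteMeasure μ] [NeZero μ] {q : X → X → ℝ}
    {c C : ℝ} (h : KernelBounds q c C) {γ : Y → X → ℝ} (n : ℕ) {τ : ℕ → Measure Y}
    [∀ k, SigmaFinite (τ k)] (hγ : ∀ k, IsObsWeight μ (τ k) γ) (x : X) :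
    ∫⁻ p, ENNReal.ofReal (pathDensity q γ n x p)
      ∂((Measure.pi fun _ : Fin n => μ).prod (Measure.pi fun k : Fin n => τ k)) =
      ENNReal.ofReal (chain μ q n (fun k x => ∫ y, γ y x ∂τ k) x) := by
  have hq0 : ∀ x x', 0 ≤ q x x' := fun x x' => h.pos.le.trans (h.le x x')
  have hqm : Measurable fun p : X × X => ENNReal.ofReal (q p.1 p.2) := h.meas.ennreal_ofReal
  have hγ0 := hγ 0
  rw [h.ofReal_chain n (fun k => (hγ k).isWeight) x, lchain_eq_lintegral_pi hqm n
    (fun k => (hγ k).isWeight.meas.ennreal_ofReal) x,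
    lintegral_prod _ (measurable_pathDensity h.meas hγ0.meas n x).ennreal_ofReal.aemeasurable]
  refine lintegral_congr fun z => ?_
  have e1 : ∀ k : Fin n, ENNReal.ofReal (∫ y, γ y (z k) ∂τ k) =
      ∫⁻ y, ENNReal.ofReal (γ y (z k)) ∂τ k := fun k =>
    ofReal_integral_eq_lintegral_ofReal ((hγ k).int_obs (z k))
      (Eventually.of_forall fun y => (hγ0.pos y (z k)).le)
  have hm : ∀ k : Fin n, Measurable fun y => ENNReal.ofReal (γ y (z k)) := fun k =>
    (hγ0.meas.comp measurable_prodMk_right).ennreal_ofReal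
  simp only [e1, Finset.prod_mul_distrib]
  have hm' : Measurable fun y : Fin n → Y => ∏ k : Fin n, ENNReal.ofReal (γ (y k) (z k)) :=
    Finset.measurable_fun_prod _ fun k _ => (hm k).comp (measurable_pi_apply k)
  rw [← lintegral_pi_prod (fun k : Fin n => τ k) hm, ← lintegral_const_mul _ hm']
  refine lintegral_congr fun y => ?_
  simp only [pathDensity]
  rw [ENNReal.ofReal_prod_of_nonneg fun k _ => mul_nonneg (hq0 _ _) (hγ0.pos _ _).le,
    ← Finset.prod_mul_distrib]
  exact Finset.prod_congr rfl fun k _ => ENNReal.ofReal_mul (hq0 _ _)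

lemma KernelBounds.pathDensity_pos {q : X → X → ℝ} {c C : ℝ} (h : KernelBounds q c C)
    {γ : Y → X → ℝ} (hγ : ∀ y x, 0 < γ y x) (n : ℕ) (x : X) (p : (Fin n → X) × (Fin n → Y)) :
    0 < pathDensity q γ n x p :=
  Finset.prod_pos fun _ _ => mul_pos (h.pos.trans_le (h.le _ _)) (hγ _ _)

lemma integrable_pathDensity {μ : Measure X} [IsFiniteMeasure μ] [NeZero μ] {q : X → X → ℝ}
    {c C : ℝ} (h : KernelBounds q c C) {γ : Y → X → ℝ} (n : ℕ) {τ : ℕ → Measure Y}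
    [∀ k, SigmaFinite (τ k)] (hγ : ∀ k, IsObsWeight μ (τ k) γ) (x : X) :
    Integrable (pathDensity q γ n x)
      ((Measure.pi fun _ : Fin n => μ).prod (Measure.pi fun k : Fin n => τ k)) := by
  refine ⟨(measurable_pathDensity h.meas (hγ 0).meas n x).aestronglyMeasurable, ?_⟩
  rw [hasFiniteIntegral_iff_ofReal (Eventually.of_forall fun p =>
    (h.pathDensity_pos (hγ 0).pos n x p).le), lintegral_pathDensity h n hγ x]
  exact ENNReal.ofReal_lt_top

lemma integral_pathDensity {μ : Measure X} [IsFiniteMeasure μ] [NeZero μ] {q : X → X → ℝ}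
    {c C : ℝ} (h : KernelBounds q c C) {γ : Y → X → ℝ} (n : ℕ) {τ : ℕ → Measure Y}
    [∀ k, SigmaFinite (τ k)] (hγ : ∀ k, IsObsWeight μ (τ k) γ) (x : X) :
    ∫ p, pathDensity q γ n x p
      ∂((Measure.pi fun _ : Fin n => μ).prod (Measure.pi fun k : Fin n => τ k)) =
      chain μ q n (fun k x => ∫ y, γ y x ∂τ k) x := by
  rw [integral_eq_lintegral_of_nonneg_ae (Eventually.of_forall fun p =>
    (h.pathDensity_pos (hγ 0).pos n x p).le)
    (measurable_pathDensity h.meas (hγ 0).meas n x).aestronglyMeasurable,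
    lintegral_pathDensity h n hγ x,
    ENNReal.toReal_ofReal (h.chain_pos n (fun k => (hγ k).isWeight) x).le]

lemma ae_prod_pi_of_forall {μ : Measure X} [SigmaFinite μ] {n : ℕ} {τ : Fin n → Measure Y}
    [∀ k, SigmaFinite (τ k)] {p : Fin n → Y → Prop} (hp : ∀ k, ∀ᵐ y ∂τ k, p k y) :
    ∀ᵐ z ∂((Measure.pi fun _ : Fin n => μ).prod (Measure.pi τ)), ∀ k, p k (z.2 k) := by
  rw [ae_all_iff]
  intro k
  have h1 : ∀ᵐ y ∂Measure.pi τ, p k (y k) := (Measure.tendsto_eval_ae_ae (i := k)).eventually (hp k)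
  exact Measure.quasiMeasurePreserving_snd.ae h1

/-- Joint measurability of chains whose weights depend measurably on a parameter. -/
lemma measurable_chain_param {μ : Measure X} [SFinite μ] {Ω : Type*} [MeasurableSpace Ω]
    {q : X → X → ℝ}
    (hq : Measurable fun p : X × X => q p.1 p.2) (n : ℕ) {w : ℕ → Ω → X → ℝ}
    (hw : ∀ k, Measurable fun p : Ω × X => w k p.1 p.2) :
    Measurable fun p : Ω × X => chain μ q n (fun k => w k p.1) p.2 := by
  induction n generalizing w with
  | zero => exact measurable_const
  | succ n ih =>
    have h := ih fun k => hw (k + 1)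
    have h2 : Measurable fun r : (Ω × X) × X => (r.1.1, r.2) :=
      (measurable_fst.comp measurable_fst).prodMk measurable_snd
    have h3 : Measurable fun r : (Ω × X) × X => (r.1.2, r.2) :=
      (measurable_snd.comp measurable_fst).prodMk measurable_snd
    have hm : StronglyMeasurable (fun r : (Ω × X) × X => q r.1.2 r.2 *
        (w 0 r.1.1 r.2 * chain μ q n (fun k => w (k + 1) r.1.1) r.2)) :=
      ((hq.comp h3).mul (((hw 0).comp h2).mul (h.comp h2))).stronglyMeasurable
    exact hm.integral_prod_right'.measurable

lemma measurable_fderiv_apply {E : Type*} [NormedAddCommGroup E] [NormedSpace ℝ E] {Ω : Type*}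
    [MeasurableSpace Ω] {f : E → Ω → ℝ} {θ : E} (hf : ∀ᶠ t in 𝓝 θ, Measurable (f t))
    (hd : ∀ ω, DifferentiableAt ℝ (fun t => f t ω) θ) (v : E) :
    Measurable (fun ω => fderiv ℝ (fun t => f t ω) θ v) := by
  have h1 : Tendsto (fun n : ℕ => θ + ((n : ℝ))⁻¹ • v) atTop (𝓝 θ) := by
    have : Tendsto (fun n : ℕ => θ + ((n : ℝ))⁻¹ • v) atTop (𝓝 (θ + (0 : ℝ) • v)) :=
      tendsto_const_nhds.add ((tendsto_inv_atTop_nhds_zero_nat (𝕜 := ℝ)).smul_const v)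
    simpa using this
  obtain ⟨N, hN⟩ := eventually_atTop.1 (h1.eventually hf)
  refine measurable_of_tendsto_metrizable (f := fun n : ℕ => fun ω =>
    ((n + N : ℕ) : ℝ) * (f (θ + (((n + N : ℕ) : ℝ))⁻¹ • v) ω - f θ ω)) ?_ ?_
  · intro n
    exact ((hN (n + N) (by omega)).sub hf.self_of_nhds).const_mul (((n + N : ℕ) : ℝ))
  · rw [tendsto_pi_nhds]
    intro ω
    exact (hd ω).hasFDerivAt.lim v (c := fun n : ℕ => ((n + N : ℕ) : ℝ)) (l := atTop) (by
      simp only [Real.norm_natCast]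
      exact tendsto_natCast_atTop_atTop.comp (tendsto_add_atTop_nat N))

lemma measurable_fderiv2_apply {E : Type*} [NormedAddCommGroup E] [NormedSpace ℝ E] {Ω : Type*}
    [MeasurableSpace Ω] {f : E → Ω → ℝ} {θ : E} (hf : ∀ᶠ t in 𝓝 θ, Measurable (f t))
    (hd : ∀ᶠ t in 𝓝 θ, ∀ ω, ContDiffAt ℝ 2 (fun t => f t ω) t) (v w : E) :
    Measurable (fun ω => fderiv2 (fun t => f t ω) θ v w) := by
  have h := measurable_fderiv_apply (f := fun t ω => fderiv ℝ (fun t => f t ω) t w) (θ := θ) ?_ ?_ v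
  · convert h using 2 with ω
    have := (hd.self_of_nhds ω).differentiableAt_fderiv.hasFDerivAt.clm_apply
      (hasFDerivAt_const w θ)
    rw [this.fderiv]
    simp
  · filter_upwards [hf.eventually_nhds, hd] with t h1 h2
    exact measurable_fderiv_apply h1 (fun ω => (h2 ω).differentiableAt (by norm_num)) w
  · intro ω
    exact (hd.self_of_nhds ω).differentiableAt_fderiv.clm_apply (differentiableAt_const w)

lemma measurable_taylor2 {E : Type*} [NormedAddCommGroup E] [NormedSpace ℝ E] {Ω : Type*}
    [MeasurableSpace Ω] {f : E → Ω → ℝ} {θ : E} (hf : ∀ᶠ t in 𝓝 θ, Measurable (f t))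
    (hd : ∀ᶠ t in 𝓝 θ, ∀ ω, ContDiffAt ℝ 2 (fun t => f t ω) t) (v : E) (r : ℝ) :
    Measurable (fun ω => taylor2 (fun t => f t ω) θ v r) :=
  hf.self_of_nhds.add (((measurable_fderiv_apply hf
    (fun ω => (hd.self_of_nhds ω).differentiableAt (by norm_num)) v).const_mul r).add
    ((measurable_fderiv2_apply hf hd v v).const_mul _))

end Representation

/-! ### Smooth families of chains -/

section SmoothModel

variable {E : Type*} [NormedAddCommGroup E] [NormedSpace ℝ E] [FiniteDimensional ℝ E]
variable {X Y : Type*} [MeasurableSpace X] [MeasurableSpace Y]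

/-- A family of positive transition densities `q` and observation densities `γ`, smooth in the
parameter `θ ∈ Θ`; functions with derivative bounded by `K` on `Θ` are `Λ * K`-Lipschitz there. -/
structure SmoothModel (Θ : Set E) (q : E → X → X → ℝ) (γ : E → Y → X → ℝ) (c C K Λ : ℝ) :
    Prop where
  kernel : ∀ θ ∈ Θ, KernelBounds (q θ) c C
  nonneg : 0 ≤ K
  log_q : ∀ θ ∈ Θ, ∀ x x', ContDiffAt ℝ 2 (fun t => Real.log (q t x x')) θ ∧
    ‖fderiv ℝ (fun t => Real.log (q t x x')) θ‖ ≤ K ∧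
    ‖fderiv2 (fun t => Real.log (q t x x')) θ‖ ≤ K
  meas : ∀ θ ∈ Θ, Measurable fun p : Y × X => γ θ p.1 p.2
  pos : ∀ θ ∈ Θ, ∀ y x, 0 < γ θ y x
  log_γ : ∀ θ ∈ Θ, ∀ y x, ContDiffAt ℝ 2 (fun t => Real.log (γ t y x)) θ
  bounded : Bornology.IsBounded Θ
  lip_nonneg : 0 ≤ Λ
  lip : ∀ (f : E → ℝ) (B : ℝ), 0 ≤ B →
      (∀ x ∈ Θ, DifferentiableAt ℝ f x ∧ ‖fderiv ℝ f x‖ ≤ B) →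
      ∀ a ∈ Θ, ∀ b ∈ Θ, |f a - f b| ≤ Λ * B * dist a b

/-- A measure on the observations for which the derivatives of the logarithm of the observation
density are bounded by `e`. -/
structure IsWindow (μ : Measure X) (Θ : Set E) (γ : E → Y → X → ℝ) (τ : Measure Y) (e : ℝ) :
    Prop where
  ne_zero : τ ≠ 0
  nonneg : 0 ≤ e
  int_obs : ∀ θ ∈ Θ, ∀ x, Integrable (fun y => γ θ y x) τ
  int : ∀ θ ∈ Θ, Integrable (fun x => ∫ y, γ θ y x ∂τ) μ
  ae : ∀ᵐ y ∂τ, ∀ θ ∈ Θ, ∀ x, ‖fderiv ℝ (fun t => Real.log (γ t y x)) θ‖ ≤ e ∧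
    ‖fderiv2 (fun t => Real.log (γ t y x)) θ‖ ≤ e

/-- The logarithm of the path density. -/
def logPath (q : E → X → X → ℝ) (γ : E → Y → X → ℝ) (n : ℕ) (x : X) (θ : E)
    (p : (Fin n → X) × (Fin n → Y)) : ℝ :=
  ∑ k : Fin n, (Real.log (q θ (Fin.cons (α := fun _ => X) x p.1 k.castSucc) (p.1 k)) +
    Real.log (γ θ (p.2 k) (p.1 k)))

/-- The weights of the windows `τ`. -/
def winWeight (γ : E → Y → X → ℝ) (τ : ℕ → Measure Y) (θ : E) (k : ℕ) (x : X) : ℝ :=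
  ∫ y, γ θ y x ∂τ k

/-- The logarithm of the likelihood of `n` windows. -/
def logChain (μ : Measure X) (q : E → X → X → ℝ) (γ : E → Y → X → ℝ) (x : X) (n : ℕ)
    (τ : ℕ → Measure Y) (θ : E) : ℝ :=
  Real.log (chain μ (q θ) n (winWeight γ τ θ) x)

/-- The effect of the first window on the conditional likelihood of the last one. -/
def forget (μ : Measure X) (q : E → X → X → ℝ) (γ : E → Y → X → ℝ) (x : X) (n : ℕ)
    (τ : ℕ → Measure Y) (θ : E) : ℝ :=
  (logChain μ q γ x (n + 2) τ θ - logChain μ q γ x (n + 1) τ θ) -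
    (logChain μ q γ x (n + 1) (fun k => τ (k + 1)) θ - logChain μ q γ x n (fun k => τ (k + 1)) θ)

namespace SmoothModel

variable {μ : Measure X} [IsFiniteMeasure μ] [NeZero μ] {Θ : Set E} {q : E → X → X → ℝ}
  {γ : E → Y → X → ℝ} {c C K Λ : ℝ} {τ : ℕ → Measure Y} [∀ k, SigmaFinite (τ k)] {e : ℕ → ℝ}

lemma isObsWeight (h : SmoothModel Θ q γ c C K Λ) {τ : Measure Y} {e : ℝ}
    (hτ : IsWindow μ Θ γ τ e) {θ : E} (hθ : θ ∈ Θ) : IsObsWeight μ τ (γ θ) where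
  meas := h.meas θ hθ
  pos := h.pos θ hθ
  ne_zero := hτ.ne_zero
  int_obs := hτ.int_obs θ hθ
  int := hτ.int θ hθ

lemma isWeight (h : SmoothModel Θ q γ c C K Λ) (hτ : ∀ k, IsWindow μ Θ γ (τ k) (e k)) {θ : E}
    (hθ : θ ∈ Θ) (k : ℕ) : IsWeight μ (winWeight γ τ θ k) :=
  (h.isObsWeight (hτ k) hθ).isWeight

lemma exp_logPath (h : SmoothModel Θ q γ c C K Λ) {θ : E} (hθ : θ ∈ Θ) (n : ℕ) (x : X)
    (p : (Fin n → X) × (Fin n → Y)) :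
    Real.exp (logPath q γ n x θ p) = pathDensity (q θ) (γ θ) n x p := by
  unfold logPath pathDensity
  rw [Real.exp_sum]
  refine Finset.prod_congr rfl fun k _ => ?_
  rw [Real.exp_add, Real.exp_log ((h.kernel θ hθ).pos.trans_le ((h.kernel θ hθ).le _ _)),
    Real.exp_log (h.pos θ hθ _ _)]

lemma integral_exp_logPath (h : SmoothModel Θ q γ c C K Λ)
    (hτ : ∀ k, IsWindow μ Θ γ (τ k) (e k)) {θ : E} (hθ : θ ∈ Θ) (n : ℕ) (x : X) :
    Integrable (fun p => Real.exp (logPath q γ n x θ p))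
      ((Measure.pi fun _ : Fin n => μ).prod (Measure.pi fun k : Fin n => τ k)) ∧
    ∫ p, Real.exp (logPath q γ n x θ p)
      ∂((Measure.pi fun _ : Fin n => μ).prod (Measure.pi fun k : Fin n => τ k)) =
      chain μ (q θ) n (winWeight γ τ θ) x := by
  simp_rw [h.exp_logPath hθ]
  exact ⟨integrable_pathDensity (h.kernel θ hθ) n (fun k => h.isObsWeight (hτ k) hθ) x,
    integral_pathDensity (h.kernel θ hθ) n (fun k => h.isObsWeight (hτ k) hθ) x⟩

lemma measurable_logPath (h : SmoothModel Θ q γ c C K Λ) {θ : E} (hθ : θ ∈ Θ) (n : ℕ) (x : X) :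
    Measurable (logPath q γ n x θ) := by
  have : logPath q γ n x θ = fun p => Real.log (pathDensity (q θ) (γ θ) n x p) := by
    funext p
    rw [← h.exp_logPath hθ, Real.log_exp]
  rw [this]
  exact Real.measurable_log.comp
    (measurable_pathDensity (h.kernel θ hθ).meas (h.meas θ hθ) n x)

/-- The derivatives of the log path density. -/
lemma logPath_bounds (h : SmoothModel Θ q γ c C K Λ) (hτ : ∀ k, IsWindow μ Θ γ (τ k) (e k))
    (n : ℕ) (x : X) :
    ∀ᵐ p ∂((Measure.pi fun _ : Fin n => μ).prod (Measure.pi fun k : Fin n => τ k)), ∀ θ ∈ Θ,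
      ContDiffAt ℝ 2 (fun t => logPath q γ n x t p) θ ∧
      ‖fderiv ℝ (fun t => logPath q γ n x t p) θ‖ ≤ ∑ k ∈ Finset.range n, (K + e k) ∧
      ‖fderiv2 (fun t => logPath q γ n x t p) θ‖ ≤ ∑ k ∈ Finset.range n, (K + e k) := by
  filter_upwards [ae_prod_pi_of_forall (μ := μ) (fun k : Fin n => (hτ k).ae)] with p hp θ hθ
  have hc : ∀ k : Fin n, ContDiffAt ℝ 2 (fun t =>
      Real.log (q t (Fin.cons (α := fun _ => X) x p.1 k.castSucc) (p.1 k)) +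
      Real.log (γ t (p.2 k) (p.1 k))) θ := fun k =>
    (h.log_q θ hθ _ _).1.add (h.log_γ θ hθ _ _)
  refine ⟨?_, ?_, ?_⟩
  · exact ContDiffAt.sum fun k _ => hc k
  · unfold logPath
    rw [fderiv_fun_sum (fun k _ => (hc k).differentiableAt (by norm_num)),
      ← Fin.sum_univ_eq_sum_range (fun k => K + e k)]
    refine (norm_sum_le _ _).trans (Finset.sum_le_sum fun k _ => ?_)
    rw [fderiv_fun_add ((h.log_q θ hθ _ _).1.differentiableAt (by norm_num))
      ((h.log_γ θ hθ _ _).differentiableAt (by norm_num))]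
    exact (norm_add_le _ _).trans (add_le_add (h.log_q θ hθ _ _).2.1 (hp k θ hθ _).1)
  · unfold logPath
    rw [fderiv2_sum _ (fun k _ => hc k), ← Fin.sum_univ_eq_sum_range (fun k => K + e k)]
    refine (norm_sum_le _ _).trans (Finset.sum_le_sum fun k _ => ?_)
    rw [fderiv2_add (h.log_q θ hθ _ _).1 (h.log_γ θ hθ _ _)]
    exact (norm_add_le _ _).trans (add_le_add (h.log_q θ hθ _ _).2.2 (hp k θ hθ _).2)

lemma sum_nonneg (h : SmoothModel Θ q γ c C K Λ) (hτ : ∀ k, IsWindow μ Θ γ (τ k) (e k)) (n : ℕ) :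
    0 ≤ ∑ k ∈ Finset.range n, (K + e k) :=
  Finset.sum_nonneg fun k _ => add_nonneg h.nonneg (hτ k).nonneg

lemma logPath_lipschitz (h : SmoothModel Θ q γ c C K Λ) (hτ : ∀ k, IsWindow μ Θ γ (τ k) (e k))
    (n : ℕ) (x : X) :
    ∀ᵐ p ∂((Measure.pi fun _ : Fin n => μ).prod (Measure.pi fun k : Fin n => τ k)),
      ∀ a ∈ Θ, ∀ b ∈ Θ, |logPath q γ n x a p - logPath q γ n x b p| ≤
        Λ * (∑ k ∈ Finset.range n, (K + e k)) * dist a b := by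
  filter_upwards [h.logPath_bounds hτ n x] with p hp
  exact h.lip _ _ (h.sum_nonneg hτ n) fun θ hθ =>
    ⟨(hp θ hθ).1.differentiableAt (by norm_num), (hp θ hθ).2.1⟩

lemma chain_pos (h : SmoothModel Θ q γ c C K Λ) (hτ : ∀ k, IsWindow μ Θ γ (τ k) (e k)) {θ : E}
    (hθ : θ ∈ Θ) (n : ℕ) (x : X) : 0 < chain μ (q θ) n (winWeight γ τ θ) x :=
  (h.kernel θ hθ).chain_pos n (h.isWeight hτ hθ) x

/-- The Lipschitz bound holds path by path for the log density and is exponentiated before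
integration. Nothing is differentiated under the integral, so boundary points of `Θ` are included.
-/
lemma chain_le_chain (h : SmoothModel Θ q γ c C K Λ) (hτ : ∀ k, IsWindow μ Θ γ (τ k) (e k))
    (n : ℕ) (x : X) {a b : E} (ha : a ∈ Θ) (hb : b ∈ Θ) :
    chain μ (q a) n (winWeight γ τ a) x ≤
      Real.exp (Λ * (∑ k ∈ Finset.range n, (K + e k)) * dist a b) *
        chain μ (q b) n (winWeight γ τ b) x := by
  obtain ⟨hia, hea⟩ := h.integral_exp_logPath hτ ha n x
  obtain ⟨hib, heb⟩ := h.integral_exp_logPath hτ hb n x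
  rw [← hea, ← heb, ← integral_const_mul]
  refine integral_mono_ae hia (hib.const_mul _) ?_
  filter_upwards [h.logPath_lipschitz hτ n x] with p hp
  rw [← Real.exp_add]
  exact Real.exp_le_exp.2 (by linarith [abs_le.1 (hp a ha b hb)])

/-- As integrable majorant serves the path density at one reference parameter, multiplied by the
exponential of the Lipschitz constant times a bound on the diameter of `Θ`. -/
lemma logDensity (h : SmoothModel Θ q γ c C K Λ) (hτ : ∀ k, IsWindow μ Θ γ (τ k) (e k))
    (n : ℕ) (x : X) : ∃ W, LogDensity
      ((Measure.pi fun _ : Fin n => μ).prod (Measure.pi fun k : Fin n => τ k)) (interior Θ)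
      (logPath q γ n x) (∑ k ∈ Finset.range n, (K + e k)) (∑ k ∈ Finset.range n, (K + e k)) W := by
  set A := ∑ k ∈ Finset.range n, (K + e k)
  have hne : ((Measure.pi fun _ : Fin n => μ).prod (Measure.pi fun k : Fin n => τ k)) ≠ 0 := by
    have : ∀ k, NeZero (τ k) := fun k => ⟨(hτ k).ne_zero⟩
    intro h0
    have := congrArg (fun m => m Set.univ) h0
    rw [← Set.univ_prod_univ] at this
    simp only [Measure.prod_prod, Measure.coe_zero, Pi.zero_apply, mul_eq_zero,
      Measure.measure_univ_eq_zero] at this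
    rcases this with h1 | h1
    · have := congrArg (fun m => m Set.univ) h1
      simp [Measure.pi_univ, NeZero.ne μ] at this
    · have := congrArg (fun m => m Set.univ) h1
      simp [Measure.pi_univ, Finset.prod_eq_zero_iff, NeZero.ne] at this
  obtain ⟨R, hR⟩ := h.bounded.subset_closedBall (0 : E)
  rcases Θ.eq_empty_or_nonempty with h0 | ⟨θ₁, h1⟩
  · refine ⟨0, isOpen_interior, hne, ?_, integrable_zero _ _ _, ?_⟩ <;> simp [h0]
  refine ⟨fun p => Real.exp (Λ * A * (R + R)) * Real.exp (logPath q γ n x θ₁ p),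
    isOpen_interior, hne, fun θ hθ => (h.measurable_logPath (interior_subset hθ) n x).aestronglyMeasurable,
    (h.integral_exp_logPath hτ h1 n x).1.const_mul _, ?_⟩
  filter_upwards [h.logPath_lipschitz hτ n x, h.logPath_bounds hτ n x] with p hp hb θ hθ
  obtain ⟨hb1, hb2, hb3⟩ := hb θ (interior_subset hθ)
  refine ⟨hb1, hb2, hb3, ?_⟩
  rw [← Real.exp_add]
  refine Real.exp_le_exp.2 ?_
  have hd : dist θ θ₁ ≤ R + R := by
    refine (dist_triangle_right _ _ (0 : E)).trans (add_le_add ?_ ?_)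
    · exact hR (interior_subset hθ)
    · exact hR h1
  have := mul_le_mul_of_nonneg_left hd (mul_nonneg h.lip_nonneg (h.sum_nonneg hτ n))
  linarith [abs_le.1 (hp θ (interior_subset hθ) θ₁ h1)]

lemma logChain_lipschitz (h : SmoothModel Θ q γ c C K Λ) (hτ : ∀ k, IsWindow μ Θ γ (τ k) (e k))
    (n : ℕ) (x : X) {a b : E} (ha : a ∈ Θ) (hb : b ∈ Θ) :
    |logChain μ q γ x n τ a - logChain μ q γ x n τ b| ≤
      Λ * (∑ k ∈ Finset.range n, (K + e k)) * dist a b := by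
  have key : ∀ a ∈ Θ, ∀ b ∈ Θ, logChain μ q γ x n τ a ≤
      Λ * (∑ k ∈ Finset.range n, (K + e k)) * dist a b + logChain μ q γ x n τ b := by
    intro a ha b hb
    unfold logChain
    have := Real.log_le_log (h.chain_pos hτ ha n x) (h.chain_le_chain hτ n x ha hb)
    rwa [Real.log_mul (Real.exp_pos _).ne' (h.chain_pos hτ hb n x).ne', Real.log_exp] at this
  rw [abs_le]
  constructor
  · have := key b hb a ha
    rw [dist_comm] at this
    linarith
  · linarith [key a ha b hb]

lemma logChain_eq (h : SmoothModel Θ q γ c C K Λ) (hτ : ∀ k, IsWindow μ Θ γ (τ k) (e k))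
    (n : ℕ) (x : X) {θ : E} (hθ : θ ∈ Θ) :
    logChain μ q γ x n τ θ = Real.log (∫ p, Real.exp (logPath q γ n x θ p)
      ∂((Measure.pi fun _ : Fin n => μ).prod (Measure.pi fun k : Fin n => τ k))) := by
  rw [(h.integral_exp_logPath hτ hθ n x).2, logChain]

lemma logChain_eventuallyEq (h : SmoothModel Θ q γ c C K Λ)
    (hτ : ∀ k, IsWindow μ Θ γ (τ k) (e k))
    (n : ℕ) (x : X) {θ : E} (hθ : θ ∈ interior Θ) :
    (fun t => logChain μ q γ x n τ t) =ᶠ[𝓝 θ] fun t => Real.log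
      (∫ p, Real.exp (logPath q γ n x t p)
      ∂((Measure.pi fun _ : Fin n => μ).prod (Measure.pi fun k : Fin n => τ k))) := by
  filter_upwards [isOpen_interior.mem_nhds hθ] with t ht
  exact h.logChain_eq hτ n x (interior_subset ht)

lemma contDiffAt_logChain (h : SmoothModel Θ q γ c C K Λ)
    (hτ : ∀ k, IsWindow μ Θ γ (τ k) (e k))
    (n : ℕ) (x : X) {θ : E} (hθ : θ ∈ interior Θ) :
    ContDiffAt ℝ 2 (fun t => logChain μ q γ x n τ t) θ := by
  obtain ⟨W, hW⟩ := h.logDensity hτ n x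
  exact (hW.contDiffAt hθ).congr_of_eventuallyEq (h.logChain_eventuallyEq hτ n x hθ)

lemma norm_fderiv_logChain_le (h : SmoothModel Θ q γ c C K Λ)
    (hτ : ∀ k, IsWindow μ Θ γ (τ k) (e k))
    (n : ℕ) (x : X) {θ : E} (hθ : θ ∈ interior Θ) :
    ‖fderiv ℝ (fun t => logChain μ q γ x n τ t) θ‖ ≤ ∑ k ∈ Finset.range n, (K + e k) ∧
    ‖fderiv2 (fun t => logChain μ q γ x n τ t) θ‖ ≤ (∑ k ∈ Finset.range n, (K + e k)) +
      2 * (∑ k ∈ Finset.range n, (K + e k)) ^ 2 := by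
  obtain ⟨W, hW⟩ := h.logDensity hτ n x
  have h0 := h.sum_nonneg hτ n
  have he := h.logChain_eventuallyEq hτ n x hθ
  unfold fderiv2
  rw [he.fderiv_eq, he.fderiv.fderiv_eq]
  constructor
  · exact ContinuousLinearMap.opNorm_le_bound _ h0 fun v => hW.abs_fderiv_log_le hθ v
  · refine ContinuousLinearMap.opNorm_le_bound _ (by positivity) fun v => ?_
    exact ContinuousLinearMap.opNorm_le_bound _ (by positivity) fun w =>
      hW.abs_fderiv2_log_le hθ v w

/-- The forgetting estimate. -/
lemma abs_forget_le (h : SmoothModel Θ q γ c C K Λ)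
    (hτ : ∀ k, IsWindow μ Θ γ (τ k) (e k)) (n : ℕ) (x : X) {θ : E} (hθ : θ ∈ Θ) :
    |forget μ q γ x n τ θ| ≤ (C / c) * (1 - c / C) ^ n := by
  -- Exactly one window is dropped, hence `k = 1`; both chains start at the same point `x`.
  have := (h.kernel θ hθ).abs_log_chain_sub_le n 1 (h.isWeight hτ hθ) (Measure.dirac x)
    (Measure.dirac x)
  rw [integral_dirac' _ _ ((h.kernel θ hθ).chain_isBdd _ (h.isWeight hτ hθ)).meas.stronglyMeasurable,
    integral_dirac' _ _ ((h.kernel θ hθ).chain_isBdd _ (h.isWeight hτ hθ)).meas.stronglyMeasurable,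
    integral_dirac' _ _ ((h.kernel θ hθ).chain_isBdd _
      (fun k => h.isWeight hτ hθ (k + 1))).meas.stronglyMeasurable,
    integral_dirac' _ _ ((h.kernel θ hθ).chain_isBdd _
      (fun k => h.isWeight hτ hθ (k + 1))).meas.stronglyMeasurable] at this
  exact this

end SmoothModel
end SmoothModel

/-! ### Forgetting of the first observation -/

section Frozen

variable {E : Type*} [NormedAddCommGroup E] [NormedSpace ℝ E] [FiniteDimensional ℝ E]
variable {X Y : Type*} [MeasurableSpace X] [MeasurableSpace Y]

lemma abs_taylor2_sub_le {f : E → ℝ} {θ v : E} {r K : ℝ} (hv : ‖v‖ ≤ 1) (hr : |r| ≤ 1)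
    (h1 : ‖fderiv ℝ f θ‖ ≤ K) (h2 : ‖fderiv2 f θ‖ ≤ K) : |taylor2 f θ v r - f θ| ≤ 2 * K := by
  have hK : 0 ≤ K := (norm_nonneg _).trans h1
  have e1 : |fderiv ℝ f θ v| ≤ K := by
    refine ((fderiv ℝ f θ).le_opNorm v).trans ?_
    nlinarith [norm_nonneg v, norm_nonneg (fderiv ℝ f θ)]
  have e2 : |fderiv2 f θ v v| ≤ K := by
    refine ((fderiv2 f θ).le_opNorm₂ v v).trans ?_
    have : ‖fderiv2 f θ‖ * ‖v‖ ≤ K := by nlinarith [norm_nonneg v, norm_nonneg (fderiv2 f θ)]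
    nlinarith [norm_nonneg v, mul_nonneg (norm_nonneg (fderiv2 f θ)) (norm_nonneg v)]
  have hr2 : |r ^ 2 / 2| ≤ 1 := by
    rw [abs_div, abs_pow, abs_two]
    nlinarith [abs_nonneg r]
  unfold taylor2
  calc |f θ + (r * fderiv ℝ f θ v + r ^ 2 / 2 * fderiv2 f θ v v) - f θ|
      = |r * fderiv ℝ f θ v + r ^ 2 / 2 * fderiv2 f θ v v| := by ring_nf
    _ ≤ |r| * |fderiv ℝ f θ v| + |r ^ 2 / 2| * |fderiv2 f θ v v| := by
        rw [← abs_mul, ← abs_mul]; exact abs_add_le _ _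
    _ ≤ 1 * K + 1 * K := by gcongr
    _ = 2 * K := by ring

/-- The transition densities obtained by freezing the second order jet of `log q` at `θ`. -/
def frozenKernel (q : E → X → X → ℝ) (θ v : E) (r : ℝ) (_ : E) (x x' : X) : ℝ :=
  Real.exp (taylor2 (fun t => Real.log (q t x x')) θ v r)

/-- The observation densities obtained by freezing the second order jet of `log γ` at `θ`. -/
def frozenObs (γ : E → Y → X → ℝ) (θ v : E) (r : ℝ) (_ : E) (y : Y) (x : X) : ℝ :=
  Real.exp (taylor2 (fun t => Real.log (γ t y x)) θ v r)

namespace SmoothModel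

variable {μ : Measure X} [IsFiniteMeasure μ] [NeZero μ] {Θ : Set E} {q : E → X → X → ℝ}
  {γ : E → Y → X → ℝ} {c C K Λ : ℝ} {τ : ℕ → Measure Y} [∀ k, SigmaFinite (τ k)] {e : ℕ → ℝ}
  {θ v : E} {r : ℝ}

lemma measurable_frozenObs (h : SmoothModel Θ q γ c C K Λ) (hθ : θ ∈ interior Θ) (s : E) :
    Measurable fun p : Y × X => frozenObs γ θ v r s p.1 p.2 := by
  refine Real.measurable_exp.comp ?_
  refine measurable_taylor2 (f := fun t (p : Y × X) => Real.log (γ t p.1 p.2)) ?_ ?_ v r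
  · filter_upwards [isOpen_interior.mem_nhds hθ] with t ht
    exact Real.measurable_log.comp (h.meas t (interior_subset ht))
  · filter_upwards [isOpen_interior.mem_nhds hθ] with t ht p
    exact h.log_γ t (interior_subset ht) _ _

/-- For `‖v‖` and `|r|` at most one, freezing changes the logarithm by at most `2 * K`. The frozen
density need not be normalised, which the contraction argument never asks for. -/
lemma kernelBounds_frozen (h : SmoothModel Θ q γ c C K Λ) (hθ : θ ∈ interior Θ) (hv : ‖v‖ ≤ 1)
    (hr : |r| ≤ 1) (s : E) :
    KernelBounds (frozenKernel q θ v r s) (c * Real.exp (-(2 * K))) (C * Real.exp (2 * K)) where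
  meas := by
    refine Real.measurable_exp.comp ?_
    refine measurable_taylor2 (f := fun t (p : X × X) => Real.log (q t p.1 p.2)) ?_ ?_ v r
    · filter_upwards [isOpen_interior.mem_nhds hθ] with t ht
      exact Real.measurable_log.comp (h.kernel t (interior_subset ht)).meas
    · filter_upwards [isOpen_interior.mem_nhds hθ] with t ht p
      exact (h.log_q t (interior_subset ht) _ _).1
  pos := mul_pos (h.kernel θ (interior_subset hθ)).pos (Real.exp_pos _)
  le x x' := by
    have hk := h.kernel θ (interior_subset hθ)
    have hq := h.log_q θ (interior_subset hθ) x x'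
    have hb := abs_le.1 (abs_taylor2_sub_le hv hr hq.2.1 hq.2.2)
    calc c * Real.exp (-(2 * K)) ≤ q θ x x' * Real.exp (-(2 * K)) := by
          gcongr; exact hk.le _ _
      _ = Real.exp (Real.log (q θ x x') + -(2 * K)) := by
          rw [Real.exp_add, Real.exp_log (hk.pos.trans_le (hk.le _ _))]
      _ ≤ _ := Real.exp_le_exp.2 (by linarith)
  ge x x' := by
    have hk := h.kernel θ (interior_subset hθ)
    have hq := h.log_q θ (interior_subset hθ) x x'
    have hb := abs_le.1 (abs_taylor2_sub_le hv hr hq.2.1 hq.2.2)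
    calc frozenKernel q θ v r s x x' ≤ Real.exp (Real.log (q θ x x') + (2 * K)) :=
          Real.exp_le_exp.2 (by linarith)
      _ = q θ x x' * Real.exp (2 * K) := by
          rw [Real.exp_add, Real.exp_log (hk.pos.trans_le (hk.le _ _))]
      _ ≤ _ := by gcongr; exact hk.ge _ _

/-- The frozen densities do not move with the parameter, so they form a model over the one-point set
`{θ}` whose derivatives vanish. This makes the forgetting estimate and the path representation
available for them. -/
lemma frozen (h : SmoothModel Θ q γ c C K Λ) (hθ : θ ∈ interior Θ) (hv : ‖v‖ ≤ 1)
    (hr : |r| ≤ 1) : SmoothModel {θ} (frozenKernel q θ v r) (frozenObs γ θ v r)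
      (c * Real.exp (-(2 * K))) (C * Real.exp (2 * K)) K Λ where
  kernel s _ := h.kernelBounds_frozen hθ hv hr s
  nonneg := h.nonneg
  log_q s _ x x' := by
    unfold frozenKernel fderiv2
    refine ⟨contDiffAt_const, ?_, ?_⟩ <;> simp [h.nonneg]
  meas s _ := h.measurable_frozenObs hθ s
  pos s _ y x := Real.exp_pos _
  log_γ s _ y x := by
    unfold frozenObs
    exact contDiffAt_const
  bounded := Bornology.isBounded_singleton
  lip_nonneg := h.lip_nonneg
  lip f B _ _ a ha b hb := by
    rw [Set.mem_singleton_iff] at ha hb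
    simp [ha, hb]

/-- On the window, freezing multiplies the observation density by at most `exp (2 * e)`, so
integrability is inherited from the original density at `θ`. -/
lemma frozen_window (h : SmoothModel Θ q γ c C K Λ) {τ : Measure Y} [SigmaFinite τ] {e : ℝ}
    (hτ : IsWindow μ Θ γ τ e) (hθ : θ ∈ interior Θ) (hv : ‖v‖ ≤ 1) (hr : |r| ≤ 1) :
    IsWindow μ {θ} (frozenObs γ θ v r) τ e := by
  have hθ' := interior_subset hθ
  have hle : ∀ᵐ y ∂τ, ∀ s x, frozenObs γ θ v r s y x ≤ γ θ y x * Real.exp (2 * e) := by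
    filter_upwards [hτ.ae] with y hy s x
    obtain ⟨h1, h2⟩ := hy θ hθ' x
    have hb := abs_le.1 (abs_taylor2_sub_le hv hr h1 h2)
    calc frozenObs γ θ v r s y x ≤ Real.exp (Real.log (γ θ y x) + (2 * e)) :=
          Real.exp_le_exp.2 (by linarith)
      _ = _ := by rw [Real.exp_add, Real.exp_log (h.pos θ hθ' _ _)]
  have hi : ∀ s x, Integrable (fun y => frozenObs γ θ v r s y x) τ := by
    intro s x
    refine ((hτ.int_obs θ hθ' x).mul_const (Real.exp (2 * e))).mono'
      ((h.measurable_frozenObs hθ s).comp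
        (measurable_id.prodMk measurable_const)).aestronglyMeasurable ?_
    filter_upwards [hle] with y hy
    rw [frozenObs, Real.norm_of_nonneg (Real.exp_pos _).le]
    exact hy s x
  refine ⟨hτ.ne_zero, hτ.nonneg, fun s _ x => hi s x, fun s _ => ?_, ?_⟩
  · refine ((hτ.int θ hθ').mul_const (Real.exp (2 * e))).mono' ?_ (Eventually.of_forall fun x => ?_)
    · have hm : Measurable fun p : X × Y => frozenObs γ θ v r s p.2 p.1 :=
        (h.measurable_frozenObs hθ s).comp measurable_swap
      exact (StronglyMeasurable.integral_prod_right' (f := fun p : X × Y =>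
        frozenObs γ θ v r s p.2 p.1) hm.stronglyMeasurable).aestronglyMeasurable
    · have h0 : 0 ≤ ∫ y, frozenObs γ θ v r s y x ∂τ :=
        integral_nonneg fun y => (Real.exp_pos _).le
      rw [Real.norm_of_nonneg h0,
        ← integral_mul_const]
      refine integral_mono_ae (hi s x) ((hτ.int_obs θ hθ' x).mul_const _) ?_
      filter_upwards [hle] with y hy using hy s x
  · refine Eventually.of_forall fun y s _ x => ?_
    unfold frozenObs fderiv2
    constructor <;> simp [hτ.nonneg]

/-- The expansion of the log likelihood of the frozen model. -/
lemma abs_frozen_logChain_sub_le (h : SmoothModel Θ q γ c C K Λ)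
    (hτ : ∀ k, IsWindow μ Θ γ (τ k) (e k)) (hθ : θ ∈ interior Θ) (hv : ‖v‖ ≤ 1)
    (n : ℕ) (x : X) {a : ℝ} (ha : ∑ k ∈ Finset.range n, (K + e k) ≤ a)
    (hr : |r| * (1 + a + a) ≤ 1 / 4) :
    |logChain μ (frozenKernel q θ v r) (frozenObs γ θ v r) x n τ θ - logChain μ q γ x n τ θ -
      (r * fderiv ℝ (fun t => logChain μ q γ x n τ t) θ v +
        r ^ 2 / 2 * fderiv2 (fun t => logChain μ q γ x n τ t) θ v v)| ≤
      20 * (|r| ^ 3 * ((1 + a) ^ 3 + (1 + a) * a)) := by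
  have ha0 : 0 ≤ a := (h.sum_nonneg hτ n).trans ha
  have hr1 : |r| ≤ 1 := by nlinarith [abs_nonneg r]
  obtain ⟨W, hW⟩ := h.logDensity hτ n x
  -- The derivative bounds are relaxed to the common value `a`, so that one and the same `r` can be
  -- used for chains of different lengths.
  have hW' : LogDensity
      ((Measure.pi fun _ : Fin n => μ).prod (Measure.pi fun k : Fin n => τ k)) (interior Θ)
      (logPath q γ n x) a a W := ⟨hW.isOpen, hW.ne_zero, hW.meas, hW.int_majorant, by
    filter_upwards [hW.ae] with p hp t ht
    exact ⟨(hp t ht).1, (hp t ht).2.1.trans ha, (hp t ht).2.2.1.trans ha, (hp t ht).2.2.2⟩⟩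
  have he := h.logChain_eventuallyEq hτ n x hθ
  have h1 := hW'.abs_log_taylor2_sub_le hθ hv hr
  rw [(h.frozen hθ hv hr1).logChain_eq (fun k => h.frozen_window (hτ k) hθ hv hr1) n x rfl,
    h.logChain_eq hτ n x (interior_subset hθ)]
  unfold fderiv2 at h1 ⊢
  rw [he.fderiv_eq, he.fderiv.fderiv_eq]
  -- Taylor polynomials are additive: freezing the log density of a path is the same as freezing
  -- each of its factors.
  have h2 : ∀ p, taylor2 (fun t => logPath q γ n x t p) θ v r =
      logPath (frozenKernel q θ v r) (frozenObs γ θ v r) n x θ p := by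
    intro p
    unfold logPath frozenKernel frozenObs
    rw [taylor2_sum]
    · refine Finset.sum_congr rfl fun k _ => ?_
      rw [Real.log_exp, Real.log_exp]
      exact taylor2_add (h.log_q θ (interior_subset hθ) _ _).1
        (h.log_γ θ (interior_subset hθ) _ _) v r
    · exact fun k _ => (h.log_q θ (interior_subset hθ) _ _).1.add
        (h.log_γ θ (interior_subset hθ) _ _)
  simp_rw [h2] at h1
  exact h1

lemma contDiffAt_forget (h : SmoothModel Θ q γ c C K Λ)
    (hτ : ∀ k, IsWindow μ Θ γ (τ k) (e k)) (n : ℕ) (x : X) (hθ : θ ∈ interior Θ) :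
    ContDiffAt ℝ 2 (fun t => forget μ q γ x n τ t) θ :=
  ((h.contDiffAt_logChain hτ _ x hθ).sub (h.contDiffAt_logChain hτ _ x hθ)).sub
    ((h.contDiffAt_logChain (fun k => hτ (k + 1)) _ x hθ).sub
      (h.contDiffAt_logChain (fun k => hτ (k + 1)) _ x hθ))

/-- Interpolating between the forgetting estimate and the crude derivative bounds. -/
lemma norm_fderiv_forget_le (h : SmoothModel Θ q γ c C K Λ)
    (hτ : ∀ k, IsWindow μ Θ γ (τ k) (e k)) (hθ : θ ∈ interior Θ) (n : ℕ) (x : X)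
    {σ A₀ A : ℝ} (hσ0 : 0 < σ) (hσ1 : σ ≤ 1) (hA₀ : 0 ≤ A₀)
    (hσ : (C * Real.exp (2 * K) / (c * Real.exp (-(2 * K)))) *
      (1 - c * Real.exp (-(2 * K)) / (C * Real.exp (2 * K))) ^ n ≤ A₀ * (σ ^ n) ^ 4)
    (hA : ∑ k ∈ Finset.range (n + 2), (K + e k) ≤ A) :
    ‖fderiv ℝ (fun t => forget μ q γ x n τ t) θ‖ ≤ 128 * (A₀ + 4) * σ ^ n * (1 + 2 * A) ^ 2 ∧
    ‖fderiv2 (fun t => forget μ q γ x n τ t) θ‖ ≤ 128 * (A₀ + 4) * σ ^ n * (1 + 2 * A) ^ 2 := by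
  have hA0 : 0 ≤ A := (h.sum_nonneg hτ _).trans hA
  set s := σ ^ n with hs
  have hs0 : 0 < s := pow_pos hσ0 n
  have hs1 : s ≤ 1 := pow_le_one₀ hσ0.le hσ1
  -- The step is as large as the expansion allows up to the factor `s = σ ^ n`. Values of order `s ^
  -- 4` and remainders of order `s ^ 3`, divided by `r ^ 2`, still leave a factor `s`, at the price
  -- of `(1 + 2 * A) ^ 2`.
  set r := s / (4 * (1 + 2 * A)) with hr
  have hD : 0 < 1 + 2 * A := by positivity
  have hr0 : 0 < r := by positivity
  have hr4 : r * (1 + A + A) = s / 4 := by rw [hr]; field_simp; ring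
  have hrle : r ≤ 1 := by nlinarith
  have hterm : ∀ k, 0 ≤ K + e k := fun k => add_nonneg h.nonneg (hτ k).nonneg
  have hA1 : ∑ k ∈ Finset.range (n + 1), (K + e k) ≤ A :=
    (Finset.sum_le_sum_of_subset_of_nonneg (Finset.range_mono (by omega))
      fun k _ _ => hterm k).trans hA
  have hA2 : ∑ k ∈ Finset.range (n + 1), (K + e (k + 1)) ≤ A := by
    rw [Finset.sum_range_succ'] at hA
    linarith [hterm 0]
  have hA3 : ∑ k ∈ Finset.range n, (K + e (k + 1)) ≤ A :=
    (Finset.sum_le_sum_of_subset_of_nonneg (Finset.range_mono (by omega))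
      fun k _ _ => hterm (k + 1)).trans hA2
  have hτ' : ∀ k, IsWindow μ Θ γ (τ (k + 1)) (e (k + 1)) := fun k => hτ (k + 1)
  have hrem : 20 * (|r| ^ 3 * ((1 + A) ^ 3 + (1 + A) * A)) ≤ s ^ 3 := by
    rw [abs_of_pos hr0]
    have h1 : (1 + A) ^ 3 + (1 + A) * A ≤ 2 * (1 + 2 * A) ^ 3 := by
      nlinarith [mul_nonneg hA0 hA0, mul_nonneg (mul_nonneg hA0 hA0) hA0]
    have h2 : r ^ 3 * (1 + 2 * A) ^ 3 = s ^ 3 / 64 := by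
      rw [← mul_pow, show r * (1 + 2 * A) = s / 4 by rw [← hr4]; ring]; ring
    calc 20 * (r ^ 3 * ((1 + A) ^ 3 + (1 + A) * A)) ≤ 20 * (r ^ 3 * (2 * (1 + 2 * A) ^ 3)) := by
          gcongr
      _ = 40 * (r ^ 3 * (1 + 2 * A) ^ 3) := by ring
      _ = 40 * (s ^ 3 / 64) := by rw [h2]
      _ ≤ s ^ 3 := by nlinarith [pow_pos hs0 3]
  -- the derivatives of `forget`
  have hf1 : fderiv ℝ (fun t => forget μ q γ x n τ t) θ =
      (fderiv ℝ (fun t => logChain μ q γ x (n + 2) τ t) θ -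
        fderiv ℝ (fun t => logChain μ q γ x (n + 1) τ t) θ) -
      (fderiv ℝ (fun t => logChain μ q γ x (n + 1) (fun k => τ (k + 1)) t) θ -
        fderiv ℝ (fun t => logChain μ q γ x n (fun k => τ (k + 1)) t) θ) := by
    have d1 := (h.contDiffAt_logChain hτ (n + 2) x hθ).differentiableAt (by norm_num)
    have d2 := (h.contDiffAt_logChain hτ (n + 1) x hθ).differentiableAt (by norm_num)
    have d3 := (h.contDiffAt_logChain hτ' (n + 1) x hθ).differentiableAt (by norm_num)
    have d4 := (h.contDiffAt_logChain hτ' n x hθ).differentiableAt (by norm_num)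
    unfold forget
    rw [fderiv_fun_sub (d1.fun_sub d2) (d3.fun_sub d4), fderiv_fun_sub d1 d2,
      fderiv_fun_sub d3 d4]
  have hf2 : fderiv2 (fun t => forget μ q γ x n τ t) θ =
      (fderiv2 (fun t => logChain μ q γ x (n + 2) τ t) θ -
        fderiv2 (fun t => logChain μ q γ x (n + 1) τ t) θ) -
      (fderiv2 (fun t => logChain μ q γ x (n + 1) (fun k => τ (k + 1)) t) θ -
        fderiv2 (fun t => logChain μ q γ x n (fun k => τ (k + 1)) t) θ) := by
    have d1 := h.contDiffAt_logChain hτ (n + 2) x hθ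
    have d2 := h.contDiffAt_logChain hτ (n + 1) x hθ
    have d3 := h.contDiffAt_logChain hτ' (n + 1) x hθ
    have d4 := h.contDiffAt_logChain hτ' n x hθ
    unfold forget
    rw [fderiv2_sub (d1.sub d2) (d3.sub d4), fderiv2_sub d1 d2, fderiv2_sub d3 d4]
  -- Forgetting for the frozen model bounds the value; the four expansions of the log likelihoods
  -- entering `forget` contribute one remainder `s ^ 3` each.
  have main : ∀ v : E, ‖v‖ ≤ 1 → ∀ r' : ℝ, |r'| = r →
      |forget μ (frozenKernel q θ v r') (frozenObs γ θ v r') x n τ θ| ≤ A₀ * s ^ 4 ∧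
      |forget μ (frozenKernel q θ v r') (frozenObs γ θ v r') x n τ θ - forget μ q γ x n τ θ -
        (r' * fderiv ℝ (fun t => forget μ q γ x n τ t) θ v +
        r' ^ 2 / 2 * fderiv2 (fun t => forget μ q γ x n τ t) θ v v)| ≤ 4 * s ^ 3 := by
    intro v hv r' hr'
    have hr1 : |r'| ≤ 1 := by rw [hr']; exact hrle
    have hr4' : |r'| * (1 + A + A) ≤ 1 / 4 := by rw [hr', hr4]; linarith
    have hrem' : 20 * (|r'| ^ 3 * ((1 + A) ^ 3 + (1 + A) * A)) ≤ s ^ 3 := by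
      rw [hr', ← abs_of_pos hr0]; exact hrem
    refine ⟨((h.frozen hθ hv hr1).abs_forget_le
      (fun k => h.frozen_window (hτ k) hθ hv hr1) n x rfl).trans hσ, ?_⟩
    have b1 := (h.abs_frozen_logChain_sub_le hτ hθ hv (n + 2) x hA hr4').trans hrem'
    have b2 := (h.abs_frozen_logChain_sub_le hτ hθ hv (n + 1) x hA1 hr4').trans hrem'
    have b3 := (h.abs_frozen_logChain_sub_le hτ' hθ hv (n + 1) x hA2 hr4').trans hrem'
    have b4 := (h.abs_frozen_logChain_sub_le hτ' hθ hv n x hA3 hr4').trans hrem'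
    rw [hf1, hf2]
    simp only [_root_.sub_apply]
    unfold forget
    rw [abs_le] at b1 b2 b3 b4 ⊢
    constructor <;> linarith [b1.1, b1.2, b2.1, b2.2, b3.1, b3.2, b4.1, b4.2]
  -- At `r = 0` the frozen model is the original one, so the central value obeys the same bound.
  have h0 : ∀ v : E, ‖v‖ ≤ 1 → |forget μ q γ x n τ θ| ≤ A₀ * s ^ 4 := by
    intro v hv
    have hK := h.kernel θ (interior_subset hθ)
    have := ((h.frozen hθ hv (r := 0) (by simp)).abs_forget_le
      (fun k => h.frozen_window (hτ k) hθ hv (r := 0) (by simp)) n x rfl).trans hσ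
    have e1 : frozenKernel q θ v 0 θ = q θ := by
      funext a b
      simp only [frozenKernel, taylor2_zero]
      exact Real.exp_log (hK.pos.trans_le (hK.le _ _))
    have e2 : frozenObs γ θ v 0 θ = γ θ := by
      funext y a
      simp only [frozenObs, taylor2_zero]
      exact Real.exp_log (h.pos θ (interior_subset hθ) _ _)
    have e3 : forget μ (frozenKernel q θ v 0) (frozenObs γ θ v 0) x n τ θ =
        forget μ q γ x n τ θ := by
      have e4 : ∀ τ : ℕ → Measure Y, winWeight (frozenObs γ θ v 0) τ θ = winWeight γ τ θ := by
        intro τ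
        funext k a
        simp only [winWeight, e2]
      simp only [forget, logChain, e1, e4]
    rwa [e3] at this
  have hcoef : ∀ v : E, ‖v‖ ≤ 1 → |fderiv ℝ (fun t => forget μ q γ x n τ t) θ v| ≤
      128 * (A₀ + 4) * s * (1 + 2 * A) ^ 2 ∧
      |fderiv2 (fun t => forget μ q γ x n τ t) θ v v| ≤
        64 * (A₀ + 4) * s * (1 + 2 * A) ^ 2 := by
    intro v hv
    obtain ⟨p1, p2⟩ := main v hv r (abs_of_pos hr0)
    obtain ⟨m1, m2⟩ := main v hv (-r) (by rw [abs_neg, abs_of_pos hr0])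
    rw [neg_sq] at m2
    obtain ⟨c1, c2⟩ := abs_coeff_le_of_small hr0 (h0 v hv) p1 m1 p2 m2
    have hs43 : s ^ 4 ≤ s ^ 3 := pow_le_pow_of_le_one hs0.le hs1 (by norm_num)
    constructor
    · refine c1.trans ?_
      rw [hr, div_div_eq_mul_div, div_le_iff₀ hs0]
      have hs32 : s ^ 3 ≤ s * s := by nlinarith
      have hD2 : 4 * (1 + 2 * A) ≤ 128 * (1 + 2 * A) ^ 2 := by nlinarith
      calc (A₀ * s ^ 4 + 4 * s ^ 3) * (4 * (1 + 2 * A))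
          ≤ (A₀ * (s * s) + 4 * (s * s)) * (128 * (1 + 2 * A) ^ 2) := by
            gcongr; exact hs43.trans hs32
        _ = _ := by ring
    · refine c2.trans ?_
      rw [hr, div_pow, div_div_eq_mul_div, div_le_iff₀ (by positivity)]
      calc (4 * (A₀ * s ^ 4) + 2 * (4 * s ^ 3)) * (4 * (1 + 2 * A)) ^ 2
          ≤ (4 * (A₀ * s ^ 3) + 4 * (4 * s ^ 3)) * (4 * (1 + 2 * A)) ^ 2 := by
            gcongr; norm_num
        _ = _ := by ring
  have hB : 0 ≤ 64 * (A₀ + 4) * s * (1 + 2 * A) ^ 2 := by positivity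
  constructor
  · refine ContinuousLinearMap.opNorm_le_of_unit_norm (by linarith) fun v hv =>
      (hcoef v hv.le).1
  -- Passing from the quadratic form to the bilinear form doubles the constant `64`.
  · refine (norm_le_of_forall_abs_apply_self_le
      (h.contDiffAt_forget hτ n x hθ).fderiv2_symm hB fun v hv => (hcoef v hv).2).trans ?_
    linarith

end SmoothModel
end Frozen

/-! ### Markov chains and ergodicity -/

section Markov

variable {Z : Type*} [MeasurableSpace Z]

/-- Square cylinders form a generating π-system. A finite index set is enlarged to an initial
segment by leaving the additional coordinates unconstrained. -/
lemma ext_of_prod_cylinder {P P' : Measure (ℕ → Z)} [IsFiniteMeasure P]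
    (h : ∀ (n : ℕ) (B : ℕ → Set Z), (∀ k, MeasurableSet (B k)) →
      P {ω | ∀ k ∈ Finset.range (n + 1), ω k ∈ B k} =
        P' {ω | ∀ k ∈ Finset.range (n + 1), ω k ∈ B k}) :
    P = P' := by
  refine ext_of_generate_finite _ (generateFrom_squareCylinders (ι := ℕ) (α := fun _ => Z)).symm
    (isPiSystem_squareCylinders (fun _ => MeasurableSpace.isPiSystem_measurableSet)
      fun _ => MeasurableSet.univ) ?_
    (by simpa using h 0 (fun _ => Set.univ) fun _ => MeasurableSet.univ)
  intro s hs
  simp only [squareCylinders, Set.mem_ofPred_eq] at hs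
  obtain ⟨I, B, hB, rfl⟩ := hs
  classical
  have hB' : ∀ i, MeasurableSet (B i) := fun i => hB i (Set.mem_univ i)
  have e : (I : Set ℕ).pi B = {ω : ℕ → Z | ∀ k ∈ Finset.range (I.sup id + 1),
      ω k ∈ if k ∈ I then B k else Set.univ} := by
    ext ω
    simp only [Set.mem_pi, SetLike.mem_coe, Set.mem_ofPred_eq, Finset.mem_range]
    constructor
    · intro hω k _
      split_ifs with hk
      · exact hω k hk
      · trivial
    · intro hω k hk
      have := hω k (Nat.lt_succ_of_le (Finset.le_sup (f := id) hk))
      rwa [if_pos hk] at this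
  rw [e]
  refine h _ _ fun k => ?_
  split_ifs
  · exact hB' k
  · exact MeasurableSet.univ

/-- The shift of sequences. -/
def seqShift (ω : ℕ → Z) : ℕ → Z := fun k => ω (k + 1)

lemma measurable_seqShift : Measurable (seqShift (Z := Z)) :=
  measurable_pi_lambda _ fun k => measurable_pi_apply (k + 1)

lemma seqShift_iterate (n : ℕ) (ω : ℕ → Z) : seqShift^[n] ω = fun k => ω (n + k) := by
  induction n with
  | zero => simp
  | succ n ih =>
    rw [Function.iterate_succ_apply', ih]
    funext k
    simp only [seqShift]
    congr 1; omega

variable (κ : Kernel Z Z) [IsMarkovKernel κ]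

/-- The kernel giving the next state from the past. -/
def stepFrom (n : ℕ) : Kernel (Finset.Iic n → Z) Z :=
  κ.comap (fun h => h ⟨n, Finset.mem_Iic.2 le_rfl⟩) (measurable_pi_apply _)

instance (n : ℕ) : IsMarkovKernel (stepFrom κ n) := by
  unfold stepFrom; infer_instance

/-- The law of the Markov chain with transition kernel `κ` and initial law `ρ`. -/
def markovLaw (ρ : Measure Z) : Measure (ℕ → Z) :=
  Kernel.trajMeasure (X := fun _ => Z) ρ (stepFrom κ)

instance (ρ : Measure Z) [IsProbabilityMeasure ρ] : IsProbabilityMeasure (markovLaw κ ρ) := by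
  unfold markovLaw; infer_instance

/-- The law of the Markov chain started at a point. -/
def markovFrom : Kernel Z (ℕ → Z) :=
  (Kernel.traj (X := fun _ => Z) (stepFrom κ) 0).comap (fun z _ => z)
    (measurable_pi_lambda _ fun _ => measurable_id)

instance : IsMarkovKernel (markovFrom κ) := by
  unfold markovFrom; infer_instance

lemma markovLaw_eq_bind (ρ : Measure Z) : markovLaw κ ρ = ρ.bind (markovFrom κ) := by
  unfold markovLaw Kernel.trajMeasure markovFrom
  refine Measure.ext fun B hB => ?_
  rw [Measure.bind_apply hB (Kernel.aemeasurable _), Measure.bind_apply hB (Kernel.aemeasurable _),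
    lintegral_map (Kernel.measurable_coe _ hB) (MeasurableEquiv.measurable _)]
  rfl

lemma markovLaw_dirac (z : Z) : markovLaw κ (Measure.dirac z) = markovFrom κ z := by
  rw [markovLaw_eq_bind, Measure.dirac_bind (Kernel.measurable _)]

/-- Expectations of product functions of a Markov chain. -/
def cyl : ℕ → (ℕ → Z → ℝ≥0∞) → Z → ℝ≥0∞
  | 0, f, z => f 0 z
  | n + 1, f, z => f 0 z * ∫⁻ z', cyl n (fun k => f (k + 1)) z' ∂κ z

lemma measurable_cyl (n : ℕ) {f : ℕ → Z → ℝ≥0∞} (hf : ∀ k, Measurable (f k)) :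
    Measurable (cyl κ n f) := by
  induction n generalizing f with
  | zero => exact hf 0
  | succ n ih =>
    exact (hf 0).mul ((ih (f := fun k => f (k + 1)) fun k => hf (k + 1)).lintegral_kernel)

lemma cyl_congr (n : ℕ) {f g : ℕ → Z → ℝ≥0∞} (h : ∀ k ≤ n, f k = g k) :
    cyl κ n f = cyl κ n g := by
  induction n generalizing f g with
  | zero => funext z; simp [cyl, h 0 le_rfl]
  | succ n ih =>
    funext z
    simp only [cyl]
    rw [h 0 (Nat.zero_le _), ih (f := fun k => f (k + 1)) (g := fun k => g (k + 1))
      fun k hk => h (k + 1) (by omega)]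

/-- The Chapman–Kolmogorov relation for product functions: everything from time `n` onwards is
collected into the factor at time `n`. -/
lemma cyl_add (n m : ℕ) (f : ℕ → Z → ℝ≥0∞) :
    cyl κ (n + m) f =
      cyl κ n (fun k => if k = n then cyl κ m (fun j => f (n + j)) else f k) := by
  induction n generalizing f with
  | zero => funext z; simp [cyl]
  | succ n ih =>
    funext z
    rw [show n + 1 + m = (n + m) + 1 by ring]
    simp only [cyl]
    rw [ih]
    congr 2
    · funext z'
      congr 2
      funext k
      by_cases hk : k = n
      · subst hk
        simp only [if_true]
        congr 1
        funext j
        congr 1; ring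
      · simp [hk]

/-- This identifies the trajectory measure with iterated integrals of the transition kernel. All
later facts about the law of the chain are reduced to it. -/
lemma lintegral_markovLaw_prod (ρ : Measure Z) [IsProbabilityMeasure ρ] (n : ℕ)
    {f : ℕ → Z → ℝ≥0∞} (hf : ∀ k, Measurable (f k)) :
    ∫⁻ ω, ∏ k ∈ Finset.range (n + 1), f k (ω k) ∂markovLaw κ ρ = ∫⁻ z, cyl κ n f z ∂ρ := by
  induction n generalizing f with
  | zero =>
    simp only [zero_add, Finset.range_one, Finset.prod_singleton, cyl]
    have hm : Measurable fun ω : ℕ → Z => f 0 (ω 0) := (hf 0).comp (measurable_pi_apply 0)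
    rw [markovLaw_eq_bind, Measure.lintegral_bind (Kernel.aemeasurable _) hm.aemeasurable]
    refine lintegral_congr fun z => ?_
    have hm' : Measurable fun h : Finset.Iic 0 → Z => f 0 (h ⟨0, by simp⟩) :=
      (hf 0).comp (measurable_pi_apply _)
    have := congrArg (fun m => ∫⁻ h, f 0 (h ⟨0, by simp⟩) ∂m)
      (Kernel.traj_map_frestrictLe_apply (X := fun _ => Z) (κ := stepFrom κ) 0 0 fun _ => z)
    beta_reduce at this
    rw [lintegral_map hm' (by fun_prop), Kernel.partialTraj_self, Kernel.id_apply,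
      lintegral_dirac' _ hm'] at this
    exact this
  | succ n ih =>
    have key := Kernel.map_frestrictLe_trajMeasure_compProd_eq_map_trajMeasure
      (X := fun _ => Z) (κ := stepFrom κ) (μ₀ := ρ) (a := n)
    have hF : Measurable fun p : (Finset.Iic n → Z) × Z =>
        (∏ k : Finset.Iic n, f k (p.1 k)) * f (n + 1) p.2 := by
      refine Measurable.mul ?_ ((hf _).comp measurable_snd)
      exact Finset.measurable_prod _ fun k _ =>
        (hf k).comp ((measurable_pi_apply k).comp measurable_fst)
    have h1 := congrArg (fun m => ∫⁻ p, (∏ k : Finset.Iic n, f k (p.1 k)) * f (n + 1) p.2 ∂m) key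
    beta_reduce at h1
    rw [Measure.lintegral_compProd hF, lintegral_map hF (by fun_prop),
      lintegral_map hF.lintegral_kernel_prod_right' (by fun_prop)] at h1
    have hp : ∀ ω : ℕ → Z, ∏ k : Finset.Iic n, f k (Preorder.frestrictLe (π := fun _ => Z) n ω k) =
        ∏ k ∈ Finset.range (n + 1), f k (ω k) := by
      intro ω
      rw [show Finset.range (n + 1) = Finset.Iic n by ext; simp]
      rw [← Finset.prod_coe_sort (Finset.Iic n) fun k => f k (ω k)]
      rfl
    simp only [hp] at h1
    -- The last coordinate is integrated out and its conditional mean absorbed into the factor at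
    -- time `n`.
    have h2 := ih (f := fun k => if k = n then fun z => f n z * ∫⁻ z', f (n + 1) z' ∂κ z else f k)
      (by
        intro k
        split_ifs
        · exact (hf n).mul (hf _).lintegral_kernel
        · exact hf k)
    rw [cyl_add κ n 1]
    have e1 : (fun z => f n z * ∫⁻ z', f (n + 1) z' ∂κ z) = cyl κ 1 (fun j => f (n + j)) := rfl
    rw [← e1]
    have e2 : cyl κ n (fun k => if k = n then fun z => f n z * ∫⁻ z', f (n + 1) z' ∂κ z else f k) =
       cyl κ n (fun k => if k = n then fun z => f n z * ∫⁻ z', f (n + 1) z' ∂κ z else f k) := rfl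
    rw [← h2]
    unfold markovLaw
    simp_rw [Finset.prod_range_succ _ (n + 1)]
    rw [← h1]
    refine lintegral_congr fun ω => ?_
    rw [lintegral_const_mul _ (hf _), Finset.prod_range_succ, Finset.prod_range_succ]
    simp only [if_true]
    rw [mul_assoc]
    congr 1
    refine Finset.prod_congr rfl fun k hk => ?_
    rw [if_neg (Finset.mem_range.1 hk).ne]

lemma lintegral_markovFrom_prod (z : Z) (n : ℕ) {f : ℕ → Z → ℝ≥0∞} (hf : ∀ k, Measurable (f k)) :
    ∫⁻ ω, ∏ k ∈ Finset.range (n + 1), f k (ω k) ∂markovFrom κ z = cyl κ n f z := by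
  rw [← markovLaw_dirac, lintegral_markovLaw_prod κ _ n hf, lintegral_dirac' _ (measurable_cyl κ n hf)]

lemma cyl_mul_head (m : ℕ) (a : Z → ℝ≥0∞) (g : ℕ → Z → ℝ≥0∞) (z : Z) :
    cyl κ m (fun j => if j = 0 then fun z => a z * g 0 z else g j) z = a z * cyl κ m g z := by
  cases m with
  | zero => simp [cyl]
  | succ m => simp [cyl, mul_assoc]

/-- The Markov property for product functions of past and future. Each side is again the integral of
one product function, once the past factor at time `n` has been merged with the function attached to
the future there. -/
lemma lintegral_prod_mul_prod (ρ : Measure Z) [IsProbabilityMeasure ρ] (n m : ℕ)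
    {a b : ℕ → Z → ℝ≥0∞} (ha : ∀ k, Measurable (a k)) (hb : ∀ k, Measurable (b k)) :
    ∫⁻ ω, (∏ k ∈ Finset.range (n + 1), a k (ω k)) * ∏ j ∈ Finset.range (m + 1), b j (ω (n + j))
        ∂markovLaw κ ρ =
      ∫⁻ ω, (∏ k ∈ Finset.range (n + 1), a k (ω k)) * cyl κ m b (ω n) ∂markovLaw κ ρ := by
  set f : ℕ → Z → ℝ≥0∞ := fun k => if k < n then a k else
    if k = n then fun z => a n z * b 0 z else b (k - n) with hf
  have hfm : ∀ k, Measurable (f k) := by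
    intro k
    simp only [hf]
    split_ifs
    · exact ha k
    · exact (ha n).mul (hb 0)
    · exact hb _
  have hfn : (fun j => f (n + j)) = fun j => if j = 0 then fun z => a n z * b 0 z else b j := by
    funext j
    by_cases hj : j = 0
    · simp [hf, hj]
    · simp [hf, hj]
  set g : ℕ → Z → ℝ≥0∞ := fun k => if k = n then fun z => a n z * cyl κ m b z else a k with hg
  have hgm : ∀ k, Measurable (g k) := by
    intro k
    simp only [hg]
    split_ifs
    · exact (ha n).mul (measurable_cyl κ m hb)
    · exact ha k
  have h1 : ∀ ω : ℕ → Z, (∏ k ∈ Finset.range (n + 1), a k (ω k)) *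
      ∏ j ∈ Finset.range (m + 1), b j (ω (n + j)) =
      ∏ k ∈ Finset.range (n + m + 1), f k (ω k) := by
    intro ω
    rw [add_assoc n m 1, Finset.prod_range_add (fun k => f k (ω k)),
      Finset.prod_range_succ (fun k => a k (ω k)), mul_assoc]
    congr 1
    · refine Finset.prod_congr rfl fun k hk => ?_
      simp [hf, Finset.mem_range.1 hk]
    · have : ∀ j, f (n + j) = if j = 0 then fun z => a n z * b 0 z else b j := congrFun hfn
      simp_rw [this]
      rw [Finset.prod_range_succ', Finset.prod_range_succ']
      simp only [if_true, add_zero, Nat.add_eq_zero_iff, one_ne_zero, and_false, if_false]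
      ring
  have h2 : ∀ ω : ℕ → Z, (∏ k ∈ Finset.range (n + 1), a k (ω k)) * cyl κ m b (ω n) =
      ∏ k ∈ Finset.range (n + 1), g k (ω k) := by
    intro ω
    rw [Finset.prod_range_succ, Finset.prod_range_succ, mul_assoc]
    congr 1
    · refine Finset.prod_congr rfl fun k hk => ?_
      simp [hg, (Finset.mem_range.1 hk).ne]
    · simp [hg]
  simp_rw [h1, h2]
  rw [lintegral_markovLaw_prod κ ρ _ hfm, lintegral_markovLaw_prod κ ρ _ hgm, cyl_add, hfn]
  have hc : ∀ u w : ℕ → Z → ℝ≥0∞, (∀ k ≤ n, u k = w k) →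
      ∫⁻ z, cyl κ n u z ∂ρ = ∫⁻ z, cyl κ n w z ∂ρ := fun u w h => by rw [cyl_congr κ n h]
  refine hc _ _ fun k hk => ?_
  rcases eq_or_lt_of_le hk with rfl | hk
  · simp only [if_true, hg]
    funext z
    exact cyl_mul_head κ m (a k) b z
  · simp [hf, hg, hk, hk.ne]

lemma indicator_forall_range (n : ℕ) (B : ℕ → Set Z) (ω : ℕ → Z) :
    ∏ k ∈ Finset.range n, (B k).indicator (fun _ => (1 : ℝ≥0∞)) (ω k) =
      {ω : ℕ → Z | ∀ k ∈ Finset.range n, ω k ∈ B k}.indicator 1 ω := by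
  classical
  by_cases h : ∀ k ∈ Finset.range n, ω k ∈ B k
  · rw [Set.indicator_of_mem (by exact h)]
    exact Finset.prod_eq_one fun k hk => Set.indicator_of_mem (h k hk) _
  · rw [Set.indicator_of_notMem (by exact h)]
    push Not at h
    obtain ⟨k, hk, hk'⟩ := h
    exact Finset.prod_eq_zero hk (Set.indicator_of_notMem hk' _)

lemma measurableSet_cylinder (n : ℕ) {B : ℕ → Set Z} (hB : ∀ k, MeasurableSet (B k)) :
    MeasurableSet {ω : ℕ → Z | ∀ k ∈ Finset.range n, ω k ∈ B k} := by
  have : {ω : ℕ → Z | ∀ k ∈ Finset.range n, ω k ∈ B k} =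
      ⋂ k ∈ Finset.range n, (fun ω : ℕ → Z => ω k) ⁻¹' B k := by ext; simp
  rw [this]
  exact Finset.measurableSet_biInter _ fun k _ => measurable_pi_apply k (hB k)

lemma measurable_seqShift_iterate (n : ℕ) : Measurable (seqShift^[n] : (ℕ → Z) → _) :=
  measurable_seqShift.iterate n

lemma map_restrict_cylinder (ρ : Measure Z) [IsProbabilityMeasure ρ] (n : ℕ) {S : ℕ → Set Z}
    (hS : ∀ k, MeasurableSet (S k)) :
    ((markovLaw κ ρ).restrict {ω | ∀ k ∈ Finset.range (n + 1), ω k ∈ S k}).map (seqShift^[n]) =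
      ((markovLaw κ ρ).restrict {ω | ∀ k ∈ Finset.range (n + 1), ω k ∈ S k}).bind
        ((markovFrom κ).comap (fun ω => ω n) (measurable_pi_apply n)) := by
  have hA := measurableSet_cylinder (n + 1) hS
  refine ext_of_prod_cylinder fun m C hC => ?_
  have hB := measurableSet_cylinder (m + 1) hC
  rw [Measure.map_apply (measurable_seqShift_iterate n) hB,
    Measure.bind_apply hB (Kernel.aemeasurable _),
    Measure.restrict_apply (measurable_seqShift_iterate n hB), ← lintegral_indicator hA,
    ← lintegral_indicator_one ((measurable_seqShift_iterate n hB).inter hA)]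
  have hi : ∀ B : Set Z, MeasurableSet B → Measurable (B.indicator fun _ => (1 : ℝ≥0∞)) :=
    fun B hB => measurable_const.indicator hB
  have key := lintegral_prod_mul_prod κ ρ n m (fun k => hi _ (hS k)) (fun k => hi _ (hC k))
  convert key using 1
  · refine lintegral_congr fun ω => ?_
    rw [indicator_forall_range]
    have := indicator_forall_range (m + 1) C (seqShift^[n] ω)
    rw [seqShift_iterate] at this
    rw [this, Set.inter_indicator_one, mul_comm]
    simp only [Pi.mul_apply]
    congr 1
    rw [← seqShift_iterate]
    rfl
  · refine lintegral_congr fun ω => ?_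
    rw [indicator_forall_range]
    have : cyl κ m (fun k => (C k).indicator fun _ => (1 : ℝ≥0∞)) (ω n) =
        markovFrom κ (ω n) {ω | ∀ k ∈ Finset.range (m + 1), ω k ∈ C k} := by
      rw [← lintegral_markovFrom_prod κ _ m (fun k => hi _ (hC k)), ← lintegral_indicator_one hB]
      exact lintegral_congr fun ω => indicator_forall_range _ _ _
    rw [this]
    by_cases hω : ω ∈ {ω | ∀ k ∈ Finset.range (n + 1), ω k ∈ S k}
    · rw [Set.indicator_of_mem hω, Set.indicator_of_mem hω, Pi.one_apply, one_mul,
        Kernel.comap_apply]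
    · rw [Set.indicator_of_notMem hω, Set.indicator_of_notMem hω, zero_mul]

/-- The Markov property at time `n`. -/
lemma map_restrict_past (ρ : Measure Z) [IsProbabilityMeasure ρ] (n : ℕ)
    {A : Set (Finset.Iic n → Z)} (hA : MeasurableSet A) :
    ((markovLaw κ ρ).restrict (Preorder.frestrictLe (π := fun _ => Z) n ⁻¹' A)).map
        (seqShift^[n]) =
      ((markovLaw κ ρ).restrict (Preorder.frestrictLe (π := fun _ => Z) n ⁻¹' A)).bind
        ((markovFrom κ).comap (fun ω => ω n) (measurable_pi_apply n)) := by
  have hfm : Measurable (Preorder.frestrictLe (π := fun _ => Z) n) := by fun_prop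
  refine Measure.ext fun B hB => ?_
  have hKm : Measurable fun ω : ℕ → Z => markovFrom κ (ω n) B :=
    (Kernel.measurable_coe _ hB).comp (measurable_pi_apply n)
  rw [Measure.map_apply (measurable_seqShift_iterate n) hB,
    Measure.bind_apply hB (Kernel.aemeasurable _),
    Measure.restrict_apply (measurable_seqShift_iterate n hB)]
  simp only [Kernel.comap_apply]
  -- The roles are exchanged: with the future event `B` fixed, both sides are finite measures of the
  -- past, so agreement on boxes is enough.
  have key : ((markovLaw κ ρ).restrict (seqShift^[n] ⁻¹' B)).map (Preorder.frestrictLe n) =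
      ((markovLaw κ ρ).withDensity fun ω => markovFrom κ (ω n) B).map
        (Preorder.frestrictLe (π := fun _ => Z) n) := by
    have hfin : ∫⁻ ω, markovFrom κ (ω n) B ∂markovLaw κ ρ ≠ ∞ := by
      refine ((lintegral_mono (g := fun _ => 1) fun ω => prob_le_one).trans_lt ?_).ne
      simp
    have : ∀ S : ℕ → Set Z, (∀ k, MeasurableSet (S k)) →
        ((markovLaw κ ρ).restrict (seqShift^[n] ⁻¹' B)).map (Preorder.frestrictLe n)
          (Set.univ.pi fun k : Finset.Iic n => S k) =
        ((markovLaw κ ρ).withDensity fun ω => markovFrom κ (ω n) B).map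
          (Preorder.frestrictLe (π := fun _ => Z) n) (Set.univ.pi fun k : Finset.Iic n => S k) := by
      intro S hS
      have e : Preorder.frestrictLe (π := fun _ => Z) n ⁻¹'
          (Set.univ.pi fun k : Finset.Iic n => S k) =
          {ω | ∀ k ∈ Finset.range (n + 1), ω k ∈ S k} := by
        ext ω
        simp [Preorder.frestrictLe]
      have hSm : MeasurableSet (Set.univ.pi fun k : Finset.Iic n => S k) :=
        MeasurableSet.univ_pi fun k => hS k
      have h2 := congrArg (fun m => m B) (map_restrict_cylinder κ ρ n hS)
      beta_reduce at h2
      rw [Measure.map_apply (measurable_seqShift_iterate n) hB,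
        Measure.bind_apply hB (Kernel.aemeasurable _),
        Measure.restrict_apply (measurable_seqShift_iterate n hB)] at h2
      rw [Measure.map_apply hfm hSm, Measure.map_apply hfm hSm, e,
        Measure.restrict_apply (measurableSet_cylinder _ hS),
        withDensity_apply _ (measurableSet_cylinder _ hS), Set.inter_comm, h2]
      rfl
    have : IsFiniteMeasure ((markovLaw κ ρ).withDensity fun ω => markovFrom κ (ω n) B) :=
      isFiniteMeasure_withDensity hfin
    refine ext_of_generate_finite _ generateFrom_pi.symm isPiSystem_pi ?_ ?_
    · rintro _ ⟨S, hS, rfl⟩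
      have := this
      have h3 := ‹∀ S : ℕ → Set Z, (∀ k, MeasurableSet (S k)) → _›
        (fun k => if h : k ∈ Finset.Iic n then S ⟨k, h⟩ else Set.univ) (by
          intro k
          split_ifs with h
          · exact hS ⟨k, h⟩ (Set.mem_univ _)
          · exact MeasurableSet.univ)
      have e : (Set.univ.pi fun k : Finset.Iic n =>
          if h : (k : ℕ) ∈ Finset.Iic n then S ⟨k, h⟩ else Set.univ) = Set.univ.pi S := by
        congr 1
        funext k
        rw [dif_pos k.2]
      rwa [e] at h3
    · have h3 := ‹∀ S : ℕ → Set Z, (∀ k, MeasurableSet (S k)) → _›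
        (fun _ => Set.univ) (fun _ => MeasurableSet.univ)
      simpa using h3
  have h4 := congrArg (fun m => m A) key
  beta_reduce at h4
  rw [Measure.map_apply hfm hA, Measure.map_apply hfm hA, Measure.restrict_apply (hfm hA),
    withDensity_apply _ (hfm hA)] at h4
  rw [Set.inter_comm, h4]

lemma setLIntegral_seqShift (ρ : Measure Z) [IsProbabilityMeasure ρ] (n : ℕ)
    {A : Set (Finset.Iic n → Z)} (hA : MeasurableSet A) {G : (ℕ → Z) → ℝ≥0∞} (hG : Measurable G) :
    ∫⁻ ω in Preorder.frestrictLe (π := fun _ => Z) n ⁻¹' A, G (seqShift^[n] ω) ∂markovLaw κ ρ =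
      ∫⁻ ω in Preorder.frestrictLe (π := fun _ => Z) n ⁻¹' A, ∫⁻ ω', G ω' ∂markovFrom κ (ω n)
        ∂markovLaw κ ρ := by
  rw [← lintegral_map hG (measurable_seqShift_iterate n), map_restrict_past κ ρ n hA,
    Measure.lintegral_bind (Kernel.aemeasurable _) hG.aemeasurable]
  rfl

lemma lintegral_seqShift (ρ : Measure Z) [IsProbabilityMeasure ρ] (n : ℕ)
    {G : (ℕ → Z) → ℝ≥0∞} (hG : Measurable G) :
    ∫⁻ ω, G (seqShift^[n] ω) ∂markovLaw κ ρ =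
      ∫⁻ ω, ∫⁻ ω', G ω' ∂markovFrom κ (ω n) ∂markovLaw κ ρ := by
  simpa using setLIntegral_seqShift κ ρ n MeasurableSet.univ hG

lemma lintegral_markovFrom_one (z : Z) {f : Z → ℝ≥0∞} (hf : Measurable f) :
    ∫⁻ ω, f (ω 1) ∂markovFrom κ z = ∫⁻ z', f z' ∂κ z := by
  have := lintegral_markovFrom_prod κ z 1 (f := fun k => if k = 1 then f else fun _ => 1) (by
    intro k
    split_ifs
    · exact hf
    · exact measurable_const)
  simpa [cyl, Finset.prod_range_succ] using this

lemma lintegral_markovLaw_zero (ρ : Measure Z) [IsProbabilityMeasure ρ] {f : Z → ℝ≥0∞}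
    (hf : Measurable f) : ∫⁻ ω, f (ω 0) ∂markovLaw κ ρ = ∫⁻ z, f z ∂ρ := by
  simpa [cyl] using lintegral_markovLaw_prod κ ρ 0 (f := fun _ => f) fun _ => hf

lemma lintegral_markovFrom_seqShift (z : Z) {G : (ℕ → Z) → ℝ≥0∞} (hG : Measurable G) :
    ∫⁻ ω, G (seqShift ω) ∂markovFrom κ z = ∫⁻ z', ∫⁻ ω', G ω' ∂markovFrom κ z' ∂κ z := by
  have := lintegral_seqShift κ (Measure.dirac z) 1 hG
  rw [markovLaw_dirac] at this
  rw [← lintegral_markovFrom_one κ z hG.lintegral_kernel]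
  simpa using this

lemma measurePreserving_seqShift {ρ : Measure Z} [IsProbabilityMeasure ρ]
    (h : Kernel.Invariant κ ρ) :
    MeasurePreserving seqShift (markovLaw κ ρ) (markovLaw κ ρ) := by
  refine ⟨measurable_seqShift, ?_⟩
  refine Measure.ext_of_lintegral _ fun G hG => ?_
  have hG' : Measurable fun ω => G (seqShift ω) := hG.comp measurable_seqShift
  rw [lintegral_map hG measurable_seqShift, markovLaw_eq_bind,
    Measure.lintegral_bind (Kernel.aemeasurable _) hG'.aemeasurable,
    Measure.lintegral_bind (Kernel.aemeasurable _) hG.aemeasurable]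
  simp_rw [lintegral_markovFrom_seqShift κ _ hG]
  rw [← Measure.lintegral_bind (Kernel.aemeasurable _) hG.lintegral_kernel.aemeasurable, h.def]

/-- The transition kernel dominates a multiple of a fixed probability measure. -/
structure Doeblin (c : ℝ) (lam : Measure Z) : Prop where
  prob : IsProbabilityMeasure lam
  pos : 0 < c
  le_one : c ≤ 1
  le : ∀ z, ENNReal.ofReal c • lam ≤ κ z

-- Every transition law contains the same part `c • lam`, whose contribution to the mean does not
-- depend on the starting point; only the fraction `1 - c` of the oscillation survives.
variable {κ} in
lemma Doeblin.contract {c : ℝ} {lam : Measure Z} (h : Doeblin κ c lam) {f : Z → ℝ}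
    (hf : Measurable f) {a δ : ℝ} (hfa : ∀ z, a ≤ f z ∧ f z ≤ a + δ) :
    ∃ a', ∀ z, a' ≤ ∫ z', f z' ∂κ z ∧ ∫ z', f z' ∂κ z ≤ a' + (1 - c) * δ := by
  have := h.prob
  have hfi : ∀ (P : Measure Z) [IsProbabilityMeasure P], Integrable f P := fun P _ =>
    Integrable.of_bound hf.aestronglyMeasurable (|a| + |a + δ|) (Eventually.of_forall fun z => by
      rw [Real.norm_eq_abs, abs_le]
      constructor
      · linarith [(hfa z).1, neg_abs_le a, abs_nonneg (a + δ)]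
      · linarith [(hfa z).2, le_abs_self (a + δ), abs_nonneg a])
  have key : ∀ z (g : Z → ℝ), (∀ z, 0 ≤ g z) → (∀ (P : Measure Z) [IsProbabilityMeasure P],
      Integrable g P) → c * ∫ z', g z' ∂lam ≤ ∫ z', g z' ∂κ z := by
    intro z g hg hgi
    have := integral_mono_measure (h.le z) (Eventually.of_forall hg) (hgi (κ z))
    rwa [integral_smul_measure, ENNReal.toReal_ofReal h.pos.le, smul_eq_mul] at this
  refine ⟨a + c * ∫ z', (f z' - a) ∂lam, fun z => ⟨?_, ?_⟩⟩
  · have := key z (fun z => f z - a) (fun z => by linarith [hfa z])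
      (fun P _ => (hfi P).sub (integrable_const _))
    rw [integral_sub (hfi (κ z)) (integrable_const _)] at this
    simp only [integral_const, probReal_univ, smul_eq_mul, one_mul] at this
    linarith
  · have := key z (fun z => a + δ - f z) (fun z => by linarith [hfa z])
      (fun P _ => (integrable_const _).sub (hfi P))
    rw [integral_sub (integrable_const _) (hfi (κ z)),
      integral_sub (integrable_const _) (hfi lam)] at this
    rw [integral_sub (hfi lam) (integrable_const _)]
    simp only [integral_const, probReal_univ, smul_eq_mul, one_mul] at this ⊢
    linarith

lemma markovFrom_preimage_succ (z : Z) (n : ℕ) {B : Set (ℕ → Z)} (hB : MeasurableSet B) :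
    (markovFrom κ z).real (seqShift^[n + 1] ⁻¹' B) =
      ∫ z', (markovFrom κ z').real (seqShift^[n] ⁻¹' B) ∂κ z := by
  have hB' := measurable_seqShift_iterate n hB
  rw [Function.iterate_succ, Set.preimage_comp]
  have := lintegral_markovFrom_seqShift κ z (G := (seqShift^[n] ⁻¹' B).indicator 1)
    (measurable_one.indicator hB')
  simp_rw [lintegral_indicator_one hB'] at this
  have e : ∀ ω, (seqShift^[n] ⁻¹' B).indicator (1 : (ℕ → Z) → ℝ≥0∞) (seqShift ω) =
      (seqShift ⁻¹' (seqShift^[n] ⁻¹' B)).indicator 1 ω := fun ω => rfl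
  simp_rw [e] at this
  rw [lintegral_indicator_one (measurable_seqShift hB')] at this
  rw [Measure.real, this, ← integral_toReal (Kernel.measurable_coe _ hB').aemeasurable
    (Eventually.of_forall fun z' => measure_lt_top _ _)]
  rfl

-- Iterating the contraction. The length of the interval depends neither on the event nor on the
-- starting point.
variable {κ} in
lemma Doeblin.exists_interval {c : ℝ} {lam : Measure Z} (h : Doeblin κ c lam) (n : ℕ)
    {B : Set (ℕ → Z)} (hB : MeasurableSet B) :
    ∃ a, ∀ z, a ≤ (markovFrom κ z).real (seqShift^[n] ⁻¹' B) ∧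
      (markovFrom κ z).real (seqShift^[n] ⁻¹' B) ≤ a + (1 - c) ^ n := by
  induction n with
  | zero => exact ⟨0, fun z => ⟨measureReal_nonneg, by simp⟩⟩
  | succ n ih =>
    obtain ⟨a, ha⟩ := ih
    obtain ⟨a', ha'⟩ := h.contract
      (Kernel.measurable_coe _ (measurable_seqShift_iterate n hB)).ennreal_toReal ha
    refine ⟨a', fun z => ?_⟩
    rw [markovFrom_preimage_succ κ z n hB, pow_succ']
    exact ha' z

variable {κ} in
/-- Mixing, uniformly in the starting point and the event. -/
lemma Doeblin.abs_sub_le {c : ℝ} {lam : Measure Z} (h : Doeblin κ c lam) {ρ : Measure Z}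
    [IsProbabilityMeasure ρ] (hρ : Kernel.Invariant κ ρ) (n : ℕ) {B : Set (ℕ → Z)}
    (hB : MeasurableSet B) (z : Z) :
    |(markovFrom κ z).real (seqShift^[n] ⁻¹' B) - (markovLaw κ ρ).real B| ≤ (1 - c) ^ n := by
  obtain ⟨a, ha⟩ := h.exists_interval n hB
  have hB' := measurable_seqShift_iterate n hB
  have hm : Measurable fun z => (markovFrom κ z).real (seqShift^[n] ⁻¹' B) :=
    (Kernel.measurable_coe _ hB').ennreal_toReal
  -- The stationary probability is an average of the probabilities from fixed starting points, so it
  -- belongs to the same short interval.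
  have e : (markovLaw κ ρ).real B = ∫ z, (markovFrom κ z).real (seqShift^[n] ⁻¹' B) ∂ρ := by
    rw [Measure.real, ← ((measurePreserving_seqShift κ hρ).iterate n).measure_preimage
      hB.nullMeasurableSet, markovLaw_eq_bind, Measure.bind_apply hB' (Kernel.aemeasurable _),
      ← integral_toReal (Kernel.measurable_coe _ hB').aemeasurable
      (Eventually.of_forall fun z' => measure_lt_top _ _)]
    rfl
  have hi : Integrable (fun z => (markovFrom κ z).real (seqShift^[n] ⁻¹' B)) ρ :=
    Integrable.of_bound hm.aestronglyMeasurable 1 (Eventually.of_forall fun z => by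
      rw [Real.norm_of_nonneg measureReal_nonneg]; exact measureReal_le_one)
  have h1 : a ≤ (markovLaw κ ρ).real B := by
    rw [e]
    simpa using integral_mono (integrable_const a) hi fun z => (ha z).1
  have h2 : (markovLaw κ ρ).real B ≤ a + (1 - c) ^ n := by
    rw [e]
    simpa using integral_mono hi (integrable_const (a + (1 - c) ^ n)) fun z => (ha z).2
  rw [abs_le]
  constructor <;> linarith [(ha z).1, (ha z).2]

variable {κ} in
/-- Every iterate of the shift is ergodic. -/
lemma Doeblin.ergodic {c : ℝ} {lam : Measure Z} (h : Doeblin κ c lam) {ρ : Measure Z}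
    [IsProbabilityMeasure ρ] (hρ : Kernel.Invariant κ ρ) {L : ℕ} (hL : L ≠ 0) :
    Ergodic (seqShift^[L]) (markovLaw κ ρ) := by
  refine ⟨(measurePreserving_seqShift κ hρ).iterate L, ⟨fun B hB hinv => ?_⟩⟩
  set P := markovLaw κ ρ
  have hk : ∀ k, seqShift^[L * k] ⁻¹' B = B := by
    intro k
    induction k with
    | zero => rfl
    | succ k ih =>
      rw [Nat.mul_succ, Function.iterate_add, Set.preimage_comp, ih, hinv]
  have hc0 : 0 ≤ 1 - c := by linarith [h.le_one]
  have hc1 : 1 - c < 1 := by linarith [h.pos]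
  -- The event equals its preimage at all times `L * k`, so mixing makes its probability independent
  -- of the starting point.
  have hz : ∀ z, (markovFrom κ z).real B = P.real B := by
    intro z
    have hb : ∀ k : ℕ, |(markovFrom κ z).real B - P.real B| ≤ (1 - c) ^ (L * k) := by
      intro k
      have := h.abs_sub_le hρ (L * k) hB z
      rwa [hk k] at this
    have hlim : Tendsto (fun k : ℕ => (1 - c) ^ (L * k)) atTop (𝓝 0) :=
      (tendsto_pow_atTop_nhds_zero_of_lt_one hc0 hc1).comp
        (tendsto_id.const_mul_atTop' (Nat.pos_of_ne_zero hL))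
    have := ge_of_tendsto hlim (Eventually.of_forall hb)
    exact sub_eq_zero.1 (abs_eq_zero.1 (le_antisymm this (abs_nonneg _)))
  have hz' : ∀ z, markovFrom κ z B = P B := fun z => by
    rw [← ENNReal.toReal_eq_toReal_iff' (measure_ne_top _ _) (measure_ne_top _ _)]
    exact hz z
  -- The Markov property at time `L * n`, which lies beyond all coordinates of the cylinder, makes
  -- `B` independent of every cylinder. Then `B` is independent of itself, and its probability is
  -- `0` or `1`.
  have hind : P.restrict B = P B • P := by
    have : IsFiniteMeasure (P B • P) := by
      constructor; simp
    refine ext_of_prod_cylinder fun n C hC => ?_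
    have hC' := measurableSet_cylinder (n + 1) hC
    have hle : n ≤ L * n := Nat.le_mul_of_pos_left n (Nat.pos_of_ne_zero hL)
    set A : Set (Finset.Iic (L * n) → Z) := ⋂ k ∈ Finset.range (n + 1),
      {w | ∀ hk : k ∈ Finset.Iic (L * n), w ⟨k, hk⟩ ∈ C k}
    have hA : MeasurableSet A := by
      refine Finset.measurableSet_biInter _ fun k hk => ?_
      have hk' : k ∈ Finset.Iic (L * n) := by
        simp only [Finset.mem_range, Finset.mem_Iic] at hk ⊢; omega
      have : {w : Finset.Iic (L * n) → Z | ∀ hk : k ∈ Finset.Iic (L * n), w ⟨k, hk⟩ ∈ C k} =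
          (fun w => w ⟨k, hk'⟩) ⁻¹' C k := by
        ext w; exact ⟨fun h => h hk', fun h _ => h⟩
      rw [this]
      exact measurable_pi_apply _ (hC k)
    have hAC : Preorder.frestrictLe (π := fun _ => Z) (L * n) ⁻¹' A =
        {ω | ∀ k ∈ Finset.range (n + 1), ω k ∈ C k} := by
      ext ω
      simp only [A, Set.mem_preimage, Set.mem_iInter, Set.mem_ofPred_eq]
      constructor
      · intro h k hk
        have hk' : k ∈ Finset.Iic (L * n) := by
          simp only [Finset.mem_range, Finset.mem_Iic] at hk ⊢; omega
        exact h k hk hk'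
      · intro h k hk _
        exact h k hk
    have h2 := congrArg (fun m => m B) (map_restrict_past κ ρ (L * n) hA)
    beta_reduce at h2
    rw [Measure.map_apply (measurable_seqShift_iterate _) hB,
      Measure.bind_apply hB (Kernel.aemeasurable _), hk, hAC] at h2
    simp only [Kernel.comap_apply, hz', lintegral_const, Measure.restrict_apply hB,
      Measure.restrict_apply MeasurableSet.univ, Set.univ_inter] at h2
    rw [Measure.restrict_apply hC', Set.inter_comm, h2]
    rfl
  have hBB : P B = P B * P B := by
    have := congrArg (fun m => m B) hind
    simpa using this
  rw [Filter.eventuallyConst_set']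
  rcases eq_or_ne (P B) 0 with h0 | h0
  · left
    exact ae_eq_empty.2 h0
  · right
    have h1 : P B = 1 := by
      have := (ENNReal.mul_eq_left h0 (measure_ne_top P B)).1 hBB.symm
      exact this
    refine ae_eq_univ.2 ?_
    rw [prob_compl_eq_zero_iff hB]
    exact h1

end Markov

/-! ### Hidden Markov families as smooth models -/

namespace HMMFamily

variable {d m : ℕ} {X : Type*} [MeasurableSpace X] (M : HMMFamily d m X)

open Classical in
/-- The observation density, replaced by `1` outside the observation space. -/
def obsDensity (θ : EuclideanSpace ℝ (Fin d)) (y : EuclideanSpace ℝ (Fin m)) (x : X) : ℝ :=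
  if y ∈ M.Obs then M.g θ y x else 1

/-- The reference measure on the closed ball of radius `ε`, a point mass for `ε = 0`. -/
def ballMeasure (ε : ℝ) (y : EuclideanSpace ℝ (Fin m)) : Measure (EuclideanSpace ℝ (Fin m)) :=
  if ε = 0 then Measure.dirac y else M.ν.restrict (Metric.closedBall y ε)

instance (ε : ℝ) (y : EuclideanSpace ℝ (Fin m)) : SigmaFinite (M.ballMeasure ε y) := by
  unfold ballMeasure
  split_ifs <;> infer_instance

lemma law_eq (θ : M.Param) (ρ : Measure (X × EuclideanSpace ℝ (Fin m))) :
    M.law θ ρ = markovLaw (M.jointKernel θ) ρ := rfl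

lemma nonempty_state (θ : M.Param) : Nonempty X := by
  have : Nonempty (X × EuclideanSpace ℝ (Fin m)) := (M.π θ).nonempty_of_neZero
  exact this.map Prod.fst

lemma neZero_μ (θ : M.Param) : NeZero M.μ := by
  refine ⟨fun h => ?_⟩
  obtain ⟨x⟩ := M.nonempty_state θ
  have h1 : M.Q θ x Set.univ = 1 := measure_univ
  rw [M.Q_eq, h] at h1
  simp at h1

lemma lintegral_jointKernel (θ : M.Param) (z : X × EuclideanSpace ℝ (Fin m))
    {F : X × EuclideanSpace ℝ (Fin m) → ℝ≥0∞} (hF : Measurable F) :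
    ∫⁻ z', F z' ∂M.jointKernel θ z =
      ∫⁻ x', ENNReal.ofReal (M.q θ z.1 x') * ∫⁻ y', F (x', y') ∂M.G θ x' ∂M.μ := by
  have hm : Measurable fun x' => ENNReal.ofReal (M.q θ z.1 x') :=
    ((M.measurable_q θ θ.2).comp measurable_prodMk_left).ennreal_ofReal
  rw [jointKernel, Kernel.comap_apply, Kernel.lintegral_compProd _ _ _ hF, M.Q_eq,
    lintegral_withDensity_eq_lintegral_mul _ hm]
  · rfl
  · simp only [Kernel.prodMkLeft_apply]
    exact Measurable.lintegral_kernel_prod_right' (κ := M.G θ) hF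

/-- The next pair depends on the hidden state alone, so the observations can be integrated out step
by step, each leaving a weight on its hidden state. -/
lemma cyl_jointKernel (θ : M.Param) (n : ℕ) {f : ℕ → X × EuclideanSpace ℝ (Fin m) → ℝ≥0∞}
    (hf : ∀ k, Measurable (f k)) (z : X × EuclideanSpace ℝ (Fin m)) :
    cyl (M.jointKernel θ) n f z = f 0 z *
      lchain M.μ (fun x x' => ENNReal.ofReal (M.q θ x x')) n
        (fun k x => ∫⁻ y, f (k + 1) (x, y) ∂M.G θ x) z.1 := by
  induction n generalizing f z with
  | zero => simp [cyl, lchain]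
  | succ n ih =>
    simp only [cyl, lchain]
    rw [M.lintegral_jointKernel θ z
      (measurable_cyl _ n (f := fun k => f (k + 1)) fun k => hf (k + 1))]
    congr 1
    refine lintegral_congr fun x' => ?_
    congr 1
    simp_rw [ih (f := fun k => f (k + 1)) fun k => hf (k + 1)]
    have hm : Measurable fun y' => f (0 + 1) (x', y') := (hf 1).comp measurable_prodMk_left
    rw [lintegral_mul_const _ hm]

lemma law_forall_mem (θ : M.Param) (ρ : Measure (X × EuclideanSpace ℝ (Fin m)))
    [IsProbabilityMeasure ρ] (n : ℕ) {D : ℕ → Set (EuclideanSpace ℝ (Fin m))}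
    (hD : ∀ k, MeasurableSet (D k)) :
    M.law θ ρ {ω | ∀ k ∈ Finset.Icc 1 n, (ω k).2 ∈ D k} =
      ∫⁻ x, lchain M.μ (fun x x' => ENNReal.ofReal (M.q θ x x')) n
        (fun k x => M.G θ x (D (k + 1))) x ∂ρ.fst := by
  -- The observation at time zero is not part of the data and is left unconstrained.
  set B : ℕ → Set (X × EuclideanSpace ℝ (Fin m)) := fun k =>
    if k = 0 then Set.univ else Prod.snd ⁻¹' D k with hB
  have hBm : ∀ k, MeasurableSet (B k) := by
    intro k
    simp only [hB]
    split_ifs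
    · exact MeasurableSet.univ
    · exact measurable_snd (hD k)
  have e : {ω : ℕ → X × EuclideanSpace ℝ (Fin m) | ∀ k ∈ Finset.Icc 1 n, (ω k).2 ∈ D k} =
      {ω | ∀ k ∈ Finset.range (n + 1), ω k ∈ B k} := by
    ext ω
    simp only [Set.mem_ofPred_eq, Finset.mem_Icc, Finset.mem_range, hB]
    constructor
    · intro h k hk
      split_ifs with h0
      · trivial
      · exact h k ⟨by omega, by omega⟩
    · intro h k hk
      have := h k (by omega)
      rwa [if_neg (by omega)] at this
  have hi : ∀ k, Measurable ((B k).indicator fun _ => (1 : ℝ≥0∞)) :=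
    fun k => measurable_const.indicator (hBm k)
  rw [e, ← lintegral_indicator_one (measurableSet_cylinder _ hBm), law_eq]
  simp_rw [← indicator_forall_range]
  rw [lintegral_markovLaw_prod _ ρ n (f := fun k => (B k).indicator fun _ => (1 : ℝ≥0∞)) hi]
  simp_rw [M.cyl_jointKernel θ n hi]
  have hw : (fun (k : ℕ) (x : X) =>
      ∫⁻ y, (B (k + 1)).indicator (fun _ => (1 : ℝ≥0∞)) (x, y) ∂M.G θ x) =
      fun k x => M.G θ x (D (k + 1)) := by
    funext k x
    rw [← lintegral_indicator_one (hD (k + 1))]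
    refine lintegral_congr fun y => ?_
    simp only [hB, if_neg (Nat.succ_ne_zero k)]
    rfl
  rw [hw, Measure.fst, lintegral_map _ measurable_fst]
  · refine lintegral_congr fun z => ?_
    simp [hB]
  · exact measurable_lchain (M.measurable_q θ θ.2).ennreal_ofReal n
      fun k => Kernel.measurable_coe _ (hD (k + 1))

/-- The hidden chain and its observations satisfy a minorisation condition. -/
lemma doeblin (θ : M.Param) {c : ℝ} (hc : 0 < c) (hq : ∀ x x', c ≤ M.q θ x x') :
    ∃ c' lam, Doeblin (M.jointKernel θ) c' lam := by
  have := M.neZero_μ θ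
  obtain ⟨x₀⟩ := M.nonempty_state θ
  set t := M.μ.real Set.univ with ht
  have ht0 : 0 < t := by
    rw [ht, measureReal_def]
    exact ENNReal.toReal_pos (NeZero.ne _) (measure_ne_top _ _)
  set μ' : Measure X := (M.μ Set.univ)⁻¹ • M.μ
  have hμ' : IsProbabilityMeasure μ' := isProbabilityMeasureSMul
  -- The lower bound on the transition density lets the joint kernel dominate `c` times `μ` followed
  -- by the observation kernel; normalising `μ` brings in its mass `t`.
  have hle : ∀ z, ENNReal.ofReal (c * t) • (μ' ⊗ₘ M.G θ) ≤ M.jointKernel θ z := by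
    intro z
    refine Measure.le_iff.2 fun B hB => ?_
    have e1 : M.jointKernel θ z B = _ := (lintegral_indicator_one hB).symm.trans
      (M.lintegral_jointKernel θ z (measurable_one.indicator hB))
    have e2 : (μ' ⊗ₘ M.G θ) B = _ := (lintegral_indicator_one hB).symm.trans
      (Measure.lintegral_compProd (measurable_one.indicator hB))
    rw [e1, Measure.smul_apply, e2, lintegral_smul_measure, smul_eq_mul, smul_eq_mul, ← mul_assoc]
    have h1 : ENNReal.ofReal (c * t) * (M.μ Set.univ)⁻¹ = ENNReal.ofReal c := by
      rw [ENNReal.ofReal_mul hc.le, ht, ofReal_measureReal, mul_assoc, ENNReal.mul_inv_cancel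
        (NeZero.ne _) (measure_ne_top _ _), mul_one]
    rw [h1, ← lintegral_const_mul]
    · refine lintegral_mono fun x' => ?_
      gcongr
      exact hq _ _
    · exact Measurable.lintegral_kernel_prod_right' (κ := M.G θ) (measurable_one.indicator hB)
  refine ⟨c * t, μ' ⊗ₘ M.G θ, inferInstance, mul_pos hc ht0, ?_, hle⟩
  have y₀ : EuclideanSpace ℝ (Fin m) := 0
  -- Comparing total masses shows `c * t ≤ 1`.
  have := hle (x₀, y₀) Set.univ
  simp only [Measure.smul_apply, measure_univ, smul_eq_mul, mul_one] at this
  exact ENNReal.ofReal_le_one.1 this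

lemma bind_jointKernel (θ : M.Param) : (M.π θ).bind (M.jointKernel θ) = M.π θ :=
  (M.invariant_π θ).def

instance (θ : M.Param) : IsProbabilityMeasure (M.stationaryLaw θ) := by
  unfold stationaryLaw
  rw [law_eq]
  infer_instance

/-- By invariance the stationary observation may be taken after one transition, where it is drawn
from a density with respect to `ν`. -/
lemma map_snd_absolutelyContinuous (θ : M.Param) : (M.π θ).map Prod.snd ≪ M.ν := by
  refine Measure.AbsolutelyContinuous.mk fun N hN h0 => ?_
  rw [Measure.map_apply measurable_snd hN, ← M.bind_jointKernel θ,
    Measure.bind_apply (measurable_snd hN) (Kernel.aemeasurable _)]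
  refine lintegral_eq_zero_of_ae_eq_zero (Eventually.of_forall fun z => ?_)
  change M.jointKernel θ z (Prod.snd ⁻¹' N) = 0
  rw [← lintegral_indicator_one (measurable_snd hN),
    M.lintegral_jointKernel θ z (measurable_one.indicator (measurable_snd hN))]
  refine lintegral_eq_zero_of_ae_eq_zero (Eventually.of_forall fun x' => ?_)
  have : ∫⁻ y', (Prod.snd ⁻¹' N).indicator (1 : X × EuclideanSpace ℝ (Fin m) → ℝ≥0∞) (x', y')
      ∂M.G θ x' = 0 := by
    have e : ∀ y', (Prod.snd ⁻¹' N).indicator (1 : X × EuclideanSpace ℝ (Fin m) → ℝ≥0∞) (x', y') =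
      N.indicator 1 y' := fun y' => rfl
    simp_rw [e]
    rw [lintegral_indicator_one hN, M.G_eq]
    exact withDensity_absolutelyContinuous _ _ h0
  simp [this]

lemma ae_of_ae_map_snd (θ : M.Param) {p : EuclideanSpace ℝ (Fin m) → Prop}
    (h : ∀ᵐ y ∂(M.π θ).map Prod.snd, p y) :
    ∀ᵐ ω ∂M.stationaryLaw θ, ∀ k, p (ω k).2 := by
  have h0 : ∀ᵐ ω ∂M.stationaryLaw θ, p (ω 0).2 := by
    obtain ⟨N, hN, hNm, hN0⟩ := exists_measurable_superset_of_null h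
    have e : (M.stationaryLaw θ) {ω | (ω 0).2 ∈ N} = 0 := by
      have := lintegral_markovLaw_zero (M.jointKernel θ) (M.π θ) (f := (Prod.snd ⁻¹' N).indicator 1)
        (measurable_one.indicator (measurable_snd hNm))
      rw [lintegral_indicator_one (measurable_snd hNm), ← Measure.map_apply measurable_snd hNm,
        hN0] at this
      have hm : MeasurableSet {ω : ℕ → X × EuclideanSpace ℝ (Fin m) | (ω 0).2 ∈ N} :=
        (measurable_snd.comp (measurable_pi_apply 0)) hNm
      rw [← lintegral_indicator_one hm]
      exact this
    refine measure_mono_null (fun ω hω => ?_) e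
    exact hN hω
  refine ae_all_iff.2 fun k => ?_
  have hp := (measurePreserving_seqShift (M.jointKernel θ) (M.invariant_π θ)).iterate k
  have := hp.quasiMeasurePreserving.ae h0
  filter_upwards [this] with ω hω
  rwa [seqShift_iterate] at hω

end HMMFamily

/-! ### Iterated derivatives and nested Fréchet derivatives -/

section Norms

variable {E : Type*} [NormedAddCommGroup E] [NormedSpace ℝ E]

lemma norm_iteratedFDeriv_two (f : E → ℝ) (θ : E) :
    ‖iteratedFDeriv ℝ 2 f θ‖ = ‖fderiv2 f θ‖ := by
  rw [← norm_iteratedFDeriv_fderiv, norm_iteratedFDeriv_one]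

lemma norm_iteratedFDeriv_three (f : E → ℝ) (θ : E) :
    ‖iteratedFDeriv ℝ 3 f θ‖ = ‖fderiv ℝ (fderiv2 f) θ‖ := by
  rw [← norm_iteratedFDeriv_fderiv, ← norm_iteratedFDeriv_fderiv, norm_iteratedFDeriv_one]

end Norms

/-! ### Smooth models and windows from the standing assumptions -/

namespace HMMFamily

variable {d m : ℕ} {X : Type*} [MeasurableSpace X] (M : HMMFamily d m X)

/-- Outside the observation space `obsDensity` is constant in the parameter, so positivity and
smoothness of its logarithm hold at every point and no exceptional set of observations has to be
carried along. -/
lemma exists_smoothModel {θ₀ : M.Param} (hquasi : IsQuasiconvexSet M.Param) (h2 : M.A2)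
    (h3 : M.A3) (h4 : M.A4) (h6 : M.A6 θ₀) :
    ∃ c C K Λ, SmoothModel M.Param M.q M.obsDensity c C K Λ := by
  obtain ⟨Λ, hΛ, hlip⟩ := hquasi.exists_lipschitz
  obtain ⟨c, C, hc, -, hq⟩ := h3
  obtain ⟨K, hK, hlog⟩ := h4
  refine ⟨c, C, K, Λ, ⟨fun θ hθ => ⟨M.measurable_q θ hθ, hc, fun x x' => ((hq θ hθ).1 x x').1,
    fun x x' => ((hq θ hθ).1 x x').2⟩, hK.le, fun θ hθ x x' => ⟨?_, ?_, ?_⟩, ?_, ?_, ?_,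
    M.isCompact_param.isBounded, hΛ, hlip⟩⟩
  · exact ((h2.1 x x' θ hθ).of_le (by norm_num)).log (hc.trans_le ((hq θ hθ).1 x x').1).ne'
  · rw [← norm_iteratedFDeriv_one]
    exact (hlog θ hθ x x').1
  · rw [← norm_iteratedFDeriv_two]
    exact (hlog θ hθ x x').2
  · intro θ hθ
    unfold obsDensity
    exact Measurable.ite (measurable_fst M.measurableSet_obs) (M.measurable_g θ hθ)
      measurable_const
  · intro θ hθ y x
    unfold obsDensity
    split_ifs with hy
    · exact h6.1 θ hθ y hy x
    · exact one_pos
  · intro θ hθ y x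
    unfold obsDensity
    by_cases hy : y ∈ M.Obs
    · simp only [if_pos hy]
      exact ((h2.2 y hy x θ hθ).of_le (by norm_num)).log (h6.1 θ hθ y hy x).ne'
    · simp only [if_neg hy]
      exact contDiffAt_const

lemma contDiffAt_log_obsDensity {θ₀ : M.Param} (h2 : M.A2) (h6 : M.A6 θ₀)
    {θ : EuclideanSpace ℝ (Fin d)} (hθ : θ ∈ M.Param) (y : EuclideanSpace ℝ (Fin m)) (x : X) :
    ContDiffAt ℝ 3 (fun t => Real.log (M.obsDensity t y x)) θ := by
  unfold obsDensity
  by_cases hy : y ∈ M.Obs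
  · simp only [if_pos hy]
    exact (h2.2 y hy x θ hθ).log (h6.1 θ hθ y hy x).ne'
  · simp only [if_neg hy]
    exact contDiffAt_const

lemma enorm_le_supLogDeriv (j : ℕ) {K : ℝ} {θ : EuclideanSpace ℝ (Fin d)} (hθ : θ ∈ M.Param)
    {y y' : EuclideanSpace ℝ (Fin m)} (hy' : y' ∈ M.Obs) (h : y' ∈ Metric.closedBall y K) (x : X) :
    ‖iteratedFDeriv ℝ j (fun t => Real.log (M.g t y' x)) θ‖ₑ ≤ M.supLogDeriv j K y := by
  unfold supLogDeriv
  have e : y' = y + (y' - y) := by abel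
  refine le_iSup₂_of_le θ hθ (le_iSup_of_le x (le_iSup₂_of_le (y' - y) ⟨?_, ?_⟩ ?_))
  · simpa [dist_eq_norm] using h
  · rwa [← e]
  · rw [← e]

lemma norm_le_of_supLogDeriv_le {j : ℕ} (hj : j ≠ 0) {K B : ℝ} (hB : 0 ≤ B)
    {θ : EuclideanSpace ℝ (Fin d)}
    (hθ : θ ∈ M.Param) {y y' : EuclideanSpace ℝ (Fin m)} (h : y' ∈ Metric.closedBall y K)
    (hs : M.supLogDeriv j K y ≤ ENNReal.ofReal B) (x : X) :
    ‖iteratedFDeriv ℝ j (fun t => Real.log (M.obsDensity t y' x)) θ‖ ≤ B := by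
  unfold obsDensity
  by_cases hy : y' ∈ M.Obs
  · simp only [if_pos hy]
    have := (M.enorm_le_supLogDeriv j hθ hy h x).trans hs
    rwa [← ofReal_norm, ENNReal.ofReal_le_ofReal_iff hB] at this
  · simp only [if_neg hy]
    rw [iteratedFDeriv_const_of_ne hj]
    simpa using hB

/-- Observations at which all the tolerances can be handled. -/
structure Good (e : EuclideanSpace ℝ (Fin m) → ℝ) (K : ℝ) (y : EuclideanSpace ℝ (Fin m)) :
    Prop where
  mem : y ∈ M.Obs
  ball_pos : ∀ ε : ℝ, 0 < ε → 0 < M.ν (Metric.closedBall y ε)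
  sup_one : M.supLogDeriv 1 K y ≤ ENNReal.ofReal (e y)
  sup_two : M.supLogDeriv 2 K y ≤ ENNReal.ofReal (e y)
  sup_three : M.supLogDeriv 3 K y < ∞

lemma ae_obs : ∀ᵐ y ∂M.ν, y ∈ M.Obs := M.ν_compl_obs

/-- A square integrable bound on the derivatives of the logarithm of the observation density. -/
lemma exists_bound {θ₀ : M.Param} (h6 : M.A6 θ₀) {K : ℝ} (hK : 0 < K) :
    ∃ e : EuclideanSpace ℝ (Fin m) → ℝ, Measurable e ∧ (∀ y, 0 ≤ e y) ∧
      Integrable (fun y => e y ^ 2) ((M.π θ₀).map Prod.snd) ∧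
      ∀ᵐ y ∂(M.π θ₀).map Prod.snd, M.Good e K y := by
  obtain ⟨⟨F, hF, hFle, hFi⟩, ⟨H, hH, hHle, hHi⟩, ⟨J, hJ, hJle, hJi⟩⟩ := h6.2 K hK
  have hac := M.map_snd_absolutelyContinuous θ₀
  have hprob : IsProbabilityMeasure ((M.π θ₀).map Prod.snd) :=
    Measure.isProbabilityMeasure_map measurable_snd.aemeasurable
  -- Here `F` majorises the cube of the first supremum and `H` the square of the second. A first
  -- supremum `s ≥ 1` satisfies `s ^ 2 ≤ s ^ 3`, hence `s ≤ 1 + √F` in all cases, and the square of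
  -- the sum is at most `3 * (1 + F + H)`. Of the third supremum only almost sure finiteness is
  -- retained.
  refine ⟨fun y => 1 + √(F y).toReal + √(H y).toReal, by fun_prop, fun y => by positivity, ?_, ?_⟩
  · have hFI := integrable_toReal_of_lintegral_ne_top hF.aemeasurable hFi.ne
    have hHI := integrable_toReal_of_lintegral_ne_top hH.aemeasurable hHi.ne
    refine (((integrable_const (1 : ℝ)).add hFI).add hHI |>.const_mul 3).mono'
      (by fun_prop) (Eventually.of_forall fun y => ?_)
    rw [Real.norm_of_nonneg (by positivity)]
    have h1 := Real.sq_sqrt (ENNReal.toReal_nonneg (a := F y))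
    have h2 := Real.sq_sqrt (ENNReal.toReal_nonneg (a := H y))
    simp only [Pi.add_apply]
    nlinarith [sq_nonneg (1 - √(F y).toReal), sq_nonneg (1 - √(H y).toReal),
      sq_nonneg (√(F y).toReal - √(H y).toReal)]
  -- The observation has a law absolutely continuous with respect to `ν`, so it lies almost surely
  -- in the support of `ν`, and every ball around it has positive mass.
  · filter_upwards [ae_lt_top hF hFi.ne, ae_lt_top hH hHi.ne, ae_lt_top hJ hJi.ne,
      hac.ae_le M.ae_obs, hac.ae_le (Measure.support_mem_ae (μ := M.ν))] with y h1 h2 h3 h4 h5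
    refine ⟨h4, fun ε hε => (Measure.mem_support_iff_forall y).1 h5 _
      (Metric.closedBall_mem_nhds y hε), ?_, ?_, (hJle y).trans_lt h3⟩
    · have hs : M.supLogDeriv 1 K y ^ 3 < ∞ := (hFle y).trans_lt h1
      have hs' : M.supLogDeriv 1 K y ≠ ∞ := fun h => by simp [h] at hs
      rw [← ENNReal.ofReal_toReal hs']
      refine ENNReal.ofReal_le_ofReal ?_
      set s := (M.supLogDeriv 1 K y).toReal
      have hs0 : 0 ≤ s := ENNReal.toReal_nonneg
      have h6 : s ^ 3 ≤ (F y).toReal := by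
        rw [← ENNReal.toReal_pow]
        exact ENNReal.toReal_mono h1.ne (hFle y)
      have h7 : s ≤ 1 + √(F y).toReal := by
        rcases le_total s 1 with h | h
        · linarith [Real.sqrt_nonneg (F y).toReal]
        · have : s ≤ √(F y).toReal := Real.le_sqrt_of_sq_le (by nlinarith)
          linarith
      linarith [Real.sqrt_nonneg (H y).toReal]
    · have hs : M.supLogDeriv 2 K y ^ 2 < ∞ := (hHle y).trans_lt h2
      have hs' : M.supLogDeriv 2 K y ≠ ∞ := fun h => by simp [h] at hs
      rw [← ENNReal.ofReal_toReal hs']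
      refine ENNReal.ofReal_le_ofReal ?_
      set s := (M.supLogDeriv 2 K y).toReal
      have h6 : s ^ 2 ≤ (H y).toReal := by
        rw [← ENNReal.toReal_pow]
        exact ENNReal.toReal_mono h2.ne (hHle y)
      linarith [Real.le_sqrt_of_sq_le h6, Real.sqrt_nonneg (F y).toReal]

lemma lintegral_obsDensity (θ : M.Param) (x : X) {s : Set (EuclideanSpace ℝ (Fin m))}
    (hs : MeasurableSet s) :
    ∫⁻ y, ENNReal.ofReal (M.obsDensity θ y x) ∂M.ν.restrict s = M.G θ x s := by
  rw [M.G_eq, withDensity_apply _ hs]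
  refine lintegral_congr_ae ?_
  filter_upwards [ae_restrict_of_ae M.ae_obs] with y hy
  simp [obsDensity, hy]

variable {M} {c C K Λ : ℝ}

lemma integrable_obsDensity (h : SmoothModel M.Param M.q M.obsDensity c C K Λ) (θ : M.Param)
    (x : X) {s : Set (EuclideanSpace ℝ (Fin m))} (hs : MeasurableSet s) :
    Integrable (fun y => M.obsDensity θ y x) (M.ν.restrict s) ∧
      ENNReal.ofReal (∫ y, M.obsDensity θ y x ∂M.ν.restrict s) = M.G θ x s := by
  have hm : Measurable fun y => M.obsDensity θ y x :=
    (h.meas θ θ.2).comp measurable_prodMk_right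
  have hi : Integrable (fun y => M.obsDensity θ y x) (M.ν.restrict s) := by
    refine ⟨hm.aestronglyMeasurable, ?_⟩
    rw [hasFiniteIntegral_iff_ofReal (Eventually.of_forall fun y => (h.pos θ θ.2 y x).le),
      M.lintegral_obsDensity θ x hs]
    exact measure_lt_top _ _
  exact ⟨hi, by rw [ofReal_integral_eq_lintegral_ofReal hi
    (Eventually.of_forall fun y => (h.pos θ θ.2 y x).le), M.lintegral_obsDensity θ x hs]⟩

/-- The bound `e y` comes from the supremum over the ball of radius `K₀`, so it serves every smaller
tolerance, the point mass included. The weights are bounded by the density bound for a point mass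
and by one, as probabilities, for a ball. -/
lemma isWindow (h : SmoothModel M.Param M.q M.obsDensity c C K Λ)
    (h3 : M.A3) {e : EuclideanSpace ℝ (Fin m) → ℝ} (he : ∀ y, 0 ≤ e y) {K₀ ε : ℝ}
    (hε : 0 ≤ ε) (hεK : ε ≤ K₀) {y : EuclideanSpace ℝ (Fin m)} (hy : M.Good e K₀ y) :
    IsWindow M.μ M.Param M.obsDensity (M.ballMeasure ε y) (e y) := by
  have hae : ∀ᵐ y' ∂M.ballMeasure ε y, y' ∈ Metric.closedBall y K₀ := by
    unfold ballMeasure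
    split_ifs with h0
    · exact (ae_dirac_iff (p := fun y' => y' ∈ Metric.closedBall y K₀)
        Metric.isClosed_closedBall.measurableSet).2 (Metric.mem_closedBall_self (hε.trans hεK))
    · exact (ae_restrict_mem Metric.isClosed_closedBall.measurableSet).mono
        fun y' hy' => Metric.closedBall_subset_closedBall hεK hy'
  have hio : ∀ θ ∈ M.Param, ∀ x, Integrable (fun y => M.obsDensity θ y x) (M.ballMeasure ε y) := by
    intro θ hθ x
    unfold ballMeasure
    split_ifs with h0
    · exact integrable_dirac (by simp)
    · exact (integrable_obsDensity h ⟨θ, hθ⟩ x Metric.isClosed_closedBall.measurableSet).1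
  refine ⟨?_, he y, hio, ?_, ?_⟩
  · unfold ballMeasure
    split_ifs with h0
    · exact NeZero.ne _
    · intro hz
      have := hy.ball_pos ε (lt_of_le_of_ne hε (Ne.symm h0))
      rw [Measure.restrict_eq_zero] at hz
      exact this.ne' hz
  · intro θ hθ
    obtain ⟨c', C', -, hC', hq⟩ := h3
    refine Integrable.of_bound ?_ (C' + 1) (Eventually.of_forall fun x => ?_)
    · have hm : Measurable fun p : X × EuclideanSpace ℝ (Fin m) => M.obsDensity θ p.2 p.1 :=
        (h.meas θ hθ).comp measurable_swap
      exact (StronglyMeasurable.integral_prod_right' (f := fun p : X × EuclideanSpace ℝ (Fin m) =>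
        M.obsDensity θ p.2 p.1) hm.stronglyMeasurable).aestronglyMeasurable
    · rw [Real.norm_of_nonneg (integral_nonneg fun y' => (h.pos θ hθ y' x).le)]
      unfold ballMeasure
      split_ifs with h0
      · rw [integral_dirac]
        simp only [obsDensity, if_pos hy.mem]
        linarith [(hq θ hθ).2 y hy.mem x]
      · have h1 := (integrable_obsDensity h ⟨θ, hθ⟩ x
          (Metric.isClosed_closedBall (x := y) (ε := ε)).measurableSet).2
        have h2 : ENNReal.ofReal (∫ y', M.obsDensity θ y' x
            ∂M.ν.restrict (Metric.closedBall y ε)) ≤ 1 := h1.trans_le prob_le_one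
        rw [ENNReal.ofReal_le_one] at h2
        linarith
  · filter_upwards [hae] with y' hy' θ hθ x
    rw [← norm_iteratedFDeriv_one, ← norm_iteratedFDeriv_two]
    exact ⟨M.norm_le_of_supLogDeriv_le one_ne_zero (he y) hθ hy' hy.sup_one x,
      M.norm_le_of_supLogDeriv_le two_ne_zero (he y) hθ hy' hy.sup_two x⟩

/-- The windows attached to a sequence of data. -/
def windows (M : HMMFamily d m X) (ε : ℝ) (y : ℕ → EuclideanSpace ℝ (Fin m)) (k : ℕ) :
    Measure (EuclideanSpace ℝ (Fin m)) := M.ballMeasure ε (y k)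

instance (ε : ℝ) (y : ℕ → EuclideanSpace ℝ (Fin m)) (k : ℕ) :
    SigmaFinite (M.windows ε y k) := by
  unfold windows; infer_instance

lemma ofReal_winWeight (h : SmoothModel M.Param M.q M.obsDensity c C K Λ) (ε : ℝ)
    {y : ℕ → EuclideanSpace ℝ (Fin m)} (hy : ∀ k, y k ∈ M.Obs) (θ : M.Param) (k : ℕ) (x : X) :
    ENNReal.ofReal (winWeight M.obsDensity (M.windows ε y) θ k x) =
      if ε = 0 then ENNReal.ofReal (M.g θ (y k) x) else M.G θ x (Metric.closedBall (y k) ε) := by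
  unfold winWeight windows ballMeasure
  split_ifs with h0
  · rw [integral_dirac, obsDensity, if_pos (hy k)]
  · exact (integrable_obsDensity h θ x Metric.isClosed_closedBall.measurableSet).2

/-- From here on the exact and the approximate likelihood are handled together. The data start at
time one whereas windows are numbered from zero, hence the shifted sequence. -/
lemma likelihood_eq (h : SmoothModel M.Param M.q M.obsDensity c C K Λ) (ε : ℝ)
    {e : ℕ → ℝ} {y : ℕ → EuclideanSpace ℝ (Fin m)} (hy : ∀ k, y k ∈ M.Obs)
    (hw : ∀ k, IsWindow M.μ M.Param M.obsDensity (M.windows ε y k) (e k))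
    (π₀ : Measure X) [IsProbabilityMeasure π₀] (n : ℕ) (θ : M.Param) :
    M.likelihood ε π₀ n y θ = ∫ x, chain M.μ (M.q θ) n
      (winWeight M.obsDensity (M.windows ε fun k => y (k + 1)) θ) x ∂π₀ := by
  have := M.neZero_μ θ
  have hW : ∀ k, IsWeight M.μ (winWeight M.obsDensity (M.windows ε fun k => y (k + 1)) θ k) :=
    fun k => h.isWeight (fun k => hw (k + 1)) θ.2 k
  have hb := (h.kernel θ θ.2).chain_isBdd n hW
  rw [integral_eq_lintegral_of_nonneg_ae
    (Eventually.of_forall fun x => ((h.kernel θ θ.2).chain_pos n hW x).le)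
    hb.meas.aestronglyMeasurable]
  simp_rw [(h.kernel θ θ.2).ofReal_chain n hW,
    ofReal_winWeight h ε (y := fun k => y (k + 1)) (fun k => hy (k + 1))]
  have hqm : Measurable fun p : X × X => ENNReal.ofReal (M.q θ p.1 p.2) :=
    (M.measurable_q θ θ.2).ennreal_ofReal
  unfold likelihood
  split_ifs with h0
  · unfold exactLikelihood
    congr 1
    refine lintegral_congr fun x => ?_
    rw [lchain_eq_lintegral_pi hqm]
    exact fun k => ((M.measurable_g θ θ.2).comp measurable_prodMk_left).ennreal_ofReal
  · unfold abcLikelihood lawFrom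
    rw [Measure.real, M.law_forall_mem θ (π₀ ⊗ₘ M.G θ) n
      (D := fun k => Metric.closedBall (y k) ε)
      (fun k => Metric.isClosed_closedBall.measurableSet), Measure.fst_compProd]

end HMMFamily

/-! ### Regular families and their limit surfaces -/

namespace HMMFamily

variable {d m : ℕ} {X : Type*} [MeasurableSpace X] {M : HMMFamily d m X}

/-- Regularity of the model, with square integrable bounds `e` for tolerances up to `K₀`. -/
structure Regular (M : HMMFamily d m X) (θ₀ : M.Param) (c C K Λ : ℝ)
    (e : EuclideanSpace ℝ (Fin m) → ℝ) (K₀ : ℝ) : Prop where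
  model : SmoothModel M.Param M.q M.obsDensity c C K Λ
  bdd : M.A3
  meas : Measurable e
  nonneg : ∀ y, 0 ≤ e y
  int : Integrable (fun y => e y ^ 2) ((M.π θ₀).map Prod.snd)
  good : ∀ᵐ y ∂(M.π θ₀).map Prod.snd, M.Good e K₀ y

/-- The observations along a trajectory. -/
def obs (ω : ℕ → X × EuclideanSpace ℝ (Fin m)) (k : ℕ) : EuclideanSpace ℝ (Fin m) := (ω k).2

/-- The relative log likelihood of `n` observations along a trajectory, started at `x`. -/
def relLogChain (M : HMMFamily d m X) (ε : ℝ) (θ₀ : M.Param) (x : X) (n : ℕ)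
    (θ : EuclideanSpace ℝ (Fin d)) (ω : ℕ → X × EuclideanSpace ℝ (Fin m)) : ℝ :=
  logChain M.μ M.q M.obsDensity x n (M.windows ε (obs ω)) θ -
    logChain M.μ M.q M.obsDensity x n (M.windows ε (obs ω)) θ₀

/-- The mean relative log likelihood of `n` stationary observations. -/
def meanLogChain (M : HMMFamily d m X) (ε : ℝ) (θ₀ : M.Param) (x : X) (n : ℕ)
    (θ : EuclideanSpace ℝ (Fin d)) : ℝ :=
  ∫ ω, M.relLogChain ε θ₀ x n θ ω ∂M.stationaryLaw θ₀

/-- The mean effect of the first observation on the prediction of the last. -/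
def meanForget (M : HMMFamily d m X) (ε : ℝ) (θ₀ : M.Param) (x : X) (n : ℕ)
    (θ : EuclideanSpace ℝ (Fin d)) : ℝ :=
  (M.meanLogChain ε θ₀ x (n + 2) θ - M.meanLogChain ε θ₀ x (n + 1) θ) -
    (M.meanLogChain ε θ₀ x (n + 1) θ - M.meanLogChain ε θ₀ x n θ)

/-- The limit of the mean log likelihoods. -/
def surface (M : HMMFamily d m X) (ε : ℝ) (θ₀ : M.Param) (x : X)
    (θ : EuclideanSpace ℝ (Fin d)) : ℝ :=
  M.meanLogChain ε θ₀ x 1 θ + ∑' n, M.meanForget ε θ₀ x n θ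

/-- The sum of the bounds of `n` windows. -/
def boundSum (K : ℝ) (e : EuclideanSpace ℝ (Fin m) → ℝ) (n : ℕ)
    (ω : ℕ → X × EuclideanSpace ℝ (Fin m)) : ℝ :=
  ∑ k ∈ Finset.range n, (K + e (obs ω k))

lemma measurable_obs (k : ℕ) :
    Measurable fun ω : ℕ → X × EuclideanSpace ℝ (Fin m) => obs ω k :=
  measurable_snd.comp (measurable_pi_apply k)

namespace Regular

variable {θ₀ : M.Param} {c C K Λ K₀ ε : ℝ} {e : EuclideanSpace ℝ (Fin m) → ℝ} {n : ℕ} {x : X}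
  {θ : EuclideanSpace ℝ (Fin d)}

lemma measurePreserving_obs (k : ℕ) :
    MeasurePreserving (fun ω => obs ω k) (M.stationaryLaw θ₀) ((M.π θ₀).map Prod.snd) := by
  have h0 : MeasurePreserving (fun ω : ℕ → X × EuclideanSpace ℝ (Fin m) => obs ω 0)
      (M.stationaryLaw θ₀) ((M.π θ₀).map Prod.snd) := by
    refine ⟨measurable_obs 0, Measure.ext_of_lintegral _ fun F hF => ?_⟩
    rw [lintegral_map hF (measurable_obs 0), lintegral_map hF measurable_snd]
    exact lintegral_markovLaw_zero (M.jointKernel θ₀) (M.π θ₀) (hF.comp measurable_snd)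
  have hs := (measurePreserving_seqShift (M.jointKernel θ₀) (M.invariant_π θ₀)).iterate k
  have e : (fun ω : ℕ → X × EuclideanSpace ℝ (Fin m) => obs ω k) =
      (fun ω => obs ω 0) ∘ seqShift^[k] := by
    funext ω
    simp [obs, seqShift_iterate]
  rw [e]
  exact h0.comp hs

lemma ae_good (h : M.Regular θ₀ c C K Λ e K₀) :
    ∀ᵐ ω ∂M.stationaryLaw θ₀, ∀ k, M.Good e K₀ (obs ω k) :=
  M.ae_of_ae_map_snd θ₀ h.good

lemma isWindow (h : M.Regular θ₀ c C K Λ e K₀) (hε : 0 ≤ ε) (hεK : ε ≤ K₀)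
    {y : ℕ → EuclideanSpace ℝ (Fin m)} (hy : ∀ k, M.Good e K₀ (y k)) (k : ℕ) :
    IsWindow M.μ M.Param M.obsDensity (M.windows ε y k) (e (y k)) :=
  HMMFamily.isWindow h.model h.bdd h.nonneg hε hεK (hy k)

lemma measurable_winWeight (h : M.Regular θ₀ c C K Λ e K₀) (hθ : θ ∈ M.Param) :
    Measurable fun p : EuclideanSpace ℝ (Fin m) × X =>
      ∫ y', M.obsDensity θ y' p.2 ∂M.ballMeasure ε p.1 := by
  unfold ballMeasure
  split_ifs with h0
  · simp_rw [integral_dirac]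
    exact h.model.meas θ hθ
  · have hm : Measurable fun p : (EuclideanSpace ℝ (Fin m) × X) × EuclideanSpace ℝ (Fin m) =>
        {p : (EuclideanSpace ℝ (Fin m) × X) × EuclideanSpace ℝ (Fin m) |
          dist p.2 p.1.1 ≤ ε}.indicator (fun p => M.obsDensity θ p.2 p.1.2) p := by
      refine Measurable.indicator ?_ ?_
      · exact (h.model.meas θ hθ).comp
          (measurable_snd.prodMk (measurable_snd.comp measurable_fst))
      · exact measurableSet_le (measurable_snd.dist (measurable_fst.comp measurable_fst))
          measurable_const
    have := (StronglyMeasurable.integral_prod_right' (ν := M.ν) hm.stronglyMeasurable).measurable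
    convert this using 1
    funext p
    rw [← integral_indicator Metric.isClosed_closedBall.measurableSet]
    rfl

lemma measurable_logChain (h : M.Regular θ₀ c C K Λ e K₀) (hθ : θ ∈ M.Param) (n : ℕ) (x : X) :
    Measurable fun ω : ℕ → X × EuclideanSpace ℝ (Fin m) =>
      logChain M.μ M.q M.obsDensity x n (M.windows ε (obs ω)) θ := by
  have hw : ∀ k, Measurable fun p : (ℕ → X × EuclideanSpace ℝ (Fin m)) × X =>
      winWeight M.obsDensity (M.windows ε (obs p.1)) θ k p.2 := by
    intro k
    have h1 : Measurable fun p : (ℕ → X × EuclideanSpace ℝ (Fin m)) × X => obs p.1 k :=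
      (measurable_obs k).comp measurable_fst
    have h2 := h1.prodMk (measurable_snd (α := ℕ → X × EuclideanSpace ℝ (Fin m)) (β := X))
    have h3 : Measurable fun p : (ℕ → X × EuclideanSpace ℝ (Fin m)) × X =>
        ∫ y', M.obsDensity θ y' p.2 ∂M.ballMeasure ε (obs p.1 k) := by
      have h4 := (h.measurable_winWeight (ε := ε) hθ).comp h2
      exact h4
    exact h3
  have h1 := measurable_chain_param (μ := M.μ) (h.model.kernel θ hθ).meas n
    (w := fun k (ω : ℕ → X × EuclideanSpace ℝ (Fin m)) =>
      winWeight M.obsDensity (M.windows ε (obs ω)) θ k) hw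
  have h2 : Measurable fun ω : ℕ → X × EuclideanSpace ℝ (Fin m) => (ω, x) :=
    measurable_prodMk_right
  have h3 := Real.measurable_log.comp (h1.comp h2)
  exact h3

lemma memLp_obs (h : M.Regular θ₀ c C K Λ e K₀) (k : ℕ) :
    MemLp (fun ω => K + e (obs ω k)) 2 (M.stationaryLaw θ₀) := by
  refine (memLp_const K).add ?_
  have hm : Measurable fun ω : ℕ → X × EuclideanSpace ℝ (Fin m) => e (obs ω k) :=
    h.meas.comp (measurable_obs k)
  refine (memLp_two_iff_integrable_sq hm.aestronglyMeasurable).2 ?_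
  exact (measurePreserving_obs (M := M) (θ₀ := θ₀) k).integrable_comp_of_integrable
    (g := fun y => e y ^ 2) h.int

lemma memLp_boundSum (h : M.Regular θ₀ c C K Λ e K₀) (n : ℕ) :
    MemLp (boundSum K e n) 2 (M.stationaryLaw θ₀) :=
  memLp_finsetSum _ fun k _ => h.memLp_obs k

lemma integrable_boundSum (h : M.Regular θ₀ c C K Λ e K₀) (n : ℕ) :
    Integrable (boundSum K e n) (M.stationaryLaw θ₀) :=
  (h.memLp_boundSum n).integrable (by norm_num)

lemma integrable_boundSum_sq (h : M.Regular θ₀ c C K Λ e K₀) (n : ℕ) :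
    Integrable (fun ω => boundSum K e n ω ^ 2) (M.stationaryLaw θ₀) :=
  (h.memLp_boundSum n).integrable_sq

/-- Cauchy–Schwarz and stationarity. The growth is only quadratic in `n`, so a geometric factor
beats it. -/
lemma integral_boundSum_sq_le (h : M.Regular θ₀ c C K Λ e K₀) : ∃ D, 0 ≤ D ∧ ∀ n : ℕ,
    ∫ ω, boundSum K e n ω ^ 2 ∂M.stationaryLaw θ₀ ≤ (n : ℝ) ^ 2 * D := by
  refine ⟨∫ y, (K + e y) ^ 2 ∂(M.π θ₀).map Prod.snd, integral_nonneg fun y => sq_nonneg _,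
    fun n => ?_⟩
  have hk : ∀ k, ∫ ω, (K + e (obs ω k)) ^ 2 ∂M.stationaryLaw θ₀ =
      ∫ y, (K + e y) ^ 2 ∂(M.π θ₀).map Prod.snd := by
    intro k
    rw [← (measurePreserving_obs (M := M) (θ₀ := θ₀) k).map_eq, integral_map
      (measurable_obs k).aemeasurable (by have := h.meas; fun_prop)]
  calc ∫ ω, boundSum K e n ω ^ 2 ∂M.stationaryLaw θ₀
      ≤ ∫ ω, (n : ℝ) * ∑ k ∈ Finset.range n, (K + e (obs ω k)) ^ 2 ∂M.stationaryLaw θ₀ := by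
        refine integral_mono (h.integrable_boundSum_sq n)
          ((integrable_finsetSum _ fun k _ => (h.memLp_obs k).integrable_sq).const_mul _)
          fun ω => ?_
        have := sq_sum_le_card_mul_sum_sq (s := Finset.range n) (f := fun k => K + e (obs ω k))
        rwa [Finset.card_range] at this
    _ = (n : ℝ) ^ 2 * ∫ y, (K + e y) ^ 2 ∂(M.π θ₀).map Prod.snd := by
        rw [integral_const_mul, integral_finsetSum _ fun k _ => (h.memLp_obs k).integrable_sq]
        simp_rw [hk]
        rw [Finset.sum_const, Finset.card_range, nsmul_eq_mul]
        ring

lemma boundSum_nonneg (h : M.Regular θ₀ c C K Λ e K₀) (n : ℕ)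
    (ω : ℕ → X × EuclideanSpace ℝ (Fin m)) : 0 ≤ boundSum K e n ω :=
  Finset.sum_nonneg fun _ _ => add_nonneg h.model.nonneg (h.nonneg _)

/-- Subtracting the value at `θ₀` leaves a quantity controlled by the derivative bounds alone,
through the Lipschitz estimate and the diameter of the parameter set. The Hessian brings in the
square of the sum of window bounds, hence the need for second moments. -/
lemma c2Dominated_relLogChain (h : M.Regular θ₀ c C K Λ e K₀) (hε : 0 ≤ ε) (hεK : ε ≤ K₀)
    (n : ℕ) (x : X) :
    C2Dominated (M.stationaryLaw θ₀) (interior M.Param) (M.relLogChain ε θ₀ x n)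
      (fun ω => (Λ * Metric.diam M.Param + 1) * boundSum K e n ω + 2 * boundSum K e n ω ^ 2) where
  isOpen := isOpen_interior
  meas θ hθ := ((h.measurable_logChain (interior_subset hθ) n x).sub
    (h.measurable_logChain θ₀.2 n x)).aestronglyMeasurable
  int_bound := ((h.integrable_boundSum n).const_mul _).add
    ((h.integrable_boundSum_sq n).const_mul _)
  ae := by
    have := M.neZero_μ θ₀
    filter_upwards [h.ae_good] with ω hω θ hθ
    have hw := h.isWindow hε hεK hω
    have h0 := h.boundSum_nonneg n ω
    have hΛ := h.model.lip_nonneg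
    have hc := h.model.contDiffAt_logChain hw n x hθ
    obtain ⟨h1, h2⟩ := h.model.norm_fderiv_logChain_le hw n x hθ
    have hd : 0 ≤ Λ * Metric.diam M.Param * boundSum K e n ω :=
      mul_nonneg (mul_nonneg hΛ Metric.diam_nonneg) h0
    change _ ≤ boundSum K e n ω at h1
    change _ ≤ boundSum K e n ω + 2 * boundSum K e n ω ^ 2 at h2
    have hsq := sq_nonneg (boundSum K e n ω)
    refine ⟨hc.sub contDiffAt_const, ?_, ?_, ?_⟩
    · have hl := h.model.logChain_lipschitz hw n x (interior_subset hθ) θ₀.2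
      change _ ≤ Λ * boundSum K e n ω * dist θ θ₀ at hl
      have hdist := Metric.dist_le_diam_of_mem M.isCompact_param.isBounded
        (interior_subset hθ) θ₀.2
      have := mul_le_mul_of_nonneg_left hdist (mul_nonneg hΛ h0)
      rw [Real.norm_eq_abs]
      unfold relLogChain
      linarith
    · unfold relLogChain
      rw [fderiv_sub_const]
      linarith
    · unfold relLogChain
      rw [fderiv2_sub_const]
      linarith

lemma relLogChain_lipschitz (h : M.Regular θ₀ c C K Λ e K₀) (hε : 0 ≤ ε) (hεK : ε ≤ K₀)
    (n : ℕ) (x : X) : ∀ᵐ ω ∂M.stationaryLaw θ₀, ∀ a ∈ M.Param, ∀ b ∈ M.Param,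
      |M.relLogChain ε θ₀ x n a ω - M.relLogChain ε θ₀ x n b ω| ≤
        Λ * boundSum K e n ω * dist a b := by
  have := M.neZero_μ θ₀
  filter_upwards [h.ae_good] with ω hω a ha b hb
  have hl := h.model.logChain_lipschitz (h.isWindow hε hεK hω) n x ha hb
  simp only [relLogChain, sub_sub_sub_cancel_right]
  exact hl

lemma measurable_relLogChain (h : M.Regular θ₀ c C K Λ e K₀) (hθ : θ ∈ M.Param) (n : ℕ) (x : X) :
    Measurable (M.relLogChain ε θ₀ x n θ) :=
  (h.measurable_logChain hθ n x).sub (h.measurable_logChain θ₀.2 n x)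

lemma integrable_relLogChain (h : M.Regular θ₀ c C K Λ e K₀) (hε : 0 ≤ ε) (hεK : ε ≤ K₀)
    (hθ : θ ∈ M.Param) (n : ℕ) (x : X) :
    Integrable (M.relLogChain ε θ₀ x n θ) (M.stationaryLaw θ₀) := by
  refine ((h.integrable_boundSum n).const_mul (Λ * dist θ θ₀)).mono'
    (h.measurable_relLogChain hθ n x).aestronglyMeasurable ?_
  filter_upwards [h.relLogChain_lipschitz hε hεK n x] with ω hω
  have := hω θ hθ θ₀ θ₀.2
  have e0 : M.relLogChain ε θ₀ x n θ₀ ω = 0 := by simp [relLogChain]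
  rw [e0, sub_zero] at this
  rw [Real.norm_eq_abs]
  linarith

lemma meanLogChain_zero (ε : ℝ) (θ₀ : M.Param) (x : X) (θ : EuclideanSpace ℝ (Fin d)) :
    M.meanLogChain ε θ₀ x 0 θ = 0 := by
  simp [meanLogChain, relLogChain, logChain, chain]

/-- Second differences telescope to first differences; the empty chain has mean zero, so the first
mean is itself an increment. -/
lemma sum_meanForget (ε : ℝ) (θ₀ : M.Param) (x : X) (N : ℕ) (θ : EuclideanSpace ℝ (Fin d)) :
    M.meanLogChain ε θ₀ x 1 θ + ∑ n ∈ Finset.range N, M.meanForget ε θ₀ x n θ =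
      M.meanLogChain ε θ₀ x (N + 1) θ - M.meanLogChain ε θ₀ x N θ := by
  induction N with
  | zero => simp [meanLogChain_zero]
  | succ N ih =>
    rw [Finset.sum_range_succ, ← add_assoc, ih, meanForget]
    ring

lemma integral_shift (f : (ℕ → X × EuclideanSpace ℝ (Fin m)) → ℝ)
    (hf : AEStronglyMeasurable f (M.stationaryLaw θ₀)) :
    ∫ ω, f (seqShift ω) ∂M.stationaryLaw θ₀ = ∫ ω, f ω ∂M.stationaryLaw θ₀ := by
  have hp : MeasurePreserving seqShift (M.stationaryLaw θ₀) (M.stationaryLaw θ₀) :=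
    measurePreserving_seqShift (M.jointKernel θ₀) (M.invariant_π θ₀)
  conv_rhs => rw [← hp.map_eq]
  rw [integral_map measurable_seqShift.aemeasurable (by rwa [hp.map_eq])]

/-- Removing the first window amounts to shifting the trajectory, which stationarity does not see in
the mean. The second difference of the means is therefore the mean of a quantity to which the
forgetting estimates apply. -/
lemma meanForget_eq (h : M.Regular θ₀ c C K Λ e K₀) (hε : 0 ≤ ε) (hεK : ε ≤ K₀)
    (hθ : θ ∈ M.Param) (n : ℕ) (x : X) :
    M.meanForget ε θ₀ x n θ = ∫ ω, (forget M.μ M.q M.obsDensity x n (M.windows ε (obs ω)) θ -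
      forget M.μ M.q M.obsDensity x n (M.windows ε (obs ω)) θ₀) ∂M.stationaryLaw θ₀ := by
  have hi := fun n => h.integrable_relLogChain hε hεK hθ n x
  have hs := fun n => integral_shift (θ₀ := θ₀) (M.relLogChain ε θ₀ x n θ)
    (hi n).aestronglyMeasurable
  have his : ∀ n, Integrable (fun ω => M.relLogChain ε θ₀ x n θ (seqShift ω))
      (M.stationaryLaw θ₀) := fun n =>
    (measurePreserving_seqShift (M.jointKernel θ₀)
      (M.invariant_π θ₀)).integrable_comp_of_integrable (g := M.relLogChain ε θ₀ x n θ) (hi n)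
  have hF : ∀ ω, forget M.μ M.q M.obsDensity x n (M.windows ε (obs ω)) θ -
      forget M.μ M.q M.obsDensity x n (M.windows ε (obs ω)) θ₀ =
      (M.relLogChain ε θ₀ x (n + 2) θ ω - M.relLogChain ε θ₀ x (n + 1) θ ω) -
      (M.relLogChain ε θ₀ x (n + 1) θ (seqShift ω) - M.relLogChain ε θ₀ x n θ (seqShift ω)) := by
    intro ω
    have : M.windows ε (obs (seqShift ω)) = fun k => M.windows ε (obs ω) (k + 1) := rfl
    simp only [relLogChain, forget, this]
    ring
  have h1 : Integrable (fun ω => M.relLogChain ε θ₀ x (n + 2) θ ω -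
      M.relLogChain ε θ₀ x (n + 1) θ ω) (M.stationaryLaw θ₀) := (hi _).sub (hi _)
  have h2 : Integrable (fun ω => M.relLogChain ε θ₀ x (n + 1) θ (seqShift ω) -
      M.relLogChain ε θ₀ x n θ (seqShift ω)) (M.stationaryLaw θ₀) := (his _).sub (his _)
  rw [integral_congr_ae (Eventually.of_forall hF), integral_sub h1 h2,
    integral_sub (hi _) (hi _), integral_sub (his _) (his _), hs, hs]
  rfl

end Regular

end HMMFamily

/-! ### Convergence of the log likelihoods -/

/-- A fourth root of the contraction rate, since the interpolation of derivatives gives up powers of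
`σ ^ n`; the maximum with `1 / 2` keeps it positive when `c = C`. -/
lemma exists_rate {c C : ℝ} (hc : 0 < c) (hcC : c ≤ C) :
    ∃ σ : ℝ, 0 < σ ∧ σ < 1 ∧ ∀ n : ℕ, (1 - c / C) ^ n ≤ (σ ^ n) ^ 4 := by
  have hC : 0 < C := hc.trans_le hcC
  set ρ := max (1 - c / C) (1 / 2) with hρ
  have h0 : 0 < ρ := lt_max_of_lt_right (by norm_num)
  have h1 : ρ < 1 := max_lt (by linarith [div_pos hc hC]) (by norm_num)
  have hnn : 0 ≤ 1 - c / C := by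
    rw [sub_nonneg, div_le_one hC]; exact hcC
  refine ⟨√√ρ, Real.sqrt_pos.2 (Real.sqrt_pos.2 h0), ?_, fun n => ?_⟩
  · rw [Real.sqrt_lt' one_pos, one_pow, Real.sqrt_lt' one_pos, one_pow]
    exact h1
  · have : (√√ρ) ^ 4 = ρ := by
      rw [show (4 : ℕ) = 2 * 2 by norm_num, pow_mul, Real.sq_sqrt (Real.sqrt_nonneg _),
        Real.sq_sqrt h0.le]
    rw [← pow_mul, mul_comm, pow_mul, this]
    exact pow_le_pow_left₀ hnn (le_max_left _ _) n

/-- A sequence whose increments are almost those of a sequence with converging averages. -/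
lemma tendsto_div_of_increments {D : ℕ → ℝ} {F : ℕ → ℕ → ℝ} {η a : ℕ → ℝ} {l : ℝ}
    (hinc : ∀ N k, |D (N + k + 1) - D (N + k) - F N k| ≤ η N)
    (hF : ∀ N, Tendsto (fun n : ℕ => (1 / (n : ℝ)) * ∑ k ∈ Finset.range n, F N k) atTop (𝓝 (a N)))
    (hη : Tendsto η atTop (𝓝 0)) (ha : Tendsto a atTop (𝓝 l)) :
    Tendsto (fun n : ℕ => (1 / (n : ℝ)) * D n) atTop (𝓝 l) := by
  rw [Metric.tendsto_atTop]
  intro δ hδ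
  -- The memory `N` is fixed first, so that the error per increment and the distance of `a N` from
  -- the limit are small. As `n` grows, the initial part `D N` and the term `N * l` become
  -- negligible.
  obtain ⟨N, hN1, hN2⟩ := ((hη.eventually (gt_mem_nhds (by positivity : 0 < δ / 8))).and
    (ha.eventually (Metric.ball_mem_nhds l (by positivity : 0 < δ / 8)))).exists
  have hsum : ∀ n : ℕ, |D (N + n) - D N - ∑ k ∈ Finset.range n, F N k| ≤ n * (δ / 8) := by
    intro n
    induction n with
    | zero => simp
    | succ n ih =>
      rw [Finset.sum_range_succ]
      have := (hinc N n).trans hN1.le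
      push_cast
      rw [abs_le] at this ih ⊢
      constructor <;> linarith [this.1, this.2, ih.1, ih.2, show D (N + (n + 1)) = D (N + n + 1) from rfl]
  have e1 : ∀ᶠ n : ℕ in atTop, |(1 / (n : ℝ)) * ∑ k ∈ Finset.range n, F N k - a N| < δ / 8 :=
    (hF N).eventually (Metric.ball_mem_nhds (a N) (by positivity : 0 < δ / 8))
  have e2 : ∀ᶠ n : ℕ in atTop, (|D N| + N * |l|) / (δ / 8) ≤ (n : ℝ) :=
    tendsto_natCast_atTop_atTop.eventually_ge_atTop _
  obtain ⟨n₀, hn₀⟩ := eventually_atTop.1 ((e1.and e2).and (eventually_gt_atTop 0))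
  refine ⟨N + n₀, fun p hp => ?_⟩
  obtain ⟨n, rfl⟩ := Nat.exists_eq_add_of_le (show N ≤ p by omega)
  obtain ⟨⟨h1, h2⟩, h3⟩ := hn₀ n (by omega)
  have hn : (0 : ℝ) < n := by exact_mod_cast h3
  have hp0 : (0 : ℝ) < ((N + n : ℕ) : ℝ) := by exact_mod_cast (by omega : 0 < N + n)
  have h4 : |∑ k ∈ Finset.range n, F N k - n * a N| ≤ n * (δ / 8) := by
    have : ∑ k ∈ Finset.range n, F N k - n * a N =
        n * ((1 / (n : ℝ)) * ∑ k ∈ Finset.range n, F N k - a N) := by field_simp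
    rw [this, abs_mul, abs_of_pos hn]
    exact mul_le_mul_of_nonneg_left h1.le hn.le
  have h5 : |n * a N - n * l| ≤ n * (δ / 8) := by
    rw [← mul_sub, abs_mul, abs_of_pos hn]
    exact mul_le_mul_of_nonneg_left (by rw [← Real.dist_eq]; exact (Metric.mem_ball.1 hN2).le) hn.le
  have h6 : |D N| + N * |l| ≤ n * (δ / 8) := by
    rwa [div_le_iff₀ (by positivity)] at h2
  have h7 : |D (N + n) - (N + n : ℕ) * l| ≤ n * (δ / 2) := by
    have h8 := hsum n
    have h9 : |(N : ℝ) * l| = N * |l| := by rw [abs_mul, Nat.abs_cast]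
    push_cast
    have : D (N + n) - ((N : ℝ) + n) * l = (D (N + n) - D N - ∑ k ∈ Finset.range n, F N k) +
      (∑ k ∈ Finset.range n, F N k - n * a N) + (n * a N - n * l) + D N - N * l := by ring
    rw [this]
    have t1 := abs_sub (D (N + n) - D N - ∑ k ∈ Finset.range n, F N k +
      (∑ k ∈ Finset.range n, F N k - n * a N) + (n * a N - n * l) + D N) (N * l)
    have t2 := abs_add_le (D (N + n) - D N - ∑ k ∈ Finset.range n, F N k +
      (∑ k ∈ Finset.range n, F N k - n * a N) + (n * a N - n * l)) (D N)
    have t3 := abs_add_le (D (N + n) - D N - ∑ k ∈ Finset.range n, F N k +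
      (∑ k ∈ Finset.range n, F N k - n * a N)) (n * a N - n * l)
    have t4 := abs_add_le (D (N + n) - D N - ∑ k ∈ Finset.range n, F N k)
      (∑ k ∈ Finset.range n, F N k - n * a N)
    linarith
  rw [Real.dist_eq]
  have e : 1 / ((N + n : ℕ) : ℝ) * D (N + n) - l =
      (1 / ((N + n : ℕ) : ℝ)) * (D (N + n) - (N + n : ℕ) * l) := by field_simp
  rw [e, abs_mul, abs_of_pos (by positivity), one_div, inv_mul_lt_iff₀ hp0]
  have : (n : ℝ) ≤ (N + n : ℕ) := by push_cast; linarith [Nat.cast_nonneg (α := ℝ) N]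
  nlinarith

/-- A series is an integral against the counting measure, so termwise differentiation is an instance
of dominated differentiation. -/
lemma C2Dominated.count {E : Type*} [NormedAddCommGroup E] [NormedSpace ℝ E]
    [FiniteDimensional ℝ E] {U : Set E} (hU : IsOpen U) {f : ℕ → E → ℝ} {β : ℕ → ℝ}
    (hβ : Summable β) (hβ0 : ∀ n, 0 ≤ β n)
    (hf : ∀ n, ∀ θ ∈ U, ContDiffAt ℝ 2 (f n) θ ∧ ‖f n θ‖ ≤ β n ∧ ‖fderiv ℝ (f n) θ‖ ≤ β n ∧
      ‖fderiv2 (f n) θ‖ ≤ β n) {θ : E} (hθ : θ ∈ U) :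
    ContDiffAt ℝ 2 (fun t => ∑' n, f n t) θ ∧ ‖fderiv2 (fun t => ∑' n, f n t) θ‖ ≤ ∑' n, β n := by
  have hi : ∀ g : ℕ → ℝ, Summable (fun n => ‖g n‖) → ∫ n, g n ∂Measure.count = ∑' n, g n := by
    intro g hg
    rw [integral_countable (integrable_count_iff.2 hg)]
    simp [Measure.real]
  have hβn : Summable fun n => ‖β n‖ := by simpa [abs_of_nonneg, hβ0] using hβ
  have h : C2Dominated (Measure.count : Measure ℕ) U (fun θ n => f n θ) β :=
    ⟨hU, fun θ _ => measurable_of_countable _ |>.aestronglyMeasurable, integrable_count_iff.2 hβn,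
      Eventually.of_forall fun n θ hθ => hf n θ hθ⟩
  have he : (fun t => ∑' n, f n t) =ᶠ[𝓝 θ] fun t => ∫ n, f n t ∂Measure.count := by
    filter_upwards [hU.mem_nhds hθ] with t ht
    rw [hi]
    exact Summable.of_nonneg_of_le (fun n => norm_nonneg _) (fun n => (hf n t ht).2.1) hβ
  refine ⟨(h.contDiffAt hθ).congr_of_eventuallyEq he, ?_⟩
  unfold fderiv2
  rw [he.fderiv.fderiv_eq, ← hi β hβn]
  exact h.norm_fderiv2_le hθ

/-! ### Summable forgetting and regularity of the limit surface -/

namespace HMMFamily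

variable {d m : ℕ} {X : Type*} [MeasurableSpace X] {M : HMMFamily d m X}

namespace Regular

variable {θ₀ : M.Param} {c C K Λ K₀ ε : ℝ} {e : EuclideanSpace ℝ (Fin m) → ℝ} {n : ℕ} {x : X}
  {θ : EuclideanSpace ℝ (Fin d)}

/-- The pathwise forgetting estimates are integrated. The sequence obtained involves neither the
tolerance nor the starting state, which is the source of all later uniformity. Values are bounded on
the whole parameter set, derivatives in its interior. -/
lemma exists_forget_bound (h : M.Regular θ₀ c C K Λ e K₀) :
    ∃ β : ℕ → ℝ, Summable β ∧ (∀ n, 0 ≤ β n) ∧ ∀ ε, 0 ≤ ε → ε ≤ K₀ → ∀ (n : ℕ) (x : X),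
      (∀ θ ∈ M.Param, ‖M.meanForget ε θ₀ x n θ‖ ≤ β n) ∧
      ∀ θ ∈ interior M.Param, ContDiffAt ℝ 2 (M.meanForget ε θ₀ x n) θ ∧
        ‖M.meanForget ε θ₀ x n θ‖ ≤ β n ∧ ‖fderiv ℝ (M.meanForget ε θ₀ x n) θ‖ ≤ β n ∧
        ‖fderiv2 (M.meanForget ε θ₀ x n) θ‖ ≤ β n := by
  have hμ := M.neZero_μ θ₀
  have hX := M.nonempty_state θ₀
  have hcC : c ≤ C := (h.model.kernel θ₀ θ₀.2).lt_one_iff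
  have hc : 0 < c := (h.model.kernel θ₀ θ₀.2).pos
  set c' := c * Real.exp (-(2 * K)) with hc'
  set C' := C * Real.exp (2 * K) with hC'
  have hc0 : 0 < c' := mul_pos hc (Real.exp_pos _)
  have hcC1 : c' ≤ c := by
    have : Real.exp (-(2 * K)) ≤ 1 := Real.exp_le_one_iff.2 (by linarith [h.model.nonneg])
    nlinarith
  have hcC2 : C ≤ C' := by
    have : 1 ≤ Real.exp (2 * K) := Real.one_le_exp (by linarith [h.model.nonneg])
    nlinarith
  have hcC' : c' ≤ C' := hcC1.trans (hcC.trans hcC2)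
  have hC0 : 0 < C := hc.trans_le hcC
  obtain ⟨σ, hσ0, hσ1, hσ⟩ := exists_rate hc0 hcC'
  obtain ⟨D, hD0, hD⟩ := h.integral_boundSum_sq_le
  set A₀ := C' / c' with hA₀
  have hA₀0 : 0 ≤ A₀ := div_nonneg (hc0.le.trans hcC') hc0.le
  have hrate : ∀ n : ℕ, C' / c' * (1 - c' / C') ^ n ≤ A₀ * (σ ^ n) ^ 4 := fun n =>
    mul_le_mul_of_nonneg_left (hσ n) hA₀0
  -- The frozen constants are the worse ones, so their rate also serves the original model.
  have hrate' : ∀ n : ℕ, C / c * (1 - c / C) ^ n ≤ A₀ * (σ ^ n) ^ 4 := by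
    intro n
    refine le_trans ?_ (hrate n)
    have h1 : C / c ≤ C' / c' := by gcongr
    have h2 : c' / C' ≤ c / C := by gcongr
    have h3 : 0 ≤ 1 - c / C := by rw [sub_nonneg, div_le_one hC0]; exact hcC
    gcongr
  set B : ℕ → (ℕ → X × EuclideanSpace ℝ (Fin m)) → ℝ := fun n ω =>
    128 * (A₀ + 4) * σ ^ n * (1 + 2 * boundSum K e (n + 2) ω) ^ 2 with hB
  have hBi : ∀ n, Integrable (B n) (M.stationaryLaw θ₀) := by
    intro n
    have e1 : B n = fun ω => 128 * (A₀ + 4) * σ ^ n * (1 + 4 * boundSum K e (n + 2) ω +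
        4 * boundSum K e (n + 2) ω ^ 2) := by funext ω; simp only [hB]; ring
    rw [e1]
    exact (((integrable_const (1 : ℝ)).add ((h.integrable_boundSum _).const_mul 4)).add
      ((h.integrable_boundSum_sq _).const_mul 4)).const_mul _
  -- From `(1 + 2 * S) ^ 2 ≤ 2 + 8 * S ^ 2` and the second moment of the sum `S` of `n + 2` window
  -- bounds.
  refine ⟨fun n => 128 * (A₀ + 4) * σ ^ n * (2 + 8 * (((n + 2 : ℕ) : ℝ) ^ 2 * D)), ?_,
    fun n => by positivity, ?_⟩
  · have hs0 : Summable fun n : ℕ => σ ^ n := summable_geometric_of_lt_one hσ0.le hσ1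
    have hs2 := summable_pow_mul_geometric_of_norm_lt_one 2
      (show ‖σ‖ < 1 by rw [Real.norm_of_nonneg hσ0.le]; exact hσ1)
    have hs1 := summable_pow_mul_geometric_of_norm_lt_one 1
      (show ‖σ‖ < 1 by rw [Real.norm_of_nonneg hσ0.le]; exact hσ1)
    have := ((hs0.mul_left (128 * (A₀ + 4) * (2 + 32 * D))).add
      (hs1.mul_left (128 * (A₀ + 4) * (32 * D)))).add (hs2.mul_left (128 * (A₀ + 4) * (8 * D)))
    refine this.congr fun n => ?_
    push_cast
    ring
  · intro ε hε hεK n x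
    have hint : ∫ ω, B n ω ∂M.stationaryLaw θ₀ ≤
        128 * (A₀ + 4) * σ ^ n * (2 + 8 * (((n + 2 : ℕ) : ℝ) ^ 2 * D)) := by
      calc ∫ ω, B n ω ∂M.stationaryLaw θ₀
          ≤ ∫ ω, 128 * (A₀ + 4) * σ ^ n * (2 + 8 * boundSum K e (n + 2) ω ^ 2)
              ∂M.stationaryLaw θ₀ := by
            refine integral_mono (hBi n) (((integrable_const _).add
              ((h.integrable_boundSum_sq _).const_mul 8)).const_mul _) fun ω => ?_
            simp only [hB]
            refine mul_le_mul_of_nonneg_left ?_ (by positivity)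
            nlinarith [sq_nonneg (1 - 2 * boundSum K e (n + 2) ω)]
        _ = 128 * (A₀ + 4) * σ ^ n * (2 + 8 * ∫ ω, boundSum K e (n + 2) ω ^ 2
              ∂M.stationaryLaw θ₀) := by
            rw [integral_const_mul, integral_add (integrable_const _)
              ((h.integrable_boundSum_sq _).const_mul 8), integral_const_mul]
            simp
        _ ≤ _ := by
            have := hD (n + 2)
            refine mul_le_mul_of_nonneg_left (by linarith) (by positivity)
    have hfb : ∀ᵐ ω ∂M.stationaryLaw θ₀, ∀ θ ∈ M.Param,
        ‖forget M.μ M.q M.obsDensity x n (M.windows ε (obs ω)) θ -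
        forget M.μ M.q M.obsDensity x n (M.windows ε (obs ω)) θ₀‖ ≤ B n ω := by
      filter_upwards [h.ae_good] with ω hω θ hθ
      have hw := h.isWindow hε hεK hω
      have h1 := (h.model.abs_forget_le hw n x hθ).trans (hrate' n)
      have h2 := (h.model.abs_forget_le hw n x θ₀.2).trans (hrate' n)
      have h3 : (σ ^ n) ^ 4 ≤ σ ^ n := pow_le_of_le_one (by positivity)
        (pow_le_one₀ hσ0.le hσ1.le) (by norm_num)
      have h4 := h.boundSum_nonneg (n + 2) ω
      have h5 : (1 : ℝ) ≤ (1 + 2 * boundSum K e (n + 2) ω) ^ 2 := by nlinarith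
      have h6 : 0 < σ ^ n := by positivity
      rw [Real.norm_eq_abs]
      calc _ ≤ _ + _ := abs_sub _ _
        _ ≤ A₀ * σ ^ n + A₀ * σ ^ n := add_le_add
          (h1.trans (mul_le_mul_of_nonneg_left h3 hA₀0))
          (h2.trans (mul_le_mul_of_nonneg_left h3 hA₀0))
        _ ≤ 128 * (A₀ + 4) * σ ^ n * 1 := by nlinarith [mul_nonneg hA₀0 h6.le]
        _ ≤ _ := by simp only [hB]; exact mul_le_mul_of_nonneg_left h5 (by positivity)
    have hc2 : C2Dominated (M.stationaryLaw θ₀) (interior M.Param)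
        (fun θ ω => forget M.μ M.q M.obsDensity x n (M.windows ε (obs ω)) θ -
          forget M.μ M.q M.obsDensity x n (M.windows ε (obs ω)) θ₀) (B n) := by
      refine ⟨isOpen_interior, fun θ hθ => ?_, hBi n, ?_⟩
      · have hm : ∀ θ ∈ M.Param, Measurable fun ω : ℕ → X × EuclideanSpace ℝ (Fin m) =>
            forget M.μ M.q M.obsDensity x n (M.windows ε (obs ω)) θ := by
          intro θ hθ
          have a1 := fun n => h.measurable_logChain (ε := ε) hθ n x
          have a2 := fun n => (a1 n).comp measurable_seqShift
          exact ((a1 _).sub (a1 _)).sub ((a2 _).sub (a2 _))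
        exact ((hm θ (interior_subset hθ)).sub (hm θ₀ θ₀.2)).aestronglyMeasurable
      · filter_upwards [h.ae_good, hfb] with ω hω hfω θ hθ
        have hw := h.isWindow hε hεK hω
        obtain ⟨h1, h2⟩ := h.model.norm_fderiv_forget_le hw hθ n x hσ0 hσ1.le hA₀0 (hrate n) le_rfl
        refine ⟨(h.model.contDiffAt_forget hw n x hθ).sub contDiffAt_const,
          hfω θ (interior_subset hθ), ?_, ?_⟩
        · rw [fderiv_sub_const]; exact h1
        · rw [fderiv2_sub_const]; exact h2
    have hval : ∀ θ ∈ M.Param, ‖M.meanForget ε θ₀ x n θ‖ ≤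
        128 * (A₀ + 4) * σ ^ n * (2 + 8 * (((n + 2 : ℕ) : ℝ) ^ 2 * D)) := by
      intro θ hθ
      rw [h.meanForget_eq hε hεK hθ]
      refine (norm_integral_le_of_norm_le (hBi n) ?_).trans hint
      filter_upwards [hfb] with ω hω using hω θ hθ
    refine ⟨hval, fun θ hθ => ?_⟩
    have he : M.meanForget ε θ₀ x n =ᶠ[𝓝 θ] fun θ => ∫ ω,
        (forget M.μ M.q M.obsDensity x n (M.windows ε (obs ω)) θ -
          forget M.μ M.q M.obsDensity x n (M.windows ε (obs ω)) θ₀) ∂M.stationaryLaw θ₀ := by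
      filter_upwards [isOpen_interior.mem_nhds hθ] with t ht
      exact h.meanForget_eq hε hεK (interior_subset ht) n x
    refine ⟨(hc2.contDiffAt hθ).congr_of_eventuallyEq he, hval θ (interior_subset hθ), ?_, ?_⟩
    · rw [he.fderiv_eq]
      exact (hc2.norm_fderiv_le hθ).trans hint
    · unfold fderiv2
      rw [he.fderiv.fderiv_eq]
      exact (hc2.norm_fderiv2_le hθ).trans hint

lemma contDiffAt_meanLogChain (h : M.Regular θ₀ c C K Λ e K₀) (hε : 0 ≤ ε) (hεK : ε ≤ K₀)
    (n : ℕ) (x : X) (hθ : θ ∈ interior M.Param) :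
    ContDiffAt ℝ 2 (M.meanLogChain ε θ₀ x n) θ :=
  (h.c2Dominated_relLogChain hε hεK n x).contDiffAt hθ

/-- The surface and its Hessian are approximated by those of the finite mean log likelihoods,
uniformly in the tolerance. -/
lemma exists_surface_approx (h : M.Regular θ₀ c C K Λ e K₀) :
    ∃ δ : ℕ → ℝ, Tendsto δ atTop (𝓝 0) ∧ ∀ ε, 0 ≤ ε → ε ≤ K₀ → ∀ (x : X),
      (∀ θ ∈ interior M.Param, ContDiffAt ℝ 2 (M.surface ε θ₀ x) θ) ∧ ∀ N,
      (∀ θ ∈ M.Param, |M.surface ε θ₀ x θ -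
        (M.meanLogChain ε θ₀ x (N + 1) θ - M.meanLogChain ε θ₀ x N θ)| ≤ δ N) ∧
      ∀ θ ∈ interior M.Param, ‖fderiv2 (M.surface ε θ₀ x) θ -
        (fderiv2 (M.meanLogChain ε θ₀ x (N + 1)) θ - fderiv2 (M.meanLogChain ε θ₀ x N) θ)‖ ≤
          δ N := by
  obtain ⟨β, hβs, hβ0, hβ⟩ := h.exists_forget_bound
  refine ⟨fun N => ∑' n, β (n + N), tendsto_sum_nat_add β, fun ε hε hεK x => ?_⟩
  -- For every `N` the surface is an increment of finite means plus a tail of the series; the tail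
  -- and its Hessian are bounded by the tail of `β`.
  have hdec : ∀ N, ∀ θ ∈ M.Param, M.surface ε θ₀ x θ =
      (M.meanLogChain ε θ₀ x (N + 1) θ - M.meanLogChain ε θ₀ x N θ) +
        ∑' n, M.meanForget ε θ₀ x (n + N) θ := by
    intro N θ hθ
    have hs : Summable fun n => M.meanForget ε θ₀ x n θ :=
      Summable.of_norm_bounded hβs fun n => (hβ ε hε hεK n x).1 θ hθ
    rw [← sum_meanForget, add_assoc, hs.sum_add_tsum_nat_add N]
    rfl
  have hR := fun N θ hθ => C2Dominated.count isOpen_interior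
    (f := fun n => M.meanForget ε θ₀ x (n + N)) ((summable_nat_add_iff N).2 hβs)
    (fun n => hβ0 _) (fun n θ hθ => (hβ ε hε hεK (n + N) x).2 θ hθ) (θ := θ) hθ
  have he : ∀ N, ∀ θ ∈ interior M.Param, M.surface ε θ₀ x =ᶠ[𝓝 θ] fun θ =>
      (M.meanLogChain ε θ₀ x (N + 1) θ - M.meanLogChain ε θ₀ x N θ) +
        ∑' n, M.meanForget ε θ₀ x (n + N) θ := by
    intro N θ hθ
    filter_upwards [isOpen_interior.mem_nhds hθ] with t ht
    exact hdec N t (interior_subset ht)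
  have hm := fun n θ hθ => h.contDiffAt_meanLogChain hε hεK n x (θ := θ) hθ
  refine ⟨fun θ hθ => ?_, fun N => ⟨fun θ hθ => ?_, fun θ hθ => ?_⟩⟩
  · exact (((hm _ θ hθ).sub (hm _ θ hθ)).add (hR 0 θ hθ).1).congr_of_eventuallyEq (he 0 θ hθ)
  · rw [hdec N θ hθ, add_sub_cancel_left, ← Real.norm_eq_abs]
    exact tsum_of_norm_bounded ((summable_nat_add_iff N).2 hβs).hasSum
      fun n => (hβ ε hε hεK (n + N) x).1 θ hθ
  · have e1 : fderiv2 (M.surface ε θ₀ x) θ =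
        (fderiv2 (M.meanLogChain ε θ₀ x (N + 1)) θ - fderiv2 (M.meanLogChain ε θ₀ x N) θ) +
        fderiv2 (fun θ => ∑' n, M.meanForget ε θ₀ x (n + N) θ) θ := by
      rw [← fderiv2_sub (hm _ θ hθ) (hm _ θ hθ),
        ← fderiv2_add ((hm _ θ hθ).sub (hm _ θ hθ)) (hR N θ hθ).1]
      unfold fderiv2
      rw [(he N θ hθ).fderiv.fderiv_eq]
    rw [e1, add_sub_cancel_left]
    exact (hR N θ hθ).2

end Regular
end HMMFamily

/-! ### Almost sure convergence of the log likelihoods and of the estimators -/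

namespace HMMFamily

variable {d m : ℕ} {X : Type*} [MeasurableSpace X] {M : HMMFamily d m X}

/-- The log likelihood of `n` observations, with initial law `π₀` of the hidden state. -/
def logLik (M : HMMFamily d m X) (ε : ℝ) (π₀ : Measure X) (n : ℕ)
    (y : ℕ → EuclideanSpace ℝ (Fin m)) (θ : EuclideanSpace ℝ (Fin d)) : ℝ :=
  Real.log (∫ x, chain M.μ (M.q θ) n (winWeight M.obsDensity (M.windows ε y) θ) x ∂π₀)

namespace Regular

variable {θ₀ : M.Param} {c C K Λ K₀ ε : ℝ} {e : EuclideanSpace ℝ (Fin m) → ℝ} {n : ℕ} {x : X}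
  {θ : EuclideanSpace ℝ (Fin d)} {y : ℕ → EuclideanSpace ℝ (Fin m)}

lemma relMeanLogLik_eq (h : M.Regular θ₀ c C K Λ e K₀) (hε : 0 ≤ ε) (hεK : ε ≤ K₀)
    (hy : ∀ k, M.Good e K₀ (y k)) (π₀ : Measure X) [IsProbabilityMeasure π₀] (n : ℕ)
    (θ : M.Param) :
    M.relMeanLogLik ε θ₀ π₀ n y θ = (1 / (n : ℝ)) *
      (M.logLik ε π₀ n (fun k => y (k + 1)) θ - M.logLik ε π₀ n (fun k => y (k + 1)) θ₀) := by
  unfold relMeanLogLik logLik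
  rw [likelihood_eq h.model ε (fun k => (hy k).mem) (h.isWindow hε hεK hy),
    likelihood_eq h.model ε (fun k => (hy k).mem) (h.isWindow hε hεK hy)]

/-- At geometric cost in `N`, the initial law and all but the last `N + 1` observations are
forgotten. What is left is a function of a shifted trajectory, suited to the ergodic theorem. -/
lemma logLik_increment (h : M.Regular θ₀ c C K Λ e K₀) (hε : 0 ≤ ε) (hεK : ε ≤ K₀)
    (hy : ∀ k, M.Good e K₀ (y k)) (π₀ : Measure X) [IsProbabilityMeasure π₀] (hθ : θ ∈ M.Param)
    (N k : ℕ) (x : X) :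
    |M.logLik ε π₀ (N + k + 1) y θ - M.logLik ε π₀ (N + k) y θ -
      (logChain M.μ M.q M.obsDensity x (N + 1) (M.windows ε fun j => y (j + k)) θ -
        logChain M.μ M.q M.obsDensity x N (M.windows ε fun j => y (j + k)) θ)| ≤
      (C / c) * (1 - c / C) ^ N := by
  have hμ := M.neZero_μ θ₀
  have hk := h.model.kernel θ hθ
  have hW := h.model.isWeight (h.isWindow hε hεK hy) hθ
  have := hk.abs_log_chain_sub_le N k hW π₀ (Measure.dirac x)
  rw [integral_dirac' _ _ (hk.chain_isBdd _ (fun j => hW (j + k))).meas.stronglyMeasurable,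
    integral_dirac' _ _ (hk.chain_isBdd _ (fun j => hW (j + k))).meas.stronglyMeasurable] at this
  exact this

lemma logLik_lipschitz (h : M.Regular θ₀ c C K Λ e K₀) (hε : 0 ≤ ε) (hεK : ε ≤ K₀)
    (hy : ∀ k, M.Good e K₀ (y k)) (π₀ : Measure X) [IsProbabilityMeasure π₀] (n : ℕ)
    {a b : EuclideanSpace ℝ (Fin d)} (ha : a ∈ M.Param) (hb : b ∈ M.Param) :
    |M.logLik ε π₀ n y a - M.logLik ε π₀ n y b| ≤
      Λ * (∑ k ∈ Finset.range n, (K + e (y k))) * dist a b := by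
  have hμ := M.neZero_μ θ₀
  have hw := h.isWindow hε hεK hy
  have key : ∀ a ∈ M.Param, ∀ b ∈ M.Param, M.logLik ε π₀ n y a ≤
      Λ * (∑ k ∈ Finset.range n, (K + e (y k))) * dist a b + M.logLik ε π₀ n y b := by
    intro a ha b hb
    have hWa := h.model.isWeight hw ha
    have hWb := h.model.isWeight hw hb
    have h1 := (h.model.kernel a ha).integral_chain_pos n hWa π₀
    have h2 := (h.model.kernel b hb).integral_chain_pos n hWb π₀
    have h3 := integral_mono ((h.model.kernel a ha).chain_integrable n hWa π₀)
      (((h.model.kernel b hb).chain_integrable n hWb π₀).const_mul _)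
      fun x => h.model.chain_le_chain hw n x ha hb
    rw [integral_const_mul] at h3
    have h4 := Real.log_le_log h1 h3
    rwa [Real.log_mul (Real.exp_pos _).ne' h2.ne', Real.log_exp] at h4
  rw [abs_le]
  constructor
  · have := key b hb a ha
    rw [dist_comm] at this
    linarith
  · linarith [key a ha b hb]

lemma tendsto_meanLogChain (h : M.Regular θ₀ c C K Λ e K₀) (hε : 0 ≤ ε) (hεK : ε ≤ K₀)
    (hθ : θ ∈ M.Param) (x : X) :
    Tendsto (fun N => M.meanLogChain ε θ₀ x (N + 1) θ - M.meanLogChain ε θ₀ x N θ) atTop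
      (𝓝 (M.surface ε θ₀ x θ)) := by
  obtain ⟨δ, hδ, hs⟩ := h.exists_surface_approx
  have := fun N => ((hs ε hε hεK x).2 N).1 θ hθ
  rw [tendsto_iff_norm_sub_tendsto_zero]
  refine squeeze_zero (fun _ => norm_nonneg _) (fun N => ?_) hδ
  rw [norm_sub_rev]
  exact this N

lemma ergodic (h : M.Regular θ₀ c C K Λ e K₀) {L : ℕ} (hL : L ≠ 0) :
    Ergodic (seqShift^[L]) (M.stationaryLaw θ₀) := by
  have hk := h.model.kernel θ₀ θ₀.2
  obtain ⟨c', lam, hD⟩ := M.doeblin θ₀ hk.pos hk.le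
  exact hD.ergodic (M.invariant_π θ₀) hL

lemma ae_seqShift {p : (ℕ → X × EuclideanSpace ℝ (Fin m)) → Prop}
    (hp : ∀ᵐ ω ∂M.stationaryLaw θ₀, p ω) : ∀ᵐ ω ∂M.stationaryLaw θ₀, p (seqShift ω) :=
  (measurePreserving_seqShift (M.jointKernel θ₀)
    (M.invariant_π θ₀)).quasiMeasurePreserving.ae hp

/-- Law of large numbers for the log likelihood. -/
lemma ae_tendsto_logLik (h : M.Regular θ₀ c C K Λ e K₀) (hε : 0 ≤ ε) (hεK : ε ≤ K₀)
    (hθ : θ ∈ M.Param) (x : X) (π₀ : Measure X) [IsProbabilityMeasure π₀] :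
    ∀ᵐ ω ∂M.stationaryLaw θ₀, Tendsto (fun n : ℕ => (1 / (n : ℝ)) *
      (M.logLik ε π₀ n (obs ω) θ - M.logLik ε π₀ n (obs ω) θ₀)) atTop
        (𝓝 (M.surface ε θ₀ x θ)) := by
  have herg := h.ergodic one_ne_zero
  rw [Function.iterate_one] at herg
  have hi := fun n => h.integrable_relLogChain hε hεK hθ n x
  have hb : ∀ᵐ ω ∂M.stationaryLaw θ₀, ∀ N : ℕ, Tendsto (fun n : ℕ => (1 / (n : ℝ)) *
      ∑ k ∈ Finset.range n, (M.relLogChain ε θ₀ x (N + 1) θ (seqShift^[k] ω) -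
        M.relLogChain ε θ₀ x N θ (seqShift^[k] ω))) atTop
      (𝓝 (M.meanLogChain ε θ₀ x (N + 1) θ - M.meanLogChain ε θ₀ x N θ)) := by
    refine ae_all_iff.2 fun N => ?_
    have := ae_tendsto_birkhoffAverage herg (f := fun ω => M.relLogChain ε θ₀ x (N + 1) θ ω -
        M.relLogChain ε θ₀ x N θ ω)
      ((h.measurable_relLogChain hθ _ x).sub (h.measurable_relLogChain hθ _ x))
      ((hi _).sub (hi _))
    rwa [integral_sub (hi _) (hi _)] at this
  filter_upwards [hb, h.ae_good] with ω hω hg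
  have hk := h.model.kernel θ hθ
  have hX := M.nonempty_state θ₀
  have hcC := hk.lt_one_iff
  have hC0 := hk.pos.trans_le hcC
  -- The factor `2` accounts for the two parameters `θ` and `θ₀`.
  have hη : Tendsto (fun N : ℕ => 2 * ((C / c) * (1 - c / C) ^ N)) atTop (𝓝 0) := by
    have : Tendsto (fun N : ℕ => (1 - c / C) ^ N) atTop (𝓝 0) :=
      tendsto_pow_atTop_nhds_zero_of_lt_one
        (by rw [sub_nonneg, div_le_one hC0]; exact hcC) (by linarith [div_pos hk.pos hC0])
    simpa using (this.const_mul (C / c)).const_mul 2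
  refine tendsto_div_of_increments (fun N k => ?_) hω hη (h.tendsto_meanLogChain hε hεK hθ x)
  have h1 := h.logLik_increment hε hεK hg π₀ hθ N k x
  have h2 := h.logLik_increment hε hεK hg π₀ θ₀.2 N k x
  have e1 : (fun j => obs ω (j + k)) = obs (seqShift^[k] ω) := by
    funext j
    rw [seqShift_iterate, add_comm]
    rfl
  rw [e1] at h1 h2
  simp only [relLogChain]
  rw [abs_le] at h1 h2 ⊢
  constructor <;> linarith [h1.1, h1.2, h2.1, h2.2]

lemma ae_eventually_sum_le (h : M.Regular θ₀ c C K Λ e K₀) :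
    ∀ᵐ ω ∂M.stationaryLaw θ₀, ∀ᶠ n : ℕ in atTop,
      (1 / (n : ℝ)) * (∑ k ∈ Finset.range n, (K + e (obs ω k))) ≤
        ∫ ω, boundSum K e 1 ω ∂M.stationaryLaw θ₀ + 1 := by
  have herg := h.ergodic one_ne_zero
  rw [Function.iterate_one] at herg
  have hm : Measurable (boundSum K e 1 : (ℕ → X × EuclideanSpace ℝ (Fin m)) → ℝ) :=
    Finset.measurable_sum _ fun k _ => measurable_const.add (h.meas.comp (measurable_obs k))
  filter_upwards [ae_tendsto_birkhoffAverage herg hm (h.integrable_boundSum 1)] with ω hω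
  filter_upwards [hω.eventually (gt_mem_nhds (lt_add_one _))] with n hn
  refine le_trans (le_of_eq ?_) hn.le
  congr 1
  refine Finset.sum_congr rfl fun k _ => ?_
  simp [boundSum, seqShift_iterate, obs]

/-- The Lipschitz constant of the limit surfaces. -/
def lipConst (θ₀ : M.Param) (K Λ : ℝ) (e : EuclideanSpace ℝ (Fin m) → ℝ) : ℝ :=
  Λ * (∫ ω, boundSum K e 1 ω ∂M.stationaryLaw θ₀ + 1)

lemma lipConst_nonneg (h : M.Regular θ₀ c C K Λ e K₀) : 0 ≤ lipConst θ₀ K Λ e :=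
  mul_nonneg h.model.lip_nonneg (add_nonneg (integral_nonneg fun ω => h.boundSum_nonneg 1 ω)
    zero_le_one)

lemma ae_eventually_lipschitz (h : M.Regular θ₀ c C K Λ e K₀) (hε : 0 ≤ ε) (hεK : ε ≤ K₀)
    (π₀ : Measure X) [IsProbabilityMeasure π₀] :
    ∀ᵐ ω ∂M.stationaryLaw θ₀, ∀ᶠ n : ℕ in atTop, ∀ a ∈ M.Param, ∀ b ∈ M.Param,
      |(1 / (n : ℝ)) * (M.logLik ε π₀ n (obs ω) a - M.logLik ε π₀ n (obs ω) θ₀) -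
      (1 / (n : ℝ)) * (M.logLik ε π₀ n (obs ω) b - M.logLik ε π₀ n (obs ω) θ₀)| ≤
        lipConst θ₀ K Λ e * dist a b := by
  filter_upwards [h.ae_eventually_sum_le, h.ae_good] with ω hω hg
  filter_upwards [hω] with n hn a ha b hb
  have h1 := h.logLik_lipschitz hε hεK hg π₀ n ha hb
  have h2 : (0 : ℝ) ≤ 1 / n := by positivity
  rw [← mul_sub, abs_mul, abs_of_nonneg h2, sub_sub_sub_cancel_right]
  calc 1 / (n : ℝ) * |M.logLik ε π₀ n (obs ω) a - M.logLik ε π₀ n (obs ω) b|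
      ≤ 1 / (n : ℝ) * (Λ * (∑ k ∈ Finset.range n, (K + e (obs ω k))) * dist a b) :=
        mul_le_mul_of_nonneg_left h1 h2
    _ = Λ * (1 / (n : ℝ) * ∑ k ∈ Finset.range n, (K + e (obs ω k))) * dist a b := by ring
    _ ≤ _ := by
        unfold lipConst
        gcongr
        exact h.model.lip_nonneg

/-- The bound passes to the limit along a single trajectory on which both limits exist and the
eventual Lipschitz bound holds. This covers the boundary of the parameter set, where derivatives of
the surface are not at hand. -/
lemma surface_lipschitz (h : M.Regular θ₀ c C K Λ e K₀) (hε : 0 ≤ ε) (hεK : ε ≤ K₀) (x : X)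
    {a b : EuclideanSpace ℝ (Fin d)} (ha : a ∈ M.Param) (hb : b ∈ M.Param) :
    |M.surface ε θ₀ x a - M.surface ε θ₀ x b| ≤ lipConst θ₀ K Λ e * dist a b := by
  obtain ⟨ω, h1, h2, h3⟩ := ((h.ae_tendsto_logLik hε hεK ha x (Measure.dirac x)).and
    ((h.ae_tendsto_logLik hε hεK hb x (Measure.dirac x)).and
      (h.ae_eventually_lipschitz hε hεK (Measure.dirac x)))).exists
  refine le_of_tendsto (h1.sub h2).abs ?_
  filter_upwards [h3] with n hn using hn a ha b hb

lemma surface_self (ε : ℝ) (θ₀ : M.Param) (x : X) : M.surface ε θ₀ x θ₀ = 0 := by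
  simp [surface, meanForget, meanLogChain, relLogChain]

/-- Uniform law of large numbers for the log likelihood. -/
theorem isLimitSurface (h : M.Regular θ₀ c C K Λ e K₀) (hε : 0 ≤ ε) (hεK : ε ≤ K₀) (x : X) :
    M.IsLimitSurface ε θ₀ (M.surface ε θ₀ x) := by
  refine ⟨?_, ?_, fun π₀ hπ₀ => ?_⟩
  · refine LipschitzOnWith.continuousOn (K := ⟨_, h.lipConst_nonneg⟩)
      (LipschitzOnWith.of_dist_le_mul fun a ha b hb => ?_)
    rw [Real.dist_eq]
    exact h.surface_lipschitz hε hεK x ha hb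
  · obtain ⟨δ, -, hs⟩ := h.exists_surface_approx
    exact fun θ hθ => ((hs ε hε hεK x).1 θ hθ).contDiffWithinAt
  · obtain ⟨D, hDc, hDd⟩ := TopologicalSpace.exists_countable_dense M.Param
    have hcomp : CompactSpace M.Param := isCompact_iff_compactSpace.1 M.isCompact_param
    -- Countability of the dense set leaves one null set. The data begin at time one, so the law of
    -- large numbers is read along the shifted trajectory.
    have h1 : ∀ᵐ ω ∂M.stationaryLaw θ₀, ∀ a ∈ D, Tendsto (fun n : ℕ => (1 / (n : ℝ)) *
        (M.logLik ε π₀ n (obs (seqShift ω)) a - M.logLik ε π₀ n (obs (seqShift ω)) θ₀)) atTop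
        (𝓝 (M.surface ε θ₀ x a)) :=
      (ae_ball_iff hDc).2 fun a _ => ae_seqShift (h.ae_tendsto_logLik hε hεK a.2 x π₀)
    filter_upwards [h1, ae_seqShift (h.ae_eventually_lipschitz hε hεK π₀), h.ae_good]
      with ω ha hb hg
    have := tendstoUniformly_of_dense_of_lipschitz (F := fun (n : ℕ) (a : M.Param) =>
      (1 / (n : ℝ)) * (M.logLik ε π₀ n (obs (seqShift ω)) a -
        M.logLik ε π₀ n (obs (seqShift ω)) θ₀)) (l := fun a => M.surface ε θ₀ x a) hDd
      h.lipConst_nonneg ?_ (fun a b => h.surface_lipschitz hε hεK x a.2 b.2) ha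
    · convert this using 3 with n
      exact h.relMeanLogLik_eq hε hεK hg π₀ n _
    · filter_upwards [hb] with n hn a b using hn a a.2 b b.2

/-- Existence of maximum likelihood estimators and convergence to the set of maximisers. -/
theorem ae_mle (h : M.Regular θ₀ c C K Λ e K₀) (hε : 0 < ε) (hεK : ε ≤ K₀) (x : X)
    (π₀ : Measure X) [IsProbabilityMeasure π₀] :
    ∀ᵐ ω ∂(M.stationaryLaw θ₀),
      (∀ n : ℕ, ∃ θ : M.Param, M.IsABCMLE ε π₀ n (fun k => (ω k).2) θ) ∧
      ∀ est : ℕ → M.Param,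
        (∀ n : ℕ, M.IsABCMLE ε π₀ n (fun k => (ω k).2) (est n)) →
        ∀ t : EuclideanSpace ℝ (Fin d),
          MapClusterPt t atTop (fun n => (est n : EuclideanSpace ℝ (Fin d))) →
            t ∈ M.maximisers (M.surface ε θ₀ x) := by
  have hμ := M.neZero_μ θ₀
  have hlim := h.isLimitSurface hε.le hεK x
  have hcomp : CompactSpace M.Param := isCompact_iff_compactSpace.1 M.isCompact_param
  filter_upwards [hlim.2.2 π₀ inferInstance, h.ae_good] with ω hω hg
  have hg' : ∀ k, M.Good e K₀ (obs ω (k + 1)) := fun k => hg (k + 1)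
  have hw := h.isWindow hε.le hεK hg'
  -- Positivity allows the likelihood to be maximised through its logarithm, which is Lipschitz on
  -- the compact parameter set.
  have hlik : ∀ n (θ : M.Param), 0 < M.abcLikelihood ε π₀ n (obs ω) θ ∧
      Real.log (M.abcLikelihood ε π₀ n (obs ω) θ) =
        M.logLik ε π₀ n (fun k => obs ω (k + 1)) θ := by
    intro n θ
    have := likelihood_eq h.model ε (fun k => (hg k).mem) (h.isWindow hε.le hεK hg) π₀ n θ
    rw [likelihood, if_neg hε.ne'] at this
    rw [this]
    exact ⟨(h.model.kernel θ θ.2).integral_chain_pos n (h.model.isWeight hw θ.2) π₀, rfl⟩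
  refine ⟨fun n => ?_, fun est hest t ht => ?_⟩
  · have hcont : Continuous fun θ : M.Param => M.logLik ε π₀ n (fun k => obs ω (k + 1)) θ := by
      refine LipschitzWith.continuous (K := ⟨Λ * (∑ k ∈ Finset.range n, (K + e (obs ω (k + 1)))),
        mul_nonneg h.model.lip_nonneg (h.model.sum_nonneg hw n)⟩)
        (LipschitzWith.of_dist_le_mul fun a b => ?_)
      rw [Real.dist_eq]
      exact h.logLik_lipschitz hε.le hεK hg' π₀ n a.2 b.2
    have : Nonempty M.Param := ⟨θ₀⟩
    obtain ⟨θ, -, hθ⟩ := isCompact_univ.exists_isMaxOn Set.univ_nonempty hcont.continuousOn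
    refine ⟨θ, fun θ' => ?_⟩
    have := hθ (Set.mem_univ θ')
    change M.logLik ε π₀ n (fun k => obs ω (k + 1)) θ' ≤
      M.logLik ε π₀ n (fun k => obs ω (k + 1)) θ at this
    rw [← (hlik n θ').2, ← (hlik n θ).2] at this
    exact (Real.log_le_log_iff (hlik n θ').1 (hlik n θ).1).1 this
  · have htP : t ∈ M.Param := by
      refine M.isCompact_param.isClosed.mem_of_mapClusterPt ht ?_
      exact Eventually.of_forall fun n => (est n).2
    refine ⟨htP, fun θ' hθ' => ?_⟩
    refine le_of_forall_pos_le_add fun δ hδ => ?_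
    rw [Metric.tendstoUniformly_iff] at hω
    have h1 := hω (δ / 4) (by positivity)
    set lc := lipConst θ₀ K Λ e with hlc
    have hlc0 : 0 ≤ lc := h.lipConst_nonneg
    have h2 := (mapClusterPt_iff_frequently.1 ht) (Metric.ball t (δ / (4 * (lc + 1))))
      (Metric.ball_mem_nhds _ (by positivity))
    -- One index suffices at which the estimate is close to `t` and uniform convergence holds. Three
    -- errors of size `δ / 4` arise: one at `θ'`, one at the estimate, and one from moving the
    -- estimate to `t`.
    obtain ⟨n, hn1, hn2⟩ := (h2.and_eventually h1).exists
    have h3 := hn2 (est n)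
    have h4 := hn2 ⟨θ', hθ'⟩
    have h5 : M.relMeanLogLik ε θ₀ π₀ n (fun k => (ω k).2) ⟨θ', hθ'⟩ ≤
        M.relMeanLogLik ε θ₀ π₀ n (fun k => (ω k).2) (est n) := by
      rw [relMeanLogLik, relMeanLogLik, likelihood, likelihood, likelihood, if_neg hε.ne',
        if_neg hε.ne', if_neg hε.ne']
      refine mul_le_mul_of_nonneg_left (sub_le_sub_right ?_ _) (by positivity)
      exact Real.log_le_log (hlik n _).1 (hest n ⟨θ', hθ'⟩)
    have h6 := h.surface_lipschitz hε.le hεK x (est n).2 htP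
    have h7 : lc * dist (est n : EuclideanSpace ℝ (Fin d)) t ≤ δ / 4 := by
      have : dist (est n : EuclideanSpace ℝ (Fin d)) t < δ / (4 * (lc + 1)) := hn1
      calc lc * dist (est n : EuclideanSpace ℝ (Fin d)) t ≤ (lc + 1) * (δ / (4 * (lc + 1))) := by
            gcongr; linarith
        _ = δ / 4 := by field_simp
    rw [Real.dist_eq, abs_lt] at h3 h4
    rw [abs_le] at h6
    linarith [h3.1, h3.2, h4.1, h4.2, h6.1, h6.2]

end Regular
end HMMFamily

/-! ### Likelihoods of blocks of observations -/

/-- Exponential bound for the number of occurrences of an event depending on `n` coordinates,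
along blocks of length `g + n` of a Markov chain. -/
lemma lintegral_prod_blocks_le {Z : Type*} [MeasurableSpace Z] (κ : Kernel Z Z) [IsMarkovKernel κ]
    [Inhabited Z]
    {B : Set (ℕ → Z)} (hB : MeasurableSet B) {n g : ℕ}
    (hdep : ∀ ω ω' : ℕ → Z, (∀ k < n, ω k = ω' k) → ω ∈ B → ω' ∈ B) {p : ℝ≥0∞} (a : ℝ≥0∞)
    (hp : ∀ z, markovFrom κ z (seqShift^[g] ⁻¹' B) ≤ p) (N : ℕ) (z : Z) :
    ∫⁻ ω, ∏ i ∈ Finset.range N, (1 + a * B.indicator 1 (seqShift^[i * (g + n) + g] ω))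
      ∂markovFrom κ z ≤ (1 + a * p) ^ N := by
  induction N generalizing z with
  | zero => simp
  | succ N ih =>
    set G : (ℕ → Z) → ℝ≥0∞ := fun ω =>
      ∏ i ∈ Finset.range N, (1 + a * B.indicator 1 (seqShift^[i * (g + n) + g] ω)) with hG
    have hGm : Measurable G := by
      refine Finset.measurable_fun_prod _ fun i _ => ?_
      have h1 : Measurable fun ω : ℕ → Z =>
          B.indicator (1 : (ℕ → Z) → ℝ≥0∞) (seqShift^[i * (g + n) + g] ω) :=
        (measurable_one.indicator hB).comp (measurable_seqShift_iterate _)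
      exact (h1.const_mul a).const_add 1
    set S : Set (ℕ → Z) := seqShift^[g] ⁻¹' B with hS
    have hSm : MeasurableSet S := measurable_seqShift_iterate _ hB
    -- The event uses `n` coordinates after a gap `g`, so it belongs to the past of time `g + n`. A
    -- finite past is continued by an arbitrary default value in order to express this.
    let ext : (Finset.Iic (g + n) → Z) → ℕ → Z := fun h k =>
      if hk : k ≤ g + n then h ⟨k, Finset.mem_Iic.2 hk⟩ else default
    have hext : Measurable ext := by
      refine measurable_pi_lambda _ fun k => ?_
      by_cases hk : k ≤ g + n
      · simp only [ext, dif_pos hk]; exact measurable_pi_apply _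
      · simp only [ext, dif_neg hk]; exact measurable_const
    have hSe : S = Preorder.frestrictLe (π := fun _ => Z) (g + n) ⁻¹' (ext ⁻¹' S) := by
      ext ω
      have key : ∀ k < n, seqShift^[g] ω k =
          seqShift^[g] (ext (Preorder.frestrictLe (π := fun _ => Z) (g + n) ω)) k := by
        intro k hk
        simp only [seqShift_iterate, ext, dif_pos (by omega : g + k ≤ g + n)]
        rfl
      exact ⟨fun h => hdep _ _ key h, fun h => hdep _ _ (fun k hk => (key k hk).symm) h⟩
    -- The first block is split off; the remaining factors are the functional `G` of the trajectory
    -- restarted at time `g + n`. The Markov property at that time separates the two.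
    have e : ∀ ω, ∏ i ∈ Finset.range (N + 1),
        (1 + a * B.indicator 1 (seqShift^[i * (g + n) + g] ω)) =
        G (seqShift^[g + n] ω) + a * S.indicator (fun ω => G (seqShift^[g + n] ω)) ω := by
      intro ω
      rw [Finset.prod_range_succ']
      have : ∏ i ∈ Finset.range N,
          (1 + a * B.indicator 1 (seqShift^[(i + 1) * (g + n) + g] ω)) =
          G (seqShift^[g + n] ω) := by
        refine Finset.prod_congr rfl fun i _ => ?_
        rw [← Function.iterate_add_apply]
        congr 4
        ring
      rw [this, mul_add, mul_one, zero_mul, zero_add]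
      congr 1
      by_cases hω : ω ∈ S
      · have hω' : seqShift^[g] ω ∈ B := hω
        rw [Set.indicator_of_mem hω, Set.indicator_of_mem hω', Pi.one_apply, mul_one, mul_comm]
      · have hω' : seqShift^[g] ω ∉ B := hω
        rw [Set.indicator_of_notMem hω, Set.indicator_of_notMem hω', mul_zero, mul_zero]
    simp_rw [e]
    have hGs : Measurable fun ω : ℕ → Z => G (seqShift^[g + n] ω) :=
      hGm.comp (measurable_seqShift_iterate _)
    rw [lintegral_add_left hGs, lintegral_const_mul _ (hGs.indicator hSm), lintegral_indicator hSm,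
      ← markovLaw_dirac, lintegral_seqShift κ _ _ hGm]
    have h0 := setLIntegral_seqShift κ (Measure.dirac z) (g + n) (hext hSm) hGm
    rw [← hSe] at h0
    rw [h0]
    set R : (ℕ → Z) → ℝ≥0∞ := fun ω => ∫⁻ ω', G ω' ∂markovFrom κ (ω (g + n)) with hR
    have h3 : ∀ ω, R ω ≤ (1 + a * p) ^ N := fun ω => ih (ω (g + n))
    clear_value R G S
    have h1 : ∫⁻ ω, R ω ∂markovLaw κ (Measure.dirac z) ≤ (1 + a * p) ^ N :=
      calc _ ≤ ∫⁻ _, (1 + a * p) ^ N ∂markovLaw κ (Measure.dirac z) := lintegral_mono h3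
        _ = _ := by rw [lintegral_const, measure_univ, mul_one]
    have h2 : ∫⁻ ω in S, R ω ∂markovLaw κ (Measure.dirac z) ≤ (1 + a * p) ^ N * p :=
      calc _ ≤ ∫⁻ _ in S, (1 + a * p) ^ N ∂markovLaw κ (Measure.dirac z) := lintegral_mono h3
        _ = (1 + a * p) ^ N * markovFrom κ z S := by rw [setLIntegral_const, markovLaw_dirac]
        _ ≤ _ := mul_le_mul_right (hp z) _
    calc _ ≤ (1 + a * p) ^ N + a * ((1 + a * p) ^ N * p) := by gcongr
      _ = _ := by ring

namespace HMMFamily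

variable {d m : ℕ} {X : Type*} [MeasurableSpace X] {M : HMMFamily d m X}

/-- The density of the first `n` observations after a hidden state `x`. -/
def obsLik (M : HMMFamily d m X) (θ : EuclideanSpace ℝ (Fin d)) (n : ℕ) (x : X)
    (y : Fin n → EuclideanSpace ℝ (Fin m)) : ℝ≥0∞ :=
  ∫⁻ z : Fin n → X, ∏ k : Fin n,
    (ENNReal.ofReal (M.q θ (Fin.cons (α := fun _ => X) x z k.castSucc) (z k)) *
      ENNReal.ofReal (M.obsDensity θ (y k) (z k))) ∂Measure.pi fun _ => M.μ

namespace Regular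

variable {θ₀ : M.Param} {c C K Λ K₀ ε : ℝ} {e : EuclideanSpace ℝ (Fin m) → ℝ} {n : ℕ} {x : X}
  {θ : EuclideanSpace ℝ (Fin d)} {y : ℕ → EuclideanSpace ℝ (Fin m)}

lemma measurable_obsLik_integrand (h : M.Regular θ₀ c C K Λ e K₀) (hθ : θ ∈ M.Param) (n : ℕ) :
    Measurable fun p : (X × (Fin n → EuclideanSpace ℝ (Fin m))) × (Fin n → X) => ∏ k : Fin n,
      (ENNReal.ofReal (M.q θ (Fin.cons (α := fun _ => X) p.1.1 p.2 k.castSucc) (p.2 k)) *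
      ENNReal.ofReal (M.obsDensity θ (p.1.2 k) (p.2 k))) := by
  refine Finset.measurable_fun_prod _ fun k _ => ?_
  have h0 : Measurable fun p : (X × (Fin n → EuclideanSpace ℝ (Fin m))) × (Fin n → X) =>
      (Fin.cons (α := fun _ => X) p.1.1 p.2 : Fin (n + 1) → X) :=
    measurable_fin_cons.comp ((measurable_fst.comp measurable_fst).prodMk measurable_snd)
  have h1 : Measurable fun p : (X × (Fin n → EuclideanSpace ℝ (Fin m))) × (Fin n → X) =>
      (Fin.cons (α := fun _ => X) p.1.1 p.2 : Fin (n + 1) → X) k.castSucc :=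
    (measurable_pi_apply _).comp h0
  have h2 : Measurable fun p : (X × (Fin n → EuclideanSpace ℝ (Fin m))) × (Fin n → X) => p.2 k :=
    (measurable_pi_apply k).comp measurable_snd
  have h3 : Measurable fun p : (X × (Fin n → EuclideanSpace ℝ (Fin m))) × (Fin n → X) =>
      p.1.2 k := (measurable_pi_apply k).comp (measurable_snd.comp measurable_fst)
  exact ((M.measurable_q θ hθ).comp (h1.prodMk h2)).ennreal_ofReal.mul
    ((h.model.meas θ hθ).comp (h3.prodMk h2)).ennreal_ofReal

lemma measurable_obsLik (h : M.Regular θ₀ c C K Λ e K₀) (hθ : θ ∈ M.Param) (n : ℕ) :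
    Measurable fun p : X × (Fin n → EuclideanSpace ℝ (Fin m)) => M.obsLik θ n p.1 p.2 :=
  (h.measurable_obsLik_integrand hθ n).lintegral_prod_right'

lemma measurable_obsLik_left (h : M.Regular θ₀ c C K Λ e K₀) (hθ : θ ∈ M.Param) (n : ℕ)
    (y : Fin n → EuclideanSpace ℝ (Fin m)) : Measurable fun x => M.obsLik θ n x y := by
  have h1 : Measurable fun x : X => (x, y) := measurable_prodMk_right
  have h2 := (h.measurable_obsLik hθ n).comp h1
  exact h2

lemma measurable_obsLik_right (h : M.Regular θ₀ c C K Λ e K₀) (hθ : θ ∈ M.Param) (n : ℕ)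
    (x : X) : Measurable (M.obsLik θ n x) := by
  have h1 : Measurable fun y : Fin n → EuclideanSpace ℝ (Fin m) => (x, y) :=
    measurable_prodMk_left
  have h2 := (h.measurable_obsLik hθ n).comp h1
  exact h2

lemma measurable_integral_obsLik (h : M.Regular θ₀ c C K Λ e K₀) (hθ : θ ∈ M.Param) (n : ℕ)
    (ρ : Measure X) [SFinite ρ] : Measurable fun y => ∫⁻ x, M.obsLik θ n x y ∂ρ :=
  (h.measurable_obsLik hθ n).lintegral_prod_left'

/-- The law of the observations after time `0`. -/
lemma map_obs_law (h : M.Regular θ₀ c C K Λ e K₀) (θ : M.Param) (n : ℕ)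
    (ρ : Measure (X × EuclideanSpace ℝ (Fin m))) [IsProbabilityMeasure ρ] :
    (M.law θ ρ).map (fun ω (i : Fin n) => obs ω (i + 1)) =
      (Measure.pi fun _ : Fin n => M.ν).withDensity
        (fun y => ∫⁻ x, M.obsLik θ n x y ∂ρ.fst) := by
  have hm : Measurable fun (ω : ℕ → X × EuclideanSpace ℝ (Fin m)) (i : Fin n) => obs ω (i + 1) :=
    measurable_pi_lambda _ fun i => measurable_obs _
  have hpr : IsProbabilityMeasure (M.law θ ρ) := by rw [law_eq]; infer_instance
  have hbox : ∀ s : Fin n → Set (EuclideanSpace ℝ (Fin m)), (∀ i, MeasurableSet (s i)) →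
      (M.law θ ρ).map (fun ω (i : Fin n) => obs ω (i + 1)) (Set.pi Set.univ s) =
      (Measure.pi fun _ : Fin n => M.ν).withDensity
        (fun y => ∫⁻ x, M.obsLik θ n x y ∂ρ.fst) (Set.pi Set.univ s) := by
    intro s hs
    have hsm : MeasurableSet (Set.pi Set.univ s) := MeasurableSet.univ_pi hs
    rw [Measure.map_apply hm hsm, withDensity_apply _ hsm]
    -- Observation `k` of the trajectory is coordinate `k - 1` of the data vector; later times are
    -- unconstrained.
    set D : ℕ → Set (EuclideanSpace ℝ (Fin m)) := fun k =>
      if hk : k - 1 < n then s ⟨k - 1, hk⟩ else Set.univ with hD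
    have hDm : ∀ k, MeasurableSet (D k) := by
      intro k
      simp only [hD]
      split_ifs
      · exact hs _
      · exact MeasurableSet.univ
    have hDs : ∀ k : Fin n, D (k + 1) = s k := by
      intro k
      simp [hD]
    have e1 : (fun (ω : ℕ → X × EuclideanSpace ℝ (Fin m)) (i : Fin n) => obs ω (i + 1)) ⁻¹'
        (Set.pi Set.univ s) = {ω | ∀ k ∈ Finset.Icc 1 n, (ω k).2 ∈ D k} := by
      ext ω
      simp only [Set.mem_preimage, Set.mem_pi, Set.mem_univ, true_imp_iff, Set.mem_ofPred_eq,
        Finset.mem_Icc]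
      constructor
      · intro hω k hk
        have := hω ⟨k - 1, by omega⟩
        rw [← hDs] at this
        have ek : (k - 1 + 1) = k := by omega
        simp only [ek, obs] at this
        exact this
      · intro hω i
        rw [← hDs]
        exact hω _ ⟨by omega, by omega⟩
    rw [e1, M.law_forall_mem θ ρ n hDm, lintegral_lintegral_swap]
    swap
    · exact ((h.measurable_obsLik θ.2 n).comp measurable_swap).aemeasurable
    refine lintegral_congr fun x => ?_
    rw [lchain_eq_lintegral_pi (M.measurable_q θ θ.2).ennreal_ofReal n
      fun k => Kernel.measurable_coe _ (hDm (k + 1))]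
    unfold obsLik
    have hcomp : Measurable fun p : (Fin n → EuclideanSpace ℝ (Fin m)) × (Fin n → X) =>
        ∏ k : Fin n,
        (ENNReal.ofReal (M.q θ (Fin.cons (α := fun _ => X) x p.2 k.castSucc) (p.2 k)) *
        ENNReal.ofReal (M.obsDensity θ (p.1 k) (p.2 k))) := by
      have h1 : Measurable fun p : (Fin n → EuclideanSpace ℝ (Fin m)) × (Fin n → X) =>
          ((x, p.1), p.2) :=
        (measurable_const.prodMk measurable_fst).prodMk measurable_snd
      have h2 := (h.measurable_obsLik_integrand θ.2 n).comp h1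
      exact h2
    rw [lintegral_lintegral_swap hcomp.aemeasurable]
    refine lintegral_congr fun z => ?_
    simp only [Finset.prod_mul_distrib]
    have hg : ∀ k : Fin n, Measurable fun y => ENNReal.ofReal (M.obsDensity θ y (z k)) := fun k =>
      ((h.model.meas θ θ.2).comp measurable_prodMk_right).ennreal_ofReal
    have hg' : Measurable fun y : Fin n → EuclideanSpace ℝ (Fin m) =>
        ∏ k : Fin n, ENNReal.ofReal (M.obsDensity θ (y k) (z k)) :=
      Finset.measurable_fun_prod _ fun k _ => (hg k).comp (measurable_pi_apply k)
    rw [lintegral_const_mul _ hg', Measure.restrict_pi_pi,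
      lintegral_pi_prod (fun k : Fin n => M.ν.restrict (s k)) hg]
    congr 1
    refine Finset.prod_congr rfl fun k _ => ?_
    rw [M.lintegral_obsDensity θ (z k) (hs k), hDs]
  refine ext_of_generate_finite _ generateFrom_pi.symm isPiSystem_pi ?_ ?_
  · rintro _ ⟨s, hs, rfl⟩
    exact hbox s fun i => hs i (Set.mem_univ i)
  · have := hbox (fun _ => Set.univ) fun _ => MeasurableSet.univ
    rwa [Set.pi_univ] at this

/-- The initial state enters only through the first transition, whose density changes by a factor of
at most `C / c`. -/
lemma obsLik_le (h : M.Regular θ₀ c C K Λ e K₀) (hθ : θ ∈ M.Param) (n : ℕ) (x x' : X)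
    (y : Fin n → EuclideanSpace ℝ (Fin m)) :
    M.obsLik θ n x' y ≤ ENNReal.ofReal (C / c) * M.obsLik θ n x y := by
  have hk := h.model.kernel θ hθ
  have hX : Nonempty X := ⟨x⟩
  have hcC := hk.lt_one_iff
  unfold obsLik
  rw [← lintegral_const_mul']
  swap
  · exact ENNReal.ofReal_ne_top
  refine lintegral_mono fun z => ?_
  cases n with
  | zero =>
    simp only [Finset.univ_eq_empty, Finset.prod_empty, mul_one]
    rw [ENNReal.one_le_ofReal]
    exact (one_le_div hk.pos).2 hcC
  | succ n =>
    simp only [Fin.prod_univ_succ, Fin.castSucc_zero, Fin.cons_zero, ← Fin.succ_castSucc,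
      Fin.cons_succ]
    simp only [← mul_assoc]
    gcongr
    rw [← ENNReal.ofReal_mul (div_nonneg (hk.pos.le.trans hcC) hk.pos.le)]
    refine ENNReal.ofReal_le_ofReal ((hk.ge _ _).trans ?_)
    rw [div_mul_eq_mul_div, le_div_iff₀ hk.pos]
    exact mul_le_mul_of_nonneg_left (hk.le _ _) (hk.pos.le.trans hcC)

lemma obsLik_eq (h : M.Regular θ₀ c C K Λ e K₀) (hK : 0 ≤ K₀)
    (hy : ∀ k, M.Good e K₀ (y k)) (hθ : θ ∈ M.Param)
    (n : ℕ) (x : X) : M.obsLik θ n x (fun i => y i) =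
      ENNReal.ofReal (Real.exp (logChain M.μ M.q M.obsDensity x n (M.windows 0 y) θ)) := by
  have hμ := M.neZero_μ θ₀
  have hk := h.model.kernel θ hθ
  have hw := h.isWindow (ε := 0) le_rfl hK hy
  have hW := h.model.isWeight hw hθ
  unfold logChain
  rw [Real.exp_log (h.model.chain_pos hw hθ n x), hk.ofReal_chain n hW x,
    lchain_eq_lintegral_pi (M.measurable_q θ hθ).ennreal_ofReal n
      fun k => (hW k).meas.ennreal_ofReal]
  have e1 : ∀ k x, winWeight M.obsDensity (M.windows 0 y) θ k x = M.obsDensity θ (y k) x := by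
    intro k x
    simp only [winWeight, windows, ballMeasure, if_true]
    exact integral_dirac _ _
  simp only [e1]
  rfl

/-- Change of measure from the stationary law to the law with another parameter. -/
lemma lintegral_exp_relLogChain_le (h : M.Regular θ₀ c C K Λ e K₀) (hK : 0 ≤ K₀) (θ : M.Param)
    (n : ℕ) (x : X) (y₀ : EuclideanSpace ℝ (Fin m))
    {Ψ : (ℕ → EuclideanSpace ℝ (Fin m)) → ℝ≥0∞} (hΨ : Measurable Ψ)
    (hdep : ∀ y y' : ℕ → EuclideanSpace ℝ (Fin m), (∀ k < n, y k = y' k) → Ψ y = Ψ y') :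
    ∫⁻ ω, ENNReal.ofReal (Real.exp (M.relLogChain 0 θ₀ x n θ ω)) * Ψ (obs ω)
        ∂M.stationaryLaw θ₀ ≤
      ENNReal.ofReal (C / c) *
        ∫⁻ ω, Ψ (obs (seqShift ω)) ∂markovFrom (M.jointKernel θ) (x, y₀) := by
  let ext : (Fin n → EuclideanSpace ℝ (Fin m)) → ℕ → EuclideanSpace ℝ (Fin m) := fun y k =>
    if hk : k < n then y ⟨k, hk⟩ else 0
  have hext : Measurable ext := by
    refine measurable_pi_lambda _ fun k => ?_
    by_cases hk : k < n
    · simp only [ext, dif_pos hk]; exact measurable_pi_apply _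
    · simp only [ext, dif_neg hk]; exact measurable_const
  have hΨe : ∀ y : ℕ → EuclideanSpace ℝ (Fin m), Ψ y = Ψ (ext fun i => y i) := by
    intro y
    refine hdep _ _ fun k hk => ?_
    simp [ext, hk]
  have hm : Measurable fun (ω : ℕ → X × EuclideanSpace ℝ (Fin m)) (i : Fin n) => obs ω (i + 1) :=
    measurable_pi_lambda _ fun i => measurable_obs _
  have hL1 : ∀ θ ∈ M.Param, Measurable (M.obsLik θ n x) := fun θ hθ =>
    h.measurable_obsLik_right hθ n x
  -- The exponential of the relative log likelihood is the ratio of the observation densities from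
  -- `x`, so the whole integrand is a function of `n` observations.
  set H : (Fin n → EuclideanSpace ℝ (Fin m)) → ℝ≥0∞ := fun y =>
    M.obsLik θ n x y / M.obsLik θ₀ n x y * Ψ (ext y) with hH
  have hHm : Measurable H := ((hL1 θ θ.2).div (hL1 θ₀ θ₀.2)).mul (hΨ.comp hext)
  have e1 : ∫⁻ ω, ENNReal.ofReal (Real.exp (M.relLogChain 0 θ₀ x n θ ω)) * Ψ (obs ω)
        ∂M.stationaryLaw θ₀ = ∫⁻ ω, H (fun i => obs ω i) ∂M.stationaryLaw θ₀ := by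
    refine lintegral_congr_ae ?_
    filter_upwards [h.ae_good] with ω hω
    simp only [hH]
    rw [h.obsLik_eq hK hω θ.2 n x, h.obsLik_eq hK hω θ₀.2 n x, ← hΨe,
      ← ENNReal.ofReal_div_of_pos (Real.exp_pos _), ← Real.exp_sub]
    rfl
  -- Stationarity moves the observations to times `1` to `n`, where their joint density is known.
  have e2 : ∫⁻ ω, H (fun i => obs ω i) ∂M.stationaryLaw θ₀ =
      ∫⁻ ω, H (fun i => obs ω (i + 1)) ∂M.stationaryLaw θ₀ := by
    have hp := measurePreserving_seqShift (M.jointKernel θ₀) (M.invariant_π θ₀)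
    have hm0 : Measurable fun ω : ℕ → X × EuclideanSpace ℝ (Fin m) =>
        H (fun i : Fin n => obs ω i) :=
      hHm.comp (measurable_pi_lambda _ fun i => measurable_obs _)
    exact (hp.lintegral_comp hm0).symm
  have e3 : ∫⁻ ω, H (fun i => obs ω (i + 1)) ∂M.stationaryLaw θ₀ =
      ∫⁻ y, (∫⁻ x', M.obsLik θ₀ n x' y ∂(M.π θ₀).fst) * H y ∂Measure.pi fun _ => M.ν := by
    rw [← lintegral_map hHm hm, stationaryLaw, h.map_obs_law θ₀ n (M.π θ₀),
      lintegral_withDensity_eq_lintegral_mul _ _ hHm]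
    · rfl
    · exact h.measurable_integral_obsLik θ₀.2 n _
  set H' : (Fin n → EuclideanSpace ℝ (Fin m)) → ℝ≥0∞ := fun y => Ψ (ext y) with hH'
  have hHm' : Measurable H' := hΨ.comp hext
  have e4 : ∫⁻ ω, Ψ (obs (seqShift ω)) ∂markovFrom (M.jointKernel θ) (x, y₀) =
      ∫⁻ y, M.obsLik θ n x y * Ψ (ext y) ∂Measure.pi fun _ => M.ν := by
    have h1 : ∀ ω : ℕ → X × EuclideanSpace ℝ (Fin m), Ψ (obs (seqShift ω)) =
        H' (fun i => obs ω (i + 1)) := fun ω => hΨe _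
    simp_rw [h1]
    rw [← markovLaw_dirac, ← law_eq,
      ← lintegral_map hHm' hm, h.map_obs_law θ n,
      lintegral_withDensity_eq_lintegral_mul _ _ hHm']
    · refine lintegral_congr fun y => ?_
      have hf : (Measure.dirac (x, y₀)).fst = Measure.dirac x := by
        rw [Measure.fst, Measure.map_dirac' measurable_fst]
      simp only [Pi.mul_apply]
      rw [hf, lintegral_dirac' _ (h.measurable_obsLik_left θ.2 n y)]
    · exact h.measurable_integral_obsLik θ.2 n _
  rw [e1, e2, e3, e4, ← lintegral_const_mul' _ _ ENNReal.ofReal_ne_top]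
  refine lintegral_mono fun y => ?_
  -- The stationary mixture of densities is at most `C / c` times the density from `x`, which
  -- cancels the denominator of the ratio.
  have h1 : ∫⁻ x', M.obsLik θ₀ n x' y ∂(M.π θ₀).fst ≤
      ENNReal.ofReal (C / c) * M.obsLik θ₀ n x y :=
    (lintegral_mono fun x' => h.obsLik_le θ₀.2 n x x' y).trans (by simp)
  simp only [hH]
  calc _ ≤ ENNReal.ofReal (C / c) * M.obsLik θ₀ n x y *
        (M.obsLik θ n x y / M.obsLik θ₀ n x y * Ψ (ext y)) := by gcongr
    _ = ENNReal.ofReal (C / c) * (M.obsLik θ₀ n x y * (M.obsLik θ n x y / M.obsLik θ₀ n x y) *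
        Ψ (ext y)) := by ring
    _ ≤ _ := by
      gcongr
      exact ENNReal.mul_div_le

end Regular

end HMMFamily

/-! ### Identifiability of the true parameter -/

/-- Jensen's inequality for the exponential, obtained by integrating `u + 1 ≤ exp u` at `u = f - log
b`. -/
lemma integral_le_log_of_lintegral_exp_le {Ω : Type*} [MeasurableSpace Ω] {P : Measure Ω}
    [IsProbabilityMeasure P] {f : Ω → ℝ} (hf : Integrable f P) {b : ℝ} (hb : 0 < b)
    (h : ∫⁻ ω, ENNReal.ofReal (Real.exp (f ω)) ∂P ≤ ENNReal.ofReal b) :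
    ∫ ω, f ω ∂P ≤ Real.log b := by
  have hm : AEStronglyMeasurable (fun ω => Real.exp (f ω)) P :=
    Real.continuous_exp.comp_aestronglyMeasurable hf.aestronglyMeasurable
  have h0 : 0 ≤ᵐ[P] fun ω => Real.exp (f ω) := Eventually.of_forall fun ω => (Real.exp_pos _).le
  have hi : Integrable (fun ω => Real.exp (f ω)) P := by
    refine ⟨hm, (hasFiniteIntegral_iff_ofReal h0).2 (h.trans_lt ENNReal.ofReal_lt_top)⟩
  have h1 : ∫ ω, Real.exp (f ω) ∂P ≤ b := by
    rw [integral_eq_lintegral_of_nonneg_ae h0 hm]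
    exact ENNReal.toReal_le_of_le_ofReal hb.le h
  have h2 : ∫ ω, f ω ∂P ≤ ∫ ω, (Real.exp (f ω) / b + (Real.log b - 1)) ∂P := by
    refine integral_mono hf ((hi.div_const b).add (integrable_const _)) fun ω => ?_
    have := Real.add_one_le_exp (f ω - Real.log b)
    rw [Real.exp_sub, Real.exp_log hb] at this
    dsimp only
    linarith
  rw [integral_add (hi.div_const b) (integrable_const _), integral_div, integral_const,
    probReal_univ, one_smul] at h2
  have h3 : (∫ ω, Real.exp (f ω) ∂P) / b ≤ 1 := (div_le_one hb).2 h1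
  linarith

/-- For small `s` the left side is of order `s * p`. With `s = (p' - p) / 2` one has `(1 + s) * p ≤
p + s < p'`, which is enough. -/
lemma exists_exp_sub_one_mul_lt {p p' : ℝ} (hp : 0 ≤ p) (hp1 : p' ≤ 1) (hpp : p < p') :
    ∃ s : ℝ, 0 < s ∧ Real.log (1 + (Real.exp s - 1) * p) < s * p' := by
  refine ⟨(p' - p) / 2, by linarith, ?_⟩
  set s := (p' - p) / 2 with hs
  have hs0 : 0 < s := by simp only [hs]; linarith
  have hs1 : s ≤ 1 := by simp only [hs]; linarith
  have h1 : Real.exp s - 1 ≤ s + s ^ 2 := by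
    have := Real.abs_exp_sub_one_sub_id_le (x := s) (by rw [abs_of_pos hs0]; exact hs1)
    linarith [(abs_le.1 this).2]
  have h0 : 0 ≤ Real.exp s - 1 := by linarith [Real.add_one_le_exp s]
  have h2 : Real.log (1 + (Real.exp s - 1) * p) ≤ (Real.exp s - 1) * p := by
    have := Real.log_le_sub_one_of_pos (x := 1 + (Real.exp s - 1) * p) (by positivity)
    linarith
  have h3 : (Real.exp s - 1) * p ≤ (s + s ^ 2) * p := mul_le_mul_of_nonneg_right h1 hp
  have h4 : s * (1 + s) * p < s * p' := by
    rw [mul_assoc]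
    refine mul_lt_mul_of_pos_left ?_ hs0
    have : s * p ≤ s := mul_le_of_le_one_right hs0.le (by linarith)
    simp only [hs] at this ⊢
    linarith
  linarith [h4, h3, h2, (by ring : (s + s ^ 2) * p = s * (1 + s) * p)]

/-- Distinct laws on sequences are separated by an event depending on finitely many coordinates. -/
lemma exists_cylinder_lt {Z : Type*} [MeasurableSpace Z] {P P' : Measure (ℕ → Z)}
    [IsProbabilityMeasure P] [IsProbabilityMeasure P'] (hne : P ≠ P') :
    ∃ (A : Set (ℕ → Z)) (n : ℕ), MeasurableSet A ∧
      (∀ y y' : ℕ → Z, (∀ k < n, y k = y' k) → y ∈ A → y' ∈ A) ∧ P.real A < P'.real A := by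
  have : ¬ ∀ (n : ℕ) (B : ℕ → Set Z), (∀ k, MeasurableSet (B k)) →
      P {ω | ∀ k ∈ Finset.range (n + 1), ω k ∈ B k} =
        P' {ω | ∀ k ∈ Finset.range (n + 1), ω k ∈ B k} := fun h => hne (ext_of_prod_cylinder h)
  push Not at this
  obtain ⟨n, B, hB, hn⟩ := this
  set A := {ω : ℕ → Z | ∀ k ∈ Finset.range (n + 1), ω k ∈ B k} with hA
  have hAm : MeasurableSet A := measurableSet_cylinder _ hB
  have hdep : ∀ y y' : ℕ → Z, (∀ k < n + 1, y k = y' k) → y ∈ A → y' ∈ A := by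
    intro y y' hy h k hk
    rw [← hy k (Finset.mem_range.1 hk)]
    exact h k hk
  have hn' : P.real A ≠ P'.real A := by
    intro h
    exact hn ((ENNReal.toReal_eq_toReal_iff' (measure_ne_top _ _) (measure_ne_top _ _)).1 h)
  rcases lt_or_gt_of_ne hn' with h | h
  · exact ⟨A, n + 1, hAm, hdep, h⟩
  · refine ⟨Aᶜ, n + 1, hAm.compl, fun y y' hy h hy' => h (hdep y' y (fun k hk => (hy k hk).symm) hy'),
      ?_⟩
    rw [probReal_compl_eq_one_sub hAm, probReal_compl_eq_one_sub hAm]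
    linarith

namespace HMMFamily

variable {d m : ℕ} {X : Type*} [MeasurableSpace X] {M : HMMFamily d m X}

lemma measurable_obs_seq :
    Measurable (obs : (ℕ → X × EuclideanSpace ℝ (Fin m)) → ℕ → EuclideanSpace ℝ (Fin m)) :=
  measurable_pi_lambda _ fun k => measurable_obs k

instance (θ : M.Param) : IsProbabilityMeasure (M.obsLaw θ) :=
  Measure.isProbabilityMeasure_map measurable_obs_seq.aemeasurable

lemma obsLaw_real {θ : M.Param} {A : Set (ℕ → EuclideanSpace ℝ (Fin m))} (hA : MeasurableSet A) :
    (M.obsLaw θ).real A = (M.stationaryLaw θ (obs ⁻¹' A)).toReal :=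
  congrArg ENNReal.toReal (Measure.map_apply measurable_obs_seq hA)

namespace Regular

variable {θ₀ : M.Param} {c C K Λ K₀ ε : ℝ} {e : EuclideanSpace ℝ (Fin m) → ℝ} {n : ℕ} {x : X}
  {θ : EuclideanSpace ℝ (Fin d)} {y : ℕ → EuclideanSpace ℝ (Fin m)}

/-- Bound for the mean relative log likelihood by the frequency of an event. -/
lemma meanLogChain_add_le (h : M.Regular θ₀ c C K Λ e K₀) (hK : 0 ≤ K₀) (θ : M.Param) (x : X)
    {A : Set (ℕ → EuclideanSpace ℝ (Fin m))} (hA : MeasurableSet A) {n g : ℕ}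
    (hdep : ∀ y y' : ℕ → EuclideanSpace ℝ (Fin m), (∀ k < n, y k = y' k) → y ∈ A → y' ∈ A)
    {p s : ℝ} (hp0 : 0 ≤ p) (hs : 0 ≤ s)
    (hp : ∀ z, markovFrom (M.jointKernel θ) z (seqShift^[g + 1] ⁻¹' (obs ⁻¹' A)) ≤
      ENNReal.ofReal p) (N : ℕ) :
    M.meanLogChain 0 θ₀ x (N * (g + 1 + n)) θ + N * (s * (M.obsLaw θ₀).real A) ≤
      Real.log (C / c) + N * Real.log (1 + (Real.exp s - 1) * p) := by
  have hk := h.model.kernel θ θ.2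
  have hX : Nonempty X := ⟨x⟩
  have hcC := hk.lt_one_iff
  have hC0 := hk.pos.trans_le hcC
  set L := g + 1 + n with hL
  have ha : 0 ≤ Real.exp s - 1 := by linarith [Real.add_one_le_exp s]
  set a := ENNReal.ofReal (Real.exp s - 1) with hadef
  -- Since `1 + (exp s - 1)` equals `exp s`, this product is the exponential of `s` times the number
  -- of blocks in which the event occurs. Each block consists of `g + 1` spare times and the `n`
  -- coordinates of the event.
  set Ψ : (ℕ → EuclideanSpace ℝ (Fin m)) → ℝ≥0∞ := fun y =>
    ∏ i ∈ Finset.range N, (1 + a * A.indicator 1 (seqShift^[i * L + g] y)) with hΨ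
  have hΨm : Measurable Ψ := by
    refine Finset.measurable_fun_prod _ fun i _ => ?_
    have h1 : Measurable fun y : ℕ → EuclideanSpace ℝ (Fin m) =>
        A.indicator (1 : (ℕ → EuclideanSpace ℝ (Fin m)) → ℝ≥0∞) (seqShift^[i * L + g] y) :=
      (measurable_one.indicator hA).comp (measurable_seqShift_iterate _)
    exact (h1.const_mul a).const_add 1
  have hΨd : ∀ y y' : ℕ → EuclideanSpace ℝ (Fin m), (∀ k < N * L, y k = y' k) → Ψ y = Ψ y' := by
    intro y y' hy
    refine Finset.prod_congr rfl fun i hi => ?_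
    have hiN : (i + 1) * L ≤ N * L := Nat.mul_le_mul_right _ (Finset.mem_range.1 hi)
    have hk : ∀ k < n, seqShift^[i * L + g] y k = seqShift^[i * L + g] y' k := by
      intro k hk
      rw [seqShift_iterate, seqShift_iterate]
      refine hy _ ?_
      rw [add_mul, one_mul] at hiN
      omega
    have : seqShift^[i * L + g] y ∈ A ↔ seqShift^[i * L + g] y' ∈ A :=
      ⟨hdep _ _ hk, hdep _ _ fun k hk' => (hk k hk').symm⟩
    by_cases h1 : seqShift^[i * L + g] y ∈ A
    · rw [Set.indicator_of_mem h1, Set.indicator_of_mem (this.1 h1), Pi.one_apply, Pi.one_apply]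
    · rw [Set.indicator_of_notMem h1, Set.indicator_of_notMem fun h2 => h1 (this.2 h2)]
  have y₀ : EuclideanSpace ℝ (Fin m) := 0
  have h1 := h.lintegral_exp_relLogChain_le hK θ (N * L) x y₀ hΨm hΨd
  -- The change of measure reads the observations from time one on, so for the chain the gap before
  -- each occurrence is `g + 1`.
  have h2 : ∫⁻ ω, Ψ (obs (seqShift ω)) ∂markovFrom (M.jointKernel θ) (x, y₀) ≤
      (1 + a * ENNReal.ofReal p) ^ N := by
    have hin : Inhabited (X × EuclideanSpace ℝ (Fin m)) := ⟨(x, y₀)⟩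
    have := lintegral_prod_blocks_le (M.jointKernel θ) (measurable_obs_seq hA) (n := n)
      (g := g + 1) (fun ω ω' hω hωA => hdep _ _ (fun k hk => by simp [obs, hω k hk]) hωA) a hp N
      (x, y₀)
    refine le_trans (le_of_eq ?_) this
    refine lintegral_congr fun ω => Finset.prod_congr rfl fun i _ => ?_
    have : seqShift^[i * L + g] (obs (seqShift ω)) =
        obs (seqShift^[i * (g + 1 + n) + (g + 1)] ω) := by
      funext k
      simp only [seqShift_iterate, obs, seqShift]
      congr 2
      simp only [hL]
      ring
    rw [this]
    rfl
  set F : (ℕ → X × EuclideanSpace ℝ (Fin m)) → ℝ := fun ω =>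
    ∑ i ∈ Finset.range N, s * A.indicator 1 (seqShift^[i * L + g] (obs ω)) with hF
  have hterm : ∀ k, Integrable (fun ω => s * A.indicator (1 : (ℕ → EuclideanSpace ℝ (Fin m)) → ℝ) (seqShift^[k] (obs ω)))
      (M.stationaryLaw θ₀) ∧ ∫ ω, s * A.indicator (1 : (ℕ → EuclideanSpace ℝ (Fin m)) → ℝ) (seqShift^[k] (obs ω))
        ∂M.stationaryLaw θ₀ = s * (M.obsLaw θ₀).real A := by
    intro k
    have hmp := (measurePreserving_seqShift (M.jointKernel θ₀) (M.invariant_π θ₀)).iterate k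
    have hBm : MeasurableSet (seqShift^[k] ⁻¹' (obs ⁻¹' A) :
        Set (ℕ → X × EuclideanSpace ℝ (Fin m))) :=
      measurable_seqShift_iterate k (measurable_obs_seq hA)
    have e1 : (fun ω : ℕ → X × EuclideanSpace ℝ (Fin m) =>
        A.indicator (1 : (ℕ → EuclideanSpace ℝ (Fin m)) → ℝ) (seqShift^[k] (obs ω))) =
        (seqShift^[k] ⁻¹' (obs ⁻¹' A)).indicator 1 := by
      funext ω
      have : seqShift^[k] (obs ω) = obs (seqShift^[k] ω) := by
        funext j
        simp [seqShift_iterate, obs]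
      rw [this]
      rfl
    have e2 : (M.stationaryLaw θ₀).real (seqShift^[k] ⁻¹' (obs ⁻¹' A)) = (M.obsLaw θ₀).real A := by
      rw [measureReal_def, obsLaw_real hA]
      congr 1
      exact hmp.measure_preimage (measurable_obs_seq hA).nullMeasurableSet
    constructor
    · refine Integrable.const_mul ?_ s
      rw [e1]
      exact (integrable_const 1).indicator hBm
    · rw [integral_const_mul, e1, integral_indicator_one hBm, e2]
  have hFi : Integrable F (M.stationaryLaw θ₀) := integrable_finsetSum _ fun i _ => (hterm _).1
  have hFv : ∫ ω, F ω ∂M.stationaryLaw θ₀ = N * (s * (M.obsLaw θ₀).real A) := by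
    simp only [hF]
    rw [integral_finsetSum _ fun i _ => (hterm _).1]
    simp [(hterm _).2]
  have hexp : ∀ ω, ENNReal.ofReal (Real.exp (F ω)) = Ψ (obs ω) := by
    intro ω
    simp only [hF, hΨ]
    rw [Real.exp_sum, ENNReal.ofReal_prod_of_nonneg fun i _ => (Real.exp_pos _).le]
    refine Finset.prod_congr rfl fun i _ => ?_
    by_cases hω : seqShift^[i * L + g] (obs ω) ∈ A
    · rw [Set.indicator_of_mem hω, Set.indicator_of_mem hω, Pi.one_apply, Pi.one_apply, mul_one,
        mul_one, hadef, ← ENNReal.ofReal_one, ← ENNReal.ofReal_add zero_le_one ha]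
      congr 1
      ring
    · rw [Set.indicator_of_notMem hω, Set.indicator_of_notMem hω]
      simp
  have hri := h.integrable_relLogChain le_rfl hK θ.2 (N * L) x
  have hb : (0 : ℝ) < 1 + (Real.exp s - 1) * p := by positivity
  -- Jensen is applied to the relative log likelihood plus `s` times the count. In the mean the
  -- count has the frequency of the true law; in the exponential moment only the other law matters.
  have hfin := integral_le_log_of_lintegral_exp_le (hri.add hFi)
    (b := C / c * (1 + (Real.exp s - 1) * p) ^ N) (mul_pos (div_pos hC0 hk.pos) (pow_pos hb _)) ?_
  · simp only [Pi.add_apply] at hfin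
    rw [integral_add hri hFi, hFv, Real.log_mul (div_pos hC0 hk.pos).ne' (pow_pos hb _).ne',
      Real.log_pow] at hfin
    exact hfin
  · calc _ = ∫⁻ ω, ENNReal.ofReal (Real.exp (M.relLogChain 0 θ₀ x (N * L) θ ω)) * Ψ (obs ω)
          ∂M.stationaryLaw θ₀ := by
          refine lintegral_congr fun ω => ?_
          rw [Pi.add_apply, Real.exp_add, ENNReal.ofReal_mul (Real.exp_pos _).le, hexp]
      _ ≤ _ := h1
      _ ≤ ENNReal.ofReal (C / c) * (1 + a * ENNReal.ofReal p) ^ N := mul_le_mul_right h2 _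
      _ = _ := by
          rw [ENNReal.ofReal_mul (div_pos hC0 hk.pos).le, ENNReal.ofReal_pow hb.le,
            ENNReal.ofReal_add zero_le_one (mul_nonneg ha hp0), ENNReal.ofReal_mul ha,
            ENNReal.ofReal_one]

lemma tendsto_meanLogChain_div (h : M.Regular θ₀ c C K Λ e K₀) (hε : 0 ≤ ε) (hεK : ε ≤ K₀)
    (hθ : θ ∈ M.Param) (x : X) :
    Tendsto (fun n : ℕ => (n : ℝ)⁻¹ * M.meanLogChain ε θ₀ x n θ) atTop
      (𝓝 (M.surface ε θ₀ x θ)) := by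
  have h1 := (h.tendsto_meanLogChain hε hεK hθ x).cesaro
  convert h1 using 2 with n
  rw [Finset.sum_range_sub (fun N => M.meanLogChain ε θ₀ x N θ), meanLogChain_zero, sub_zero]

/-- Identifiability: the exact surface is negative away from the true parameter. -/
theorem surface_zero_neg (h : M.Regular θ₀ c C K Λ e K₀) (hK : 0 ≤ K₀) (x : X) (θ : M.Param)
    (hne : M.obsLaw θ ≠ M.obsLaw θ₀) : M.surface 0 θ₀ x θ < 0 := by
  obtain ⟨A, n, hA, hdep, hlt⟩ := exists_cylinder_lt hne
  set p := (M.obsLaw θ).real A with hp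
  set p₀ := (M.obsLaw θ₀).real A with hp₀
  have hk := h.model.kernel θ θ.2
  obtain ⟨c', lam, hD⟩ := M.doeblin θ hk.pos hk.le
  have hη : Tendsto (fun n : ℕ => (1 - c') ^ n) atTop (𝓝 0) :=
    tendsto_pow_atTop_nhds_zero_of_lt_one (by linarith [hD.le_one]) (by linarith [hD.pos])
  -- After this gap the event has probability at most the midpoint of `p` and `p₀` from any starting
  -- state, still below its true frequency `p₀`.
  obtain ⟨g, hg⟩ := ((hη.comp (tendsto_add_atTop_nat 1)).eventually_lt_const
    (by linarith : 0 < (p₀ - p) / 2)).exists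
  simp only [Function.comp_apply] at hg
  obtain ⟨s, hs, hlog⟩ := exists_exp_sub_one_mul_lt (p := (p + p₀) / 2) (p' := p₀)
    (by have : 0 ≤ p := measureReal_nonneg
        have : 0 ≤ p₀ := measureReal_nonneg
        linarith) measureReal_le_one (by linarith)
  have hpz : ∀ z, markovFrom (M.jointKernel θ) z (seqShift^[g + 1] ⁻¹' (obs ⁻¹' A)) ≤
      ENNReal.ofReal ((p + p₀) / 2) := by
    intro z
    have h1 := hD.abs_sub_le (M.invariant_π θ) (g + 1) (measurable_obs_seq hA) z
    have h2 : (markovLaw (M.jointKernel θ) (M.π θ)).real (obs ⁻¹' A) = p := by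
      rw [hp, obsLaw_real hA]
      rfl
    rw [h2] at h1
    rw [← ENNReal.ofReal_toReal (measure_ne_top (markovFrom (M.jointKernel θ) z) _)]
    refine ENNReal.ofReal_le_ofReal ?_
    have := (abs_le.1 h1).2
    rw [measureReal_def] at this
    linarith
  set L := g + 1 + n with hL
  have hmain := h.meanLogChain_add_le hK θ x hA hdep (p := (p + p₀) / 2)
    (by have : 0 ≤ p := measureReal_nonneg
        have : 0 ≤ p₀ := measureReal_nonneg
        linarith) hs.le hpz
  set r := Real.log (1 + (Real.exp s - 1) * ((p + p₀) / 2)) with hr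
  have ht := (h.tendsto_meanLogChain_div le_rfl hK θ.2 x).comp
    (tendsto_id.atTop_mul_const' (show 0 < L by omega))
  have hb : Tendsto (fun N : ℕ => (L : ℝ)⁻¹ * ((N : ℝ)⁻¹ * Real.log (C / c) + (r - s * p₀))) atTop
      (𝓝 ((L : ℝ)⁻¹ * (0 * Real.log (C / c) + (r - s * p₀)))) :=
    (((tendsto_inv_atTop_nhds_zero_nat (𝕜 := ℝ)).mul_const _).add_const _).const_mul _
  -- Dividing by the total length `N * L` removes the constant `log (C / c)` in the limit and leaves
  -- `(r - s * p₀) / L`, negative by the choice of `s`.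
  have hle := le_of_tendsto_of_tendsto ht hb (by
    filter_upwards [eventually_gt_atTop 0] with N hN
    have hN' : (0 : ℝ) < N := Nat.cast_pos.2 hN
    have hL' : (0 : ℝ) < L := Nat.cast_pos.2 (by omega)
    have := hmain N
    simp only [Function.comp_apply, id, Nat.cast_mul, mul_inv]
    rw [mul_comm (N : ℝ)⁻¹, mul_assoc]
    refine mul_le_mul_of_nonneg_left ?_ (inv_pos.2 hL').le
    have e1 : (N : ℝ) * ((N : ℝ)⁻¹ * Real.log (C / c) + (r - s * p₀)) =
        Real.log (C / c) + N * r - N * (s * p₀) := by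
      field_simp
      ring
    rw [inv_mul_le_iff₀ hN', e1]
    linarith)
  refine hle.trans_lt ?_
  rw [zero_mul, zero_add]
  exact mul_neg_of_pos_of_neg (inv_pos.2 (Nat.cast_pos.2 (by omega))) (by linarith)

end Regular

end HMMFamily

/-! ### The surfaces as the tolerance vanishes -/

/-- Ratios of averages over small balls converge to the ratio of the densities. -/
lemma ae_tendsto_setLIntegral_div {β : Type*} [MetricSpace β] [MeasurableSpace β] [BorelSpace β]
    [SecondCountableTopology β] [HasBesicovitchCovering β] {m : Measure β} {f f₀ : β → ℝ≥0∞}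
    (hf : Measurable f) (hf₀ : Measurable f₀) (hi : ∫⁻ y, f y ∂m ≠ ∞) (hi₀ : ∫⁻ y, f₀ y ∂m ≠ ∞)
    (hpos : ∀ y, f₀ y ≠ 0) :
    ∀ᵐ y ∂m.withDensity f₀, Tendsto (fun r => (∫⁻ y' in Metric.closedBall y r, f y' ∂m) /
      ∫⁻ y' in Metric.closedBall y r, f₀ y' ∂m) (𝓝[>] 0) (𝓝 (f y / f₀ y)) := by
  have hfin : IsFiniteMeasure (m.withDensity f) := isFiniteMeasure_withDensity hi
  have hfin₀ : IsFiniteMeasure (m.withDensity f₀) := isFiniteMeasure_withDensity hi₀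
  -- The quotient of ball averages differentiates one measure with respect to another, so it
  -- suffices to exhibit the density of the first with respect to the second.
  have e1 : m.withDensity f = (m.withDensity f₀).withDensity (f / f₀) := by
    rw [← withDensity_mul _ hf₀ (hf.div hf₀)]
    refine withDensity_congr_ae ?_
    filter_upwards [ae_lt_top hf₀ hi₀] with y hy
    exact (ENNReal.mul_div_cancel (hpos y) hy.ne).symm
  have h1 := Besicovitch.ae_tendsto_rnDeriv (m.withDensity f) (m.withDensity f₀)
  have h2 : (m.withDensity f).rnDeriv (m.withDensity f₀) =ᵐ[m.withDensity f₀] f / f₀ := by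
    rw [e1]
    exact Measure.rnDeriv_withDensity _ (hf.div hf₀)
  filter_upwards [h1, h2] with y hy hy2
  rw [hy2] at hy
  simpa only [withDensity_apply _ Metric.isClosed_closedBall.measurableSet, Pi.div_apply] using hy

namespace HMMFamily

variable {d m : ℕ} {X : Type*} [MeasurableSpace X] {M : HMMFamily d m X}

/-- The density of the first `n` observations after a hidden state `x`, weighted by a function of
the hidden path. -/
def weightedLik (M : HMMFamily d m X) (θ : EuclideanSpace ℝ (Fin d)) (n : ℕ) (x : X)
    (h : (Fin n → X) → ℝ≥0∞) (y : Fin n → EuclideanSpace ℝ (Fin m)) : ℝ≥0∞ :=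
  ∫⁻ z : Fin n → X, h z * ∏ k : Fin n,
    (ENNReal.ofReal (M.q θ (Fin.cons (α := fun _ => X) x z k.castSucc) (z k)) *
      ENNReal.ofReal (M.obsDensity θ (y k) (z k))) ∂Measure.pi fun _ => M.μ

lemma weightedLik_one (θ : EuclideanSpace ℝ (Fin d)) (n : ℕ) (x : X)
    (y : Fin n → EuclideanSpace ℝ (Fin m)) :
    M.weightedLik θ n x (fun _ => 1) y = M.obsLik θ n x y := by
  simp only [weightedLik, obsLik, one_mul]

namespace Regular

variable {θ₀ : M.Param} {c C K Λ K₀ ε : ℝ} {e : EuclideanSpace ℝ (Fin m) → ℝ} {n : ℕ} {x : X}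
  {θ : EuclideanSpace ℝ (Fin d)} {y : ℕ → EuclideanSpace ℝ (Fin m)}

lemma measurable_lik_path (h : M.Regular θ₀ c C K Λ e K₀) (hθ : θ ∈ M.Param) (n : ℕ) (x : X) :
    Measurable fun p : (Fin n → EuclideanSpace ℝ (Fin m)) × (Fin n → X) => ∏ k : Fin n,
      (ENNReal.ofReal (M.q θ (Fin.cons (α := fun _ => X) x p.2 k.castSucc) (p.2 k)) *
      ENNReal.ofReal (M.obsDensity θ (p.1 k) (p.2 k))) := by
  have h1 : Measurable fun p : (Fin n → EuclideanSpace ℝ (Fin m)) × (Fin n → X) =>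
      ((x, p.1), p.2) :=
    (measurable_const.prodMk measurable_fst).prodMk measurable_snd
  have h2 := (h.measurable_obsLik_integrand hθ n).comp h1
  exact h2

lemma measurable_weightedLik (h : M.Regular θ₀ c C K Λ e K₀) (hθ : θ ∈ M.Param) (n : ℕ) (x : X)
    {w : (Fin n → X) → ℝ≥0∞} (hw : Measurable w) : Measurable (M.weightedLik θ n x w) := by
  have h1 : Measurable fun p : (Fin n → EuclideanSpace ℝ (Fin m)) × (Fin n → X) => w p.2 :=
    hw.comp measurable_snd
  have h2 := (h1.mul (h.measurable_lik_path hθ n x)).lintegral_prod_right' (ν := Measure.pi fun _ : Fin n => M.μ)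
  exact h2

lemma lintegral_obsLik (h : M.Regular θ₀ c C K Λ e K₀) (θ : M.Param) (n : ℕ) (x : X) :
    ∫⁻ y, M.obsLik θ n x y ∂(Measure.pi fun _ : Fin n => M.ν) = 1 := by
  have y₀ : EuclideanSpace ℝ (Fin m) := 0
  have h1 := h.map_obs_law θ n (Measure.dirac (x, y₀))
  have hf : (Measure.dirac (x, y₀)).fst = Measure.dirac x := by
    rw [Measure.fst, Measure.map_dirac' measurable_fst]
  have hm : Measurable fun (ω : ℕ → X × EuclideanSpace ℝ (Fin m)) (i : Fin n) => obs ω (i + 1) :=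
    measurable_pi_lambda _ fun i => measurable_obs _
  have hpr : IsProbabilityMeasure (M.law θ (Measure.dirac (x, y₀))) := by
    rw [law_eq]; infer_instance
  have h2 := congrArg (fun m => m Set.univ) h1
  rw [hf] at h2
  rw [Measure.map_apply hm MeasurableSet.univ, Set.preimage_univ, measure_univ,
    withDensity_apply _ MeasurableSet.univ, Measure.restrict_univ] at h2
  rw [h2]
  refine lintegral_congr fun y => ?_
  rw [lintegral_dirac' _ (h.measurable_obsLik_left θ.2 n y)]

lemma obsLik_pos (h : M.Regular θ₀ c C K Λ e K₀) (hθ : θ ∈ M.Param) (n : ℕ) (x : X)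
    (y : Fin n → EuclideanSpace ℝ (Fin m)) : M.obsLik θ n x y ≠ 0 := by
  have hμ := M.neZero_μ θ₀
  have hk := h.model.kernel θ hθ
  have hm : Measurable fun z : Fin n → X => ∏ k : Fin n,
      (ENNReal.ofReal (M.q θ (Fin.cons (α := fun _ => X) x z k.castSucc) (z k)) *
      ENNReal.ofReal (M.obsDensity θ (y k) (z k))) := by
    have h1 : Measurable fun z : Fin n → X => (y, z) := measurable_prodMk_left
    have h2 := (h.measurable_lik_path hθ n x).comp h1
    exact h2
  rw [obsLik, ← pos_iff_ne_zero, lintegral_pos_iff_support hm]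
  have : Function.support (fun z : Fin n → X => ∏ k : Fin n,
      (ENNReal.ofReal (M.q θ (Fin.cons (α := fun _ => X) x z k.castSucc) (z k)) *
      ENNReal.ofReal (M.obsDensity θ (y k) (z k)))) = Set.univ := by
    refine Set.eq_univ_of_forall fun z => ?_
    rw [Function.mem_support, Finset.prod_ne_zero_iff]
    intro k _
    exact mul_ne_zero (ENNReal.ofReal_pos.2 (hk.pos.trans_le (hk.le _ _))).ne'
      (ENNReal.ofReal_pos.2 (h.model.pos θ hθ _ _)).ne'
  rw [this, Measure.pi_univ]
  exact pos_iff_ne_zero.2 (Finset.prod_ne_zero_iff.2 fun k _ =>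
    (Measure.measure_univ_ne_zero.2 (NeZero.ne M.μ)))

/-- After a shift by one, the observations have a mixture of the densities from the various initial
states, all bounded by `C / c` times the one from `x`. Exceptional sets of the differentiation
theorem are thus null for the data. -/
lemma map_obs_absolutelyContinuous (h : M.Regular θ₀ c C K Λ e K₀) (n : ℕ) (x : X) :
    (M.stationaryLaw θ₀).map (fun ω (i : Fin n) => obs ω i) ≪
      (Measure.pi fun _ : Fin n => M.ν).withDensity (M.obsLik θ₀ n x) := by
  have hm : Measurable fun (ω : ℕ → X × EuclideanSpace ℝ (Fin m)) (i : Fin n) => obs ω i :=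
    measurable_pi_lambda _ fun i => measurable_obs _
  have hp := measurePreserving_seqShift (M.jointKernel θ₀) (M.invariant_π θ₀)
  have e1 : (M.stationaryLaw θ₀).map (fun ω (i : Fin n) => obs ω i) =
      (M.stationaryLaw θ₀).map (fun ω (i : Fin n) => obs ω (i + 1)) := by
    have h1 : (M.stationaryLaw θ₀).map seqShift = M.stationaryLaw θ₀ := hp.map_eq
    conv_lhs => rw [← h1]
    rw [Measure.map_map hm measurable_seqShift]
    rfl
  rw [e1, stationaryLaw, h.map_obs_law θ₀ n (M.π θ₀)]
  refine Measure.absolutelyContinuous_of_le_smul (c := ENNReal.ofReal (C / c)) ?_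
  rw [← withDensity_smul _ (h.measurable_obsLik_right θ₀.2 n x)]
  refine withDensity_mono (Eventually.of_forall fun y => ?_)
  calc _ ≤ ∫⁻ _, ENNReal.ofReal (C / c) * M.obsLik θ₀ n x y ∂(M.π θ₀).fst :=
        lintegral_mono fun x' => h.obsLik_le θ₀.2 n x x' y
    _ = _ := by rw [lintegral_const, measure_univ, mul_one]; rfl

/-- Ratios of likelihoods of small balls converge to the ratio of the densities. -/
lemma ae_tendsto_box (h : M.Regular θ₀ c C K Λ e K₀) (n : ℕ) (x : X)
    {f : (Fin n → EuclideanSpace ℝ (Fin m)) → ℝ≥0∞} (hf : Measurable f)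
    (hi : ∫⁻ y, f y ∂(Measure.pi fun _ : Fin n => M.ν) ≠ ∞) :
    ∀ᵐ ω ∂M.stationaryLaw θ₀, Tendsto (fun r =>
      (∫⁻ y in Set.pi Set.univ fun i : Fin n => Metric.closedBall (obs ω i) r, f y
        ∂(Measure.pi fun _ : Fin n => M.ν)) /
      ∫⁻ y in Set.pi Set.univ fun i : Fin n => Metric.closedBall (obs ω i) r, M.obsLik θ₀ n x y
        ∂(Measure.pi fun _ : Fin n => M.ν)) (𝓝[>] 0)
      (𝓝 (f (fun i => obs ω i) / M.obsLik θ₀ n x (fun i => obs ω i))) := by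
  have hm : Measurable fun (ω : ℕ → X × EuclideanSpace ℝ (Fin m)) (i : Fin n) => obs ω i :=
    measurable_pi_lambda _ fun i => measurable_obs _
  have h1 := ae_tendsto_setLIntegral_div hf (h.measurable_obsLik_right θ₀.2 n x) hi
    (by rw [h.lintegral_obsLik θ₀ n x]; exact ENNReal.one_ne_top) (h.obsLik_pos θ₀.2 n x)
  have h2 := ae_of_ae_map hm.aemeasurable ((h.map_obs_absolutelyContinuous n x).ae_le h1)
  filter_upwards [h2] with ω hω
  refine hω.congr' ?_
  filter_upwards [self_mem_nhdsWithin] with r hr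
  -- In the supremum norm a closed ball is the product of the windows of the same radius.
  rw [closedBall_pi _ (le_of_lt hr)]

lemma setLIntegral_weightedLik (h : M.Regular θ₀ c C K Λ e K₀) (hθ : θ ∈ M.Param) (hε : 0 < ε)
    (y : ℕ → EuclideanSpace ℝ (Fin m)) (n : ℕ) (x : X) {w : (Fin n → X) → ℝ≥0∞}
    (hw : Measurable w) :
    ∫⁻ y' in Set.pi Set.univ fun i : Fin n => Metric.closedBall (y i) ε, M.weightedLik θ n x w y'
      ∂(Measure.pi fun _ : Fin n => M.ν) =
    ∫⁻ p, ENNReal.ofReal (Real.exp (logPath M.q M.obsDensity n x θ p)) * w p.1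
      ∂((Measure.pi fun _ : Fin n => M.μ).prod (Measure.pi fun k : Fin n => M.windows ε y k)) := by
  have hk := h.model.kernel θ hθ
  have e1 : (Measure.pi fun k : Fin n => M.windows ε y k) = (Measure.pi fun _ : Fin n =>
      M.ν).restrict (Set.pi Set.univ fun i : Fin n => Metric.closedBall (y i) ε) := by
    rw [Measure.restrict_pi_pi]
    congr 1
    funext k
    simp only [windows, ballMeasure, if_neg hε.ne']
  have hm : Measurable fun p : (Fin n → X) × (Fin n → EuclideanSpace ℝ (Fin m)) =>
      ENNReal.ofReal (Real.exp (logPath M.q M.obsDensity n x θ p)) * w p.1 :=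
    (h.model.measurable_logPath hθ n x).exp.ennreal_ofReal.mul (hw.comp measurable_fst)
  rw [e1, lintegral_prod_symm' _ hm]
  refine lintegral_congr fun y' => lintegral_congr fun z => ?_
  rw [h.model.exp_logPath hθ, pathDensity, ENNReal.ofReal_prod_of_nonneg fun k _ => mul_nonneg
    (hk.pos.le.trans (hk.le _ _)) (h.model.pos θ hθ _ _).le, mul_comm]
  congr 1
  refine Finset.prod_congr rfl fun k _ => ?_
  rw [ENNReal.ofReal_mul (hk.pos.le.trans (hk.le _ _))]

lemma setLIntegral_obsLik (h : M.Regular θ₀ c C K Λ e K₀) (hθ : θ ∈ M.Param) (hε : 0 < ε)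
    (hεK : ε ≤ K₀) (hy : ∀ k, M.Good e K₀ (y k)) (n : ℕ) (x : X) :
    ∫⁻ y' in Set.pi Set.univ fun i : Fin n => Metric.closedBall (y i) ε, M.obsLik θ n x y'
      ∂(Measure.pi fun _ : Fin n => M.ν) =
    ENNReal.ofReal (Real.exp (logChain M.μ M.q M.obsDensity x n (M.windows ε y) θ)) := by
  have hμ := M.neZero_μ θ₀
  have hw := h.isWindow hε.le hεK hy
  have h1 := h.setLIntegral_weightedLik hθ hε y n x (w := fun _ => 1) measurable_const
  simp only [weightedLik_one, mul_one] at h1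
  rw [h1]
  simp only [h.model.exp_logPath hθ]
  rw [lintegral_pathDensity (h.model.kernel θ hθ) n (fun k => h.model.isObsWeight (hw k) hθ),
    logChain, Real.exp_log (h.model.chain_pos hw hθ n x)]
  rfl

/-- The tilted path measure is the posterior law of the hidden path and of observations confined to
the windows. This writes its averages as the ball quotients to which Besicovitch's theorem applies.
-/
lemma lintegral_tilted_logPath (h : M.Regular θ₀ c C K Λ e K₀) (hθ : θ ∈ M.Param) (hε : 0 < ε)
    (hεK : ε ≤ K₀) (hy : ∀ k, M.Good e K₀ (y k)) (n : ℕ) (x : X) {w : (Fin n → X) → ℝ≥0∞}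
    (hw : Measurable w) :
    ∫⁻ p, w p.1 ∂((Measure.pi fun _ : Fin n => M.μ).prod
      (Measure.pi fun k : Fin n => M.windows ε y k)).tilted (logPath M.q M.obsDensity n x θ) =
    (∫⁻ y' in Set.pi Set.univ fun i : Fin n => Metric.closedBall (y i) ε, M.weightedLik θ n x w y'
      ∂(Measure.pi fun _ : Fin n => M.ν)) /
    ∫⁻ y' in Set.pi Set.univ fun i : Fin n => Metric.closedBall (y i) ε, M.obsLik θ n x y'
      ∂(Measure.pi fun _ : Fin n => M.ν) := by
  have hμ := M.neZero_μ θ₀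
  have hwin := h.isWindow hε.le hεK hy
  have hm : Measurable fun p : (Fin n → X) × (Fin n → EuclideanSpace ℝ (Fin m)) =>
      ENNReal.ofReal (Real.exp (logPath M.q M.obsDensity n x θ p)) * w p.1 :=
    (h.model.measurable_logPath hθ n x).exp.ennreal_ofReal.mul (hw.comp measurable_fst)
  rw [h.setLIntegral_weightedLik hθ hε y n x hw, h.setLIntegral_obsLik hθ hε hεK hy n x,
    lintegral_tilted, h.model.logChain_eq hwin n x hθ, ENNReal.div_eq_inv_mul,
    ← lintegral_const_mul _ hm]
  have hpos : 0 < ∫ p, Real.exp (logPath M.q M.obsDensity n x θ p)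
      ∂((Measure.pi fun _ : Fin n => M.μ).prod (Measure.pi fun k : Fin n => M.windows ε y k)) := by
    rw [(h.model.integral_exp_logPath hwin hθ n x).2]
    exact h.model.chain_pos hwin hθ n x
  refine lintegral_congr fun p => ?_
  rw [Real.exp_log hpos, ENNReal.ofReal_div_of_pos hpos, ENNReal.div_eq_inv_mul, mul_assoc]

/-- Continuity at tolerance zero of the relative log likelihood. -/
lemma ae_tendsto_relLogChain (h : M.Regular θ₀ c C K Λ e K₀) (hK : 0 < K₀) (θ : M.Param)
    (n : ℕ) (x : X) : ∀ᵐ ω ∂M.stationaryLaw θ₀,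
      Tendsto (fun ε => M.relLogChain ε θ₀ x n θ ω) (𝓝[>] 0) (𝓝 (M.relLogChain 0 θ₀ x n θ ω)) := by
  have h1 := h.ae_tendsto_box n x (h.measurable_obsLik_right θ.2 n x)
    (by rw [h.lintegral_obsLik θ n x]; exact ENNReal.one_ne_top)
  filter_upwards [h1, h.ae_good] with ω hω hg
  rw [h.obsLik_eq hK.le hg θ.2, h.obsLik_eq hK.le hg θ₀.2,
    ← ENNReal.ofReal_div_of_pos (Real.exp_pos _), ← Real.exp_sub] at hω
  have h2 := (ENNReal.tendsto_toReal ENNReal.ofReal_ne_top).comp hω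
  rw [ENNReal.toReal_ofReal (Real.exp_pos _).le] at h2
  have h3 := (Real.continuousAt_log (Real.exp_pos _).ne').tendsto.comp h2
  rw [Real.log_exp] at h3
  refine h3.congr' ?_
  filter_upwards [Ioc_mem_nhdsGT hK] with ε hε
  simp only [Function.comp_apply]
  rw [h.setLIntegral_obsLik θ.2 hε.1 hε.2 hg, h.setLIntegral_obsLik θ₀.2 hε.1 hε.2 hg,
    ← ENNReal.ofReal_div_of_pos (Real.exp_pos _), ← Real.exp_sub,
    ENNReal.toReal_ofReal (Real.exp_pos _).le, Real.log_exp]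
  rfl

lemma tendsto_meanLogChain_zero (h : M.Regular θ₀ c C K Λ e K₀) (hK : 0 < K₀) (θ : M.Param)
    (n : ℕ) (x : X) :
    Tendsto (fun ε => M.meanLogChain ε θ₀ x n θ) (𝓝[>] 0) (𝓝 (M.meanLogChain 0 θ₀ x n θ)) := by
  refine tendsto_integral_filter_of_dominated_convergence
    (fun ω => Λ * boundSum K e n ω * dist (θ : EuclideanSpace ℝ (Fin d)) θ₀)
    (Eventually.of_forall fun ε => (h.measurable_relLogChain θ.2 n x).aestronglyMeasurable) ?_
    (((h.integrable_boundSum n).const_mul _).mul_const _) (h.ae_tendsto_relLogChain hK θ n x)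
  filter_upwards [Ioc_mem_nhdsGT hK] with ε hε
  filter_upwards [h.relLogChain_lipschitz hε.1.le hε.2 n x] with ω hω
  have := hω θ θ.2 θ₀ θ₀.2
  have e0 : M.relLogChain ε θ₀ x n θ₀ ω = 0 := sub_self _
  rwa [e0, sub_zero] at this

/-- The increment of finite means approximates the surface with an error uniform in the tolerance,
so the limits in length and in tolerance may be interchanged. -/
lemma tendsto_surface_zero (h : M.Regular θ₀ c C K Λ e K₀) (hK : 0 < K₀) (θ : M.Param) (x : X) :
    Tendsto (fun ε => M.surface ε θ₀ x θ) (𝓝[>] 0) (𝓝 (M.surface 0 θ₀ x θ)) := by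
  obtain ⟨δ, hδ, hs⟩ := h.exists_surface_approx
  rw [Metric.tendsto_nhds]
  intro η hη
  obtain ⟨N, hN⟩ := (hδ.eventually_lt_const (show 0 < η / 3 by positivity)).exists
  have h1 := (h.tendsto_meanLogChain_zero hK θ (N + 1) x).sub
    (h.tendsto_meanLogChain_zero hK θ N x)
  filter_upwards [Metric.tendsto_nhds.1 h1 (η / 3) (by positivity), Ioc_mem_nhdsGT hK] with ε h2 hε
  have h3 := ((hs ε hε.1.le hε.2 x).2 N).1 θ θ.2
  have h4 := ((hs 0 le_rfl hK.le x).2 N).1 θ θ.2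
  rw [Real.dist_eq] at h2 ⊢
  rw [abs_lt] at h2 ⊢
  rw [abs_le] at h3 h4
  constructor <;> linarith [h2.1, h2.2, h3.1, h3.2, h4.1, h4.2]

/-- Uniform convergence of the surfaces at tolerance zero. -/
theorem tendstoUniformlyOn_surface (h : M.Regular θ₀ c C K Λ e K₀) (hK : 0 < K₀) (x : X) :
    TendstoUniformlyOn (fun ε => M.surface ε θ₀ x) (M.surface 0 θ₀ x) (𝓝[>] 0) M.Param := by
  have hcomp : CompactSpace M.Param := isCompact_iff_compactSpace.1 M.isCompact_param
  rw [tendstoUniformlyOn_iff_tendstoUniformly_comp_coe]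
  refine tendstoUniformly_iff_seq_tendstoUniformly.2 fun u hu => ?_
  refine tendstoUniformly_of_dense_of_lipschitz (D := Set.univ) dense_univ h.lipConst_nonneg
    ?_ (fun a b => h.surface_lipschitz le_rfl hK.le x a.2 b.2)
    fun a _ => (h.tendsto_surface_zero hK a x).comp hu
  filter_upwards [hu (Ioc_mem_nhdsGT hK)] with j hj a b
  exact h.surface_lipschitz (le_of_lt hj.1) hj.2 x a.2 b.2

/-- The maximisers converge to the true parameter. -/
theorem tendsto_maximisers (h : M.Regular θ₀ c C K Λ e K₀) (hK : 0 < K₀) (x : X)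
    (hid : ∀ θ : M.Param, θ ≠ θ₀ → M.obsLaw θ ≠ M.obsLaw θ₀) {ρ : ℝ} (hρ : 0 < ρ) :
    ∀ᶠ ε in 𝓝[>] (0 : ℝ), ∀ t ∈ M.maximisers (M.surface ε θ₀ x),
      dist t (θ₀ : EuclideanSpace ℝ (Fin d)) < ρ := by
  have hcont : ContinuousOn (M.surface 0 θ₀ x) M.Param := (h.isLimitSurface le_rfl hK.le x).1
  have hc : IsCompact (M.Param \ Metric.ball (θ₀ : EuclideanSpace ℝ (Fin d)) ρ) :=
    M.isCompact_param.diff Metric.isOpen_ball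
  have hneg : ∀ t ∈ M.Param \ Metric.ball (θ₀ : EuclideanSpace ℝ (Fin d)) ρ,
      M.surface 0 θ₀ x t < 0 := by
    rintro t ⟨ht, htb⟩
    refine h.surface_zero_neg hK.le x ⟨t, ht⟩ (hid ⟨t, ht⟩ ?_)
    rintro rfl
    exact htb (Metric.mem_ball_self hρ)
  -- By compactness the exact surface is at most `-b` away from the true parameter. All surfaces
  -- vanish at the true parameter, so a maximiser has value at least zero; closeness within `b`
  -- rules out the complement of the ball.
  obtain ⟨b, hb, hS⟩ := hc.exists_forall_le' (hcont.mono Set.sdiff_subset).neg (a := 0)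
    fun t ht => neg_pos.2 (hneg t ht)
  filter_upwards [Metric.tendstoUniformlyOn_iff.1 (h.tendstoUniformlyOn_surface hK x) b
    hb] with ε hε t ht
  by_contra hcon
  have h1 := hS t ⟨ht.1, hcon⟩
  have h2 := hε t ht.1
  have h3 := ht.2 θ₀ θ₀.2
  rw [surface_self] at h3
  rw [Pi.neg_apply] at h1
  rw [Real.dist_eq] at h2
  linarith [(abs_lt.1 h2).1]

end Regular

end HMMFamily

/-! ### Second derivatives of logarithms of integrals -/

/-- The densities of the two tilted laws are within a factor `exp (2 * D)` of each other, one `D`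
coming from the exponents and the other from the normalising constants. -/
lemma abs_integral_tilted_sub_le {Ω : Type*} [MeasurableSpace Ω] {m : Measure Ω} [NeZero m]
    {L L' g : Ω → ℝ} (hL : Integrable (fun ω => Real.exp (L ω)) m)
    (hL' : Integrable (fun ω => Real.exp (L' ω)) m) {D B : ℝ} (hD : ∀ᵐ ω ∂m, |L ω - L' ω| ≤ D)
    (hg : ∀ᵐ ω ∂m, |g ω| ≤ B) (hgm : AEStronglyMeasurable g m) :
    |∫ ω, g ω ∂m.tilted L - ∫ ω, g ω ∂m.tilted L'| ≤ B * (Real.exp (2 * D) - 1) := by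
  have hZ := integral_exp_pos hL
  have hZ' := integral_exp_pos hL'
  set Z := ∫ ω, Real.exp (L ω) ∂m with hZd
  set Z' := ∫ ω, Real.exp (L' ω) ∂m with hZd'
  have hup : ∀ᵐ ω ∂m, Real.exp (L ω) ≤ Real.exp D * Real.exp (L' ω) ∧
      Real.exp (L' ω) ≤ Real.exp D * Real.exp (L ω) := by
    filter_upwards [hD] with ω hω
    rw [abs_le] at hω
    rw [← Real.exp_add, ← Real.exp_add, Real.exp_le_exp, Real.exp_le_exp]
    constructor <;> linarith
  have h1 : Z ≤ Real.exp D * Z' := by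
    rw [hZd, hZd', ← integral_const_mul]
    exact integral_mono_ae hL (hL'.const_mul _) (hup.mono fun ω h => h.1)
  have h2 : Z' ≤ Real.exp D * Z := by
    rw [hZd, hZd', ← integral_const_mul]
    exact integral_mono_ae hL' (hL.const_mul _) (hup.mono fun ω h => h.2)
  have hi : ∀ {L : Ω → ℝ}, Integrable (fun ω => Real.exp (L ω)) m →
      Integrable (fun ω => Real.exp (L ω) / (∫ ω, Real.exp (L ω) ∂m) * g ω) m := by
    intro L hL
    refine (hL.div_const _).mul_bdd (c := B) hgm ?_
    filter_upwards [hg] with ω hω using hω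
  have hne : ∃ ω, |L ω - L' ω| ≤ D ∧ |g ω| ≤ B := (hD.and hg).exists
  obtain ⟨ω₁, hω1, hω2⟩ := hne
  have hD0 : 0 ≤ D := (abs_nonneg _).trans hω1
  have hB0 : 0 ≤ B := (abs_nonneg _).trans hω2
  simp only [integral_tilted, smul_eq_mul]
  rw [← integral_sub (hi hL) (hi hL'), ← Real.norm_eq_abs]
  have hexp : Real.exp (2 * D) = Real.exp D * Real.exp D := by rw [← Real.exp_add]; ring_nf
  have key : ∀ᵐ ω ∂m, ‖Real.exp (L ω) / Z * g ω - Real.exp (L' ω) / Z' * g ω‖ ≤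
      B * (Real.exp (2 * D) - 1) * (Real.exp (L' ω) / Z') := by
    filter_upwards [hup, hg] with ω hω hgω
    rw [← sub_mul, norm_mul, Real.norm_eq_abs, Real.norm_eq_abs, mul_comm, mul_assoc]
    refine mul_le_mul hgω ?_ (abs_nonneg _) hB0
    have h3 : Real.exp (L ω) / Z ≤ Real.exp (2 * D) * (Real.exp (L' ω) / Z') := by
      rw [hexp, div_le_iff₀ hZ]
      have : Real.exp D * Real.exp D * (Real.exp (L' ω) / Z') * Z =
          (Real.exp D * Real.exp (L' ω)) * ((Real.exp D * Z) / Z') := by field_simp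
      rw [this]
      refine hω.1.trans (le_mul_of_one_le_right (by positivity) ?_)
      exact (one_le_div hZ').2 h2
    have h4 : Real.exp (L' ω) / Z' ≤ Real.exp (2 * D) * (Real.exp (L ω) / Z) := by
      rw [hexp, div_le_iff₀ hZ']
      have : Real.exp D * Real.exp D * (Real.exp (L ω) / Z) * Z' =
          (Real.exp D * Real.exp (L ω)) * ((Real.exp D * Z') / Z) := by field_simp
      rw [this]
      refine hω.2.trans (le_mul_of_one_le_right (by positivity) ?_)
      exact (one_le_div hZ).2 h1
    have he1 : 1 ≤ Real.exp (2 * D) := Real.one_le_exp (by positivity)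
    set s := Real.exp (L ω) / Z
    set s' := Real.exp (L' ω) / Z' with hs'
    have hs0 : 0 < s' := div_pos (Real.exp_pos _) hZ'
    rw [abs_le]
    constructor
    · rcases le_or_gt s' s with h5 | h5
      · have : 0 ≤ (Real.exp (2 * D) - 1) * s' := mul_nonneg (by linarith) hs0.le
        linarith
      · have : (Real.exp (2 * D) - 1) * s ≤ (Real.exp (2 * D) - 1) * s' :=
          mul_le_mul_of_nonneg_left h5.le (by linarith)
        linarith
    · linarith
  have h5 := norm_integral_le_of_norm_le ((hL'.div_const Z').const_mul _) key
  rw [integral_const_mul, integral_div, div_self hZ'.ne', mul_one] at h5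
  exact h5

namespace LogDensity

variable {E : Type*} [NormedAddCommGroup E] [NormedSpace ℝ E] [FiniteDimensional ℝ E]
  {Ω : Type*} [MeasurableSpace Ω]
  {m : Measure Ω} {U : Set E} {L : E → Ω → ℝ} {a b : ℝ} {W : Ω → ℝ} {θ : E}

/-- Continuity of the second derivative of the logarithm of a parametric integral. -/
lemma abs_fderiv2_log_sub_le (h : LogDensity m U L a b W) {θ' : E} (hθ : θ ∈ U) (hθ' : θ' ∈ U)
    {D G : ℝ} (hD : ∀ᵐ ω ∂m, |L θ ω - L θ' ω| ≤ D)
    (hG : ∀ᵐ ω ∂m, ‖fderiv ℝ (fun t => L t ω) θ - fderiv ℝ (fun t => L t ω) θ'‖ ≤ G) (v w : E) :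
    |fderiv2 (fun t => Real.log (∫ ω, Real.exp (L t ω) ∂m)) θ v w -
      fderiv2 (fun t => Real.log (∫ ω, Real.exp (L t ω) ∂m)) θ' v w| ≤
      ∫ ω, |fderiv2 (fun t => L t ω) θ v w - fderiv2 (fun t => L t ω) θ' v w| ∂m.tilted (L θ') +
        ((b + 3 * a ^ 2) * (Real.exp (2 * D) - 1) + 4 * a * G) * ‖v‖ * ‖w‖ := by
  have hne : NeZero m := ⟨h.ne_zero⟩
  have ha := h.nonneg_left hθ
  have hb := h.nonneg_right hθ
  have hp := h.isProbabilityMeasure_tilted hθ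
  have hp' := h.isProbabilityMeasure_tilted hθ'
  set κ := Real.exp (2 * D) - 1 with hκ
  have hac : m.tilted (L θ') ≪ m := tilted_absolutelyContinuous m (L θ')
  have hm1 : ∀ θ ∈ U, ∀ v, AEStronglyMeasurable (fun ω => fderiv ℝ (fun t => L t ω) θ v) m :=
    fun θ hθ v => (h.meas_fderiv hθ).apply_continuousLinearMap v
  have hm2 : ∀ θ ∈ U, AEStronglyMeasurable (fun ω => fderiv2 (fun t => L t ω) θ v w) m :=
    fun θ hθ => ((h.meas_fderiv2 hθ).apply_continuousLinearMap v).apply_continuousLinearMap w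
  have hb1 : ∀ θ ∈ U, ∀ v, ∀ᵐ ω ∂m, |fderiv ℝ (fun t => L t ω) θ v| ≤ a * ‖v‖ := by
    intro θ hθ v
    filter_upwards [h.ae] with ω hω
    exact (ContinuousLinearMap.le_opNorm _ _).trans
      (mul_le_mul_of_nonneg_right (hω θ hθ).2.1 (norm_nonneg _))
  have hb2 : ∀ θ ∈ U, ∀ᵐ ω ∂m, |fderiv2 (fun t => L t ω) θ v w| ≤ b * ‖v‖ * ‖w‖ := by
    intro θ hθ
    filter_upwards [h.ae] with ω hω
    refine (ContinuousLinearMap.le_opNorm₂ (fderiv2 (fun t => L t ω) θ) v w).trans ?_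
    have := (hω θ hθ).2.2.1
    gcongr
  have hGv : ∀ v, ∀ᵐ ω ∂m,
      |fderiv ℝ (fun t => L t ω) θ v - fderiv ℝ (fun t => L t ω) θ' v| ≤ G * ‖v‖ := by
    intro v
    filter_upwards [hG] with ω hω
    rw [← _root_.sub_apply]
    exact (ContinuousLinearMap.le_opNorm _ _).trans
      (mul_le_mul_of_nonneg_right hω (norm_nonneg _))
  have hint : ∀ {f : Ω → ℝ} {B : ℝ}, AEStronglyMeasurable f m → (∀ᵐ ω ∂m, |f ω| ≤ B) →
      Integrable f (m.tilted (L θ')) := fun hf hB =>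
    Integrable.of_bound (hf.mono_ac hac) _ (hac.ae_le hB)
  -- The measure is changed first, at cost `κ`, and then the integrand, at cost `G`. The second
  -- moments are treated in the same order.
  have hfirst : ∀ v, |∫ ω, fderiv ℝ (fun t => L t ω) θ v ∂m.tilted (L θ) -
      ∫ ω, fderiv ℝ (fun t => L t ω) θ' v ∂m.tilted (L θ')| ≤ (a * κ + G) * ‖v‖ := by
    intro v
    have h1 := abs_integral_tilted_sub_le (h.integrable_exp hθ) (h.integrable_exp hθ') hD
      (hb1 θ hθ v) (hm1 θ hθ v)
    have h2 : |∫ ω, fderiv ℝ (fun t => L t ω) θ v ∂m.tilted (L θ') -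
        ∫ ω, fderiv ℝ (fun t => L t ω) θ' v ∂m.tilted (L θ')| ≤ G * ‖v‖ := by
      rw [← integral_sub (hint (hm1 θ hθ v) (hb1 θ hθ v)) (hint (hm1 θ' hθ' v) (hb1 θ' hθ' v)),
        ← Real.norm_eq_abs]
      have h3 : ∀ᵐ ω ∂m.tilted (L θ'), ‖fderiv ℝ (fun t => L t ω) θ v -
          fderiv ℝ (fun t => L t ω) θ' v‖ ≤ G * ‖v‖ := hac.ae_le (hGv v)
      have := norm_integral_le_of_norm_le_const h3
      rwa [probReal_univ, mul_one] at this
    calc _ ≤ a * ‖v‖ * κ + G * ‖v‖ := (abs_sub_le _ _ _).trans (add_le_add h1 h2)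
      _ = _ := by ring
  have hmean : ∀ θ ∈ U, ∀ v, |∫ ω, fderiv ℝ (fun t => L t ω) θ v ∂m.tilted (L θ)| ≤ a * ‖v‖ := by
    intro θ hθ v
    rw [← h.fderiv_log_apply hθ]
    exact h.abs_fderiv_log_le hθ v
  have hprod : ∀ θ ∈ U, ∀ᵐ ω ∂m, |fderiv ℝ (fun t => L t ω) θ v *
      fderiv ℝ (fun t => L t ω) θ w| ≤ a ^ 2 * ‖v‖ * ‖w‖ := by
    intro θ hθ
    filter_upwards [hb1 θ hθ v, hb1 θ hθ w] with ω h1 h2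
    rw [abs_mul]
    calc _ ≤ (a * ‖v‖) * (a * ‖w‖) := mul_le_mul h1 h2 (abs_nonneg _) (by positivity)
      _ = _ := by ring
  have hF : ∀ θ ∈ U, AEStronglyMeasurable (fun ω => fderiv2 (fun t => L t ω) θ v w +
      fderiv ℝ (fun t => L t ω) θ v * fderiv ℝ (fun t => L t ω) θ w) m := fun θ hθ =>
    (hm2 θ hθ).add ((hm1 θ hθ v).mul (hm1 θ hθ w))
  have hFb : ∀ θ ∈ U, ∀ᵐ ω ∂m, |fderiv2 (fun t => L t ω) θ v w +
      fderiv ℝ (fun t => L t ω) θ v * fderiv ℝ (fun t => L t ω) θ w| ≤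
        (b + a ^ 2) * ‖v‖ * ‖w‖ := by
    intro θ hθ
    filter_upwards [hb2 θ hθ, hprod θ hθ] with ω h1 h2
    calc _ ≤ b * ‖v‖ * ‖w‖ + a ^ 2 * ‖v‖ * ‖w‖ := (abs_add_le _ _).trans (add_le_add h1 h2)
      _ = _ := by ring
  have hdm : AEStronglyMeasurable (fun ω =>
      |fderiv2 (fun t => L t ω) θ v w - fderiv2 (fun t => L t ω) θ' v w|) m :=
    ((hm2 θ hθ).sub (hm2 θ' hθ')).norm
  have hdi : Integrable (fun ω =>
      |fderiv2 (fun t => L t ω) θ v w - fderiv2 (fun t => L t ω) θ' v w|) (m.tilted (L θ')) :=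
    ((hint (hm2 θ hθ) (hb2 θ hθ)).sub (hint (hm2 θ' hθ') (hb2 θ' hθ'))).norm
  have hsecond : |∫ ω, (fderiv2 (fun t => L t ω) θ v w +
        fderiv ℝ (fun t => L t ω) θ v * fderiv ℝ (fun t => L t ω) θ w) ∂m.tilted (L θ) -
      ∫ ω, (fderiv2 (fun t => L t ω) θ' v w +
        fderiv ℝ (fun t => L t ω) θ' v * fderiv ℝ (fun t => L t ω) θ' w) ∂m.tilted (L θ')| ≤
      (b + a ^ 2) * ‖v‖ * ‖w‖ * κ + (∫ ω, |fderiv2 (fun t => L t ω) θ v w -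
        fderiv2 (fun t => L t ω) θ' v w| ∂m.tilted (L θ') + 2 * a * G * ‖v‖ * ‖w‖) := by
    refine (abs_sub_le _ _ _).trans (add_le_add (abs_integral_tilted_sub_le (h.integrable_exp hθ)
      (h.integrable_exp hθ') hD (hFb θ hθ) (hF θ hθ)) ?_)
    rw [← integral_sub (hint (hF θ hθ) (hFb θ hθ)) (hint (hF θ' hθ') (hFb θ' hθ')),
      ← Real.norm_eq_abs]
    have hc : ∫ _, 2 * a * G * ‖v‖ * ‖w‖ ∂m.tilted (L θ') = 2 * a * G * ‖v‖ * ‖w‖ := by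
      rw [integral_const, probReal_univ, one_smul]
    rw [← hc, ← integral_add hdi (integrable_const _)]
    refine norm_integral_le_of_norm_le (hdi.add (integrable_const _)) (hac.ae_le ?_)
    filter_upwards [hGv v, hGv w, hb1 θ hθ v, hb1 θ' hθ' w] with ω h1 h2 h3 h4
    set p := fderiv ℝ (fun t => L t ω) θ v
    set q := fderiv ℝ (fun t => L t ω) θ w
    set p' := fderiv ℝ (fun t => L t ω) θ' v
    set q' := fderiv ℝ (fun t => L t ω) θ' w
    set s := fderiv2 (fun t => L t ω) θ v w
    set s' := fderiv2 (fun t => L t ω) θ' v w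
    have e1 : s + p * q - (s' + p' * q') = (s - s') + (p * (q - q') + (p - p') * q') := by ring
    rw [Real.norm_eq_abs, e1]
    refine (abs_add_le _ _).trans (add_le_add le_rfl ((abs_add_le _ _).trans ?_))
    rw [abs_mul, abs_mul]
    have h5 : |p| * |q - q'| ≤ (a * ‖v‖) * (G * ‖w‖) :=
      mul_le_mul h3 h2 (abs_nonneg _) (by positivity)
    have h6 : |p - p'| * |q'| ≤ (G * ‖v‖) * (a * ‖w‖) :=
      mul_le_mul h1 h4 (abs_nonneg _) ((abs_nonneg _).trans h1)
    linarith
  rw [h.fderiv2_log_apply hθ, h.fderiv2_log_apply hθ']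
  have h1 := hfirst v
  have h2 := hfirst w
  have h3 := hmean θ hθ v
  have h4 := hmean θ' hθ' w
  set P := ∫ ω, fderiv ℝ (fun t => L t ω) θ v ∂m.tilted (L θ)
  set Q := ∫ ω, fderiv ℝ (fun t => L t ω) θ w ∂m.tilted (L θ)
  set P' := ∫ ω, fderiv ℝ (fun t => L t ω) θ' v ∂m.tilted (L θ')
  set Q' := ∫ ω, fderiv ℝ (fun t => L t ω) θ' w ∂m.tilted (L θ')
  have h5 : |P * Q - P' * Q'| ≤ 2 * a * (a * κ + G) * ‖v‖ * ‖w‖ := by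
    have e1 : P * Q - P' * Q' = P * (Q - Q') + (P - P') * Q' := by ring
    rw [e1]
    refine (abs_add_le _ _).trans ?_
    rw [abs_mul, abs_mul]
    have h6 : |P| * |Q - Q'| ≤ (a * ‖v‖) * ((a * κ + G) * ‖w‖) :=
      mul_le_mul h3 h2 (abs_nonneg _) (by positivity)
    have h7 : |P - P'| * |Q'| ≤ ((a * κ + G) * ‖v‖) * (a * ‖w‖) :=
      mul_le_mul h1 h4 (abs_nonneg _) ((abs_nonneg _).trans h1)
    linarith
  have h6 : ∀ s s' r r' : ℝ, |s - r - (s' - r')| ≤ |s - s'| + |r - r'| := by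
    intro s s' r r'
    have : s - r - (s' - r') = (s - s') - (r - r') := by ring
    rw [this]
    exact abs_sub _ _
  -- The mean part contributes `(b + a ^ 2) * κ + 2 * a * G`, the product of the means `2 * a * (a *
  -- κ + G)`.
  refine (h6 _ _ _ _).trans ((add_le_add hsecond h5).trans (le_of_eq ?_))
  ring

end LogDensity

/-- Continuous bilinear forms converging to zero at every pair of vectors converge to zero. -/
lemma tendsto_norm_zero_of_apply {E ι : Type*} [NormedAddCommGroup E] [NormedSpace ℝ E]
    [FiniteDimensional ℝ E] {F : Filter ι} {B : ι → E →L[ℝ] E →L[ℝ] ℝ}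
    (h : ∀ v w, Tendsto (fun i => B i v w) F (𝓝 0)) : Tendsto (fun i => ‖B i‖) F (𝓝 0) := by
  obtain ⟨C₁, hC1, h1⟩ := (Module.finBasis ℝ E).exists_opNorm_le (F := E →L[ℝ] ℝ)
  obtain ⟨C₂, hC2, h2⟩ := (Module.finBasis ℝ E).exists_opNorm_le (F := ℝ)
  have h3 : Tendsto (fun i => C₁ * (C₂ * ∑ k, ∑ l,
      |B i (Module.finBasis ℝ E k) (Module.finBasis ℝ E l)|)) F
      (𝓝 (C₁ * (C₂ * ∑ k : Fin (Module.finrank ℝ E), ∑ l : Fin (Module.finrank ℝ E), |(0 : ℝ)|))) :=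
    ((tendsto_finsetSum _ fun k _ => tendsto_finsetSum _ fun l _ =>
      (h _ _).abs).const_mul _).const_mul _
  simp only [abs_zero, Finset.sum_const_zero, mul_zero] at h3
  refine squeeze_zero (fun _ => norm_nonneg _) (fun i => ?_) h3
  have hs : 0 ≤ ∑ k, ∑ l, |B i (Module.finBasis ℝ E k) (Module.finBasis ℝ E l)| :=
    Finset.sum_nonneg fun _ _ => Finset.sum_nonneg fun _ _ => abs_nonneg _
  refine h1 (mul_nonneg hC2.le hs) fun k => h2 hs fun l => ?_
  refine (Finset.single_le_sum (f := fun l =>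
    |B i (Module.finBasis ℝ E k) (Module.finBasis ℝ E l)|) (fun _ _ => abs_nonneg _)
    (Finset.mem_univ l)).trans ?_
  exact Finset.single_le_sum (f := fun k => ∑ l,
    |B i (Module.finBasis ℝ E k) (Module.finBasis ℝ E l)|)
    (fun _ _ => Finset.sum_nonneg fun _ _ => abs_nonneg _) (Finset.mem_univ k)

lemma ContDiffAt.fderiv2_right {E : Type*} [NormedAddCommGroup E] [NormedSpace ℝ E]
    [FiniteDimensional ℝ E] {f : E → ℝ} {θ : E} (h : ContDiffAt ℝ 3 f θ) :
    ContDiffAt ℝ 1 (fderiv2 f) θ := by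
  have h1 : ContDiffAt ℝ 2 (fderiv ℝ f) θ := h.fderiv_right (by norm_num)
  exact h1.fderiv_right (by norm_num)

namespace HMMFamily

variable {d m : ℕ} {X : Type*} [MeasurableSpace X] {M : HMMFamily d m X}

/-- The variation between two parameters of the second derivative of the log density of a hidden
path. -/
def pathGap (M : HMMFamily d m X) (θ₀ : EuclideanSpace ℝ (Fin d)) (n : ℕ) (x : X)
    (v w z : EuclideanSpace ℝ (Fin d)) (p : Fin n → X) : ℝ :=
  ∑ k : Fin n, |fderiv2 (fun t => Real.log (M.q t (Fin.cons (α := fun _ => X) x p k.castSucc) (p k)))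
      z v w -
    fderiv2 (fun t => Real.log (M.q t (Fin.cons (α := fun _ => X) x p k.castSucc) (p k))) θ₀ v w|

lemma pathGap_nonneg (θ₀ : EuclideanSpace ℝ (Fin d)) (n : ℕ) (x : X)
    (v w z : EuclideanSpace ℝ (Fin d)) (p : Fin n → X) : 0 ≤ M.pathGap θ₀ n x v w z p :=
  Finset.sum_nonneg fun _ _ => abs_nonneg _

namespace Regular

variable {θ₀ : M.Param} {c C K Λ K₀ ε : ℝ} {e : EuclideanSpace ℝ (Fin m) → ℝ} {n : ℕ} {x : X}
  {θ : EuclideanSpace ℝ (Fin d)} {y : ℕ → EuclideanSpace ℝ (Fin m)}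
  {v w z : EuclideanSpace ℝ (Fin d)}

lemma measurable_pathGap (h : M.Regular θ₀ c C K Λ e K₀)
    (h0 : (θ₀ : EuclideanSpace ℝ (Fin d)) ∈ interior M.Param) (hz : z ∈ interior M.Param)
    (n : ℕ) (x : X) (v w : EuclideanSpace ℝ (Fin d)) : Measurable (M.pathGap θ₀ n x v w z) := by
  have hq : ∀ t ∈ interior M.Param, Measurable fun p : X × X =>
      fderiv2 (fun t => Real.log (M.q t p.1 p.2)) t v w := by
    intro t ht
    refine measurable_fderiv2_apply (f := fun t (p : X × X) => Real.log (M.q t p.1 p.2)) ?_ ?_ v w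
    · filter_upwards [isOpen_interior.mem_nhds ht] with s hs
      exact (M.measurable_q s (interior_subset hs)).log
    · filter_upwards [isOpen_interior.mem_nhds ht] with s hs p
      exact (h.model.log_q s (interior_subset hs) p.1 p.2).1
  refine Finset.measurable_fun_sum _ fun k _ => ?_
  have h1 : Measurable fun p : Fin n → X => (Fin.cons (α := fun _ => X) x p : Fin (n + 1) → X) :=
    measurable_fin_cons.comp (measurable_const.prodMk measurable_id)
  have h2 : Measurable fun p : Fin n → X =>
      ((Fin.cons (α := fun _ => X) x p : Fin (n + 1) → X) k.castSucc, p k) :=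
    ((measurable_pi_apply _).comp h1).prodMk (measurable_pi_apply k)
  have h3 := ((hq z hz).comp h2).sub ((hq θ₀ h0).comp h2)
  exact h3.abs

lemma pathGap_le (h : M.Regular θ₀ c C K Λ e K₀) (hz : z ∈ M.Param) (n : ℕ) (x : X)
    (v w : EuclideanSpace ℝ (Fin d)) (p : Fin n → X) :
    M.pathGap θ₀ n x v w z p ≤ n * (2 * K * ‖v‖ * ‖w‖) := by
  have h1 : ∀ t ∈ M.Param, ∀ x x', |fderiv2 (fun t => Real.log (M.q t x x')) t v w| ≤
      K * ‖v‖ * ‖w‖ := by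
    intro t ht x x'
    refine (ContinuousLinearMap.le_opNorm₂ (fderiv2 (fun t => Real.log (M.q t x x')) t) v w).trans ?_
    have := (h.model.log_q t ht x x').2.2
    gcongr
  have h2 : ∀ k ∈ (Finset.univ : Finset (Fin n)),
      |fderiv2 (fun t => Real.log (M.q t (Fin.cons (α := fun _ => X) x p k.castSucc) (p k))) z v w -
      fderiv2 (fun t => Real.log (M.q t (Fin.cons (α := fun _ => X) x p k.castSucc) (p k))) θ₀ v w| ≤
      2 * K * ‖v‖ * ‖w‖ := by
    intro k _
    refine (abs_sub _ _).trans ?_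
    linarith [h1 z hz (Fin.cons (α := fun _ => X) x p k.castSucc) (p k),
      h1 θ₀ θ₀.2 (Fin.cons (α := fun _ => X) x p k.castSucc) (p k)]
  refine (Finset.sum_le_card_nsmul _ _ _ h2).trans ?_
  simp

lemma tendsto_pathGap (h : M.Regular θ₀ c C K Λ e K₀) (n : ℕ) (x : X)
    (v w : EuclideanSpace ℝ (Fin d)) (p : Fin n → X) :
    Tendsto (fun z => M.pathGap θ₀ n x v w z p) (𝓝 (θ₀ : EuclideanSpace ℝ (Fin d))) (𝓝 0) := by
  have : Tendsto (fun z => M.pathGap θ₀ n x v w z p) (𝓝 (θ₀ : EuclideanSpace ℝ (Fin d)))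
      (𝓝 (∑ k : Fin n, |(0 : ℝ)|)) := by
    refine tendsto_finsetSum _ fun k _ => Tendsto.abs ?_
    have h1 := (h.model.log_q θ₀ θ₀.2 (Fin.cons (α := fun _ => X) x p k.castSucc)
      (p k)).1.continuousAt_fderiv2
    have h2 : Tendsto (fun z => fderiv2 (fun t =>
        Real.log (M.q t (Fin.cons (α := fun _ => X) x p k.castSucc) (p k))) z v w)
        (𝓝 (θ₀ : EuclideanSpace ℝ (Fin d))) (𝓝 (fderiv2 (fun t =>
        Real.log (M.q t (Fin.cons (α := fun _ => X) x p k.castSucc) (p k))) θ₀ v w)) :=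
      (h1.clm_apply continuousAt_const).clm_apply continuousAt_const
    simpa using h2.sub_const (fderiv2 (fun t =>
        Real.log (M.q t (Fin.cons (α := fun _ => X) x p k.castSucc) (p k))) θ₀ v w)
  simpa using this

/-- The posterior mean of the variation of the second derivatives vanishes, as the tolerance
vanishes and the parameters merge. -/
lemma ae_tendsto_lintegral_pathGap (h : M.Regular θ₀ c C K Λ e K₀) (hK : 0 < K₀)
    (h0 : (θ₀ : EuclideanSpace ℝ (Fin d)) ∈ interior M.Param) (n : ℕ) (x : X)
    (v w : EuclideanSpace ℝ (Fin d)) {ε : ℕ → ℝ} {z : ℕ → EuclideanSpace ℝ (Fin d)}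
    (hεj : ∀ j, 0 < ε j ∧ ε j ≤ K₀) (hε : Tendsto ε atTop (𝓝[>] 0))
    (hzj : ∀ j, z j ∈ interior M.Param) (hz : Tendsto z atTop (𝓝 (θ₀ : EuclideanSpace ℝ (Fin d)))) :
    ∀ᵐ ω ∂M.stationaryLaw θ₀, Tendsto (fun j =>
      ∫⁻ p, ENNReal.ofReal (M.pathGap θ₀ n x v w (z j) p.1)
        ∂((Measure.pi fun _ : Fin n => M.μ).prod
        (Measure.pi fun k : Fin n => M.windows (ε j) (obs ω) k)).tilted
          (logPath M.q M.obsDensity n x θ₀)) atTop (𝓝 0) := by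
  set W : ℕ → (Fin n → X) → ℝ≥0∞ := fun j p => ENNReal.ofReal (M.pathGap θ₀ n x v w (z j) p)
    with hW
  have hWm : ∀ j, Measurable (W j) := fun j =>
    (h.measurable_pathGap h0 (hzj j) n x v w).ennreal_ofReal
  -- Differentiation needs a weight independent of the radius, whereas the variation changes along
  -- the sequence. Tail suprema dominate all later terms, stay bounded and tend to zero at every
  -- path.
  set S : ℕ → (Fin n → X) → ℝ≥0∞ := fun i p => ⨆ j, W (i + j) p with hS
  have hSm : ∀ i, Measurable (S i) := fun i => Measurable.iSup fun j => hWm _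
  set B : ℝ≥0∞ := ENNReal.ofReal (n * (2 * K * ‖v‖ * ‖w‖)) with hB
  have hSB : ∀ i p, S i p ≤ B := fun i p => iSup_le fun j =>
    ENNReal.ofReal_le_ofReal (h.pathGap_le (interior_subset (hzj _)) n x v w p)
  have hS0 : ∀ p, Tendsto (fun i => S i p) atTop (𝓝 0) := by
    intro p
    have h1 : Tendsto (fun j => W j p) atTop (𝓝 0) := by
      have := (ENNReal.continuous_ofReal.tendsto 0).comp ((h.tendsto_pathGap n x v w p).comp hz)
      rwa [ENNReal.ofReal_zero] at this
    rw [ENNReal.tendsto_nhds_zero] at h1 ⊢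
    intro η hη
    obtain ⟨N, hN⟩ := eventually_atTop.1 (h1 η hη)
    filter_upwards [eventually_ge_atTop N] with i hi
    exact iSup_le fun j => hN _ (by omega)
  have hle : ∀ i y, M.weightedLik θ₀ n x (S i) y ≤ B * M.obsLik θ₀ n x y := by
    intro i y
    rw [obsLik, ← lintegral_const_mul' _ _ ENNReal.ofReal_ne_top]
    exact lintegral_mono fun p => mul_le_mul_left (hSB i p) _
  have hfin : ∀ i, ∫⁻ y, M.weightedLik θ₀ n x (S i) y ∂(Measure.pi fun _ : Fin n => M.ν) ≠ ∞ := by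
    intro i
    refine ne_top_of_le_ne_top ?_ (lintegral_mono (hle i))
    rw [lintegral_const_mul' _ _ ENNReal.ofReal_ne_top, h.lintegral_obsLik θ₀ n x, mul_one]
    exact ENNReal.ofReal_ne_top
  have hbox : ∀ᵐ ω ∂M.stationaryLaw θ₀, ∀ i, Tendsto (fun r =>
      (∫⁻ y in Set.pi Set.univ fun i : Fin n => Metric.closedBall (obs ω i) r,
        M.weightedLik θ₀ n x (S i) y ∂(Measure.pi fun _ : Fin n => M.ν)) /
      ∫⁻ y in Set.pi Set.univ fun i : Fin n => Metric.closedBall (obs ω i) r, M.obsLik θ₀ n x y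
        ∂(Measure.pi fun _ : Fin n => M.ν)) (𝓝[>] 0)
      (𝓝 (M.weightedLik θ₀ n x (S i) (fun i => obs ω i) / M.obsLik θ₀ n x (fun i => obs ω i))) :=
    ae_all_iff.2 fun i => h.ae_tendsto_box n x (h.measurable_weightedLik θ₀.2 n x (hSm i)) (hfin i)
  filter_upwards [hbox, h.ae_good] with ω hω hg
  set y : Fin n → EuclideanSpace ℝ (Fin m) := fun i => obs ω i with hy
  have hLfin : M.obsLik θ₀ n x y ≠ ∞ := by
    rw [hy, h.obsLik_eq hK.le hg θ₀.2]
    exact ENNReal.ofReal_ne_top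
  have hLpos := h.obsLik_pos θ₀.2 n x y
  have hlim : Tendsto (fun i => M.weightedLik θ₀ n x (S i) y) atTop (𝓝 0) := by
    have hm1 : Measurable fun p : Fin n → X => ∏ k : Fin n,
        (ENNReal.ofReal (M.q θ₀ (Fin.cons (α := fun _ => X) x p k.castSucc) (p k)) *
        ENNReal.ofReal (M.obsDensity θ₀ (y k) (p k))) := by
      have h1 : Measurable fun z : Fin n → X => (y, z) := measurable_prodMk_left
      have h2 := (h.measurable_lik_path θ₀.2 n x).comp h1
      exact h2
    have hfinprod : ∀ p : Fin n → X, (∏ k : Fin n,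
        (ENNReal.ofReal (M.q θ₀ (Fin.cons (α := fun _ => X) x p k.castSucc) (p k)) *
        ENNReal.ofReal (M.obsDensity θ₀ (y k) (p k)))) ≠ ∞ := fun p =>
      ENNReal.prod_ne_top fun k _ => ENNReal.mul_ne_top ENNReal.ofReal_ne_top ENNReal.ofReal_ne_top
    have := tendsto_lintegral_of_dominated_convergence
      (μ := Measure.pi fun _ : Fin n => M.μ)
      (F := fun i p => S i p * ∏ k : Fin n,
        (ENNReal.ofReal (M.q θ₀ (Fin.cons (α := fun _ => X) x p k.castSucc) (p k)) *
        ENNReal.ofReal (M.obsDensity θ₀ (y k) (p k)))) (f := fun _ => 0)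
      (fun p => B * ∏ k : Fin n,
        (ENNReal.ofReal (M.q θ₀ (Fin.cons (α := fun _ => X) x p k.castSucc) (p k)) *
        ENNReal.ofReal (M.obsDensity θ₀ (y k) (p k)))) (fun i => (hSm i).mul hm1)
      (fun i => Eventually.of_forall fun p => mul_le_mul_left (hSB i p) _)
      (by
        rw [lintegral_const_mul' _ _ ENNReal.ofReal_ne_top]
        exact ENNReal.mul_ne_top ENNReal.ofReal_ne_top hLfin)
      (Eventually.of_forall fun p => by
        have := ENNReal.Tendsto.mul_const (hS0 p) (Or.inr (hfinprod p))
        rwa [zero_mul] at this)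
    rw [lintegral_zero] at this
    exact this
  have hratio : Tendsto (fun i => M.weightedLik θ₀ n x (S i) y / M.obsLik θ₀ n x y) atTop
      (𝓝 0) := by
    have := ENNReal.Tendsto.div_const hlim (Or.inr hLpos)
    rwa [ENNReal.zero_div] at this
  rw [ENNReal.tendsto_nhds_zero]
  intro η hη
  -- First `i` is fixed so that the limiting posterior mean of the supremum is small; then the
  -- tolerance tends to zero with this weight held fixed.
  obtain ⟨i, hi⟩ := ((tendsto_order.1 hratio).2 η hη).exists
  have h1 := hε.eventually ((tendsto_order.1 (hω i)).2 η hi)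
  filter_upwards [h1, eventually_ge_atTop i] with j hj hij
  have h2 := h.lintegral_tilted_logPath θ₀.2 (hεj j).1 (hεj j).2 hg n x (hSm i)
  rw [← h2] at hj
  refine le_trans (lintegral_mono fun p => ?_) hj.le
  obtain ⟨l, rfl⟩ := Nat.exists_eq_add_of_le hij
  exact le_iSup (fun l => W (i + l) p.1) l

end Regular

end HMMFamily

/-! ### Equicontinuity of the Hessians -/

namespace HMMFamily

variable {d m : ℕ} {X : Type*} [MeasurableSpace X] {M : HMMFamily d m X}

namespace Regular

variable {θ₀ : M.Param} {c C K Λ K₀ ε : ℝ} {e : EuclideanSpace ℝ (Fin m) → ℝ} {n : ℕ} {x : X}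
  {θ : EuclideanSpace ℝ (Fin d)} {y : ℕ → EuclideanSpace ℝ (Fin m)}
  {v w z : EuclideanSpace ℝ (Fin d)}

/-- The second derivatives of the log densities of the observations are Lipschitz. -/
lemma norm_fderiv2_log_obsDensity_sub_le
    (hC3 : ∀ θ ∈ M.Param, ∀ y x, ContDiffAt ℝ 3 (fun t => Real.log (M.obsDensity t y x)) θ)
    {r : ℝ} (hball : Metric.ball (θ₀ : EuclideanSpace ℝ (Fin d)) r ⊆ M.Param)
    (hz : z ∈ Metric.ball (θ₀ : EuclideanSpace ℝ (Fin d)) r) {y y' : EuclideanSpace ℝ (Fin m)}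
    (hy : M.Good e K₀ y) (hy' : y' ∈ Metric.closedBall y K₀) (x : X) :
    ‖fderiv2 (fun t => Real.log (M.obsDensity t y' x)) z -
      fderiv2 (fun t => Real.log (M.obsDensity t y' x)) θ₀‖ ≤
        (M.supLogDeriv 3 K₀ y).toReal * dist z θ₀ := by
  have hr : 0 < r := (dist_nonneg).trans_lt hz
  rw [dist_eq_norm]
  refine (convex_ball (θ₀ : EuclideanSpace ℝ (Fin d)) r).norm_image_sub_le_of_norm_fderiv_le
    (𝕜 := ℝ) (f := fderiv2 fun t => Real.log (M.obsDensity t y' x)) (fun t ht => ?_) (fun t ht => ?_)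
    (Metric.mem_ball_self hr) hz
  · exact (hC3 t (hball ht) y' x).fderiv2_right.differentiableAt (by norm_num)
  · rw [← norm_iteratedFDeriv_three]
    refine M.norm_le_of_supLogDeriv_le (by norm_num) ENNReal.toReal_nonneg (hball ht) hy' ?_ x
    rw [ENNReal.ofReal_toReal hy.sup_three.ne]

lemma abs_fderiv2_logPath_sub_le (h : M.Regular θ₀ c C K Λ e K₀)
    (hC3 : ∀ θ ∈ M.Param, ∀ y x, ContDiffAt ℝ 3 (fun t => Real.log (M.obsDensity t y x)) θ)
    {r : ℝ} (hball : Metric.ball (θ₀ : EuclideanSpace ℝ (Fin d)) r ⊆ M.Param)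
    (hz : z ∈ Metric.ball (θ₀ : EuclideanSpace ℝ (Fin d)) r) (hε : 0 < ε) (hεK : ε ≤ K₀)
    (hy : ∀ k, M.Good e K₀ (y k)) (n : ℕ) (x : X) (v w : EuclideanSpace ℝ (Fin d)) :
    ∀ᵐ p ∂((Measure.pi fun _ : Fin n => M.μ).prod (Measure.pi fun k : Fin n => M.windows ε y k)),
      |fderiv2 (fun t => logPath M.q M.obsDensity n x t p) z v w -
        fderiv2 (fun t => logPath M.q M.obsDensity n x t p) θ₀ v w| ≤
        M.pathGap θ₀ n x v w z p.1 +
          (∑ k : Fin n, (M.supLogDeriv 3 K₀ (y k)).toReal) * dist z θ₀ * ‖v‖ * ‖w‖ := by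
  have hwin : ∀ k : Fin n, ∀ᵐ y' ∂M.windows ε y k, y' ∈ Metric.closedBall (y k) K₀ := by
    intro k
    simp only [windows, ballMeasure, if_neg hε.ne']
    filter_upwards [ae_restrict_mem Metric.isClosed_closedBall.measurableSet] with y' hy'
    exact Metric.closedBall_subset_closedBall hεK hy'
  filter_upwards [ae_prod_pi_of_forall (μ := M.μ) (n := n) hwin] with p hp
  have hcq : ∀ t ∈ M.Param, ∀ k : Fin n, ContDiffAt ℝ 2 (fun t =>
      Real.log (M.q t (Fin.cons (α := fun _ => X) x p.1 k.castSucc) (p.1 k))) t :=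
    fun t ht k => (h.model.log_q t ht _ _).1
  have hcg : ∀ t ∈ M.Param, ∀ k : Fin n, ContDiffAt ℝ 2 (fun t =>
      Real.log (M.obsDensity t (p.2 k) (p.1 k))) t := fun t ht k => h.model.log_γ t ht _ _
  have hsum : ∀ t ∈ M.Param, fderiv2 (fun t => logPath M.q M.obsDensity n x t p) t v w =
      ∑ k : Fin n, (fderiv2 (fun t =>
        Real.log (M.q t (Fin.cons (α := fun _ => X) x p.1 k.castSucc) (p.1 k))) t v w +
        fderiv2 (fun t => Real.log (M.obsDensity t (p.2 k) (p.1 k))) t v w) := by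
    intro t ht
    have e1 := fderiv2_sum (Finset.univ : Finset (Fin n)) (f := fun k t =>
      Real.log (M.q t (Fin.cons (α := fun _ => X) x p.1 k.castSucc) (p.1 k)) +
        Real.log (M.obsDensity t (p.2 k) (p.1 k))) (θ := t)
      fun k _ => (hcq t ht k).add (hcg t ht k)
    have e2 : (fun t => logPath M.q M.obsDensity n x t p) = fun t => ∑ k : Fin n,
      (Real.log (M.q t (Fin.cons (α := fun _ => X) x p.1 k.castSucc) (p.1 k)) +
        Real.log (M.obsDensity t (p.2 k) (p.1 k))) := rfl
    rw [e2, e1, _root_.sum_apply, _root_.sum_apply]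
    refine Finset.sum_congr rfl fun k _ => ?_
    rw [fderiv2_add (hcq t ht k) (hcg t ht k)]
    rfl
  rw [hsum z (hball hz), hsum θ₀ θ₀.2, ← Finset.sum_sub_distrib, pathGap, Finset.sum_mul,
    Finset.sum_mul, Finset.sum_mul, ← Finset.sum_add_distrib]
  refine (Finset.abs_sum_le_sum_abs _ _).trans (Finset.sum_le_sum fun k _ => ?_)
  rw [add_sub_add_comm]
  refine (abs_add_le _ _).trans (add_le_add le_rfl ?_)
  have h1 := norm_fderiv2_log_obsDensity_sub_le hC3 hball hz (hy k) (hp k) (p.1 k)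
  rw [← _root_.sub_apply, ← _root_.sub_apply]
  refine (ContinuousLinearMap.le_opNorm₂ (fderiv2 (fun t =>
    Real.log (M.obsDensity t (p.2 k) (p.1 k))) z - fderiv2 (fun t =>
    Real.log (M.obsDensity t (p.2 k) (p.1 k))) θ₀) v w).trans ?_
  gcongr

/-- The continuity estimate for logarithms of parametric integrals, with `Λ * a * dist z θ₀` for the
change of the log density and `a * dist z θ₀` for that of its gradient. Every term except the
posterior mean of `pathGap` is explicit in the distance. -/
lemma abs_fderiv2_logChain_sub_le (h : M.Regular θ₀ c C K Λ e K₀)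
    (hC3 : ∀ θ ∈ M.Param, ∀ y x, ContDiffAt ℝ 3 (fun t => Real.log (M.obsDensity t y x)) θ)
    {r : ℝ} (hball : Metric.ball (θ₀ : EuclideanSpace ℝ (Fin d)) r ⊆ M.Param)
    (hz : z ∈ Metric.ball (θ₀ : EuclideanSpace ℝ (Fin d)) r) (hε : 0 < ε) (hεK : ε ≤ K₀)
    (hy : ∀ k, M.Good e K₀ (y k)) (n : ℕ) (x : X) (v w : EuclideanSpace ℝ (Fin d)) {a : ℝ}
    (ha : ∑ k ∈ Finset.range n, (K + e (y k)) = a) :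
    |fderiv2 (fun t => logChain M.μ M.q M.obsDensity x n (M.windows ε y) t) z v w -
      fderiv2 (fun t => logChain M.μ M.q M.obsDensity x n (M.windows ε y) t) θ₀ v w| ≤
    (∫⁻ p, ENNReal.ofReal (M.pathGap θ₀ n x v w z p.1) ∂((Measure.pi fun _ : Fin n => M.μ).prod
      (Measure.pi fun k : Fin n => M.windows ε y k)).tilted
        (logPath M.q M.obsDensity n x θ₀)).toReal +
      ((∑ k : Fin n, (M.supLogDeriv 3 K₀ (y k)).toReal) * dist z θ₀ +
        ((a + 3 * a ^ 2) * (Real.exp (2 * (Λ * a * dist z θ₀)) - 1) +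
          4 * a * (a * dist z θ₀))) * ‖v‖ * ‖w‖ := by
  have hμ := M.neZero_μ θ₀
  have hr : 0 < r := (dist_nonneg).trans_lt hz
  have hint : Metric.ball (θ₀ : EuclideanSpace ℝ (Fin d)) r ⊆ interior M.Param :=
    interior_maximal hball Metric.isOpen_ball
  have h0 := hint (Metric.mem_ball_self hr)
  have hw := h.isWindow hε.le hεK hy
  obtain ⟨W, hW⟩ := h.model.logDensity hw n x
  rw [ha] at hW
  have ez := h.model.logChain_eventuallyEq hw n x (hint hz)
  have e0 := h.model.logChain_eventuallyEq hw n x h0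
  unfold fderiv2
  rw [ez.fderiv.fderiv_eq, e0.fderiv.fderiv_eq]
  set P := (Measure.pi fun _ : Fin n => M.μ).prod (Measure.pi fun k : Fin n => M.windows ε y k)
    with hP
  have hp := hW.isProbabilityMeasure_tilted h0
  have hD : ∀ᵐ p ∂P, |logPath M.q M.obsDensity n x z p - logPath M.q M.obsDensity n x θ₀ p| ≤
      Λ * a * dist z θ₀ := by
    filter_upwards [h.model.logPath_lipschitz hw n x] with p hp
    rw [← ha]
    exact hp z (hball hz) θ₀ θ₀.2
  have hG : ∀ᵐ p ∂P, ‖fderiv ℝ (fun t => logPath M.q M.obsDensity n x t p) z -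
      fderiv ℝ (fun t => logPath M.q M.obsDensity n x t p) θ₀‖ ≤ a * dist z θ₀ := by
    filter_upwards [hW.ae] with p hp
    rw [dist_eq_norm]
    refine (convex_ball (θ₀ : EuclideanSpace ℝ (Fin d)) r).norm_image_sub_le_of_norm_fderiv_le
      (𝕜 := ℝ) (f := fderiv ℝ fun t => logPath M.q M.obsDensity n x t p) (fun t ht => ?_)
      (fun t ht => (hp t (hint ht)).2.2.1) (Metric.mem_ball_self hr) hz
    exact (hp t (hint ht)).1.differentiableAt_fderiv
  have h1 := hW.abs_fderiv2_log_sub_le (hint hz) h0 hD hG v w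
  have hgap := h.abs_fderiv2_logPath_sub_le hC3 hball hz hε hεK hy n x v w
  have hac : P.tilted (logPath M.q M.obsDensity n x θ₀) ≪ P := tilted_absolutelyContinuous _ _
  have hgm : Measurable fun p : (Fin n → X) × (Fin n → EuclideanSpace ℝ (Fin m)) =>
      M.pathGap θ₀ n x v w z p.1 := (h.measurable_pathGap h0 (hint hz) n x v w).comp measurable_fst
  have hgi : Integrable (fun p : (Fin n → X) × (Fin n → EuclideanSpace ℝ (Fin m)) =>
      M.pathGap θ₀ n x v w z p.1) (P.tilted (logPath M.q M.obsDensity n x θ₀)) := by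
    refine Integrable.of_bound hgm.aestronglyMeasurable (n * (2 * K * ‖v‖ * ‖w‖))
      (Eventually.of_forall fun p => ?_)
    rw [Real.norm_eq_abs, abs_of_nonneg (pathGap_nonneg _ _ _ _ _ _ _)]
    exact h.pathGap_le (hball hz) n x v w p.1
  set R := (∑ k : Fin n, (M.supLogDeriv 3 K₀ (y k)).toReal) * dist z θ₀ * ‖v‖ * ‖w‖ with hR
  have h2 : ∫ p, |fderiv2 (fun t => logPath M.q M.obsDensity n x t p) z v w -
        fderiv2 (fun t => logPath M.q M.obsDensity n x t p) θ₀ v w|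
        ∂P.tilted (logPath M.q M.obsDensity n x θ₀) ≤
      ∫ p, (M.pathGap θ₀ n x v w z p.1 + R) ∂P.tilted (logPath M.q M.obsDensity n x θ₀) :=
    integral_mono_of_nonneg (Eventually.of_forall fun p => abs_nonneg _)
      (hgi.add (integrable_const _)) (hac.ae_le hgap)
  rw [integral_add hgi (integrable_const _), integral_const, probReal_univ, one_smul,
    integral_eq_lintegral_of_nonneg_ae (Eventually.of_forall fun p => pathGap_nonneg _ _ _ _ _ _ _)
      hgm.aestronglyMeasurable] at h2
  refine h1.trans ((add_le_add h2 le_rfl).trans (le_of_eq ?_))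
  rw [hR]
  ring

/-- Along sequences of tolerances and parameters, the variation of the second derivative of the
log likelihood vanishes. -/
lemma ae_tendsto_fderiv2_logChain (h : M.Regular θ₀ c C K Λ e K₀) (hK : 0 < K₀)
    (hC3 : ∀ θ ∈ M.Param, ∀ y x, ContDiffAt ℝ 3 (fun t => Real.log (M.obsDensity t y x)) θ)
    {r : ℝ} (hball : Metric.ball (θ₀ : EuclideanSpace ℝ (Fin d)) r ⊆ M.Param) (n : ℕ) (x : X)
    (v w : EuclideanSpace ℝ (Fin d)) {ε : ℕ → ℝ} {z : ℕ → EuclideanSpace ℝ (Fin d)}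
    (hεj : ∀ j, 0 < ε j ∧ ε j ≤ K₀) (hε : Tendsto ε atTop (𝓝[>] 0))
    (hzj : ∀ j, z j ∈ Metric.ball (θ₀ : EuclideanSpace ℝ (Fin d)) r)
    (hz : Tendsto z atTop (𝓝 (θ₀ : EuclideanSpace ℝ (Fin d)))) :
    ∀ᵐ ω ∂M.stationaryLaw θ₀, Tendsto (fun j =>
      fderiv2 (fun t => logChain M.μ M.q M.obsDensity x n (M.windows (ε j) (obs ω)) t) (z j) v w -
      fderiv2 (fun t => logChain M.μ M.q M.obsDensity x n (M.windows (ε j) (obs ω)) t) θ₀ v w)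
      atTop (𝓝 0) := by
  have hr : 0 < r := (dist_nonneg).trans_lt (hzj 0)
  have hint : Metric.ball (θ₀ : EuclideanSpace ℝ (Fin d)) r ⊆ interior M.Param :=
    interior_maximal hball Metric.isOpen_ball
  filter_upwards [h.ae_tendsto_lintegral_pathGap hK (hint (Metric.mem_ball_self hr)) n x v w hεj hε
    (fun j => hint (hzj j)) hz, h.ae_good] with ω hω hg
  set a := ∑ k ∈ Finset.range n, (K + e (obs ω k)) with ha
  set S := ∑ k : Fin n, (M.supLogDeriv 3 K₀ (obs ω k)).toReal
  have h1 := fun j => h.abs_fderiv2_logChain_sub_le hC3 hball (hzj j) (hεj j).1 (hεj j).2 hg n x v w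
    (a := a) rfl
  refine squeeze_zero_norm h1 ?_
  have hd : Tendsto (fun j => dist (z j) (θ₀ : EuclideanSpace ℝ (Fin d))) atTop (𝓝 0) :=
    tendsto_iff_dist_tendsto_zero.1 hz
  have h2 := (ENNReal.tendsto_toReal ENNReal.zero_ne_top).comp hω
  have hcont : Continuous fun s : ℝ => (S * s + ((a + 3 * a ^ 2) *
      (Real.exp (2 * (Λ * a * s)) - 1) + 4 * a * (a * s))) * ‖v‖ * ‖w‖ := by fun_prop
  have h3 := h2.add ((hcont.tendsto 0).comp hd)
  simpa using h3

/-- The exceptional set of trajectories depends on the chosen tolerances and parameters, so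
convergence is tested along sequences. The dominating function is the same for all of them. -/
lemma tendsto_fderiv2_meanLogChain (h : M.Regular θ₀ c C K Λ e K₀) (hK : 0 < K₀)
    (hC3 : ∀ θ ∈ M.Param, ∀ y x, ContDiffAt ℝ 3 (fun t => Real.log (M.obsDensity t y x)) θ)
    (h0 : (θ₀ : EuclideanSpace ℝ (Fin d)) ∈ interior M.Param) (n : ℕ) (x : X) :
    Tendsto (fun p : ℝ × EuclideanSpace ℝ (Fin d) => ‖fderiv2 (M.meanLogChain p.1 θ₀ x n) p.2 -
      fderiv2 (M.meanLogChain p.1 θ₀ x n) θ₀‖) (𝓝[>] 0 ×ˢ 𝓝 (θ₀ : EuclideanSpace ℝ (Fin d)))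
      (𝓝 0) := by
  obtain ⟨r, hr, hball⟩ := Metric.isOpen_iff.1 isOpen_interior _ h0
  refine tendsto_norm_zero_of_apply fun v w => tendsto_of_seq_tendsto fun u hu => ?_
  have hev : ∀ᶠ j in atTop, (0 < (u j).1 ∧ (u j).1 ≤ K₀) ∧
      (u j).2 ∈ Metric.ball (θ₀ : EuclideanSpace ℝ (Fin d)) r :=
    hu.eventually (prod_mem_prod (Ioc_mem_nhdsGT hK) (Metric.ball_mem_nhds _ hr))
  obtain ⟨J, hJ⟩ := eventually_atTop.1 hev
  -- Dropping finitely many terms puts all tolerances in the admissible range and all parameters in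
  -- the ball.
  rw [← tendsto_add_atTop_iff_nat J]
  have hu1 : Tendsto (fun j => (u (j + J)).1) atTop (𝓝[>] 0) :=
    (tendsto_fst.comp hu).comp (tendsto_add_atTop_nat J)
  have hu2 : Tendsto (fun j => (u (j + J)).2) atTop (𝓝 (θ₀ : EuclideanSpace ℝ (Fin d))) :=
    (tendsto_snd.comp hu).comp (tendsto_add_atTop_nat J)
  have hJ' := fun j => hJ (j + J) (by omega)
  have hae := h.ae_tendsto_fderiv2_logChain hK hC3 (hball.trans interior_subset) n x v w
    (fun j => (hJ' j).1) hu1 (fun j => (hJ' j).2) hu2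
  have hc := fun j => h.c2Dominated_relLogChain (hJ' j).1.1.le (hJ' j).1.2 n x
  have hi := fun j => (hc j).integrable_fderiv2 (hball (hJ' j).2)
  have hi0 := fun j => (hc j).integrable_fderiv2 h0
  have e1 : ∀ j, (fderiv2 (M.meanLogChain (u (j + J)).1 θ₀ x n) (u (j + J)).2 -
      fderiv2 (M.meanLogChain (u (j + J)).1 θ₀ x n) θ₀) v w =
      ∫ ω, (fderiv2 (fun t => M.relLogChain (u (j + J)).1 θ₀ x n t ω) (u (j + J)).2 v w -
        fderiv2 (fun t => M.relLogChain (u (j + J)).1 θ₀ x n t ω) θ₀ v w) ∂M.stationaryLaw θ₀ := by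
    intro j
    have e2 := (hc j).fderiv2_eq (hball (hJ' j).2)
    have e3 := (hc j).fderiv2_eq h0
    change fderiv2 (M.meanLogChain (u (j + J)).1 θ₀ x n) _ = _ at e2
    change fderiv2 (M.meanLogChain (u (j + J)).1 θ₀ x n) _ = _ at e3
    rw [_root_.sub_apply, _root_.sub_apply, e2, e3,
      ContinuousLinearMap.integral_apply (hi j),
      ContinuousLinearMap.integral_apply ((hi j).apply_continuousLinearMap v),
      ContinuousLinearMap.integral_apply (hi0 j),
      ContinuousLinearMap.integral_apply ((hi0 j).apply_continuousLinearMap v),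
      integral_sub (((hi j).apply_continuousLinearMap v).apply_continuousLinearMap w)
        (((hi0 j).apply_continuousLinearMap v).apply_continuousLinearMap w)]
  refine Tendsto.congr (fun j => (e1 j).symm) ?_
  rw [← integral_zero (ℕ → X × EuclideanSpace ℝ (Fin m)) ℝ (μ := M.stationaryLaw θ₀)]
  refine tendsto_integral_of_dominated_convergence
    (fun ω => 2 * ((Λ * Metric.diam M.Param + 1) * boundSum K e n ω + 2 * boundSum K e n ω ^ 2) *
      ‖v‖ * ‖w‖) (fun j => ?_) ?_ (fun j => ?_) ?_
  · exact (((hi j).apply_continuousLinearMap v).apply_continuousLinearMap w).aestronglyMeasurable.sub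
      (((hi0 j).apply_continuousLinearMap v).apply_continuousLinearMap w).aestronglyMeasurable
  · exact (((hc 0).int_bound.const_mul 2).mul_const _).mul_const _
  · filter_upwards [(hc j).ae] with ω hω
    have h1 := (hω _ (hball (hJ' j).2)).2.2.2
    have h2 := (hω _ h0).2.2.2
    rw [← _root_.sub_apply, ← _root_.sub_apply]
    refine (ContinuousLinearMap.le_opNorm₂ (fderiv2 (fun t => M.relLogChain (u (j + J)).1 θ₀ x n t ω)
      (u (j + J)).2 - fderiv2 (fun t => M.relLogChain (u (j + J)).1 θ₀ x n t ω) θ₀) v w).trans ?_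
    gcongr
    refine (norm_sub_le _ _).trans ?_
    linarith
  · filter_upwards [hae] with ω hω
    simp only [relLogChain, fderiv2_sub_const]
    exact hω

/-- Equicontinuity at the true parameter of the Hessians of the surfaces, as the tolerance
vanishes. -/
theorem tendsto_fderiv2_surface (h : M.Regular θ₀ c C K Λ e K₀) (hK : 0 < K₀)
    (hC3 : ∀ θ ∈ M.Param, ∀ y x, ContDiffAt ℝ 3 (fun t => Real.log (M.obsDensity t y x)) θ)
    (h0 : (θ₀ : EuclideanSpace ℝ (Fin d)) ∈ interior M.Param) (x : X) :
    Tendsto (fun p : ℝ × EuclideanSpace ℝ (Fin d) => ‖fderiv2 (M.surface p.1 θ₀ x) p.2 -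
      fderiv2 (M.surface p.1 θ₀ x) θ₀‖) (𝓝[>] 0 ×ˢ 𝓝 (θ₀ : EuclideanSpace ℝ (Fin d)))
      (𝓝 0) := by
  obtain ⟨δ, hδ, hs⟩ := h.exists_surface_approx
  rw [Metric.tendsto_nhds]
  intro η hη
  obtain ⟨N, hN⟩ := (hδ.eventually_lt_const (show 0 < η / 4 by positivity)).exists
  have h1 := (h.tendsto_fderiv2_meanLogChain hK hC3 h0 (N + 1) x).eventually
    (gt_mem_nhds (show 0 < η / 4 by positivity))
  have h2 := (h.tendsto_fderiv2_meanLogChain hK hC3 h0 N x).eventually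
    (gt_mem_nhds (show 0 < η / 4 by positivity))
  have h3 : ∀ᶠ p : ℝ × EuclideanSpace ℝ (Fin d) in
      𝓝[>] 0 ×ˢ 𝓝 (θ₀ : EuclideanSpace ℝ (Fin d)), (0 < p.1 ∧ p.1 ≤ K₀) ∧ p.2 ∈ interior M.Param :=
    prod_mem_prod (Ioc_mem_nhdsGT hK) (isOpen_interior.mem_nhds h0)
  filter_upwards [h1, h2, h3] with p hp1 hp2 hp3
  have h4 := ((hs p.1 hp3.1.1.le hp3.1.2 x).2 N).2 p.2 hp3.2
  have h5 := ((hs p.1 hp3.1.1.le hp3.1.2 x).2 N).2 θ₀ h0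
  rw [Real.dist_eq, sub_zero, abs_norm]
  set A := fderiv2 (M.surface p.1 θ₀ x) p.2
  set A₀ := fderiv2 (M.surface p.1 θ₀ x) θ₀
  set B := fderiv2 (M.meanLogChain p.1 θ₀ x (N + 1)) p.2
  set B₀ := fderiv2 (M.meanLogChain p.1 θ₀ x (N + 1)) θ₀
  set D := fderiv2 (M.meanLogChain p.1 θ₀ x N) p.2
  set D₀ := fderiv2 (M.meanLogChain p.1 θ₀ x N) θ₀
  -- Two approximation errors, at the moving parameter and at the true one, and two variations of
  -- finite-length Hessians, each below `η / 4`.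
  have e1 : A - A₀ = (A - (B - D)) - (A₀ - (B₀ - D₀)) + ((B - B₀) - (D - D₀)) := by abel
  rw [e1]
  refine (norm_add_le _ _).trans_lt ?_
  have h6 := norm_sub_le (A - (B - D)) (A₀ - (B₀ - D₀))
  have h7 := norm_sub_le (B - B₀) (D - D₀)
  linarith

end Regular

end HMMFamily

/-! ### Uniqueness of the maximiser -/

/-- A second difference is bounded by means of a bound on the second derivative. -/
lemma second_difference_le {φ φ' φ'' : ℝ → ℝ} {R b : ℝ} (hR : 0 ≤ R)
    (h1 : ∀ s ∈ Set.Icc (-R) R, HasDerivAt φ (φ' s) s)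
    (h2 : ∀ s ∈ Set.Icc (-R) R, HasDerivAt φ' (φ'' s) s)
    (hb : ∀ s ∈ Set.Icc (-R) R, φ'' s ≤ b) : φ R + φ (-R) - 2 * φ 0 ≤ b * R ^ 2 := by
  have hd1 : ∀ s ∈ Set.Icc (-R) R, HasDerivAt (fun s => φ s - b / 2 * s ^ 2) (φ' s - b * s) s := by
    intro s hs
    have h3 := (h1 s hs).sub ((hasDerivAt_pow 2 s).const_mul (b / 2))
    refine h3.congr_deriv ?_
    norm_num
    ring
  have hd2 : ∀ s ∈ Set.Icc (-R) R, HasDerivAt (fun s => φ' s - b * s) (φ'' s - b) s := by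
    intro s hs
    have h3 := (h2 s hs).sub ((hasDerivAt_id s).const_mul b)
    exact h3.congr_deriv (by rw [mul_one])
  -- Subtracting the parabola of curvature `b` makes the function concave; the claim is its midpoint
  -- inequality at zero.
  have hc : ConcaveOn ℝ (Set.Icc (-R) R) (fun s => φ s - b / 2 * s ^ 2) :=
    concaveOn_of_hasDerivWithinAt2_nonpos (convex_Icc _ _)
      (fun s hs => (hd1 s hs).continuousAt.continuousWithinAt)
      (fun s hs => (hd1 s (interior_subset hs)).hasDerivWithinAt)
      (fun s hs => (hd2 s (interior_subset hs)).hasDerivWithinAt)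
      (fun s hs => sub_nonpos.2 (hb s (interior_subset hs)))
  have h3 := hc.2 (Set.right_mem_Icc.2 (by linarith)) (Set.left_mem_Icc.2 (by linarith))
    (show (0 : ℝ) ≤ 1 / 2 by norm_num) (show (0 : ℝ) ≤ 1 / 2 by norm_num) (by norm_num)
  simp only [smul_eq_mul] at h3
  rw [show 1 / 2 * R + 1 / 2 * -R = 0 by ring] at h3
  nlinarith [h3]

section Lines

variable {E : Type*} [NormedAddCommGroup E] [NormedSpace ℝ E] {f : E → ℝ} {z v : E}

lemma hasDerivAt_line (s : ℝ) : HasDerivAt (fun s : ℝ => z + s • v) v s := by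
  simpa using ((hasDerivAt_id s).smul_const v).const_add z

lemma ContDiffAt.hasDerivAt_line_fst {s : ℝ} (hf : ContDiffAt ℝ 2 f (z + s • v)) :
    HasDerivAt (fun s : ℝ => f (z + s • v)) (fderiv ℝ f (z + s • v) v) s :=
  (hf.differentiableAt (by norm_num)).hasFDerivAt.comp_hasDerivAt s (hasDerivAt_line s)

lemma ContDiffAt.hasDerivAt_line_snd {s : ℝ} (hf : ContDiffAt ℝ 2 f (z + s • v)) :
    HasDerivAt (fun s : ℝ => fderiv ℝ f (z + s • v) v) (fderiv2 f (z + s • v) v v) s := by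
  have h1 : HasDerivAt (fun s : ℝ => fderiv ℝ f (z + s • v)) (fderiv2 f (z + s • v) v) s :=
    hf.differentiableAt_fderiv.hasFDerivAt.comp_hasDerivAt s (hasDerivAt_line s)
  simpa using h1.clm_apply (hasDerivAt_const s v)

/-- A function with negative definite Hessians has at most one maximiser in a convex set. -/
lemma eq_of_isMaxOn_of_fderiv2_neg {B : Set E} (hB : Convex ℝ B)
    (hf : ∀ z ∈ B, ContDiffAt ℝ 2 f z) (hneg : ∀ z ∈ B, ∀ v ≠ 0, fderiv2 f z v v < 0)
    {a b : E} (ha : a ∈ B) (hb : b ∈ B) (hma : IsMaxOn f B a) (hmb : IsMaxOn f B b) : a = b := by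
  by_contra hab
  have hv : b - a ≠ 0 := sub_ne_zero.2 (Ne.symm hab)
  have hmem : ∀ s ∈ Set.Icc (0 : ℝ) 1, a + s • (b - a) ∈ B := fun s hs =>
    hB.add_smul_sub_mem ha hb hs
  have hd1 := fun s hs => (hf _ (hmem s hs)).hasDerivAt_line_fst
  have hd2 := fun s hs => (hf _ (hmem s hs)).hasDerivAt_line_snd
  have hc : StrictConcaveOn ℝ (Set.Icc (0 : ℝ) 1) fun s => f (a + s • (b - a)) := by
    refine strictConcaveOn_of_deriv2_neg (convex_Icc _ _)
      (fun s hs => (hd1 s hs).continuousAt.continuousWithinAt) fun s hs => ?_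
    have he : deriv (fun s => f (a + s • (b - a))) =ᶠ[𝓝 s]
        fun s => fderiv ℝ f (a + s • (b - a)) (b - a) := by
      filter_upwards [isOpen_interior.mem_nhds hs] with u hu
      exact (hd1 u (interior_subset hu)).deriv
    rw [Function.iterate_succ_apply, Function.iterate_one, he.deriv_eq,
      (hd2 s (interior_subset hs)).deriv]
    exact hneg _ (hmem s (interior_subset hs)) _ hv
  have h0 : (0 : ℝ) ∈ Set.Icc (0 : ℝ) 1 := by simp
  have h1 : (1 : ℝ) ∈ Set.Icc (0 : ℝ) 1 := by simp
  have e := hc.eq_of_isMaxOn (x := 0) (y := 1) (fun s hs => by simpa using hma (hmem s hs))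
    (fun s hs => by simpa using hmb (hmem s hs)) h0 h1
  norm_num at e

lemma norm_fderiv2_apply_sub_le (A B : E →L[ℝ] E →L[ℝ] ℝ) {η : ℝ} (h : ‖A - B‖ ≤ η)
    (hv : ‖v‖ = 1) : |A v v - B v v| ≤ η := by
  have h1 := (A - B).le_opNorm₂ v v
  rw [hv, mul_one, mul_one] at h1
  exact h1.trans h

/-- Closeness of the values transfers to the Hessians if these vary slowly. -/
lemma fderiv2_le_of_dist_le {g : E → ℝ} {r η δ : ℝ} (hr : 0 < r)
    (hf : ∀ t ∈ Metric.closedBall z r, ContDiffAt ℝ 2 f t)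
    (hg : ∀ t ∈ Metric.closedBall z r, ContDiffAt ℝ 2 g t)
    (hvf : ∀ t ∈ Metric.closedBall z r, ‖fderiv2 f t - fderiv2 f z‖ ≤ η)
    (hvg : ∀ t ∈ Metric.closedBall z r, ‖fderiv2 g t - fderiv2 g z‖ ≤ η)
    (hfg : ∀ t ∈ Metric.closedBall z r, |f t - g t| ≤ δ * r ^ 2) (hv : ‖v‖ = 1) :
    fderiv2 f z v v ≤ fderiv2 g z v v + 2 * η + 4 * δ := by
  have hmem : ∀ s ∈ Set.Icc (-r) r, z + s • v ∈ Metric.closedBall z r := by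
    intro s hs
    rw [mem_closedBall_iff_norm, add_sub_cancel_left, norm_smul, hv, mul_one, Real.norm_eq_abs]
    exact abs_le.2 hs
  -- The second difference of `g` along the segment is bounded above by its curvature, that of `f`
  -- below. They differ by at most `4 * δ * r ^ 2`, the value at the centre counting twice.
  have h1 := second_difference_le (φ := fun s => g (z + s • v))
    (b := fderiv2 g z v v + η) hr.le (fun s hs => (hg _ (hmem s hs)).hasDerivAt_line_fst)
    (fun s hs => (hg _ (hmem s hs)).hasDerivAt_line_snd) (fun s hs => by
      have := (abs_le.1 (norm_fderiv2_apply_sub_le _ _ (hvg _ (hmem s hs)) hv)).2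
      linarith)
  have h2 := second_difference_le (φ := fun s => -f (z + s • v))
    (b := -(fderiv2 f z v v - η)) hr.le (fun s hs => (hf _ (hmem s hs)).hasDerivAt_line_fst.fun_neg)
    (fun s hs => (hf _ (hmem s hs)).hasDerivAt_line_snd.fun_neg) (fun s hs => by
      have := (abs_le.1 (norm_fderiv2_apply_sub_le _ _ (hvf _ (hmem s hs)) hv)).1
      linarith)
  have h3 := abs_le.1 (hfg _ (hmem r ⟨by linarith, le_rfl⟩))
  have h4 := abs_le.1 (hfg _ (hmem (-r) ⟨le_rfl, by linarith⟩))
  have h5 := abs_le.1 (hfg _ (hmem 0 ⟨by linarith, hr.le⟩))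
  have h6 : (fderiv2 f z v v - η - (fderiv2 g z v v + η) - 4 * δ) * r ^ 2 ≤ 0 := by
    linarith
  have h7 : 0 < r ^ 2 := by positivity
  nlinarith [h6, h7]

end Lines

/-- Near a nondegenerate maximiser of the limit, the approximating functions have at most one
maximiser, provided that their Hessians are equicontinuous there. -/
theorem exists_ball_unique_maximiser {E : Type*} [NormedAddCommGroup E] [NormedSpace ℝ E]
    [FiniteDimensional ℝ E] {S : Set E} {θ₀ : E} (h0 : θ₀ ∈ interior S) {l : ℝ → E → ℝ}
    {K₀ : ℝ} (hK : 0 < K₀)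
    (hC : ∀ ε, 0 ≤ ε → ε ≤ K₀ → ContDiffOn ℝ 2 (l ε) (interior S))
    (hu : TendstoUniformlyOn l (l 0) (𝓝[>] 0) S)
    (hH : Tendsto (fun p : ℝ × E => ‖fderiv2 (l p.1) p.2 - fderiv2 (l p.1) θ₀‖)
      (𝓝[>] 0 ×ˢ 𝓝 θ₀) (𝓝 0))
    (hneg : ∀ v ≠ 0, fderiv2 (l 0) θ₀ v v < 0) :
    ∃ ρ > 0, ∀ᶠ ε in 𝓝[>] (0 : ℝ), ∀ s t, s ∈ Metric.ball θ₀ ρ → t ∈ Metric.ball θ₀ ρ →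
      IsMaxOn (l ε) S s → IsMaxOn (l ε) S t → s = t := by
  have hCA : ∀ ε, 0 ≤ ε → ε ≤ K₀ → ∀ t ∈ interior S, ContDiffAt ℝ 2 (l ε) t :=
    fun ε hε hεK t ht => (hC ε hε hεK).contDiffAt (isOpen_interior.mem_nhds ht)
  obtain ⟨κ, hκ, hκv⟩ : ∃ κ > 0, ∀ v ∈ Metric.sphere (0 : E) 1, κ ≤ -fderiv2 (l 0) θ₀ v v := by
    have hcont : Continuous fun v : E => -fderiv2 (l 0) θ₀ v v := by fun_prop
    have hprop : ProperSpace E := FiniteDimensional.proper ℝ E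
    refine (isCompact_sphere (0 : E) 1).exists_forall_le' hcont.continuousOn fun v hv => ?_
    have hv0 : v ≠ 0 := by
      rintro rfl
      simp at hv
    linarith [hneg v hv0]
  -- The transfer of curvature costs `2 * η + 4 * η`, and moving away from `θ₀` costs another `η`;
  -- the total `7 * η` is below the least curvature `κ`.
  set η := κ / 16 with hη
  have hη0 : 0 < η := by positivity
  -- The product filter supplies one neighbourhood of `θ₀` valid for all small tolerances, so the
  -- radius `ρ` does not depend on the tolerance.
  obtain ⟨P, hP, Q, hQ, hPQ⟩ := mem_prod_iff.1 (hH.eventually (gt_mem_nhds hη0))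
  have hcont0 : ContinuousAt (fun t => ‖fderiv2 (l 0) t - fderiv2 (l 0) θ₀‖) θ₀ := by
    have h1 : ContinuousAt (fderiv2 (l 0)) θ₀ := by
      have h2 := (hCA 0 le_rfl hK.le θ₀ h0).fderiv_right (m := 1) (by norm_num)
      exact (h2.fderiv_right (m := 0) (by norm_num)).continuousAt
    exact (h1.sub continuousAt_const).norm
  have hev0 := hcont0.eventually (gt_mem_nhds (show _ < η by simpa using hη0))
  obtain ⟨ρ, hρ, hρsub⟩ := Metric.mem_nhds_iff.1
    (inter_mem (inter_mem hQ hev0) (isOpen_interior.mem_nhds h0))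
  refine ⟨ρ, hρ, ?_⟩
  set r := ρ / 2 with hr
  have hr0 : 0 < r := by positivity
  have hsub : Metric.closedBall θ₀ r ⊆ Metric.ball θ₀ ρ :=
    Metric.closedBall_subset_ball (by rw [hr]; linarith)
  filter_upwards [hP, Ioc_mem_nhdsGT hK, Metric.tendstoUniformlyOn_iff.1 hu (η * r ^ 2)
    (by positivity)] with ε hεP hεK hεu
  have hv1 : ∀ t ∈ Metric.ball θ₀ ρ, ‖fderiv2 (l ε) t - fderiv2 (l ε) θ₀‖ ≤ η := by
    intro t ht
    have h1 : (ε, t) ∈ P ×ˢ Q := ⟨hεP, (hρsub ht).1.1⟩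
    have h2 := hPQ h1
    exact le_of_lt h2
  have hdiff : ∀ t ∈ Metric.ball θ₀ ρ, ContDiffAt ℝ 2 (l ε) t :=
    fun t ht => hCA ε hεK.1.le hεK.2 t (hρsub ht).2
  have hunit : ∀ v : E, ‖v‖ = 1 → ∀ t ∈ Metric.ball θ₀ ρ, fderiv2 (l ε) t v v < 0 := by
    intro v hv t ht
    have h1 := fderiv2_le_of_dist_le (z := θ₀) (f := l ε) (g := l 0) (δ := η) (η := η) hr0
      (fun t ht => hdiff t (hsub ht)) (fun t ht => hCA 0 le_rfl hK.le t (hρsub (hsub ht)).2)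
      (fun t ht => hv1 t (hsub ht)) (fun t ht => le_of_lt (hρsub (hsub ht)).1.2)
      (fun t ht => by
        have h2 := hεu t (interior_subset (hρsub (hsub ht)).2)
        rw [dist_comm, Real.dist_eq] at h2
        exact h2.le) hv
    have h2 := (abs_le.1 (norm_fderiv2_apply_sub_le _ _ (hv1 t ht) hv)).2
    have h3 := hκv v (by simpa using hv)
    linarith
  intro s t hs ht hms hmt
  have hBS : Metric.ball θ₀ ρ ⊆ S := fun t ht => interior_subset (hρsub ht).2
  refine eq_of_isMaxOn_of_fderiv2_neg (convex_ball θ₀ ρ) hdiff (fun z hz v hv => ?_) hs ht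
    (hms.on_subset hBS) (hmt.on_subset hBS)
  have hn : 0 < ‖v‖ := norm_pos_iff.2 hv
  have h1 := hunit (‖v‖⁻¹ • v) (by rw [norm_smul, norm_inv, norm_norm, inv_mul_cancel₀ hn.ne']) z hz
  simp only [map_smul, _root_.smul_apply, smul_eq_mul] at h1
  by_contra h2
  push Not at h2
  have h3 : 0 ≤ ‖v‖⁻¹ * (‖v‖⁻¹ * fderiv2 (l ε) z v v) := by positivity
  linarith

/-! ### Assembly of the standing assumptions -/

namespace HMMFamily

variable {d m : ℕ} {X : Type*} [MeasurableSpace X] {M : HMMFamily d m X}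

/-- Under the standing assumptions the family is regular for windows of radius at most `K₀`. -/
lemma exists_regular {θ₀ : M.Param} (hquasi : IsQuasiconvexSet M.Param) (h2 : M.A2)
    (h3 : M.A3) (h4 : M.A4) (h6 : M.A6 θ₀) {K₀ : ℝ} (hK : 0 < K₀) :
    ∃ c C K Λ e, M.Regular θ₀ c C K Λ e K₀ := by
  obtain ⟨c, C, K, Λ, hmodel⟩ := M.exists_smoothModel hquasi h2 h3 h4 h6
  obtain ⟨e, he, he0, hei, heg⟩ := M.exists_bound h6 hK
  exact ⟨c, C, K, Λ, e, hmodel, h3, he, he0, hei, heg⟩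

lemma maximisers_nonempty (θ₀ : M.Param) {l : EuclideanSpace ℝ (Fin d) → ℝ}
    (hl : ContinuousOn l M.Param) : (M.maximisers l).Nonempty := by
  obtain ⟨t, ht, hmax⟩ := M.isCompact_param.exists_isMaxOn ⟨_, θ₀.2⟩ hl
  exact ⟨t, ht, fun θ' h' => hmax h'⟩

end HMMFamily

end

theorem theorem2 {d m : ℕ} {X : Type*} [TopologicalSpace X] [PolishSpace X] [CompactSpace X]
    [MeasurableSpace X] [BorelSpace X] (M : HMMFamily d m X) (θ₀ : M.Param)
    (hquasi : IsQuasiconvexSet M.Param)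
    (h1 : M.A1 θ₀) (h2 : M.A2) (h3 : M.A3) (h4 : M.A4) (h5 : M.A5) (h6 : M.A6 θ₀) :
    ∃ (l : ℝ → EuclideanSpace ℝ (Fin d) → ℝ) (T : ℝ → Set (EuclideanSpace ℝ (Fin d))),
      (∀ ε : ℝ, 0 ≤ ε → M.IsLimitSurface ε θ₀ (l ε)) ∧
      (∀ ε : ℝ, 0 < ε → T ε = M.maximisers (l ε) ∧ (T ε).Nonempty) ∧
      (∀ ε : ℝ, 0 < ε → ∀ π₀ : Measure X, IsProbabilityMeasure π₀ →
        ∀ᵐ ω ∂(M.stationaryLaw θ₀),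
          (∀ n : ℕ, ∃ θ : M.Param, M.IsABCMLE ε π₀ n (fun k => (ω k).2) θ) ∧
          ∀ est : ℕ → M.Param,
            (∀ n : ℕ, M.IsABCMLE ε π₀ n (fun k => (ω k).2) (est n)) →
            ∀ t : EuclideanSpace ℝ (Fin d),
              MapClusterPt t atTop (fun n => (est n : EuclideanSpace ℝ (Fin d))) → t ∈ T ε) ∧
      Tendsto (fun ε : ℝ => ⨆ θ ∈ T ε, edist θ (θ₀ : EuclideanSpace ℝ (Fin d)))
        (𝓝[>] 0) (𝓝 0) ∧
      ((∀ v : EuclideanSpace ℝ (Fin d), v ≠ 0 →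
          iteratedFDeriv ℝ 2 (l 0) (θ₀ : EuclideanSpace ℝ (Fin d)) ![v, v] < 0) →
        ∀ᶠ ε in 𝓝[>] (0 : ℝ), ∃ t, T ε = {t}) := by
  obtain ⟨x⟩ := M.nonempty_state θ₀
  have hsurf : ∀ ε : ℝ, 0 ≤ ε → M.IsLimitSurface ε θ₀ (M.surface ε θ₀ x) := by
    intro ε hε
    -- The surface is defined without reference to the constants of regularity, so each tolerance
    -- may use windows of its own maximal radius `max 1 ε`. For the limits in the tolerance, radius
    -- one is enough.
    obtain ⟨c, C, K, Λ, e, h⟩ := HMMFamily.exists_regular hquasi h2 h3 h4 h6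
      (show 0 < max 1 ε from one_pos.trans_le (le_max_left _ _))
    exact h.isLimitSurface hε (le_max_right _ _) x
  obtain ⟨c, C, K, Λ, e, h⟩ := HMMFamily.exists_regular hquasi h2 h3 h4 h6 one_pos
  have hid : ∀ θ : M.Param, θ ≠ θ₀ → M.obsLaw θ ≠ M.obsLaw θ₀ :=
    fun θ hne heq => hne ((h1.2 θ).2 heq)
  have hmax := fun {ρ : ℝ} (hρ : 0 < ρ) => h.tendsto_maximisers one_pos x hid hρ
  refine ⟨fun ε => M.surface ε θ₀ x, fun ε => M.maximisers (M.surface ε θ₀ x), hsurf,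
    fun ε hε => ⟨rfl, HMMFamily.maximisers_nonempty θ₀ (hsurf ε hε.le).1⟩, ?_, ?_, ?_⟩
  · intro ε hε π₀ hπ₀
    obtain ⟨c, C, K, Λ, e, h⟩ := HMMFamily.exists_regular hquasi h2 h3 h4 h6
      (show 0 < max 1 ε from one_pos.trans_le (le_max_left _ _))
    exact h.ae_mle hε (le_max_right _ _) x π₀
  · rw [ENNReal.tendsto_nhds_zero]
    intro δ hδ
    obtain ⟨ρ, hρ, hρδ⟩ : ∃ ρ : ℝ, 0 < ρ ∧ ENNReal.ofReal ρ ≤ δ := by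
      rcases eq_or_ne δ ∞ with rfl | hδ'
      · exact ⟨1, one_pos, le_top⟩
      · exact ⟨δ.toReal, ENNReal.toReal_pos hδ.ne' hδ', ENNReal.ofReal_toReal_le⟩
    filter_upwards [hmax hρ] with ε hε
    refine iSup₂_le fun t ht => ?_
    rw [edist_dist]
    exact (ENNReal.ofReal_le_ofReal (hε t ht).le).trans hρδ
  · intro hneg
    have hneg' : ∀ v ≠ 0, fderiv2 (M.surface 0 θ₀ x) θ₀ v v < 0 := by
      intro v hv
      have h7 := hneg v hv
      rw [iteratedFDeriv_two_apply] at h7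
      exact h7
    obtain ⟨ρ, hρ, hev⟩ := exists_ball_unique_maximiser (l := fun ε => M.surface ε θ₀ x) h1.1
      one_pos (fun ε hε _ => (hsurf ε hε).2.1) (h.tendstoUniformlyOn_surface one_pos x)
      (h.tendsto_fderiv2_surface one_pos (fun θ hθ y x => M.contDiffAt_log_obsDensity h2 h6 hθ y x)
        h1.1 x) hneg'
    -- For small tolerances every maximiser lies in the ball of radius `ρ`, where there is at most
    -- one.
    filter_upwards [hev, hmax hρ, self_mem_nhdsWithin] with ε hε hε' hε0
    obtain ⟨t, ht⟩ := HMMFamily.maximisers_nonempty θ₀ (hsurf ε (le_of_lt hε0)).1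
    exact ⟨t, Set.eq_singleton_iff_unique_mem.2 ⟨ht, fun s hs =>
      hε s t (hε' s hs) (hε' t ht) hs.2 ht.2⟩⟩
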